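/- **Setting.** Algebras are associative over $\mathbb C$, possibly without identity, with non-degenerate product; $M(\cdot)$ is the multiplier algebra and $\iota$ an identity map. A *regular multiplier Hopf algebra* is such an algebra $A$ with a homomorphism $\Delta_A:A\to M(A\otimes A)$ such that $a\otimes a'\mapsto\Delta_A(a)(1\otimes a')$ and $a\otimes a'\mapsto(a\otimes1)\Delta_A(a')$ are bijections of $A\otimes A$, $\Delta_A$ is coassociative, i.e. $(a\otimes1\otimes1)(\Delta_A\otimes\iota)(\Delta_A(b)(1\otimes c))=(\iota\otimes\Delta_A)((a\otimes1)\Delta_A(b))(1\otimes1\otimes c)$, and the opposite coproduct has the same properties. Write $\Delta_A(a)=\sum a_{(1)}\otimes a_{(2)}$, and $S_A$ for the antipode. A right (left) *integral* is a non-zero linear functional $\psi$ on $A$ with $(\psi\otimes\iota)\Delta_A(a)=\psi(a)1$ (respectively $(\iota\otimes\psi)\Delta_A(a)=\psi(a)1$) in $M(A)$ for all $a$. An *algebraic quantum group* is a regular multiplier Hopf algebra that has a left and a right integral. It is a *$*$-algebraic quantum group* if moreover $A$ is a $*$-algebra and $\Delta_A$ a $*$-homomorphism. A functional $\psi$ is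 *positive* if $\psi(a^*a)\ge0$ for all $a$. Let $A$ and $B$ be regular multiplier Hopf algebras. *Action.* Let $B$ be a right $A$-module algebra: $b\otimes a\mapsto b\triangleleft a$ is a right action of $A$ on $B$ with $B\triangleleft A=B$ (linear span) and $(bb')\triangleleft a=\sum(b\triangleleft a_{(1)})(b'\triangleleft a_{(2)})$. Put $R(b\otimes a)=\sum a_{(1)}\otimes(b\triangleleft a_{(2)})$ and $R^{\rm op}(b\otimes a)=\sum a_{(2)}\otimes(b\triangleleft a_{(1)})$, maps from $B\otimes A$ to $A\otimes B$. The *smash product* $AB$ is the space $A\otimes B$, with $a\otimes b$ written $ab$, and the product $(ab)(a'b')=\sum(aa'_{(1)})((b\triangleleft a'_{(2)})b')$. The algebras $A$ and $B$ embed in $M(AB)$. *Coaction.* Let $M_0(B\otimes A)$ be the completion of $B\otimes A$ for multiplication by $B$ in the first factor: the pairs of linear maps $B\to B\otimes A$, written $b\mapsto(b\otimes1)y$ and $b\mapsto y(b\otimes1)$, that are compatible with the $B$-bimodule structure. Let $A$ be a left $B$-comodule coalgebra: there is an injective linear map $\Gamma:A\to M_0(B\otimes A)$ with $(\iota\otimes\Gamma)\Gamma=(\Delta_B\otimes\iota)\Gamma$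 such that, with $T(a\otimes b)=\Gamma(a)(b\otimes1)$ and $T^{\rm op}(a\otimes b)=(b\otimes1)\Gamma(a)$ from $A\otimes B$ to $B\otimes A$, the elements $((\iota\otimes T)(\Delta_A(a)\otimes b))(1\otimes1\otimes a')$ and $(1\otimes1\otimes a')((\iota\otimes T)(\Delta_A(a)\otimes b))$ lie in $A\otimes B\otimes A$ for all $a,a'\in A$, $b\in B$, and $$(T\otimes\iota)(\iota\otimes T)(\Delta_A\otimes\iota)=(\iota\otimes\Delta_A)T\quad\text{on }A\otimes B,$$ an equation read after multiplication by $1\otimes1\otimes a'$ from either side. *Compatibility.* With $P=T^{\rm op}\circ R^{\rm op}$ on $B\otimes A$ and $m_A$ the product of $A$, assume $$P(\iota\otimes m_A)=(\iota\otimes m_A)P_{13}P_{12}\ \text{ on }B\otimes A\otimes A,\qquad(\Delta_B\otimes\iota)P=P_{23}P_{13}(\Delta_B\otimes\iota)\ \text{ on }B\otimes A,\qquad T\circ R=T^{\rm op}\circ R^{\rm op},$$ where the second relation is read after multiplication by elements of $B$ from the left in the first factor. **Theorem 4.3.** Assume in addition that $A$ and $B$ are algebraic quantum groups. Then there is a coproduct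 $\Delta_\#$ on the smash product $AB$, determined by $$(a'\otimes1)\Delta_\#(ab)(1\otimes b')=(\iota\otimes T\otimes\iota)\big((a'\otimes1)\Delta_A(a)\otimes\Delta_B(b)(1\otimes b')\big)\qquad(a,a'\in A,\ b,b'\in B),$$ which makes $AB$ (the bicrossproduct) a regular multiplier Hopf algebra, and $AB$ is an algebraic quantum group. If $\psi_A$ and $\psi_B$ are right integrals on $A$ and $B$, then $\psi_\#(ab)=\psi_A(a)\psi_B(b)$ defines a right integral on $AB$. If moreover $A$ and $B$ are $*$-algebraic quantum groups with $(b\triangleleft a)^*=b^*\triangleleft S_A(a)^*$ and $\Gamma(S_A(a)^*)=((\iota\otimes S_A)\Gamma(a))^*$ for all $a\in A$, $b\in B$, then $AB$ is a $*$-algebra with $(ab)^*=b^*a^*=\sum (a^*)_{(1)}(b^*\triangleleft (a^*)_{(2)})$ and, with $\Delta_\#$, a $*$-algebraic quantum group; and if the right integrals $\psi_A$ and $\psi_B$ are positive, then so is $\psi_\#$. -/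

import Mathlib

open scoped TensorProduct ComplexOrder

set_option linter.unusedSectionVars false

namespace Bicross

universe u v w

section Cancel

variable {A : Type u} {A' : Type v} {V : Type w} [AddCommGroup A] [Module ℂ A]
  [AddCommGroup A'] [Module ℂ A'] [AddCommGroup V] [Module ℂ V]

/-- A jointly injective family of linear maps stays jointly injective after tensoring with `V`. -/
theorem rTensor_cancel {ι : Type*} (f : ι → A →ₗ[ℂ] A') (h : ∀ a, (∀ i, f i a = 0) → a = 0)
    (z : A ⊗[ℂ] V) (hz : ∀ i, (f i).rTensor V z = 0) : z = 0 := by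
  classical
  let C := Module.Basis.ofVectorSpace ℂ V
  have key : ∀ i k (t : A ⊗[ℂ] V),
      TensorProduct.equivFinsuppOfBasisRight C ((f i).rTensor V t) k
      = f i (TensorProduct.equivFinsuppOfBasisRight C t k) := by
    intro i k t
    induction t with
    | zero => simp
    | tmul x y => simp
    | add x y hx hy => simp only [map_add, Finsupp.add_apply, hx, hy]
  apply (TensorProduct.equivFinsuppOfBasisRight C).injective
  rw [map_zero]
  ext k
  exact h _ fun i => by rw [← key, hz]; simp

theorem lTensor_cancel {ι : Type*} (f : ι → A →ₗ[ℂ] A') (h : ∀ a, (∀ i, f i a = 0) → a = 0)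
    (z : V ⊗[ℂ] A) (hz : ∀ i, (f i).lTensor V z = 0) : z = 0 := by
  apply (TensorProduct.comm ℂ V A).injective
  rw [map_zero]
  refine rTensor_cancel f h _ fun i => ?_
  rw [← LinearMap.comm_comp_lTensor_comp_comm_eq]
  simp [hz]

end Cancel

section Multiplier

variable (A : Type u) [NonUnitalRing A] [Module ℂ A] [IsScalarTower ℂ A A] [SMulCommClass ℂ A A]

/-- The multiplier algebra, as a subalgebra of `End(A) × End(A)ᵒᵖ`: pairs `(l, r)` with
`l (x y) = l(x) y`, `r (x y) = x r(y)` and `x l(y) = r(x) y`. -/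
def multiplierSubalgebra : Subalgebra ℂ (Module.End ℂ A × (Module.End ℂ A)ᵐᵒᵖ) where
  carrier := {m | (∀ x y, m.1 (x * y) = m.1 x * y) ∧
    (∀ x y, m.2.unop (x * y) = x * m.2.unop y) ∧ ∀ x y, x * m.1 y = m.2.unop x * y}
  mul_mem' := by
    rintro m n ⟨h1, h2, h3⟩ ⟨k1, k2, k3⟩
    refine ⟨?_, ?_, ?_⟩ <;> intro x y
    · simp [h1, k1]
    · simp [h2, k2]
    · simp [h3, k3]
  add_mem' := by
    rintro m n ⟨h1, h2, h3⟩ ⟨k1, k2, k3⟩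
    refine ⟨?_, ?_, ?_⟩ <;> intro x y
    · simp [h1, k1, add_mul]
    · simp [h2, k2, mul_add]
    · simp [h3, k3, mul_add, add_mul]
  algebraMap_mem' := by
    intro r
    refine ⟨?_, ?_, ?_⟩ <;> intro x y <;>
      simp [smul_mul_assoc, mul_smul_comm, Module.algebraMap_end_apply]

/-- The multiplier algebra `M(A)`: pairs `m = (x ↦ m x, x ↦ x m)` of a left multiplication and a
right multiplication operator, with composition as product. -/
def Multiplier : Type u := multiplierSubalgebra A

instance : Ring (Multiplier A) := inferInstanceAs (Ring (multiplierSubalgebra A))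

instance : Algebra ℂ (Multiplier A) := inferInstanceAs (Algebra ℂ (multiplierSubalgebra A))

variable {A}

/-- Left multiplication by a multiplier, `x ↦ m x`. -/
def Multiplier.L (m : Multiplier A) : A →ₗ[ℂ] A := m.1.1

/-- Right multiplication by a multiplier, `x ↦ x m`. -/
def Multiplier.R (m : Multiplier A) : A →ₗ[ℂ] A := m.1.2.unop

theorem Multiplier.L_mul (m : Multiplier A) (x y : A) : m.L (x * y) = m.L x * y := m.2.1 x y

theorem Multiplier.R_mul (m : Multiplier A) (x y : A) : m.R (x * y) = x * m.R y := m.2.2.1 x y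

theorem Multiplier.mul_L (m : Multiplier A) (x y : A) : x * m.L y = m.R x * y := m.2.2.2 x y

theorem Multiplier.L_comp (m n : Multiplier A) (x : A) : (m * n).L x = m.L (n.L x) := rfl

theorem Multiplier.R_comp (m n : Multiplier A) (x : A) : (m * n).R x = n.R (m.R x) := rfl

theorem Multiplier.ext {m n : Multiplier A} (h : ∀ x, m.L x = n.L x) (k : ∀ x, m.R x = n.R x) :
    m = n :=
  Subtype.ext (Prod.ext (LinearMap.ext h) (MulOpposite.unop_injective (LinearMap.ext k)))

/-- The multiplier with the given left and right multiplication operators. -/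
def Multiplier.ofMaps (l r : A →ₗ[ℂ] A) (h1 : ∀ x y, l (x * y) = l x * y)
    (h2 : ∀ x y, r (x * y) = x * r y) (h3 : ∀ x y, x * l y = r x * y) : Multiplier A :=
  ⟨(l, MulOpposite.op r), h1, h2, h3⟩

/-- The canonical map `A → M(A)` (injective if the product of `A` is non-degenerate). -/
def incl (a : A) : Multiplier A :=
  Multiplier.ofMaps (LinearMap.mulLeft ℂ a) (LinearMap.mulRight ℂ a)
    (fun x y => by simp [mul_assoc]) (fun x y => by simp [mul_assoc])
    (fun x y => by simp [mul_assoc])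

@[simp] theorem incl_L (a x : A) : (incl a).L x = a * x := rfl

@[simp] theorem incl_R (a x : A) : (incl a).R x = x * a := rfl

theorem rTensor_tmul_mul (l : A →ₗ[ℂ] A) (h : ∀ x y, l (x * y) = l x * y) (x y : A ⊗[ℂ] A) :
    l.rTensor A (x * y) = l.rTensor A x * y := by
  induction x with
  | zero => simp
  | add x x' hx hx' => simp only [add_mul, map_add, hx, hx']
  | tmul a b =>
    induction y with
    | zero => simp
    | add x x' hx hx' => simp only [mul_add, map_add, hx, hx']
    | tmul c d => simp [h]

theorem rTensor_mul_tmul (l : A →ₗ[ℂ] A) (h : ∀ x y, l (x * y) = x * l y) (x y : A ⊗[ℂ] A) :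
    l.rTensor A (x * y) = x * l.rTensor A y := by
  induction x with
  | zero => simp
  | add x x' hx hx' => simp only [add_mul, map_add, hx, hx']
  | tmul a b =>
    induction y with
    | zero => simp
    | add x x' hx hx' => simp only [mul_add, map_add, hx, hx']
    | tmul c d => simp [h]

theorem comm_mul (x y : A ⊗[ℂ] A) : TensorProduct.comm ℂ A A (x * y)
    = TensorProduct.comm ℂ A A x * TensorProduct.comm ℂ A A y := by
  induction x with
  | zero => simp
  | add x x' hx hx' => simp only [add_mul, map_add, hx, hx']
  | tmul a b =>
    induction y with
    | zero => simp
    | add x x' hx hx' => simp only [mul_add, map_add, hx, hx']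
    | tmul c d => simp

/-- `m ⊗ 1 ∈ M(A ⊗ A)` for `m ∈ M(A)`. -/
noncomputable def tmulOne (m : Multiplier A) : Multiplier (A ⊗[ℂ] A) :=
  Multiplier.ofMaps (m.L.rTensor A) (m.R.rTensor A)
    (rTensor_tmul_mul _ m.L_mul) (rTensor_mul_tmul _ m.R_mul) (fun x y => by
      induction x with
      | zero => simp
      | add x x' hx hx' => simp only [add_mul, map_add, hx, hx']
      | tmul a b =>
        induction y with
        | zero => simp
        | add x x' hx hx' => simp only [mul_add, map_add, hx, hx']
        | tmul c d => simp [m.mul_L])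

/-- The flip `M(A ⊗ A) → M(A ⊗ A)`, extending `a ⊗ b ↦ b ⊗ a`. -/
noncomputable def flip (m : Multiplier (A ⊗[ℂ] A)) : Multiplier (A ⊗[ℂ] A) :=
  Multiplier.ofMaps
    ((TensorProduct.comm ℂ A A).toLinearMap ∘ₗ m.L ∘ₗ (TensorProduct.comm ℂ A A).toLinearMap)
    ((TensorProduct.comm ℂ A A).toLinearMap ∘ₗ m.R ∘ₗ (TensorProduct.comm ℂ A A).toLinearMap)
    (fun x y => by
      simp only [LinearMap.comp_apply, LinearEquiv.coe_coe, comm_mul, m.L_mul]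
      simp)
    (fun x y => by
      simp only [LinearMap.comp_apply, LinearEquiv.coe_coe, comm_mul, m.R_mul]
      simp)
    (fun x y => by
      apply (TensorProduct.comm ℂ A A).injective
      simp only [LinearMap.comp_apply, LinearEquiv.coe_coe, comm_mul,
        TensorProduct.comm_comm, m.mul_L])

/-- `1 ⊗ m ∈ M(A ⊗ A)` for `m ∈ M(A)`. -/
noncomputable def oneTmul (m : Multiplier A) : Multiplier (A ⊗[ℂ] A) := flip (tmulOne m)

/-- The involution of `M(A)` for a `*`-algebra `A`: `m* x = (x* m)*` and `x m* = (m x*)*`. -/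
def starMultiplier [StarRing A] [StarModule ℂ A] (m : Multiplier A) : Multiplier A :=
  Multiplier.ofMaps
    { toFun := fun x => star (m.R (star x))
      map_add' := fun x y => by simp
      map_smul' := fun c x => by simp }
    { toFun := fun x => star (m.L (star x))
      map_add' := fun x y => by simp
      map_smul' := fun c x => by simp }
    (fun x y => by simp [m.R_mul])
    (fun x y => by simp [m.L_mul])
    (fun x y => by
      apply star_injective
      simp [m.mul_L])

end Multiplier

section Hopf

variable (A : Type u) [NonUnitalRing A] [Module ℂ A] [IsScalarTower ℂ A A] [SMulCommClass ℂ A A]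

/-- A multiplier Hopf algebra: a (possibly non-unital) complex algebra `A` with non-degenerate
product and a homomorphism `Δ : A → M(A ⊗ A)` such that `Δ(a)(1 ⊗ b)` and `(a ⊗ 1)Δ(b)` lie in
`A ⊗ A`, the resulting linear maps `T₁(a ⊗ b) = Δ(a)(1 ⊗ b)` and `T₂(a ⊗ b) = (a ⊗ 1)Δ(b)` are
bijections of `A ⊗ A`, and `Δ` is coassociative, i.e.
`(a ⊗ 1 ⊗ 1)(Δ ⊗ ι)(Δ(b)(1 ⊗ c)) = (ι ⊗ Δ)((a ⊗ 1)Δ(b))(1 ⊗ 1 ⊗ c)`.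
The maps `T₁` and `T₂` are determined by `Δ`. -/
structure MultiplierHopfAlgebra where
  /-- The product is non-degenerate. -/
  nondeg_right : ∀ a : A, (∀ b, a * b = 0) → a = 0
  nondeg_left : ∀ a : A, (∀ b, b * a = 0) → a = 0
  /-- The coproduct. -/
  Δ : A →ₙₐ[ℂ] Multiplier (A ⊗[ℂ] A)
  /-- `a ⊗ b ↦ Δ(a)(1 ⊗ b)`. -/
  T₁ : (A ⊗[ℂ] A) ≃ₗ[ℂ] (A ⊗[ℂ] A)
  /-- `a ⊗ b ↦ (a ⊗ 1)Δ(b)`. -/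
  T₂ : (A ⊗[ℂ] A) ≃ₗ[ℂ] (A ⊗[ℂ] A)
  T₁_spec : ∀ a b, Δ a * oneTmul (incl b) = incl (T₁ (a ⊗ₜ[ℂ] b))
  T₂_spec : ∀ a b, tmulOne (incl a) * Δ b = incl (T₂ (a ⊗ₜ[ℂ] b))
  coassoc : ∀ a b c : A,
    TensorProduct.assoc ℂ A A A
        ((T₂.toLinearMap ∘ₗ TensorProduct.mk ℂ A A a).rTensor A (T₁ (b ⊗ₜ[ℂ] c)))
      = (T₁.toLinearMap ∘ₗ (TensorProduct.mk ℂ A A).flip c).lTensor A (T₂ (a ⊗ₜ[ℂ] b))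

/-- A regular multiplier Hopf algebra: the opposite coproduct `Δᵒᵖ`, obtained from `Δ` by the flip,
also makes `A` into a multiplier Hopf algebra. -/
structure RegularMHA extends MultiplierHopfAlgebra A where
  /-- The multiplier Hopf algebra with the opposite coproduct. -/
  coop : MultiplierHopfAlgebra A
  coop_Δ : ∀ a, coop.Δ a = flip (Δ a)

variable {A}

theorem flip_flip (m : Multiplier (A ⊗[ℂ] A)) : flip (flip m) = m :=
  Multiplier.ext
    (fun x => by
      change TensorProduct.comm ℂ A A (TensorProduct.comm ℂ A A (m.L (TensorProduct.comm ℂ A A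
        (TensorProduct.comm ℂ A A x)))) = _
      simp)
    (fun x => by
      change TensorProduct.comm ℂ A A (TensorProduct.comm ℂ A A (m.R (TensorProduct.comm ℂ A A
        (TensorProduct.comm ℂ A A x)))) = _
      simp)

theorem flip_mul (m n : Multiplier (A ⊗[ℂ] A)) : flip (m * n) = flip m * flip n :=
  Multiplier.ext
    (fun x => by
      change TensorProduct.comm ℂ A A (m.L (n.L (TensorProduct.comm ℂ A A x))) =
        TensorProduct.comm ℂ A A (m.L (TensorProduct.comm ℂ A A (TensorProduct.comm ℂ A A
          (n.L (TensorProduct.comm ℂ A A x)))))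
      simp)
    (fun x => by
      change TensorProduct.comm ℂ A A (n.R (m.R (TensorProduct.comm ℂ A A x))) =
        TensorProduct.comm ℂ A A (n.R (TensorProduct.comm ℂ A A (TensorProduct.comm ℂ A A
          (m.R (TensorProduct.comm ℂ A A x)))))
      simp)

theorem flip_incl (x : A ⊗[ℂ] A) : flip (incl x) = incl (TensorProduct.comm ℂ A A x) :=
  Multiplier.ext
    (fun y => by
      change TensorProduct.comm ℂ A A (x * TensorProduct.comm ℂ A A y) = _
      rw [comm_mul]; simp)
    (fun y => by
      change TensorProduct.comm ℂ A A (TensorProduct.comm ℂ A A y * x) = _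
      rw [comm_mul]; simp)

theorem oneTmul_L (m : Multiplier A) (x : A ⊗[ℂ] A) : (oneTmul m).L x = m.L.lTensor A x := by
  change TensorProduct.comm ℂ A A (m.L.rTensor A (TensorProduct.comm ℂ A A x)) = _
  induction x with
  | zero => simp
  | add x y hx hy => simp only [map_add, hx, hy]
  | tmul a b => simp

theorem oneTmul_R (m : Multiplier A) (x : A ⊗[ℂ] A) : (oneTmul m).R x = m.R.lTensor A x := by
  change TensorProduct.comm ℂ A A (m.R.rTensor A (TensorProduct.comm ℂ A A x)) = _
  induction x with
  | zero => simp
  | add x y hx hy => simp only [map_add, hx, hy]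
  | tmul a b => simp

theorem tmulOne_L (m : Multiplier A) (x : A ⊗[ℂ] A) : (tmulOne m).L x = m.L.rTensor A x := rfl

theorem tmulOne_R (m : Multiplier A) (x : A ⊗[ℂ] A) : (tmulOne m).R x = m.R.rTensor A x := rfl

theorem oneTmul_mul_incl (a : A) (x : A ⊗[ℂ] A) :
    oneTmul (incl a) * incl x = incl ((LinearMap.mulLeft ℂ a).lTensor A x) :=
  Multiplier.ext
    (fun y => by
      rw [Multiplier.L_comp, incl_L, Multiplier.L_mul, oneTmul_L]; rfl)
    (fun y => by
      rw [Multiplier.R_comp, incl_R, ← Multiplier.mul_L, oneTmul_L]; rfl)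

theorem tmulOne_mul_incl (a : A) (x : A ⊗[ℂ] A) :
    tmulOne (incl a) * incl x = incl ((LinearMap.mulLeft ℂ a).rTensor A x) :=
  Multiplier.ext
    (fun y => by
      rw [Multiplier.L_comp, incl_L, Multiplier.L_mul, tmulOne_L]; rfl)
    (fun y => by
      rw [Multiplier.R_comp, incl_R, ← Multiplier.mul_L, tmulOne_L]; rfl)

theorem incl_mul_oneTmul (a : A) (x : A ⊗[ℂ] A) :
    incl x * oneTmul (incl a) = incl ((LinearMap.mulRight ℂ a).lTensor A x) :=
  Multiplier.ext
    (fun y => by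
      rw [Multiplier.L_comp, incl_L, Multiplier.mul_L, oneTmul_R]; rfl)
    (fun y => by
      rw [Multiplier.R_comp, incl_R, Multiplier.R_mul, oneTmul_R]; rfl)

theorem tmulOne_mul_oneTmul (m n : Multiplier A) :
    tmulOne m * oneTmul n = oneTmul n * tmulOne m :=
  Multiplier.ext
    (fun y => by
      simp only [Multiplier.L_comp, tmulOne_L, oneTmul_L]
      rw [← LinearMap.comp_apply, ← LinearMap.comp_apply, LinearMap.rTensor_comp_lTensor,
        LinearMap.lTensor_comp_rTensor])
    (fun y => by
      simp only [Multiplier.R_comp, tmulOne_R, oneTmul_R]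
      rw [← LinearMap.comp_apply, ← LinearMap.comp_apply, LinearMap.rTensor_comp_lTensor,
        LinearMap.lTensor_comp_rTensor])

namespace MultiplierHopfAlgebra

theorem rTensor_mulLeft_cancel (H : MultiplierHopfAlgebra A) {V : Type w} [AddCommGroup V]
    [Module ℂ V] {z z' : A ⊗[ℂ] V}
    (h : ∀ c, (LinearMap.mulLeft ℂ c).rTensor V z = (LinearMap.mulLeft ℂ c).rTensor V z') :
    z = z' := by
  rw [← sub_eq_zero]
  exact rTensor_cancel (fun c => LinearMap.mulLeft ℂ c) (fun a ha => H.nondeg_left a ha) _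
    fun c => by rw [map_sub, h, sub_self]

theorem lTensor_mulLeft_cancel (H : MultiplierHopfAlgebra A) {V : Type w} [AddCommGroup V]
    [Module ℂ V] {z z' : V ⊗[ℂ] A}
    (h : ∀ c, (LinearMap.mulLeft ℂ c).lTensor V z = (LinearMap.mulLeft ℂ c).lTensor V z') :
    z = z' := by
  rw [← sub_eq_zero]
  exact lTensor_cancel (fun c => LinearMap.mulLeft ℂ c) (fun a ha => H.nondeg_left a ha) _
    fun c => by rw [map_sub, h, sub_self]

theorem lTensor_mulRight_cancel (H : MultiplierHopfAlgebra A) {V : Type w} [AddCommGroup V]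
    [Module ℂ V] {z z' : V ⊗[ℂ] A}
    (h : ∀ c, (LinearMap.mulRight ℂ c).lTensor V z = (LinearMap.mulRight ℂ c).lTensor V z') :
    z = z' := by
  rw [← sub_eq_zero]
  exact lTensor_cancel (fun c => LinearMap.mulRight ℂ c) (fun a ha => H.nondeg_right a ha) _
    fun c => by rw [map_sub, h, sub_self]

theorem lTensor_mulLeft_rTensor_mulLeft (c d : A) (x : A ⊗[ℂ] A) :
    (LinearMap.mulLeft ℂ d).lTensor A ((LinearMap.mulLeft ℂ c).rTensor A x) = (c ⊗ₜ[ℂ] d) * x := by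
  induction x with
  | zero => simp
  | add x y hx hy => simp only [map_add, mul_add, hx, hy]
  | tmul a b => simp

theorem incl_injective (H : MultiplierHopfAlgebra A) {x y : A ⊗[ℂ] A} (h : incl x = incl y) :
    x = y := by
  refine H.rTensor_mulLeft_cancel fun c => H.lTensor_mulLeft_cancel fun d => ?_
  rw [lTensor_mulLeft_rTensor_mulLeft, lTensor_mulLeft_rTensor_mulLeft]
  exact congrArg (fun m => Multiplier.R m (c ⊗ₜ[ℂ] d)) h

theorem mulLeft_T₁ (H : MultiplierHopfAlgebra A) (c a b : A) :
    (LinearMap.mulLeft ℂ c).rTensor A (H.T₁ (a ⊗ₜ b))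
      = (LinearMap.mulRight ℂ b).lTensor A (H.T₂ (c ⊗ₜ a)) := by
  apply H.incl_injective
  rw [← tmulOne_mul_incl, ← incl_mul_oneTmul, ← H.T₁_spec, ← H.T₂_spec, mul_assoc]

theorem incl_mul (m : Multiplier (A ⊗[ℂ] A)) (x : A ⊗[ℂ] A) : incl x * m = incl (m.R x) :=
  Multiplier.ext
    (fun y => by rw [Multiplier.L_comp, incl_L, Multiplier.mul_L]; rfl)
    (fun y => by rw [Multiplier.R_comp, incl_R, Multiplier.R_mul]; rfl)

theorem mul_incl (m : Multiplier (A ⊗[ℂ] A)) (x : A ⊗[ℂ] A) : m * incl x = incl (m.L x) :=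
  Multiplier.ext
    (fun y => by rw [Multiplier.L_comp, incl_L, Multiplier.L_mul]; rfl)
    (fun y => by rw [Multiplier.R_comp, incl_R, ← Multiplier.mul_L]; rfl)

theorem T₂_mul (H : MultiplierHopfAlgebra A) (c a b : A) :
    H.T₂ (c ⊗ₜ (a * b)) = (H.Δ b).R (H.T₂ (c ⊗ₜ a)) := by
  apply H.incl_injective
  rw [← H.T₂_spec, ← incl_mul, ← H.T₂_spec, map_mul, mul_assoc]

theorem T₁_mul (H : MultiplierHopfAlgebra A) (a b c : A) :
    H.T₁ ((a * b) ⊗ₜ c) = (H.Δ a).L (H.T₁ (b ⊗ₜ c)) := by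
  apply H.incl_injective
  rw [← H.T₁_spec, ← mul_incl, ← H.T₁_spec, map_mul, mul_assoc]

theorem Δ_R_tmul (H : MultiplierHopfAlgebra A) (a p q : A) :
    (H.Δ a).R (p ⊗ₜ q) = (LinearMap.mulLeft ℂ q).lTensor A (H.T₂ (p ⊗ₜ a)) := by
  apply H.incl_injective
  have h : incl (p ⊗ₜ[ℂ] q) = oneTmul (incl q) * tmulOne (incl p) :=
    Multiplier.ext
      (fun y => by
        rw [Multiplier.L_comp, oneTmul_L, incl_L, ← lTensor_mulLeft_rTensor_mulLeft]; rfl)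
      (fun y => by
        rw [Multiplier.R_comp, oneTmul_R, tmulOne_R, incl_R]
        induction y with
        | zero => simp
        | add x y hx hy => simp only [map_add, add_mul, hx, hy]
        | tmul a b => simp [Multiplier.R, incl, Multiplier.ofMaps])
  rw [← incl_mul, ← oneTmul_mul_incl, ← H.T₂_spec, h, mul_assoc]

theorem Δ_L_tmul (H : MultiplierHopfAlgebra A) (a p q : A) :
    (H.Δ a).L (p ⊗ₜ q) = (LinearMap.mulRight ℂ p).rTensor A (H.T₁ (a ⊗ₜ q)) := by
  apply H.incl_injective
  have h : incl (p ⊗ₜ[ℂ] q) = oneTmul (incl q) * tmulOne (incl p) :=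
    Multiplier.ext
      (fun y => by
        rw [Multiplier.L_comp, oneTmul_L, incl_L, ← lTensor_mulLeft_rTensor_mulLeft]; rfl)
      (fun y => by
        rw [Multiplier.R_comp, oneTmul_R, tmulOne_R, incl_R]
        induction y with
        | zero => simp
        | add x y hx hy => simp only [map_add, add_mul, hx, hy]
        | tmul a b => simp [Multiplier.R, incl, Multiplier.ofMaps])
  have k : ∀ x : A ⊗[ℂ] A, incl x * tmulOne (incl p) = incl ((LinearMap.mulRight ℂ p).rTensor A x) :=
    fun x => incl_mul _ _
  rw [← mul_incl, ← k, ← H.T₁_spec, h, mul_assoc]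

/-- Coassociativity, as commutation of `T₂ ⊗ ι` and `ι ⊗ T₁`. -/
theorem coassoc' (H : MultiplierHopfAlgebra A) (a : A) (w : A ⊗[ℂ] A) :
    TensorProduct.assoc ℂ A A A
        ((H.T₂.toLinearMap ∘ₗ TensorProduct.mk ℂ A A a).rTensor A (H.T₁ w))
      = H.T₁.toLinearMap.lTensor A (TensorProduct.assoc ℂ A A A
        ((H.T₂.toLinearMap ∘ₗ TensorProduct.mk ℂ A A a).rTensor A w)) := by
  induction w with
  | zero => simp
  | add x y hx hy => simp only [map_add, hx, hy]
  | tmul b c =>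
    rw [H.coassoc]
    simp only [LinearMap.rTensor_tmul, LinearMap.comp_apply, TensorProduct.mk_apply,
      LinearEquiv.coe_coe]
    generalize H.T₂ (a ⊗ₜ b) = t
    induction t with
    | zero => simp
    | add x y hx hy => simp only [map_add, TensorProduct.add_tmul, hx, hy]
    | tmul b c => simp

theorem coassoc_symm (H : MultiplierHopfAlgebra A) (a b c : A) :
    H.T₁.symm.toLinearMap.lTensor A (TensorProduct.assoc ℂ A A A (H.T₂ (a ⊗ₜ b) ⊗ₜ c))
      = TensorProduct.assoc ℂ A A A
        ((H.T₂.toLinearMap ∘ₗ TensorProduct.mk ℂ A A a).rTensor A (H.T₁.symm (b ⊗ₜ c))) := by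
  have h := congrArg (H.T₁.symm.toLinearMap.lTensor A) (H.coassoc' a (H.T₁.symm (b ⊗ₜ c)))
  rw [← LinearMap.comp_apply (H.T₁.symm.toLinearMap.lTensor A), ← LinearMap.lTensor_comp] at h
  simpa using h

theorem lTensor_counit_aux (H : MultiplierHopfAlgebra A) (t : A ⊗[ℂ] A) (c : A) :
    (LinearMap.mul' ℂ A ∘ₗ H.T₁.symm.toLinearMap).lTensor A
      (TensorProduct.assoc ℂ A A A (H.T₂ t ⊗ₜ c)) = LinearMap.mul' ℂ A t ⊗ₜ c := by
  induction t with
  | zero => simp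
  | add x y hx hy => simp only [map_add, TensorProduct.add_tmul, hx, hy]
  | tmul a b =>
    rw [LinearMap.lTensor_comp, LinearMap.comp_apply, coassoc_symm]
    have key : ∀ w : A ⊗[ℂ] A, (LinearMap.mul' ℂ A).lTensor A (TensorProduct.assoc ℂ A A A
        ((H.T₂.toLinearMap ∘ₗ TensorProduct.mk ℂ A A a).rTensor A w))
        = (LinearMap.mulLeft ℂ a).rTensor A (H.T₁ w) := by
      intro w
      induction w with
      | zero => simp
      | add x y hx hy => simp only [map_add, hx, hy]
      | tmul u v =>
        rw [H.mulLeft_T₁]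
        simp only [LinearMap.rTensor_tmul, LinearMap.comp_apply, TensorProduct.mk_apply,
          LinearEquiv.coe_coe]
        generalize H.T₂ (a ⊗ₜ u) = t
        induction t with
        | zero => simp
        | add x y hx hy => simp only [map_add, TensorProduct.add_tmul, hx, hy]
        | tmul b c => simp
    rw [key]
    simp

theorem exists_counit_aux (H : MultiplierHopfAlgebra A) : ∃ ε : A →ₗ[ℂ] ℂ, ∀ a b : A,
    LinearMap.mul' ℂ A (H.T₁.symm (a ⊗ₜ b)) = ε a • b := by
  by_cases hA : ∃ x : A, x ≠ 0
  · obtain ⟨x, hx⟩ := hA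
    obtain ⟨f, hf⟩ : ∃ f : Module.Dual ℂ A, f x ≠ 0 := by
      by_contra! h
      exact hx ((Module.forall_dual_apply_eq_zero_iff ℂ x).1 h)
    refine ⟨(f x)⁻¹ • (f ∘ₗ LinearMap.mul' ℂ A ∘ₗ H.T₂.symm.toLinearMap ∘ₗ
      TensorProduct.mk ℂ A A x), fun a b => ?_⟩
    have h := H.lTensor_counit_aux (H.T₂.symm (x ⊗ₜ a)) b
    have h2 := congrArg (fun t => TensorProduct.lid ℂ A (f.rTensor A t)) h
    simp at h2
    simp only [LinearMap.smul_apply, LinearMap.comp_apply, TensorProduct.mk_apply,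
      LinearEquiv.coe_coe, smul_eq_mul]
    rw [mul_smul, ← h2, smul_smul, inv_mul_cancel₀ hf, one_smul]
  · push Not at hA
    exact ⟨0, fun a b => by rw [hA b]; simp⟩

theorem exists_counit (H : MultiplierHopfAlgebra A) : ∃ ε : A →ₗ[ℂ] ℂ,
    (∀ a b : A, TensorProduct.lid ℂ A (ε.rTensor A (H.T₁ (a ⊗ₜ b))) = a * b) ∧
    ∀ a b : A, TensorProduct.rid ℂ A (ε.lTensor A (H.T₂ (a ⊗ₜ b))) = a * b := by
  obtain ⟨ε, hε⟩ := H.exists_counit_aux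
  refine ⟨ε, fun a b => ?_, fun a b => ?_⟩
  · have key : ∀ w : A ⊗[ℂ] A, TensorProduct.lid ℂ A (ε.rTensor A w)
        = LinearMap.mul' ℂ A (H.T₁.symm w) := by
      intro w
      induction w with
      | zero => simp
      | add x y hx hy => simp only [map_add, hx, hy]
      | tmul u v => rw [hε]; simp
    rw [key]; simp
  · rw [← sub_eq_zero]
    refine H.nondeg_right _ fun c => ?_
    rw [sub_mul, sub_eq_zero]
    have h := congrArg (LinearMap.mul' ℂ A) (H.lTensor_counit_aux (a ⊗ₜ b) c)
    rw [LinearMap.mul'_apply, LinearMap.mul'_apply] at h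
    rw [← h]
    generalize H.T₂ (a ⊗ₜ b) = t
    induction t with
    | zero => simp
    | add x y hx hy => simp only [map_add, TensorProduct.add_tmul, add_mul, hx, hy]
    | tmul b d => simp [hε, smul_mul_assoc]

/-- The counit `ε`, characterised by `(ε ⊗ ι)(Δ(a)(1 ⊗ b)) = a b` and
`(ι ⊗ ε)((a ⊗ 1)Δ(b)) = a b`. -/
noncomputable def counit (H : MultiplierHopfAlgebra A) : A →ₗ[ℂ] ℂ := H.exists_counit.choose

theorem counit_T₁ (H : MultiplierHopfAlgebra A) (w : A ⊗[ℂ] A) :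
    TensorProduct.lid ℂ A (H.counit.rTensor A (H.T₁ w)) = LinearMap.mul' ℂ A w := by
  induction w with
  | zero => simp
  | add x y hx hy => simp only [map_add, hx, hy]
  | tmul u v => rw [LinearMap.mul'_apply]; exact H.exists_counit.choose_spec.1 u v

theorem counit_T₂ (H : MultiplierHopfAlgebra A) (w : A ⊗[ℂ] A) :
    TensorProduct.rid ℂ A (H.counit.lTensor A (H.T₂ w)) = LinearMap.mul' ℂ A w := by
  induction w with
  | zero => simp
  | add x y hx hy => simp only [map_add, hx, hy]
  | tmul u v => rw [LinearMap.mul'_apply]; exact H.exists_counit.choose_spec.2 u v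

theorem mul_T₁_symm (H : MultiplierHopfAlgebra A) (a b : A) :
    LinearMap.mul' ℂ A (H.T₁.symm (a ⊗ₜ b)) = H.counit a • b := by
  rw [← H.counit_T₁]; simp

theorem counit_mul (H : MultiplierHopfAlgebra A) (p q : A) :
    H.counit (p * q) = H.counit p * H.counit q := by
  by_cases hA : ∃ x : A, x ≠ 0
  · obtain ⟨b, hb⟩ := hA
    have h1 : ∀ (u : A) (t : A ⊗[ℂ] A), LinearMap.mul' ℂ A (H.T₁.symm ((H.Δ u).L (H.T₁ t)))
        = u * LinearMap.mul' ℂ A t := by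
      intro u t
      induction t with
      | zero => simp
      | add x y hx hy => simp only [map_add, mul_add, hx, hy]
      | tmul r w => rw [← T₁_mul]; simp [mul_assoc]
    have h2 : ∀ s : A ⊗[ℂ] A, LinearMap.mul' ℂ A (H.T₁.symm
        ((LinearMap.mulRight ℂ q).rTensor A (H.T₁ s))) = H.counit q • LinearMap.mul' ℂ A s := by
      intro s
      induction s with
      | zero => simp
      | add x y hx hy => simp only [map_add, smul_add, hx, hy]
      | tmul u v =>
        have h := h1 u (H.T₁.symm (q ⊗ₜ v))
        rw [mul_T₁_symm, LinearEquiv.apply_symm_apply, Δ_L_tmul] at h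
        rw [h, mul_smul_comm, LinearMap.mul'_apply]
    have h := h2 (H.T₁.symm (p ⊗ₜ b))
    rw [mul_T₁_symm, LinearEquiv.apply_symm_apply, LinearMap.rTensor_tmul,
      LinearMap.mulRight_apply, mul_T₁_symm, smul_smul] at h
    rw [mul_comm (H.counit p)]
    exact smul_left_injective ℂ hb h
  · push Not at hA
    rw [hA p]; simp

/-- `a ⊗ b ↦ S(a) b`, with `S` the antipode. -/
noncomputable def antipodeMul (H : MultiplierHopfAlgebra A) : A ⊗[ℂ] A →ₗ[ℂ] A :=
  (TensorProduct.lid ℂ A).toLinearMap ∘ₗ H.counit.rTensor A ∘ₗ H.T₁.symm.toLinearMap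

theorem antipodeMul_mul (H : MultiplierHopfAlgebra A) (p q b : A) :
    H.antipodeMul ((p * q) ⊗ₜ b) = H.antipodeMul (q ⊗ₜ H.antipodeMul (p ⊗ₜ b)) := by
  have h1 : ∀ (u : A) (t : A ⊗[ℂ] A), H.antipodeMul ((H.Δ u).L (H.T₁ t))
      = H.counit u • TensorProduct.lid ℂ A (H.counit.rTensor A t) := by
    intro u t
    induction t with
    | zero => simp
    | add x y hx hy => simp only [map_add, smul_add, hx, hy]
    | tmul r w => rw [← T₁_mul]; simp [antipodeMul, counit_mul, mul_smul]
  have h2 : ∀ s : A ⊗[ℂ] A, H.antipodeMul ((LinearMap.mulRight ℂ q).rTensor A (H.T₁ s))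
      = H.antipodeMul (q ⊗ₜ TensorProduct.lid ℂ A (H.counit.rTensor A s)) := by
    intro s
    induction s with
    | zero => simp
    | add x y hx hy => simp only [map_add, TensorProduct.tmul_add, hx, hy]
    | tmul u v =>
      have h := h1 u (H.T₁.symm (q ⊗ₜ v))
      rw [LinearEquiv.apply_symm_apply, Δ_L_tmul] at h
      rw [h]; simp [antipodeMul]
  have h := h2 (H.T₁.symm (p ⊗ₜ b))
  rw [LinearEquiv.apply_symm_apply, LinearMap.rTensor_tmul, LinearMap.mulRight_apply] at h
  rw [h]; rfl

theorem mul_antipodeMul_T₂ (H : MultiplierHopfAlgebra A) (y q d : A) :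
    LinearMap.mul' ℂ A ((H.antipodeMul ∘ₗ (TensorProduct.mk ℂ A A).flip d).lTensor A
      (H.T₂ (y ⊗ₜ q))) = H.counit q • (y * d) := by
  have h := congrArg (fun t => LinearMap.mul' ℂ A (((TensorProduct.lid ℂ A).toLinearMap ∘ₗ
    H.counit.rTensor A).lTensor A t)) (H.coassoc_symm y q d)
  have h1 : ∀ t : A ⊗[ℂ] A, (H.antipodeMul ∘ₗ (TensorProduct.mk ℂ A A).flip d).lTensor A t =
      ((TensorProduct.lid ℂ A).toLinearMap ∘ₗ H.counit.rTensor A).lTensor A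
        (H.T₁.symm.toLinearMap.lTensor A (TensorProduct.assoc ℂ A A A (t ⊗ₜ d))) := by
    intro t
    induction t with
    | zero => simp
    | add x y hx hy => simp only [map_add, TensorProduct.add_tmul, hx, hy]
    | tmul u v => simp [antipodeMul]
  have h2 : ∀ w : A ⊗[ℂ] A, ((TensorProduct.lid ℂ A).toLinearMap ∘ₗ
      H.counit.rTensor A).lTensor A (TensorProduct.assoc ℂ A A A
        ((H.T₂.toLinearMap ∘ₗ TensorProduct.mk ℂ A A y).rTensor A w))
      = (LinearMap.mulLeft ℂ y).rTensor A w := by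
    intro w
    induction w with
    | zero => simp
    | add x y hx hy => simp only [map_add, hx, hy]
    | tmul u v =>
      have h3 := H.counit_T₂ (y ⊗ₜ u)
      rw [LinearMap.mul'_apply] at h3
      simp only [LinearMap.rTensor_tmul, LinearMap.comp_apply, TensorProduct.mk_apply,
        LinearEquiv.coe_coe, LinearMap.mulLeft_apply]
      rw [← h3]
      generalize H.T₂ (y ⊗ₜ u) = t
      induction t with
      | zero => simp
      | add x y hx hy => simp only [map_add, TensorProduct.add_tmul, hx, hy]
      | tmul b c => simp [TensorProduct.smul_tmul]
  have h4 : ∀ w : A ⊗[ℂ] A, LinearMap.mul' ℂ A ((LinearMap.mulLeft ℂ y).rTensor A w)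
      = y * LinearMap.mul' ℂ A w := by
    intro w
    induction w with
    | zero => simp
    | add x y hx hy => simp only [map_add, mul_add, hx, hy]
    | tmul u v => simp [mul_assoc]
  rw [h1, h, h2, h4, mul_T₁_symm, mul_smul_comm]

/-- `a ⊗ b ↦ a S(b)`, with `S` the antipode. -/
noncomputable def mulAntipode (H : MultiplierHopfAlgebra A) : A ⊗[ℂ] A →ₗ[ℂ] A :=
  (TensorProduct.rid ℂ A).toLinearMap ∘ₗ H.counit.lTensor A ∘ₗ H.T₂.symm.toLinearMap

theorem mulAntipode_mul (H : MultiplierHopfAlgebra A) (t : A ⊗[ℂ] A) (b : A) :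
    H.mulAntipode t * b = LinearMap.mul' ℂ A
      ((H.antipodeMul ∘ₗ (TensorProduct.mk ℂ A A).flip b).lTensor A t) := by
  obtain ⟨s, rfl⟩ := H.T₂.surjective t
  induction s with
  | zero => simp
  | add x y hx hy => simp only [map_add, add_mul, hx, hy]
  | tmul g h => rw [mul_antipodeMul_T₂]; simp [mulAntipode, smul_mul_assoc]

end MultiplierHopfAlgebra

namespace RegularMHA

/-- The regular multiplier Hopf algebra with the opposite coproduct. -/
def op (H : RegularMHA A) : RegularMHA A where
  toMultiplierHopfAlgebra := H.coop
  coop := H.toMultiplierHopfAlgebra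
  coop_Δ a := by rw [H.coop_Δ, flip_flip]

/-- `a ⊗ b ↦ Δ(a)(b ⊗ 1)`. -/
noncomputable def T₃ (H : RegularMHA A) : (A ⊗[ℂ] A) ≃ₗ[ℂ] (A ⊗[ℂ] A) :=
  H.coop.T₁ ≪≫ₗ TensorProduct.comm ℂ A A

/-- `a ⊗ b ↦ (1 ⊗ a)Δ(b)`. -/
noncomputable def T₄ (H : RegularMHA A) : (A ⊗[ℂ] A) ≃ₗ[ℂ] (A ⊗[ℂ] A) :=
  H.coop.T₂ ≪≫ₗ TensorProduct.comm ℂ A A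

theorem T₃_spec (H : RegularMHA A) (a b : A) :
    H.Δ a * tmulOne (incl b) = incl (H.T₃ (a ⊗ₜ b)) := by
  change _ = incl (TensorProduct.comm ℂ A A (H.coop.T₁ (a ⊗ₜ b)))
  rw [← flip_incl, ← H.coop.T₁_spec, flip_mul, H.coop_Δ, oneTmul, flip_flip, flip_flip]

theorem T₄_spec (H : RegularMHA A) (a b : A) :
    oneTmul (incl a) * H.Δ b = incl (H.T₄ (a ⊗ₜ b)) := by
  change _ = incl (TensorProduct.comm ℂ A A (H.coop.T₂ (a ⊗ₜ b)))
  rw [← flip_incl, ← H.coop.T₂_spec, flip_mul, H.coop_Δ, oneTmul, flip_flip]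

theorem mulLeft_T₄ (H : RegularMHA A) (c e a : A) :
    (LinearMap.mulLeft ℂ c).rTensor A (H.T₄ (e ⊗ₜ a))
      = (LinearMap.mulLeft ℂ e).lTensor A (H.T₂ (c ⊗ₜ a)) := by
  apply H.incl_injective
  rw [← tmulOne_mul_incl, ← oneTmul_mul_incl, ← H.T₄_spec, ← H.T₂_spec, ← mul_assoc,
    ← mul_assoc, tmulOne_mul_oneTmul]

theorem mul_antipodeMul_T₄ (H : RegularMHA A) (p q b : A) :
    LinearMap.mul' ℂ A ((H.antipodeMul ∘ₗ (TensorProduct.mk ℂ A A).flip b).lTensor A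
      (H.T₄ (p ⊗ₜ q))) = H.counit q • H.antipodeMul (p ⊗ₜ b) := by
  rw [← sub_eq_zero]
  refine H.nondeg_left _ fun y => ?_
  rw [mul_sub, sub_eq_zero, mul_smul_comm, ← H.mul_antipodeMul_T₂]
  have h1 : ∀ t : A ⊗[ℂ] A, y * LinearMap.mul' ℂ A
      ((H.antipodeMul ∘ₗ (TensorProduct.mk ℂ A A).flip b).lTensor A t)
      = LinearMap.mul' ℂ A ((H.antipodeMul ∘ₗ (TensorProduct.mk ℂ A A).flip b).lTensor A
        ((LinearMap.mulLeft ℂ y).rTensor A t)) := by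
    intro t
    induction t with
    | zero => simp
    | add x y hx hy => simp only [map_add, mul_add, hx, hy]
    | tmul u v => simp [mul_assoc]
  rw [h1, mulLeft_T₄]
  congr 1
  rw [← LinearMap.comp_apply, ← LinearMap.lTensor_comp]
  congr 2
  ext x
  simp [H.antipodeMul_mul]

theorem exists_antipode (H : RegularMHA A) : ∃ S : A →ₗ[ℂ] A,
    (∀ a b : A, LinearMap.mul' ℂ A (S.rTensor A (H.T₁ (a ⊗ₜ b))) = H.counit a • b) ∧
    ∀ a b : A, LinearMap.mul' ℂ A (S.lTensor A (H.T₂ (a ⊗ₜ b))) = H.counit b • a := by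
  have hS : ∃ S : A →ₗ[ℂ] A, ∀ a b : A, S a * b = H.antipodeMul (a ⊗ₜ b) := by
    by_cases hA : ∃ q, H.counit q ≠ 0
    · obtain ⟨q, hq⟩ := hA
      refine ⟨(H.counit q)⁻¹ • (H.mulAntipode ∘ₗ H.T₄.toLinearMap ∘ₗ
        (TensorProduct.mk ℂ A A).flip q), fun a b => ?_⟩
      simp only [LinearMap.smul_apply, LinearMap.comp_apply, LinearMap.flip_apply,
        TensorProduct.mk_apply, LinearEquiv.coe_coe, smul_mul_assoc]
      rw [H.mulAntipode_mul, H.mul_antipodeMul_T₄, smul_smul, inv_mul_cancel₀ hq, one_smul]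
    · push Not at hA
      refine ⟨0, fun a b => ?_⟩
      simp only [LinearMap.zero_apply, zero_mul]
      have : H.counit = 0 := LinearMap.ext hA
      simp [MultiplierHopfAlgebra.antipodeMul, this]
  obtain ⟨S, hS⟩ := hS
  refine ⟨S, fun a b => ?_, fun a b => ?_⟩
  · have key : ∀ w : A ⊗[ℂ] A, LinearMap.mul' ℂ A (S.rTensor A w) = H.antipodeMul w := by
      intro w
      induction w with
      | zero => simp
      | add x y hx hy => simp only [map_add, hx, hy]
      | tmul u v => simp [hS]
    rw [key]
    simp [MultiplierHopfAlgebra.antipodeMul]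
  · rw [← sub_eq_zero]
    refine H.nondeg_right _ fun d => ?_
    rw [sub_mul, sub_eq_zero, smul_mul_assoc, ← H.mul_antipodeMul_T₂]
    generalize H.T₂ (a ⊗ₜ b) = t
    induction t with
    | zero => simp
    | add x y hx hy => simp only [map_add, add_mul, hx, hy]
    | tmul u v => simp [hS, mul_assoc]

/-- The antipode `S : A → A` of a regular multiplier Hopf algebra, characterised by
`m(S ⊗ ι)(Δ(a)(1 ⊗ b)) = ε(a) b` and `m(ι ⊗ S)((a ⊗ 1)Δ(b)) = ε(b) a`. -/
noncomputable def antipode (H : RegularMHA A) : A →ₗ[ℂ] A := H.exists_antipode.choose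

/-- `ψ` is a right integral: a non-zero linear functional with `(ψ ⊗ ι)Δ(a) = ψ(a)1` in `M(A)`,
i.e. `(ψ ⊗ ι)(Δ(a)(1 ⊗ b)) = ψ(a) b` and `(ψ ⊗ ι)((1 ⊗ b)Δ(a)) = ψ(a) b`. -/
structure IsRightIntegral (H : RegularMHA A) (ψ : A →ₗ[ℂ] ℂ) : Prop where
  ne_zero : ψ ≠ 0
  right : ∀ a b : A, TensorProduct.lid ℂ A (ψ.rTensor A (H.T₁ (a ⊗ₜ b))) = ψ a • b
  left : ∀ a b : A, TensorProduct.lid ℂ A (ψ.rTensor A (H.T₄ (b ⊗ₜ a))) = ψ a • b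

/-- `φ` is a left integral: a non-zero linear functional with `(ι ⊗ φ)Δ(a) = φ(a)1` in `M(A)`,
i.e. `(ι ⊗ φ)(Δ(a)(b ⊗ 1)) = φ(a) b` and `(ι ⊗ φ)((b ⊗ 1)Δ(a)) = φ(a) b`. -/
structure IsLeftIntegral (H : RegularMHA A) (φ : A →ₗ[ℂ] ℂ) : Prop where
  ne_zero : φ ≠ 0
  right : ∀ a b : A, TensorProduct.rid ℂ A (φ.lTensor A (H.T₃ (a ⊗ₜ b))) = φ a • b
  left : ∀ a b : A, TensorProduct.rid ℂ A (φ.lTensor A (H.T₂ (b ⊗ₜ a))) = φ a • b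

/-- An algebraic quantum group is a regular multiplier Hopf algebra with integrals. -/
def IsAlgebraicQuantumGroup (H : RegularMHA A) : Prop :=
  (∃ φ, H.IsLeftIntegral φ) ∧ ∃ ψ, H.IsRightIntegral ψ

/-- A regular multiplier Hopf algebra on a `*`-algebra is a multiplier Hopf `*`-algebra if the
coproduct is a `*`-homomorphism, `Δ(a*) = Δ(a)*` in `M(A ⊗ A)`. -/
def IsMultiplierHopfStar [StarRing A] [StarModule ℂ A] (H : RegularMHA A) : Prop :=
  ∀ a, H.Δ (star a) = starMultiplier (H.Δ a)

/-- A `*`-algebraic quantum group is a multiplier Hopf `*`-algebra with integrals. -/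
def IsStarAlgebraicQuantumGroup [StarRing A] [StarModule ℂ A] (H : RegularMHA A) : Prop :=
  H.IsMultiplierHopfStar ∧ H.IsAlgebraicQuantumGroup

end RegularMHA

/-- A linear functional `ψ` on a `*`-algebra is positive if `ψ(a* a) ≥ 0` for all `a`. -/
def IsPositiveFunctional [StarRing A] (ψ : A →ₗ[ℂ] ℂ) : Prop := ∀ a, 0 ≤ ψ (star a * a)

end Hopf

section Action

variable {A : Type u} [NonUnitalRing A] [Module ℂ A] [IsScalarTower ℂ A A] [SMulCommClass ℂ A A]

/-- A unital right action `b ◁ a = act b a` of the algebra `A` on the vector space `B`; unital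
means that the elements `b ◁ a` span `B`. -/
structure RightAction (A : Type u) [NonUnitalRing A] [Module ℂ A]
    (B : Type v) [AddCommGroup B] [Module ℂ B] where
  /-- `b ◁ a`. -/
  act : B →ₗ[ℂ] A →ₗ[ℂ] B
  act_mul : ∀ b a a', act b (a * a') = act (act b a) a'
  unital : Submodule.span ℂ {x | ∃ b a, x = act b a} = ⊤

/-- A right `A`-module algebra `B`: a unital right action of `A` on the algebra `B` such that
`(b b') ◁ a = ∑ (b ◁ a₍₁₎)(b' ◁ a₍₂₎)`. Since the action is unital it suffices to write this for
`b = d ◁ e`, in which case the right hand side is `∑ (d ◁ p)(b' ◁ q)` with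
`∑ p ⊗ q = (e ⊗ 1)Δ(a)`. -/
structure RightModuleAlgebra (H : RegularMHA A) (B : Type v) [NonUnitalRing B] [Module ℂ B]
    [IsScalarTower ℂ B B] [SMulCommClass ℂ B B] extends RightAction A B where
  act_algebra : ∀ (d : B) (e : A) (b' : B) (a : A),
    act (act d e * b') a
      = LinearMap.mul' ℂ B (TensorProduct.map (act d) (act b') (H.T₂ (e ⊗ₜ a)))

theorem exists_twist (H : RegularMHA A) {B : Type v} [AddCommGroup B] [Module ℂ B]
    (M : RightAction A B) :
    ∃ R : B ⊗[ℂ] A →ₗ[ℂ] A ⊗[ℂ] B, ∀ c b a,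
      (LinearMap.mulLeft ℂ c).rTensor B (R (b ⊗ₜ a)) = (M.act b).lTensor A (H.T₂ (c ⊗ₜ a)) := by
  have hs : Function.Surjective (TensorProduct.lift M.act) := by
    rw [← LinearMap.range_eq_top, eq_top_iff, ← M.unital, Submodule.span_le]
    rintro x ⟨b, a, rfl⟩
    exact ⟨b ⊗ₜ a, by simp⟩
  obtain ⟨s, hs⟩ := LinearMap.exists_rightInverse_of_surjective _ (LinearMap.range_eq_top.2 hs)
  let F : B ⊗[ℂ] A →ₗ[ℂ] A →ₗ[ℂ] A ⊗[ℂ] B := TensorProduct.lift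
    (LinearMap.mk₂ ℂ (fun d e => (M.act d).lTensor A ∘ₗ H.T₄.toLinearMap ∘ₗ
        TensorProduct.mk ℂ A A e)
      (by intros; ext; simp [LinearMap.lTensor_add]) (by intros; ext; simp [LinearMap.lTensor_smul])
      (by intros; ext; simp)
      (by intros; ext; simp))
  have hF : ∀ (w : B ⊗[ℂ] A) (a c : A), (LinearMap.mulLeft ℂ c).rTensor B (F w a)
      = (M.act (TensorProduct.lift M.act w)).lTensor A (H.T₂ (c ⊗ₜ a)) := by
    intro w a c
    induction w with
    | zero => simp
    | add x y hx hy => simp only [map_add, LinearMap.add_apply, LinearMap.lTensor_add, hx, hy]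
    | tmul d e =>
      simp only [F, TensorProduct.lift.tmul, LinearMap.mk₂_apply, LinearMap.comp_apply,
        TensorProduct.mk_apply, LinearEquiv.coe_coe]
      rw [← LinearMap.comp_apply, LinearMap.rTensor_comp_lTensor, ← LinearMap.lTensor_comp_rTensor,
        LinearMap.comp_apply, H.mulLeft_T₄, ← LinearMap.comp_apply, ← LinearMap.lTensor_comp]
      congr 2
      ext x
      simp [M.act_mul]
  refine ⟨TensorProduct.lift (F ∘ₗ s), fun c b a => ?_⟩
  rw [TensorProduct.lift.tmul, LinearMap.comp_apply, hF]
  have : TensorProduct.lift M.act (s b) = b := LinearMap.congr_fun hs b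
  rw [this]

/-- The twist map `R(b ⊗ a) = ∑ a₍₁₎ ⊗ (b ◁ a₍₂₎)`, the unique linear map `B ⊗ A → A ⊗ B` with
`(c ⊗ 1)R(b ⊗ a) = (ι ⊗ (b ◁ ·))((c ⊗ 1)Δ(a))` for all `c`. -/
noncomputable def twist (H : RegularMHA A) {B : Type v} [AddCommGroup B] [Module ℂ B]
    (M : RightAction A B) : B ⊗[ℂ] A →ₗ[ℂ] A ⊗[ℂ] B := (exists_twist H M).choose

theorem mulLeft_twist (H : RegularMHA A) {B : Type v} [AddCommGroup B] [Module ℂ B]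
    (M : RightAction A B) (c : A) (b : B) (a : A) :
    (LinearMap.mulLeft ℂ c).rTensor B (twist H M (b ⊗ₜ a))
      = (M.act b).lTensor A (H.T₂ (c ⊗ₜ a)) := (exists_twist H M).choose_spec c b a

/-- The opposite twist map `Rᵒᵖ(b ⊗ a) = ∑ a₍₂₎ ⊗ (b ◁ a₍₁₎)`. -/
noncomputable def twistOp (H : RegularMHA A) {B : Type v} [AddCommGroup B] [Module ℂ B]
    (M : RightAction A B) : B ⊗[ℂ] A →ₗ[ℂ] A ⊗[ℂ] B := twist H.op M

/-- `ι ⊗ f ⊗ ι` on `X ⊗ Y ⊗ Z ⊗ W`, with the factors grouped in pairs. -/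
noncomputable def middle {X Y Z W P Q : Type*} [AddCommGroup X] [Module ℂ X] [AddCommGroup Y]
    [Module ℂ Y] [AddCommGroup Z] [Module ℂ Z] [AddCommGroup W] [Module ℂ W]
    [AddCommGroup P] [Module ℂ P] [AddCommGroup Q] [Module ℂ Q] (f : Y ⊗[ℂ] Z →ₗ[ℂ] P ⊗[ℂ] Q) :
    (X ⊗[ℂ] Y) ⊗[ℂ] (Z ⊗[ℂ] W) →ₗ[ℂ] (X ⊗[ℂ] P) ⊗[ℂ] (Q ⊗[ℂ] W) :=
  (TensorProduct.assoc ℂ X P (Q ⊗[ℂ] W)).symm.toLinearMap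
    ∘ₗ ((TensorProduct.assoc ℂ P Q W).toLinearMap ∘ₗ f.rTensor W
        ∘ₗ (TensorProduct.assoc ℂ Y Z W).symm.toLinearMap).lTensor X
    ∘ₗ (TensorProduct.assoc ℂ X Y (Z ⊗[ℂ] W)).toLinearMap

variable {B : Type v} [NonUnitalRing B] [Module ℂ B] [IsScalarTower ℂ B B] [SMulCommClass ℂ B B]

/-- The product of the smash product, `(m_A ⊗ m_B)(ι_A ⊗ R ⊗ ι_B)`, i.e.
`(a ⊗ b)(a' ⊗ b') = ∑ a a'₍₁₎ ⊗ (b ◁ a'₍₂₎) b'`. -/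
noncomputable def smashMul (H : RegularMHA A) (M : RightAction A B) :
    (A ⊗[ℂ] B) ⊗[ℂ] (A ⊗[ℂ] B) →ₗ[ℂ] A ⊗[ℂ] B :=
  TensorProduct.map (LinearMap.mul' ℂ A) (LinearMap.mul' ℂ B) ∘ₗ middle (twist H M)

/-- Right multiplication by `a'` on the smash product: `a ⊗ b ↦ a R(b ⊗ a')`. -/
noncomputable def smashRightA (H : RegularMHA A) (M : RightAction A B) (a' : A) :
    A ⊗[ℂ] B →ₗ[ℂ] A ⊗[ℂ] B :=
  (LinearMap.mul' ℂ A).rTensor B ∘ₗ (TensorProduct.assoc ℂ A A B).symm.toLinearMap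
    ∘ₗ (twist H M ∘ₗ (TensorProduct.mk ℂ B A).flip a').lTensor A

/-- Left multiplication by `b'` on the smash product: `a ⊗ b ↦ R(b' ⊗ a) b`. -/
noncomputable def smashLeftB (H : RegularMHA A) (M : RightAction A B) (b' : B) :
    A ⊗[ℂ] B →ₗ[ℂ] A ⊗[ℂ] B :=
  (LinearMap.mul' ℂ B).lTensor A ∘ₗ (TensorProduct.assoc ℂ A B B).toLinearMap
    ∘ₗ (twist H M ∘ₗ TensorProduct.mk ℂ B A b').rTensor B

theorem smashRightA_tmul (H : RegularMHA A) (M : RightAction A B) (a' a : A) (b : B) :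
    smashRightA H M a' (a ⊗ₜ b) = (LinearMap.mulLeft ℂ a).rTensor B (twist H M (b ⊗ₜ a')) := by
  simp only [smashRightA, LinearMap.comp_apply, LinearMap.lTensor_tmul, LinearMap.flip_apply,
    TensorProduct.mk_apply]
  generalize twist H M (b ⊗ₜ a') = t
  induction t with
  | zero => simp
  | add x y hx hy => simp only [map_add, TensorProduct.tmul_add, hx, hy]
  | tmul u v => simp

theorem smashLeftB_tmul (H : RegularMHA A) (M : RightAction A B) (a : A) (b' b : B) :
    smashLeftB H M b' (a ⊗ₜ b) = (LinearMap.mulRight ℂ b).lTensor A (twist H M (b' ⊗ₜ a)) := by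
  simp only [smashLeftB, LinearMap.comp_apply, LinearMap.rTensor_tmul,
    TensorProduct.mk_apply]
  generalize twist H M (b' ⊗ₜ a) = t
  induction t with
  | zero => simp
  | add x y hx hy => simp only [map_add, TensorProduct.add_tmul, hx, hy]
  | tmul u v => simp

theorem smashMul_tmul_tmul (H : RegularMHA A) (M : RightAction A B) (a a' : A) (b b' : B) :
    smashMul H M ((a ⊗ₜ b) ⊗ₜ (a' ⊗ₜ b'))
      = TensorProduct.map (LinearMap.mulLeft ℂ a) (LinearMap.mulRight ℂ b')
        (twist H M (b ⊗ₜ a')) := by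
  simp only [smashMul, middle, LinearMap.comp_apply, LinearEquiv.coe_coe,
    TensorProduct.assoc_tmul, LinearMap.lTensor_tmul, TensorProduct.assoc_symm_tmul,
    LinearMap.rTensor_tmul]
  generalize twist H M (b ⊗ₜ a') = t
  induction t with
  | zero => simp
  | add x y hx hy => simp only [map_add, TensorProduct.tmul_add, TensorProduct.add_tmul, hx, hy]
  | tmul u v => simp

theorem smashMul_tmul_left (H : RegularMHA A) (M : RightAction A B) (a : A) (b : B)
    (y : A ⊗[ℂ] B) : smashMul H M ((a ⊗ₜ b) ⊗ₜ y)
      = (LinearMap.mulLeft ℂ a).rTensor B (smashLeftB H M b y) := by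
  induction y with
  | zero => simp
  | add x y hx hy => simp only [map_add, TensorProduct.tmul_add, hx, hy]
  | tmul u v =>
    rw [smashMul_tmul_tmul, smashLeftB_tmul, ← LinearMap.rTensor_comp_lTensor]
    rfl

theorem smashMul_tmul_right (H : RegularMHA A) (M : RightAction A B) (a : A) (b : B)
    (x : A ⊗[ℂ] B) : smashMul H M (x ⊗ₜ (a ⊗ₜ b))
      = (LinearMap.mulRight ℂ b).lTensor A (smashRightA H M a x) := by
  induction x with
  | zero => simp
  | add x y hx hy => simp only [map_add, TensorProduct.add_tmul, hx, hy]
  | tmul u v =>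
    rw [smashMul_tmul_tmul, smashRightA_tmul, ← LinearMap.lTensor_comp_rTensor]
    rfl

theorem mulLeft_smashRightA (H : RegularMHA A) (M : RightAction A B) (c a : A) (x : A ⊗[ℂ] B) :
    (LinearMap.mulLeft ℂ c).rTensor B (smashRightA H M a x)
      = smashRightA H M a ((LinearMap.mulLeft ℂ c).rTensor B x) := by
  induction x with
  | zero => simp
  | add x y hx hy => simp only [map_add, hx, hy]
  | tmul u v =>
    rw [LinearMap.rTensor_tmul, smashRightA_tmul, smashRightA_tmul, ← LinearMap.comp_apply,
      ← LinearMap.rTensor_comp]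
    congr 2
    ext y; simp

theorem mulRight_smashLeftB (H : RegularMHA A) (M : RightAction A B) (c b : B) (x : A ⊗[ℂ] B) :
    (LinearMap.mulRight ℂ c).lTensor A (smashLeftB H M b x)
      = smashLeftB H M b ((LinearMap.mulRight ℂ c).lTensor A x) := by
  induction x with
  | zero => simp
  | add x y hx hy => simp only [map_add, hx, hy]
  | tmul u v =>
    rw [LinearMap.lTensor_tmul, smashLeftB_tmul, smashLeftB_tmul, ← LinearMap.comp_apply,
      ← LinearMap.lTensor_comp]
    congr 2
    ext y; simp [mul_assoc]

theorem twist_mul (H : RegularMHA A) (M : RightAction A B) (b : B) (a a' : A) :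
    twist H M (b ⊗ₜ (a * a')) = smashRightA H M a' (twist H M (b ⊗ₜ a)) := by
  refine H.rTensor_mulLeft_cancel fun c => ?_
  rw [mulLeft_smashRightA, mulLeft_twist, mulLeft_twist, H.T₂_mul]
  generalize H.T₂ (c ⊗ₜ a) = t
  induction t with
  | zero => simp
  | add x y hx hy => simp only [map_add, hx, hy]
  | tmul p q =>
    rw [H.Δ_R_tmul, LinearMap.lTensor_tmul, smashRightA_tmul, mulLeft_twist,
      ← LinearMap.comp_apply, ← LinearMap.lTensor_comp]
    congr 2
    ext x; simp [M.act_mul]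

theorem smashRightA_mul (H : RegularMHA A) (M : RightAction A B) (a a' : A) (x : A ⊗[ℂ] B) :
    smashRightA H M (a * a') x = smashRightA H M a' (smashRightA H M a x) := by
  induction x with
  | zero => simp
  | add x y hx hy => simp only [map_add, hx, hy]
  | tmul u v =>
    rw [smashRightA_tmul, smashRightA_tmul, twist_mul, mulLeft_smashRightA]

/-- `x ↦ wΔ(x)`. -/
def mulΔ (H : RegularMHA A) (w : A ⊗[ℂ] A) : A →ₗ[ℂ] A ⊗[ℂ] A where
  toFun x := (H.Δ x).R w
  map_add' x y := by rw [map_add]; rfl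
  map_smul' c x := by rw [map_smul]; rfl

theorem mulΔ_zero (H : RegularMHA A) : mulΔ H (0 : A ⊗[ℂ] A) = 0 := by
  ext x; exact map_zero (Multiplier.R (H.Δ x))

theorem mulΔ_add (H : RegularMHA A) (s t : A ⊗[ℂ] A) :
    mulΔ H (s + t) = mulΔ H s + mulΔ H t := by
  ext x; exact map_add (Multiplier.R (H.Δ x)) s t

theorem mulΔ_tmul (H : RegularMHA A) (c e y : A) :
    mulΔ H (c ⊗ₜ e) y = (LinearMap.mulLeft ℂ e).lTensor A (H.T₂ (c ⊗ₜ y)) := H.Δ_R_tmul y c e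

/-- `u ⊗ v ↦ (v ⊗ 1)Δ(u)`. -/
noncomputable def T₂flip (H : RegularMHA A) : A ⊗[ℂ] A →ₗ[ℂ] A ⊗[ℂ] A :=
  H.T₂.toLinearMap ∘ₗ (TensorProduct.comm ℂ A A).toLinearMap

theorem lTensor_T₂flip (H : RegularMHA A) (e : A) (t : A ⊗[ℂ] A) :
    (T₂flip H).lTensor A (TensorProduct.assoc ℂ A A A (t ⊗ₜ e))
      = (H.T₂.toLinearMap ∘ₗ TensorProduct.mk ℂ A A e).lTensor A t := by
  induction t with
  | zero => simp
  | add x y hx hy => simp only [map_add, TensorProduct.add_tmul, hx, hy]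
  | tmul u v => simp [T₂flip]

theorem assoc_lTensor_mulLeft (e z : A) (t : A ⊗[ℂ] A) :
    ((LinearMap.mulLeft ℂ e).rTensor A).lTensor A (TensorProduct.assoc ℂ A A A (t ⊗ₜ z))
      = TensorProduct.assoc ℂ A A A ((LinearMap.mulLeft ℂ e).lTensor A t ⊗ₜ z) := by
  induction t with
  | zero => simp
  | add x y hx hy => simp only [map_add, TensorProduct.add_tmul, hx, hy]
  | tmul u v => simp

theorem assoc_lTensor_mulRight (d z : A) (t : A ⊗[ℂ] A) :
    ((LinearMap.mulRight ℂ d).lTensor A).lTensor A (TensorProduct.assoc ℂ A A A (t ⊗ₜ z))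
      = TensorProduct.assoc ℂ A A A (t ⊗ₜ (z * d)) := by
  induction t with
  | zero => simp
  | add x y hx hy => simp only [map_add, TensorProduct.add_tmul, hx, hy]
  | tmul u v => simp

theorem coassoc_T₂_aux (H : RegularMHA A) (a d : A) (w : A ⊗[ℂ] A) :
    ((LinearMap.mulRight ℂ d).lTensor A).lTensor A ((T₂flip H).lTensor A
      (TensorProduct.assoc ℂ A A A
        ((H.T₂.toLinearMap ∘ₗ (TensorProduct.mk ℂ A A).flip a).rTensor A w)))
      = TensorProduct.assoc ℂ A A A ((mulΔ H w).rTensor A (H.T₁ (a ⊗ₜ d))) := by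
  induction w with
  | zero => simp [mulΔ_zero]
  | add x y hx hy =>
    simp only [map_add, hx, hy, mulΔ_add, LinearMap.rTensor_add, LinearMap.add_apply]
  | tmul c e =>
    have h3 : (LinearMap.mulRight ℂ d).lTensor A ∘ₗ H.T₂.toLinearMap ∘ₗ TensorProduct.mk ℂ A A e
        = (LinearMap.mulLeft ℂ e).rTensor A ∘ₗ H.T₁.toLinearMap
          ∘ₗ (TensorProduct.mk ℂ A A).flip d :=
      LinearMap.ext fun x => (H.mulLeft_T₁ e x d).symm
    rw [LinearMap.rTensor_tmul, lTensor_T₂flip, ← LinearMap.comp_apply,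
      ← LinearMap.lTensor_comp, h3, LinearMap.lTensor_comp, LinearMap.comp_apply]
    have h4 := H.coassoc c a d
    change _ = TensorProduct.assoc ℂ A A A ((mulΔ H (c ⊗ₜ e)).rTensor A (H.T₁ (a ⊗ₜ d)))
    change ((LinearMap.mulLeft ℂ e).rTensor A).lTensor A
      ((H.T₁.toLinearMap ∘ₗ (TensorProduct.mk ℂ A A).flip d).lTensor A (H.T₂ (c ⊗ₜ a))) = _
    rw [← h4]
    generalize H.T₁ (a ⊗ₜ d) = t
    induction t with
    | zero => simp
    | add x y hx hy => simp only [map_add, hx, hy]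
    | tmul y z =>
      rw [LinearMap.rTensor_tmul, LinearMap.rTensor_tmul, assoc_lTensor_mulLeft, mulΔ_tmul]
      rfl

theorem mulΔ_T₂ (H : RegularMHA A) (p q : A) : mulΔ H (H.T₂ (p ⊗ₜ q))
    = (H.T₂.toLinearMap ∘ₗ TensorProduct.mk ℂ A A p) ∘ₗ LinearMap.mulLeft ℂ q :=
  LinearMap.ext fun y => (H.T₂_mul p q y).symm

theorem lTensor_mulRight_cancel₂ (H : MultiplierHopfAlgebra A) {z z' : A ⊗[ℂ] (A ⊗[ℂ] A)}
    (h : ∀ c, ((LinearMap.mulRight ℂ c).lTensor A).lTensor A z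
      = ((LinearMap.mulRight ℂ c).lTensor A).lTensor A z') : z = z' := by
  have h1 : ∀ t : A ⊗[ℂ] A, (∀ d : A, (LinearMap.mulRight ℂ d).lTensor A t = 0) → t = 0 :=
    fun t ht => H.lTensor_mulRight_cancel (z' := 0) fun d => by rw [ht, map_zero]
  have h2 := lTensor_cancel (V := A) (fun d : A => (LinearMap.mulRight ℂ d).lTensor A) h1 (z - z')
    fun d => (map_sub _ z z').trans (sub_eq_zero.2 (h d))
  exact sub_eq_zero.1 h2

theorem assoc_rTensor_mulRight (d : A) (f : A →ₗ[ℂ] A ⊗[ℂ] A) (t : A ⊗[ℂ] A) :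
    ((LinearMap.mulRight ℂ d).lTensor A).lTensor A
      (TensorProduct.assoc ℂ A A A (f.rTensor A t))
      = TensorProduct.assoc ℂ A A A (f.rTensor A ((LinearMap.mulRight ℂ d).lTensor A t)) := by
  induction t with
  | zero => simp
  | add x y hx hy => simp only [map_add, hx, hy]
  | tmul u v =>
    rw [LinearMap.rTensor_tmul, assoc_lTensor_mulRight, LinearMap.lTensor_tmul,
      LinearMap.rTensor_tmul, LinearMap.mulRight_apply]

theorem coassoc_T₂ (H : RegularMHA A) (a : A) (p q : A) :
    (T₂flip H).lTensor A (TensorProduct.assoc ℂ A A A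
        ((H.T₂.toLinearMap ∘ₗ (TensorProduct.mk ℂ A A).flip a).rTensor A (H.T₂ (p ⊗ₜ q))))
    = TensorProduct.assoc ℂ A A A
        ((H.T₂.toLinearMap ∘ₗ TensorProduct.mk ℂ A A p).rTensor A (H.T₂ (q ⊗ₜ a))) := by
  refine lTensor_mulRight_cancel₂ H.toMultiplierHopfAlgebra fun d => ?_
  refine (coassoc_T₂_aux H a d _).trans (Eq.trans ?_ (assoc_rTensor_mulRight d _ _).symm)
  rw [mulΔ_T₂, ← H.mulLeft_T₁]
  exact congrArg _ (LinearMap.rTensor_comp_apply A _ (LinearMap.mulLeft ℂ q) _)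

theorem mul_twist (H : RegularMHA A) (M : RightModuleAlgebra H B) (b b' : B) (a : A) :
    twist H M.toRightAction ((b * b') ⊗ₜ a)
      = smashLeftB H M.toRightAction b (twist H M.toRightAction (b' ⊗ₜ a)) := by
  have hb : b ∈ Submodule.span ℂ {x | ∃ b a, x = M.act b a} := by
    rw [M.unital]; trivial
  induction hb using Submodule.span_induction with
  | zero => simp [smashLeftB]
  | add x y _ _ hx hy =>
    have : smashLeftB H M.toRightAction (x + y)
        = smashLeftB H M.toRightAction x + smashLeftB H M.toRightAction y := by
      simp [smashLeftB, LinearMap.comp_add]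
    rw [add_mul, TensorProduct.add_tmul, map_add, hx, hy, this, LinearMap.add_apply]
  | smul c x _ hx =>
    have : smashLeftB H M.toRightAction (c • x) = c • smashLeftB H M.toRightAction x := by
      simp [smashLeftB, LinearMap.comp_smul]
    rw [smul_mul_assoc, ← TensorProduct.smul_tmul', map_smul, hx, this, LinearMap.smul_apply]
  | mem x hx =>
    obtain ⟨d, e, rfl⟩ := hx
    refine H.rTensor_mulLeft_cancel fun c => ?_
    rw [mulLeft_twist]
    have key : ∀ w : A ⊗[ℂ] A, (LinearMap.mul' ℂ B ∘ₗ TensorProduct.map (M.act d)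
        (M.act b')).lTensor A
          ((T₂flip H).lTensor A
            (TensorProduct.assoc ℂ A A A
              ((H.T₂.toLinearMap ∘ₗ (TensorProduct.mk ℂ A A).flip a).rTensor A w)))
        = (LinearMap.mul' ℂ B).lTensor A (TensorProduct.assoc ℂ A B B
          (((M.act d).lTensor A ∘ₗ mulΔ H w).rTensor B (twist H M.toRightAction (b' ⊗ₜ a)))) := by
      intro w
      obtain ⟨s, rfl⟩ := H.T₂.surjective w
      induction s with
      | zero => simp [mulΔ_zero]
      | add x y hx hy =>
        rw [map_add H.T₂, mulΔ_add, LinearMap.comp_add, LinearMap.rTensor_add, LinearMap.add_apply]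
        simp only [map_add, hx, hy]
      | tmul p q =>
        rw [coassoc_T₂]
        have h1 : mulΔ H (H.T₂ (p ⊗ₜ q))
            = (H.T₂.toLinearMap ∘ₗ TensorProduct.mk ℂ A A p) ∘ₗ LinearMap.mulLeft ℂ q := by
          ext y
          exact (H.T₂_mul p q y).symm
        rw [h1, ← LinearMap.comp_assoc, LinearMap.rTensor_comp _ _ (LinearMap.mulLeft ℂ q),
          LinearMap.comp_apply (LinearMap.rTensor B _) (LinearMap.rTensor B _), mulLeft_twist]
        generalize H.T₂ (q ⊗ₜ a) = t
        induction t with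
        | zero => simp
        | add x y hx hy => simp only [map_add, hx, hy]
        | tmul y z =>
          simp only [LinearMap.rTensor_tmul, LinearMap.lTensor_tmul, LinearMap.comp_apply,
            TensorProduct.mk_apply, LinearEquiv.coe_coe]
          generalize H.T₂ (p ⊗ₜ y) = t
          induction t with
          | zero => simp
          | add x y hx hy => simp only [map_add, TensorProduct.add_tmul, hx, hy]
          | tmul u v => simp
    have h2 := key (c ⊗ₜ e)
    have h3 : ∀ u : A ⊗[ℂ] B, (LinearMap.mulLeft ℂ c).rTensor B
        (smashLeftB H M.toRightAction (M.act d e) u)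
        = (LinearMap.mul' ℂ B).lTensor A (TensorProduct.assoc ℂ A B B
          (((M.act d).lTensor A ∘ₗ mulΔ H (c ⊗ₜ e)).rTensor B u)) := by
      intro u
      induction u with
      | zero => simp
      | add x y hx hy => simp only [map_add, hx, hy]
      | tmul x z =>
        have h4 : ((M.act d).lTensor A ∘ₗ mulΔ H (c ⊗ₜ e)) x
            = (LinearMap.mulLeft ℂ c).rTensor B (twist H M.toRightAction (M.act d e ⊗ₜ x)) := by
          rw [mulLeft_twist, LinearMap.comp_apply, mulΔ_tmul, ← LinearMap.comp_apply,
            ← LinearMap.lTensor_comp]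
          congr 2
          ext y; simp [M.act_mul]
        rw [smashLeftB_tmul, LinearMap.rTensor_tmul, h4]
        generalize twist H M.toRightAction (M.act d e ⊗ₜ x) = t
        induction t with
        | zero => simp
        | add x y hx hy => simp only [map_add, TensorProduct.add_tmul, hx, hy]
        | tmul u v => simp
    rw [h3, ← h2, LinearMap.rTensor_tmul]
    have h6 : ∀ t : A ⊗[ℂ] A, (M.act (M.act d e * b')).lTensor A t
        = (LinearMap.mul' ℂ B ∘ₗ TensorProduct.map (M.act d) (M.act b')).lTensor A
          ((T₂flip H).lTensor A
            (TensorProduct.assoc ℂ A A A (t ⊗ₜ e))) := by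
      intro t
      induction t with
      | zero => simp
      | add x y hx hy => simp only [map_add, TensorProduct.add_tmul, hx, hy]
      | tmul u v => simp [M.act_algebra, T₂flip]
    rw [h6]
    simp

theorem smashLeftB_mul (H : RegularMHA A) (M : RightModuleAlgebra H B) (b b' : B)
    (x : A ⊗[ℂ] B) : smashLeftB H M.toRightAction (b * b') x
      = smashLeftB H M.toRightAction b (smashLeftB H M.toRightAction b' x) := by
  induction x with
  | zero => simp
  | add x y hx hy => simp only [map_add, hx, hy]
  | tmul u v =>
    rw [smashLeftB_tmul, smashLeftB_tmul, mul_twist, mulRight_smashLeftB]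

theorem smashLeftB_smashRightA (H : RegularMHA A) (M : RightModuleAlgebra H B) (b : B) (a : A)
    (x : A ⊗[ℂ] B) : smashLeftB H M.toRightAction b (smashRightA H M.toRightAction a x)
      = smashRightA H M.toRightAction a (smashLeftB H M.toRightAction b x) := by
  induction x with
  | zero => simp
  | add x y hx hy => simp only [map_add, hx, hy]
  | tmul a' b' =>
    have h1 : ∀ s : A ⊗[ℂ] B, smashRightA H M.toRightAction a
        ((LinearMap.mulRight ℂ b').lTensor A s)
        = smashMul H M.toRightAction (s ⊗ₜ twist H M.toRightAction (b' ⊗ₜ a)) := by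
      intro s
      induction s with
      | zero => simp
      | add x y hx hy => simp only [map_add, TensorProduct.add_tmul, hx, hy]
      | tmul p q =>
        rw [LinearMap.lTensor_tmul, smashRightA_tmul, smashMul_tmul_left,
          LinearMap.mulRight_apply, mul_twist]
    rw [smashRightA_tmul, smashLeftB_tmul, h1]
    generalize twist H M.toRightAction (b' ⊗ₜ a) = t
    induction t with
    | zero => simp
    | add x y hx hy => simp only [map_add, TensorProduct.tmul_add, hx, hy]
    | tmul r s =>
      rw [LinearMap.rTensor_tmul, smashLeftB_tmul, smashMul_tmul_right, LinearMap.mulLeft_apply,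
        twist_mul]

theorem mulLeft_mulRight_comm (a : A) (b : B) (x : A ⊗[ℂ] B) :
    (LinearMap.mulLeft ℂ a).rTensor B ((LinearMap.mulRight ℂ b).lTensor A x)
      = (LinearMap.mulRight ℂ b).lTensor A ((LinearMap.mulLeft ℂ a).rTensor B x) := by
  rw [← LinearMap.comp_apply, ← LinearMap.comp_apply, LinearMap.rTensor_comp_lTensor,
    LinearMap.lTensor_comp_rTensor]

theorem smashMul_assoc (H : RegularMHA A) (M : RightModuleAlgebra H B) (x y z : A ⊗[ℂ] B) :
    smashMul H M.toRightAction (smashMul H M.toRightAction (x ⊗ₜ y) ⊗ₜ z)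
      = smashMul H M.toRightAction (x ⊗ₜ smashMul H M.toRightAction (y ⊗ₜ z)) := by
  induction x with
  | zero => simp
  | add x y hx hy => simp only [map_add, TensorProduct.add_tmul, hx, hy]
  | tmul a b =>
    induction z with
    | zero => simp
    | add x y hx hy => simp only [map_add, TensorProduct.tmul_add, hx, hy]
    | tmul c d =>
      rw [smashMul_tmul_left, smashMul_tmul_right, smashMul_tmul_right, smashMul_tmul_left,
        ← mulRight_smashLeftB, mulLeft_mulRight_comm, smashLeftB_smashRightA,
        mulLeft_smashRightA]

/-- The smash product `A # B` (also written `AB`): the space `A ⊗ B` with the product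
`(a # b)(a' # b') = ∑ a a'₍₁₎ # (b ◁ a'₍₂₎) b'`. -/
def SmashProduct {H : RegularMHA A} (_M : RightModuleAlgebra H B) : Type (max u v) := A ⊗[ℂ] B

namespace SmashProduct

variable {H : RegularMHA A} (M : RightModuleAlgebra H B)

noncomputable instance : AddCommGroup (SmashProduct M) := inferInstanceAs (AddCommGroup (A ⊗[ℂ] B))

noncomputable instance : Module ℂ (SmashProduct M) := inferInstanceAs (Module ℂ (A ⊗[ℂ] B))

/-- The linear identification of `A ⊗ B` with `A # B`, `a ⊗ b ↦ a # b`. -/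
noncomputable def mk : A ⊗[ℂ] B ≃ₗ[ℂ] SmashProduct M := LinearEquiv.refl ℂ (A ⊗[ℂ] B)

noncomputable instance : Mul (SmashProduct M) :=
  ⟨fun x y => mk M (smashMul H M.toRightAction ((mk M).symm x ⊗ₜ (mk M).symm y))⟩

theorem mul_def (x y : A ⊗[ℂ] B) :
    mk M x * mk M y = mk M (smashMul H M.toRightAction (x ⊗ₜ y)) := rfl

noncomputable instance : NonUnitalRing (SmashProduct M) where
  left_distrib x y z := by
    obtain ⟨x, rfl⟩ := (mk M).surjective x
    obtain ⟨y, rfl⟩ := (mk M).surjective y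
    obtain ⟨z, rfl⟩ := (mk M).surjective z
    rw [← map_add, mul_def, mul_def, mul_def, TensorProduct.tmul_add, map_add, map_add]
  right_distrib x y z := by
    obtain ⟨x, rfl⟩ := (mk M).surjective x
    obtain ⟨y, rfl⟩ := (mk M).surjective y
    obtain ⟨z, rfl⟩ := (mk M).surjective z
    rw [← map_add, mul_def, mul_def, mul_def, TensorProduct.add_tmul, map_add, map_add]
  zero_mul x := by
    obtain ⟨x, rfl⟩ := (mk M).surjective x
    rw [← map_zero (mk M), mul_def, TensorProduct.zero_tmul, map_zero]
  mul_zero x := by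
    obtain ⟨x, rfl⟩ := (mk M).surjective x
    rw [← map_zero (mk M), mul_def, TensorProduct.tmul_zero, map_zero]
  mul_assoc x y z := by
    obtain ⟨x, rfl⟩ := (mk M).surjective x
    obtain ⟨y, rfl⟩ := (mk M).surjective y
    obtain ⟨z, rfl⟩ := (mk M).surjective z
    rw [mul_def, mul_def, mul_def, mul_def, smashMul_assoc]

instance : IsScalarTower ℂ (SmashProduct M) (SmashProduct M) where
  smul_assoc c x y := by
    obtain ⟨x, rfl⟩ := (mk M).surjective x
    obtain ⟨y, rfl⟩ := (mk M).surjective y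
    rw [smul_eq_mul, smul_eq_mul, ← map_smul, mul_def, mul_def, ← TensorProduct.smul_tmul',
      map_smul, map_smul]

instance : SMulCommClass ℂ (SmashProduct M) (SmashProduct M) where
  smul_comm c x y := by
    obtain ⟨x, rfl⟩ := (mk M).surjective x
    obtain ⟨y, rfl⟩ := (mk M).surjective y
    rw [smul_eq_mul, smul_eq_mul, ← map_smul, mul_def, mul_def, TensorProduct.tmul_smul,
      map_smul, map_smul]

/-- The embedding `π_A : A → M(A # B)`: `π_A(a')(a # b) = a'a # b` and
`(a # b)π_A(a') = a R(b ⊗ a') = ∑ a a'₍₁₎ # (b ◁ a'₍₂₎)`. -/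
noncomputable def πA (a : A) : Multiplier (SmashProduct M) :=
  Multiplier.ofMaps (A := SmashProduct M)
    ((mk M).toLinearMap ∘ₗ (LinearMap.mulLeft ℂ a).rTensor B ∘ₗ (mk M).symm.toLinearMap)
    ((mk M).toLinearMap ∘ₗ smashRightA H M.toRightAction a ∘ₗ (mk M).symm.toLinearMap)
    (fun x y => by
      obtain ⟨x, rfl⟩ := (mk M).surjective x
      obtain ⟨y, rfl⟩ := (mk M).surjective y
      simp only [LinearMap.comp_apply, LinearEquiv.coe_coe, mul_def, LinearEquiv.symm_apply_apply]
      congr 1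
      induction y with
      | zero => simp
      | add x y hx hy => simp only [map_add, TensorProduct.tmul_add, hx, hy]
      | tmul c d =>
        rw [smashMul_tmul_right, smashMul_tmul_right, mulLeft_mulRight_comm, mulLeft_smashRightA])
    (fun x y => by
      obtain ⟨x, rfl⟩ := (mk M).surjective x
      obtain ⟨y, rfl⟩ := (mk M).surjective y
      simp only [LinearMap.comp_apply, LinearEquiv.coe_coe, mul_def, LinearEquiv.symm_apply_apply]
      congr 1
      induction x with
      | zero => simp
      | add x y hx hy => simp only [map_add, TensorProduct.add_tmul, hx, hy]
      | tmul c d =>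
        rw [smashMul_tmul_left, smashMul_tmul_left, ← mulLeft_smashRightA, smashLeftB_smashRightA])
    (fun x y => by
      obtain ⟨x, rfl⟩ := (mk M).surjective x
      obtain ⟨y, rfl⟩ := (mk M).surjective y
      simp only [LinearMap.comp_apply, LinearEquiv.coe_coe, mul_def, LinearEquiv.symm_apply_apply]
      congr 1
      induction y with
      | zero => simp
      | add x y hx hy => simp only [map_add, TensorProduct.tmul_add, hx, hy]
      | tmul c d =>
        rw [LinearMap.rTensor_tmul, smashMul_tmul_right, smashMul_tmul_right,
          LinearMap.mulLeft_apply, smashRightA_mul])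

/-- The embedding `π_B : B → M(A # B)`: `(a # b)π_B(b') = a # bb'` and
`π_B(b')(a # b) = R(b' ⊗ a) b = ∑ a₍₁₎ # (b' ◁ a₍₂₎) b`. -/
noncomputable def πB (b : B) : Multiplier (SmashProduct M) :=
  Multiplier.ofMaps (A := SmashProduct M)
    ((mk M).toLinearMap ∘ₗ smashLeftB H M.toRightAction b ∘ₗ (mk M).symm.toLinearMap)
    ((mk M).toLinearMap ∘ₗ (LinearMap.mulRight ℂ b).lTensor A ∘ₗ (mk M).symm.toLinearMap)
    (fun x y => by
      obtain ⟨x, rfl⟩ := (mk M).surjective x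
      obtain ⟨y, rfl⟩ := (mk M).surjective y
      simp only [LinearMap.comp_apply, LinearEquiv.coe_coe, mul_def, LinearEquiv.symm_apply_apply]
      congr 1
      induction y with
      | zero => simp
      | add x y hx hy => simp only [map_add, TensorProduct.tmul_add, hx, hy]
      | tmul c d =>
        rw [smashMul_tmul_right, smashMul_tmul_right, ← mulRight_smashLeftB,
          smashLeftB_smashRightA])
    (fun x y => by
      obtain ⟨x, rfl⟩ := (mk M).surjective x
      obtain ⟨y, rfl⟩ := (mk M).surjective y
      simp only [LinearMap.comp_apply, LinearEquiv.coe_coe, mul_def, LinearEquiv.symm_apply_apply]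
      congr 1
      induction x with
      | zero => simp
      | add x y hx hy => simp only [map_add, TensorProduct.add_tmul, hx, hy]
      | tmul c d =>
        rw [smashMul_tmul_left, smashMul_tmul_left, ← mulLeft_mulRight_comm, mulRight_smashLeftB])
    (fun x y => by
      obtain ⟨x, rfl⟩ := (mk M).surjective x
      obtain ⟨y, rfl⟩ := (mk M).surjective y
      simp only [LinearMap.comp_apply, LinearEquiv.coe_coe, mul_def, LinearEquiv.symm_apply_apply]
      congr 1
      induction x with
      | zero => simp
      | add x y hx hy => simp only [map_add, TensorProduct.add_tmul, hx, hy]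
      | tmul c d =>
        rw [LinearMap.lTensor_tmul, smashMul_tmul_left, smashMul_tmul_left,
          LinearMap.mulRight_apply, smashLeftB_mul])

/-- The functional `ψ_#(ab) = ψ_A(a)ψ_B(b)` on the smash product. -/
noncomputable def functional (ψA : A →ₗ[ℂ] ℂ) (ψB : B →ₗ[ℂ] ℂ) : SmashProduct M →ₗ[ℂ] ℂ :=
  LinearMap.mul' ℂ ℂ ∘ₗ TensorProduct.map ψA ψB ∘ₗ (mk M).symm.toLinearMap

end SmashProduct

end Action

section Coaction

variable {A : Type u} {B : Type v} [NonUnitalRing B] [Module ℂ B] [IsScalarTower ℂ B B]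
  [SMulCommClass ℂ B B]

/-- The completed module `M₀(B ⊗ A)` of the `B`-bimodule `B ⊗ A` (multiplication in the first
factor): pairs of linear maps `y = (b ↦ (b ⊗ 1)y, b ↦ y(b ⊗ 1))` from `B` to `B ⊗ A` compatible
with the bimodule structure. -/
def CompletedModule (B : Type v) [NonUnitalRing B] [Module ℂ B] [IsScalarTower ℂ B B]
    [SMulCommClass ℂ B B] (A : Type u) [AddCommGroup A] [Module ℂ A] :
    Submodule ℂ ((B →ₗ[ℂ] B ⊗[ℂ] A) × (B →ₗ[ℂ] B ⊗[ℂ] A)) where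
  carrier := {y |
    (∀ b b', y.1 (b * b') = (LinearMap.mulLeft ℂ b).rTensor A (y.1 b')) ∧
    (∀ b b', y.2 (b * b') = (LinearMap.mulRight ℂ b').rTensor A (y.2 b)) ∧
    ∀ b b', (LinearMap.mulLeft ℂ b).rTensor A (y.2 b')
      = (LinearMap.mulRight ℂ b').rTensor A (y.1 b)}
  add_mem' := by
    rintro y z ⟨h1, h2, h3⟩ ⟨k1, k2, k3⟩
    refine ⟨?_, ?_, ?_⟩ <;> intro b b'
    · simp [h1, k1]
    · simp [h2, k2]
    · simp [h3, k3]
  zero_mem' := by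
    refine ⟨?_, ?_, ?_⟩ <;> intro b b' <;> simp
  smul_mem' := by
    rintro c y ⟨h1, h2, h3⟩
    refine ⟨?_, ?_, ?_⟩ <;> intro b b'
    · simp [h1]
    · simp [h2]
    · simp [h3]

variable [AddCommGroup A] [Module ℂ A]

/-- The cotwist map `T(a ⊗ b) = Γ(a)(b ⊗ 1)` of a linear map `Γ : A → M₀(B ⊗ A)`. -/
noncomputable def cotwist (Γ : A →ₗ[ℂ] CompletedModule B A) : A ⊗[ℂ] B →ₗ[ℂ] B ⊗[ℂ] A :=
  TensorProduct.lift (LinearMap.snd ℂ _ _ ∘ₗ (CompletedModule B A).subtype ∘ₗ Γ)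

/-- The opposite cotwist map `Tᵒᵖ(a ⊗ b) = (b ⊗ 1)Γ(a)`. -/
noncomputable def cotwistOp (Γ : A →ₗ[ℂ] CompletedModule B A) : A ⊗[ℂ] B →ₗ[ℂ] B ⊗[ℂ] A :=
  TensorProduct.lift (LinearMap.fst ℂ _ _ ∘ₗ (CompletedModule B A).subtype ∘ₗ Γ)

/-- A left coaction of a regular multiplier Hopf algebra `B` on a vector space `A`: an injective
linear map `Γ : A → M₀(B ⊗ A)` with `(ι ⊗ Γ)Γ = (Δ_B ⊗ ι)Γ` in `M₀(B ⊗ B ⊗ A)`. The equation in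
`M₀(B ⊗ B ⊗ A)` says that both sides agree after multiplication in the first two factors by
`B ⊗ B = (B ⊗ 1)Δ_B(B)` from the left and by `B ⊗ B = Δ_B(B)(B ⊗ 1)` from the right. -/
structure LeftCoaction (HB : RegularMHA B) (A : Type u) [AddCommGroup A] [Module ℂ A] where
  /-- The coaction. -/
  Γ : A →ₗ[ℂ] CompletedModule B A
  injective : Function.Injective Γ
  coassoc_left : ∀ (a : A) (p q : B),
    (cotwistOp Γ).lTensor B (TensorProduct.assoc ℂ B A B
        ((cotwistOp Γ ∘ₗ TensorProduct.mk ℂ A B a).rTensor B (HB.T₂ (p ⊗ₜ q))))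
      = TensorProduct.assoc ℂ B B A
        ((HB.T₂.toLinearMap ∘ₗ TensorProduct.mk ℂ B B p).rTensor A (cotwistOp Γ (a ⊗ₜ q)))
  coassoc_right : ∀ (a : A) (p q : B),
    (cotwist Γ).lTensor B (TensorProduct.assoc ℂ B A B
        ((cotwist Γ ∘ₗ TensorProduct.mk ℂ A B a).rTensor B (HB.T₃ (q ⊗ₜ p))))
      = TensorProduct.assoc ℂ B B A
        ((HB.T₃.toLinearMap ∘ₗ (TensorProduct.mk ℂ B B).flip p).rTensor A (cotwist Γ (a ⊗ₜ q)))

end Coaction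

section Comodule

/-- `f ⊗ ι` on the first two of three tensor factors. -/
noncomputable def leg₁₂ {X Y P Q : Type*} (Z : Type*) [AddCommGroup X] [Module ℂ X]
    [AddCommGroup Y] [Module ℂ Y] [AddCommGroup P] [Module ℂ P] [AddCommGroup Q] [Module ℂ Q]
    [AddCommGroup Z] [Module ℂ Z] (f : X ⊗[ℂ] Y →ₗ[ℂ] P ⊗[ℂ] Q) :
    X ⊗[ℂ] (Y ⊗[ℂ] Z) →ₗ[ℂ] P ⊗[ℂ] (Q ⊗[ℂ] Z) :=
  (TensorProduct.assoc ℂ P Q Z).toLinearMap ∘ₗ f.rTensor Z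
    ∘ₗ (TensorProduct.assoc ℂ X Y Z).symm.toLinearMap

variable {A : Type u} [NonUnitalRing A] [Module ℂ A] [IsScalarTower ℂ A A] [SMulCommClass ℂ A A]
  {B : Type v} [NonUnitalRing B] [Module ℂ B] [IsScalarTower ℂ B B] [SMulCommClass ℂ B B]

/-- `z ∈ A ⊗ B ⊗ A` is the element `((ι ⊗ T)(Δ_A(a) ⊗ b))(1 ⊗ 1 ⊗ a')`. Here
`(ι ⊗ T)(Δ_A(a) ⊗ b)` is an element of the completion of `A ⊗ B ⊗ A` with respect to
multiplication in the first factor, given by `(c ⊗ 1 ⊗ 1)(·) = (ι ⊗ T)((c ⊗ 1)Δ_A(a) ⊗ b)` and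
`(·)(c ⊗ 1 ⊗ 1) = (ι ⊗ T)(Δ_A(a)(c ⊗ 1) ⊗ b)`. -/
def IsCoveredRight (HA : RegularMHA A) {HB : RegularMHA B} (Γ : LeftCoaction HB A)
    (a a' : A) (b : B) (z : A ⊗[ℂ] (B ⊗[ℂ] A)) : Prop :=
  (∀ c, (LinearMap.mulLeft ℂ c).rTensor _ z
    = ((LinearMap.mulRight ℂ a').lTensor B).lTensor A
      ((cotwist Γ.Γ ∘ₗ (TensorProduct.mk ℂ A B).flip b).lTensor A (HA.T₂ (c ⊗ₜ a)))) ∧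
  ∀ c, (LinearMap.mulRight ℂ c).rTensor _ z
    = ((LinearMap.mulRight ℂ a').lTensor B).lTensor A
      ((cotwist Γ.Γ ∘ₗ (TensorProduct.mk ℂ A B).flip b).lTensor A (HA.T₃ (a ⊗ₜ c)))

/-- `z ∈ A ⊗ B ⊗ A` is the element `(1 ⊗ 1 ⊗ a')((ι ⊗ T)(Δ_A(a) ⊗ b))`. -/
def IsCoveredLeft (HA : RegularMHA A) {HB : RegularMHA B} (Γ : LeftCoaction HB A)
    (a a' : A) (b : B) (z : A ⊗[ℂ] (B ⊗[ℂ] A)) : Prop :=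
  (∀ c, (LinearMap.mulLeft ℂ c).rTensor _ z
    = ((LinearMap.mulLeft ℂ a').lTensor B).lTensor A
      ((cotwist Γ.Γ ∘ₗ (TensorProduct.mk ℂ A B).flip b).lTensor A (HA.T₂ (c ⊗ₜ a)))) ∧
  ∀ c, (LinearMap.mulRight ℂ c).rTensor _ z
    = ((LinearMap.mulLeft ℂ a').lTensor B).lTensor A
      ((cotwist Γ.Γ ∘ₗ (TensorProduct.mk ℂ A B).flip b).lTensor A (HA.T₃ (a ⊗ₜ c)))

/-- A left `B`-comodule coalgebra `A`: a left coaction `Γ` of `B` on the regular multiplier Hopf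
algebra `A` such that the elements `((ι ⊗ T)(Δ_A(a) ⊗ b))(1 ⊗ 1 ⊗ a')` and
`(1 ⊗ 1 ⊗ a')((ι ⊗ T)(Δ_A(a) ⊗ b))` lie in `A ⊗ B ⊗ A`, and
`(T ⊗ ι)(ι ⊗ T)(Δ_A ⊗ ι) = (ι ⊗ Δ_A)T` on `A ⊗ B`, an equation that is read after multiplication
by `1 ⊗ 1 ⊗ a'` from the right and from the left. -/
structure LeftComoduleCoalgebra (HA : RegularMHA A) (HB : RegularMHA B)
    extends LeftCoaction HB A where
  covered_right : ∀ a a' b, ∃ z, IsCoveredRight HA toLeftCoaction a a' b z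
  covered_left : ∀ a a' b, ∃ z, IsCoveredLeft HA toLeftCoaction a a' b z
  comul_right : ∀ a a' b z, IsCoveredRight HA toLeftCoaction a a' b z →
    leg₁₂ A (cotwist Γ) z
      = (HA.T₁.toLinearMap ∘ₗ (TensorProduct.mk ℂ A A).flip a').lTensor B (cotwist Γ (a ⊗ₜ b))
  comul_left : ∀ a a' b z, IsCoveredLeft HA toLeftCoaction a a' b z →
    leg₁₂ A (cotwist Γ) z
      = (HA.T₄.toLinearMap ∘ₗ TensorProduct.mk ℂ A A a').lTensor B (cotwist Γ (a ⊗ₜ b))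

variable {HA : RegularMHA A} {HB : RegularMHA B}

/-- The map `P = Tᵒᵖ ∘ Rᵒᵖ` on `B ⊗ A`, `P(b ⊗ a) = ∑ ((b ◁ a₍₁₎) ⊗ 1)Γ(a₍₂₎)`. -/
noncomputable def mapP (M : RightModuleAlgebra HA B) (C : LeftComoduleCoalgebra HA HB) :
    B ⊗[ℂ] A →ₗ[ℂ] B ⊗[ℂ] A :=
  cotwistOp C.Γ ∘ₗ twistOp HA M.toRightAction

/-- The compatibility relations between a right `A`-module algebra `B` and a left `B`-comodule
coalgebra `A`:
* `P(ι ⊗ m_A) = (ι ⊗ m_A)P₁₃P₁₂` on `B ⊗ A ⊗ A`;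
* `(Δ_B ⊗ ι)P = P₂₃P₁₃(Δ_B ⊗ ι)` on `B ⊗ A`, read after multiplication by `c ∈ B` from the left in
  the first factor: `z = (c ⊗ 1 ⊗ 1)P₁₃(Δ_B(b) ⊗ a)` lies in `B ⊗ B ⊗ A` and
  `P₂₃ z = (c ⊗ 1 ⊗ 1)(Δ_B ⊗ ι)P(b ⊗ a)`, where `P₁₃(Δ_B(b) ⊗ a)` is given by
  `(1 ⊗ d ⊗ 1)P₁₃(Δ_B(b) ⊗ a) = P₁₃((1 ⊗ d)Δ_B(b) ⊗ a)`;
* `T ∘ R = Tᵒᵖ ∘ Rᵒᵖ`. -/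
structure Compatible (M : RightModuleAlgebra HA B) (C : LeftComoduleCoalgebra HA HB) : Prop where
  mul : mapP M C ∘ₗ (LinearMap.mul' ℂ A).lTensor B
    = (LinearMap.mul' ℂ A).lTensor B
      ∘ₗ ((TensorProduct.comm ℂ A A).toLinearMap.lTensor B ∘ₗ leg₁₂ A (mapP M C)
          ∘ₗ (TensorProduct.comm ℂ A A).toLinearMap.lTensor B)
      ∘ₗ leg₁₂ A (mapP M C)
  comul : ∀ (c b : B) (a : A), ∃ z : B ⊗[ℂ] (B ⊗[ℂ] A),
    (∀ d : B, ((LinearMap.mulLeft ℂ d).rTensor A).lTensor B z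
      = (LinearMap.mulLeft ℂ c).rTensor (B ⊗[ℂ] A)
        (((TensorProduct.leftComm ℂ B B A).toLinearMap ∘ₗ (mapP M C).lTensor B
            ∘ₗ (TensorProduct.leftComm ℂ B B A).toLinearMap)
          (TensorProduct.assoc ℂ B B A (HB.T₄ (d ⊗ₜ b) ⊗ₜ a)))) ∧
    (mapP M C).lTensor B z
      = TensorProduct.assoc ℂ B B A
        ((HB.T₂.toLinearMap ∘ₗ TensorProduct.mk ℂ B B c).rTensor A (mapP M C (b ⊗ₜ a)))
  twist_cotwist : cotwist C.Γ ∘ₗ twist HA M.toRightAction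
    = cotwistOp C.Γ ∘ₗ twistOp HA M.toRightAction

/-- `Δ` is the coproduct `Δ_#` of the bicrossproduct: formally
`Δ_#(ab) = (ι ⊗ T ⊗ ι)(Δ_A(a) ⊗ Δ_B(b)) = ∑ (a₍₁₎ ⊗ 1)Γ(a₍₂₎)Δ_B(b)`, that is,
`(a' ⊗ 1)Δ_#(ab)(1 ⊗ b') = (ι ⊗ T ⊗ ι)((a' ⊗ 1)Δ_A(a) ⊗ Δ_B(b)(1 ⊗ b'))` for all `a' ∈ A`,
`b' ∈ B`. This determines `Δ_#(ab) ∈ M(AB ⊗ AB)`. -/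
def IsSmashCoproduct (M : RightModuleAlgebra HA B) (C : LeftComoduleCoalgebra HA HB)
    (Δ : SmashProduct M → Multiplier (SmashProduct M ⊗[ℂ] SmashProduct M)) : Prop :=
  ∀ (a a' : A) (b b' : B),
    tmulOne (SmashProduct.πA M a') * Δ (SmashProduct.mk M (a ⊗ₜ b))
        * oneTmul (SmashProduct.πB M b')
      = incl (TensorProduct.map (SmashProduct.mk M).toLinearMap (SmashProduct.mk M).toLinearMap
        (middle (cotwist C.Γ) (HA.T₂ (a' ⊗ₜ a) ⊗ₜ HB.T₁ (b ⊗ₜ b'))))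

/-- Compatibility of the action with the involutions: `(b ◁ a)* = b* ◁ S(a)*`. -/
def IsStarAction [StarRing A] [StarRing B] (M : RightModuleAlgebra HA B) : Prop :=
  ∀ a b, star (M.act b a) = M.act (star b) (star (HA.antipode a))

/-- Compatibility of the coaction with the involutions: `Γ(S_A(a)*) = ((ι ⊗ S_A)Γ(a))*` in
`M₀(B ⊗ A)`, where `(b ⊗ 1)y* = (y(b* ⊗ 1))*` and `y*(b ⊗ 1) = ((b* ⊗ 1)y)*`. -/
def IsStarCoaction [StarRing A] [StarModule ℂ A] [StarRing B] [StarModule ℂ B]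
    (C : LeftComoduleCoalgebra HA HB) : Prop :=
  ∀ a b,
    cotwistOp C.Γ (star (HA.antipode a) ⊗ₜ b)
      = star (HA.antipode.lTensor B (cotwist C.Γ (a ⊗ₜ star b))) ∧
    cotwist C.Γ (star (HA.antipode a) ⊗ₜ b)
      = star (HA.antipode.lTensor B (cotwistOp C.Γ (a ⊗ₜ star b)))

end Comodule

end Bicross

open Bicross

/-! The coproduct `Δ_#` is obtained from its two canonical maps, T₁(x ⊗ y) = Δ_#(x)(1 ⊗ y) and T₂(x
⊗ y) = (x ⊗ 1)Δ_#(y), so that all computations take place in honest tensor products. By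
`MultiplierHopfAlgebra.ofCanonicalMaps`, two bijections T₁ and T₂ come from a multiplier Hopf
algebra as soon as (x ⊗ 1)T₁(y ⊗ z) = T₂(x ⊗ y)(1 ⊗ z), T₂ is multiplicative in its second argument,
and T₂ ⊗ ι and ι ⊗ T₁ satisfy coassociativity.

Both maps are composites of bijections. R is bijective because S_A is invertible, Tᵒᵖ because S_B
is; so P = TᵒᵖRᵒᵖ is bijective, and T is bijective by T∘R = P. The comodule coalgebra condition says
that a ⊗ b ⊗ w ↦ ∑ a₍₁₎ ⊗ T(a₍₂₎ ⊗ b)(1 ⊗ w) is the conjugate, by T on the first two legs, of the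
canonical map T₁ of A. This bijection is `cotwistComul`; composed with the T₁ of B it gives the T₁
of AB. On the other side, (pc ⊗ 1)Δ_#(ab) is the T₂ of A followed by P and the T₂ of B.

Coassociativity (`smashCanon_coassoc`) holds because each factor of T₂ commutes with T₁.
Multiplicativity (`smashT₂_mul`) is checked on (ab)(a'b') = a(ba')b': passing a uses P(ι ⊗ m_A) = (ι
⊗ m_A)P₁₃P₁₂, exchanging b and a' uses `smashSigma_twist`, which rests on the relation for (Δ_B ⊗
ι)P, and passing b' is multiplicativity of Δ_B. The link between T₁ and T₂ is `smashMul_smashT₁`.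

The antipode is S(ab) = R(S_B ⊗ S_A)T(a ⊗ b). It is bijective, and a multiplier Hopf algebra with
bijective antipode is regular (`toRegular`). For the integral, ψ_A on the first leg turns
`cotwistComul` into ψ_A(a)(b ⊗ w) (`integral_cotwistComul`), after which ψ_B absorbs Δ_B. A left
integral is then ψ_#∘S⁻¹.

The map (ab)* = b*a* is an involution because the star condition on the action matches the formula
for R⁻¹. As for the coproduct, formally Δ_#(a) = ∑ (a₍₁₎ ⊗ 1)Γ(a₍₂₎) = ∑ Γ'(a₍₂₎)(a₍₁₎ ⊗ 1) with Γ'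
= (ι ⊗ S_A)ΓS_A⁻¹ (`twist_mapP_comul`), since (ι ⊗ S_A)Γ is a convolution inverse of Γ. The star
condition on the coaction reads Γ'(x) = Γ(x*)*, so the adjoint of the first expression is the second
one for a*. Finally ψ_#((ab)*(a'b')) = ψ_A(a*a')ψ_B(b*b'), hence positivity of ψ_# is the Schur
product theorem for Gram matrices. -/

namespace Bicross

universe u v w

/-! ### Additivity instances for linear maps -/

section Instances

variable {X Y : Type*} [AddCommMonoid X] [Module ℂ X] [AddCommMonoid Y] [Module ℂ Y]

instance : AddHomClass (X →ₗ[ℂ] Y) X Y := inferInstance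

instance : ZeroHomClass (X →ₗ[ℂ] Y) X Y := inferInstance

instance : AddMonoidHomClass (X →ₗ[ℂ] Y) X Y := inferInstance

instance : AddHomClass (X ≃ₗ[ℂ] Y) X Y := inferInstance

instance : ZeroHomClass (X ≃ₗ[ℂ] Y) X Y := inferInstance

instance : AddMonoidHomClass (X ≃ₗ[ℂ] Y) X Y := inferInstance

end Instances

/-! ### Inverses of the canonical maps and the antipode -/

section General

variable {A : Type u} [NonUnitalRing A] [Module ℂ A] [IsScalarTower ℂ A A] [SMulCommClass ℂ A A]

namespace MultiplierHopfAlgebra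

/-- Applying ε to the middle leg of coassociativity for T₁⁻¹ leaves S on one side and a
multiplication by y on the other. Formally T₁⁻¹(x ⊗ z) = ∑ x₍₁₎ ⊗ S(x₍₂₎)z, which makes sense once
the first leg is covered. -/
theorem mulLeft_T₁_symm (H : MultiplierHopfAlgebra A) (y x z : A) :
    (LinearMap.mulLeft ℂ y).rTensor A (H.T₁.symm (x ⊗ₜ z))
      = (H.antipodeMul ∘ₗ (TensorProduct.mk ℂ A A).flip z).lTensor A (H.T₂ (y ⊗ₜ x)) := by
  have h := congrArg (((TensorProduct.lid ℂ A).toLinearMap ∘ₗ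
    H.counit.rTensor A).lTensor A) (H.coassoc_symm y x z)
  have h1 : ∀ t : A ⊗[ℂ] A, (H.antipodeMul ∘ₗ (TensorProduct.mk ℂ A A).flip z).lTensor A t =
      ((TensorProduct.lid ℂ A).toLinearMap ∘ₗ H.counit.rTensor A).lTensor A
        (H.T₁.symm.toLinearMap.lTensor A (TensorProduct.assoc ℂ A A A (t ⊗ₜ z))) := by
    intro t
    induction t with
    | zero => simp
    | add x y hx hy => simp only [map_add, TensorProduct.add_tmul, hx, hy]
    | tmul u v => simp [antipodeMul]
  rw [h1, h]
  generalize H.T₁.symm (x ⊗ₜ z) = w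
  induction w with
  | zero => simp
  | add x y hx hy => simp only [map_add, hx, hy]
  | tmul u v =>
    have h3 := H.counit_T₂ (y ⊗ₜ u)
    rw [LinearMap.mul'_apply] at h3
    simp only [LinearMap.rTensor_tmul, LinearMap.comp_apply, TensorProduct.mk_apply,
      LinearEquiv.coe_coe, LinearMap.mulLeft_apply]
    rw [← h3]
    generalize H.T₂ (y ⊗ₜ u) = t
    induction t with
    | zero => simp
    | add x y hx hy => simp only [map_add, TensorProduct.add_tmul, hx, hy]
    | tmul b c => simp [TensorProduct.smul_tmul]

/-- The mirror image: T₂⁻¹(z ⊗ x) = ∑ zS(x₍₁₎) ⊗ x₍₂₎, covered in the second leg. -/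
theorem mulRight_T₂_symm (H : MultiplierHopfAlgebra A) (y x z : A) :
    (LinearMap.mulRight ℂ y).lTensor A (H.T₂.symm (z ⊗ₜ x))
      = (H.mulAntipode ∘ₗ TensorProduct.mk ℂ A A z).rTensor A (H.T₁ (x ⊗ₜ y)) := by
  -- A counit is inserted in order to create a T₁, past which coassociativity can move T₂.
  have key : ∀ t s : A ⊗[ℂ] A, (LinearMap.mulRight ℂ y).lTensor A t
      = ((TensorProduct.rid ℂ A).toLinearMap ∘ₗ H.counit.lTensor A).rTensor A
        ((TensorProduct.assoc ℂ A A A).symm (H.T₁.toLinearMap.lTensor A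
          (TensorProduct.assoc ℂ A A A (t ⊗ₜ y)))) := by
    intro t s
    induction t with
    | zero => simp
    | add x y hx hy => simp only [map_add, TensorProduct.add_tmul, hx, hy]
    | tmul u v =>
      have h3 := H.counit_T₁ (v ⊗ₜ y)
      rw [LinearMap.mul'_apply] at h3
      simp only [LinearMap.lTensor_tmul, TensorProduct.assoc_tmul,
        LinearEquiv.coe_coe, LinearMap.mulRight_apply]
      rw [← h3]
      generalize H.T₁ (v ⊗ₜ y) = t
      induction t with
      | zero => simp
      | add x y hx hy => simp only [map_add, TensorProduct.tmul_add, hx, hy]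
      | tmul b c => simp [TensorProduct.smul_tmul]
  have h5 : ∀ t : A ⊗[ℂ] A, (TensorProduct.assoc ℂ A A A).symm (H.T₁.toLinearMap.lTensor A
          (TensorProduct.assoc ℂ A A A (t ⊗ₜ y)))
      = H.T₂.symm.toLinearMap.rTensor A ((TensorProduct.assoc ℂ A A A).symm
        ((H.T₁.toLinearMap ∘ₗ (TensorProduct.mk ℂ A A).flip y).lTensor A (H.T₂ t))) := by
    intro t
    induction t with
    | zero => simp
    | add x y hx hy => simp only [map_add, TensorProduct.add_tmul, hx, hy]
    | tmul u v =>
      rw [← H.coassoc, LinearEquiv.symm_apply_apply, ← LinearMap.comp_apply,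
        ← LinearMap.rTensor_comp]
      simp only [TensorProduct.assoc_tmul, LinearMap.lTensor_tmul, LinearEquiv.coe_coe]
      generalize H.T₁ (v ⊗ₜ y) = t
      induction t with
      | zero => simp
      | add x y hx hy => simp only [map_add, TensorProduct.tmul_add, hx, hy]
      | tmul b c => simp
  rw [key _ 0, h5, LinearEquiv.apply_symm_apply]
  simp only [LinearMap.lTensor_tmul, LinearMap.comp_apply, LinearMap.flip_apply,
    TensorProduct.mk_apply, LinearEquiv.coe_coe]
  generalize H.T₁ (x ⊗ₜ y) = t
  induction t with
  | zero => simp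
  | add x y hx hy => simp only [map_add, TensorProduct.tmul_add, hx, hy]
  | tmul b c => simp [mulAntipode]

theorem rTensor_mulRight_cancel (H : MultiplierHopfAlgebra A) {V : Type w} [AddCommGroup V]
    [Module ℂ V] {z z' : A ⊗[ℂ] V}
    (h : ∀ c, (LinearMap.mulRight ℂ c).rTensor V z = (LinearMap.mulRight ℂ c).rTensor V z') :
    z = z' := by
  rw [← sub_eq_zero]
  exact rTensor_cancel (fun c => LinearMap.mulRight ℂ c) (fun a ha => H.nondeg_right a ha) _
    fun c => by rw [map_sub, h, sub_self]

/-- T₁ is onto, so evaluating at T₁⁻¹(a ⊗ b) with b ≠ 0 determines f(a). -/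
theorem counit_unique (H : MultiplierHopfAlgebra A) (f : A →ₗ[ℂ] ℂ)
    (hf : ∀ w, TensorProduct.lid ℂ A (f.rTensor A (H.T₁ w)) = LinearMap.mul' ℂ A w) :
    f = H.counit := by
  ext a
  by_cases hA : ∃ x : A, x ≠ 0
  · obtain ⟨b, hb⟩ := hA
    have h := hf (H.T₁.symm (a ⊗ₜ b))
    rw [mul_T₁_symm, LinearEquiv.apply_symm_apply] at h
    refine smul_left_injective ℂ hb ?_
    simpa using h
  · push Not at hA
    rw [hA a]; simp

theorem T₁_mul_right (H : MultiplierHopfAlgebra A) (a b c : A) :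
    H.T₁ (a ⊗ₜ (b * c)) = (LinearMap.mulRight ℂ c).lTensor A (H.T₁ (a ⊗ₜ b)) := by
  refine H.rTensor_mulLeft_cancel fun d => ?_
  rw [H.mulLeft_T₁, mulLeft_mulRight_comm, H.mulLeft_T₁, ← LinearMap.comp_apply,
    ← LinearMap.lTensor_comp]
  congr 2
  ext x; simp [mul_assoc]

theorem T₂_mul_left (H : MultiplierHopfAlgebra A) (a b c : A) :
    H.T₂ ((c * a) ⊗ₜ b) = (LinearMap.mulLeft ℂ c).rTensor A (H.T₂ (a ⊗ₜ b)) := by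
  refine H.lTensor_mulRight_cancel fun d => ?_
  rw [← H.mulLeft_T₁, ← mulLeft_mulRight_comm, ← H.mulLeft_T₁, ← LinearMap.comp_apply,
    ← LinearMap.rTensor_comp]
  congr 2
  ext x; simp

/-- `S` is the antipode of `H`: `S(a) b = ∑ (ε ⊗ ι)T₁⁻¹(a ⊗ b)`. -/
def IsAntipode (H : MultiplierHopfAlgebra A) (S : A →ₗ[ℂ] A) : Prop :=
  ∀ a b : A, S a * b = H.antipodeMul (a ⊗ₜ b)

section Antipode

variable {H : MultiplierHopfAlgebra A} {S : A →ₗ[ℂ] A} (hS : H.IsAntipode S)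

include hS

theorem IsAntipode.mul (p q : A) : S (p * q) = S q * S p := by
  rw [← sub_eq_zero]
  refine H.nondeg_right _ fun b => ?_
  rw [sub_mul, sub_eq_zero, mul_assoc, hS, hS, hS, antipodeMul_mul]

theorem IsAntipode.mulAntipode_eq (a b : A) : H.mulAntipode (a ⊗ₜ b) = a * S b := by
  rw [← sub_eq_zero]
  refine H.nondeg_right _ fun c => ?_
  rw [sub_mul, sub_eq_zero, mulAntipode_mul, mul_assoc, hS]
  simp

theorem IsAntipode.mulLeft_T₁_symm (y x z : A) :
    (LinearMap.mulLeft ℂ y).rTensor A (H.T₁.symm (x ⊗ₜ z))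
      = (LinearMap.mulRight ℂ z ∘ₗ S).lTensor A (H.T₂ (y ⊗ₜ x)) := by
  rw [MultiplierHopfAlgebra.mulLeft_T₁_symm]
  congr 2
  ext a
  simp [hS a z]

theorem IsAntipode.mulRight_T₂_symm (y x z : A) :
    (LinearMap.mulRight ℂ y).lTensor A (H.T₂.symm (z ⊗ₜ x))
      = (LinearMap.mulLeft ℂ z ∘ₗ S).rTensor A (H.T₁ (x ⊗ₜ y)) := by
  rw [MultiplierHopfAlgebra.mulRight_T₂_symm]
  congr 2
  ext a
  simp [hS.mulAntipode_eq]

/-- If zS(v) = 0 for all v, the formula for T₂⁻¹ gives T₂⁻¹(z ⊗ x) = 0, so z ⊗ x = 0. This stands in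
for non-degeneracy as long as S is not known to be surjective. -/
theorem IsAntipode.mul_right_cancel (z : A) (h : ∀ v, z * S v = 0) : z = 0 := by
  have h1 : ∀ x, H.T₂.symm (z ⊗ₜ x) = 0 := by
    intro x
    refine H.lTensor_mulRight_cancel fun y => ?_
    rw [hS.mulRight_T₂_symm]
    have : LinearMap.mulLeft ℂ z ∘ₗ S = 0 := by ext a; simp [h]
    simp [this]
  refine H.nondeg_right _ fun b => ?_
  have h2 : z ⊗ₜ[ℂ] b = 0 := by simpa using h1 b
  have := congrArg (LinearMap.mul' ℂ A) h2
  simpa using this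

end Antipode

end MultiplierHopfAlgebra

end General
end Bicross

namespace Bicross

universe u v w

/-! ### A bijective antipode implies regularity -/

section Tensor

variable {X X' Y Y' Z : Type*} [AddCommGroup X] [Module ℂ X] [AddCommGroup X'] [Module ℂ X']
  [AddCommGroup Y] [Module ℂ Y] [AddCommGroup Y'] [Module ℂ Y'] [AddCommGroup Z] [Module ℂ Z]

theorem rTensor_lTensor_comm (f : X →ₗ[ℂ] X') (g : Y →ₗ[ℂ] Y') (t : X ⊗[ℂ] Y) :
    f.rTensor Y' (g.lTensor X t) = g.lTensor X' (f.rTensor Y t) := by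
  rw [← LinearMap.comp_apply, ← LinearMap.comp_apply, LinearMap.rTensor_comp_lTensor,
    LinearMap.lTensor_comp_rTensor]

end Tensor

section General

variable {A : Type u} [NonUnitalRing A] [Module ℂ A] [IsScalarTower ℂ A A] [SMulCommClass ℂ A A]

theorem lTensor_mulRight_rTensor_mulRight (c d : A) (x : A ⊗[ℂ] A) :
    (LinearMap.mulRight ℂ d).lTensor A ((LinearMap.mulRight ℂ c).rTensor A x)
      = x * (c ⊗ₜ[ℂ] d) := by
  induction x with
  | zero => simp
  | add x y hx hy => simp only [map_add, add_mul, hx, hy]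
  | tmul a b => simp

theorem tensor_mul_left_cancel (hl : ∀ a : A, (∀ b, b * a = 0) → a = 0) {z z' : A ⊗[ℂ] A}
    (h : ∀ x, x * z = x * z') : z = z' := by
  rw [← sub_eq_zero]
  refine rTensor_cancel (fun c => LinearMap.mulLeft ℂ c) hl _ fun c =>
    lTensor_cancel (fun c => LinearMap.mulLeft ℂ c) hl _ fun d => ?_
  rw [MultiplierHopfAlgebra.lTensor_mulLeft_rTensor_mulLeft, mul_sub, h, sub_self]

theorem tensor_mul_right_cancel (hr : ∀ a : A, (∀ b, a * b = 0) → a = 0) {z z' : A ⊗[ℂ] A}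
    (h : ∀ x, z * x = z' * x) : z = z' := by
  rw [← sub_eq_zero]
  refine rTensor_cancel (fun c => LinearMap.mulRight ℂ c) hr _ fun c =>
    lTensor_cancel (fun c => LinearMap.mulRight ℂ c) hr _ fun d => ?_
  rw [lTensor_mulRight_rTensor_mulRight, sub_mul, h, sub_self]

/-- Non-degeneracy and y(mx) = (ym)x let the right multiplication operator determine the left one.
-/
theorem Multiplier.ext_R (hl : ∀ a : A, (∀ b, b * a = 0) → a = 0)
    {m n : Multiplier (A ⊗[ℂ] A)} (h : ∀ x, m.R x = n.R x) : m = n :=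
  Multiplier.ext (fun x => tensor_mul_left_cancel hl fun y => by
    rw [m.mul_L, n.mul_L, h]) h

theorem Multiplier.ext_L (hr : ∀ a : A, (∀ b, a * b = 0) → a = 0)
    {m n : Multiplier (A ⊗[ℂ] A)} (h : ∀ x, m.L x = n.L x) : m = n :=
  Multiplier.ext h (fun x => tensor_mul_right_cancel hr fun y => by
    rw [← m.mul_L, ← n.mul_L, h])

theorem flip_add (m n : Multiplier (A ⊗[ℂ] A)) : flip (m + n) = flip m + flip n :=
  Multiplier.ext (fun _ => map_add (TensorProduct.comm ℂ A A) _ _)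
    (fun _ => map_add (TensorProduct.comm ℂ A A) _ _)

theorem flip_smul (c : ℂ) (m : Multiplier (A ⊗[ℂ] A)) : flip (c • m) = c • flip m :=
  Multiplier.ext (fun _ => map_smul (TensorProduct.comm ℂ A A) _ _)
    (fun _ => map_smul (TensorProduct.comm ℂ A A) _ _)

namespace MultiplierHopfAlgebra

section ToRegular

variable (H : MultiplierHopfAlgebra A) (S : A ≃ₗ[ℂ] A) (hS : H.IsAntipode S.toLinearMap)

/-- `a ⊗ b ↦ Δ(a)(b ⊗ 1)`, as `(S⁻¹ ⊗ ι)T₂⁻¹(S(b) ⊗ a)`. -/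
noncomputable def canonThree : (A ⊗[ℂ] A) ≃ₗ[ℂ] (A ⊗[ℂ] A) :=
  TensorProduct.comm ℂ A A ≪≫ₗ TensorProduct.congr S (LinearEquiv.refl ℂ A) ≪≫ₗ H.T₂.symm
    ≪≫ₗ TensorProduct.congr S.symm (LinearEquiv.refl ℂ A)

/-- `a ⊗ b ↦ (1 ⊗ a)Δ(b)`, as `(ι ⊗ S⁻¹)T₁⁻¹(b ⊗ S(a))`. -/
noncomputable def canonFour : (A ⊗[ℂ] A) ≃ₗ[ℂ] (A ⊗[ℂ] A) :=
  TensorProduct.comm ℂ A A ≪≫ₗ TensorProduct.congr (LinearEquiv.refl ℂ A) S ≪≫ₗ H.T₁.symm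
    ≪≫ₗ TensorProduct.congr (LinearEquiv.refl ℂ A) S.symm

include hS

/-- S⁻¹ undoes the product S(b)S(x) = S(xb) that T₂⁻¹ leaves in the first leg. Hence the map defined
through T₂⁻¹ really is Δ(a)(b ⊗ 1). -/
theorem canonThree_mulRight (a b d : A) :
    (LinearMap.mulRight ℂ d).lTensor A (H.canonThree S (a ⊗ₜ b))
      = (LinearMap.mulRight ℂ b).rTensor A (H.T₁ (a ⊗ₜ d)) := by
  have h := congrArg (S.symm.toLinearMap.rTensor A) (hS.mulRight_T₂_symm d a (S b))
  rw [rTensor_lTensor_comm, ← LinearMap.rTensor_comp_apply] at h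
  refine Eq.trans h ?_
  congr 2
  ext x
  apply S.injective
  have := hS.mul x b
  simp only [LinearEquiv.coe_coe] at this
  simp [this]

theorem canonFour_mulLeft (a b d : A) :
    (LinearMap.mulLeft ℂ d).rTensor A (H.canonFour S (a ⊗ₜ b))
      = (LinearMap.mulLeft ℂ a).lTensor A (H.T₂ (d ⊗ₜ b)) := by
  have h := congrArg (S.symm.toLinearMap.lTensor A) (hS.mulLeft_T₁_symm d b (S a))
  rw [← rTensor_lTensor_comm, ← LinearMap.lTensor_comp_apply] at h
  refine Eq.trans h ?_
  congr 2
  ext x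
  apply S.injective
  have := hS.mul a x
  simp only [LinearEquiv.coe_coe] at this
  simp [this]

theorem canonThree_mulLeft (a b d : A) :
    (LinearMap.mulLeft ℂ d).rTensor A (H.canonThree S (a ⊗ₜ b))
      = (LinearMap.mulRight ℂ b).rTensor A (H.T₂ (d ⊗ₜ a)) := by
  refine H.lTensor_mulRight_cancel fun e => ?_
  rw [← mulLeft_mulRight_comm, H.canonThree_mulRight S hS]
  have h : ∀ x : A ⊗[ℂ] A, (LinearMap.mulLeft ℂ d).rTensor A ((LinearMap.mulRight ℂ b).rTensor A x)
    = (LinearMap.mulRight ℂ b).rTensor A ((LinearMap.mulLeft ℂ d).rTensor A x) := by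
    intro x
    rw [← LinearMap.comp_apply, ← LinearMap.comp_apply, ← LinearMap.rTensor_comp,
      ← LinearMap.rTensor_comp]
    congr 2
    ext y; simp [mul_assoc]
  rw [h, H.mulLeft_T₁, ← LinearMap.comp_apply, ← LinearMap.comp_apply,
    LinearMap.rTensor_comp_lTensor, LinearMap.lTensor_comp_rTensor]

theorem canonFour_mulRight (a b d : A) :
    (LinearMap.mulRight ℂ d).lTensor A (H.canonFour S (a ⊗ₜ b))
      = (LinearMap.mulLeft ℂ a).lTensor A (H.T₁ (b ⊗ₜ d)) := by
  refine H.rTensor_mulLeft_cancel fun e => ?_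
  rw [mulLeft_mulRight_comm, H.canonFour_mulLeft S hS, ← LinearMap.comp_apply,
    ← LinearMap.comp_apply, LinearMap.rTensor_comp_lTensor, ← LinearMap.lTensor_comp_rTensor,
    LinearMap.comp_apply, LinearMap.comp_apply, H.mulLeft_T₁, ← LinearMap.comp_apply,
    ← LinearMap.comp_apply, ← LinearMap.lTensor_comp, ← LinearMap.lTensor_comp]
  congr 2
  ext y; simp [mul_assoc]

/-- Covering the last leg on the right turns (1 ⊗ a)Δ(b) into an expression in T₁, to which ordinary
coassociativity applies. -/
theorem T₂_canonFour (a b x : A) :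
    TensorProduct.assoc ℂ A A A ((H.T₂.toLinearMap ∘ₗ TensorProduct.mk ℂ A A x).rTensor A
        (H.canonFour S (a ⊗ₜ b)))
      = ((H.canonFour S).toLinearMap ∘ₗ TensorProduct.mk ℂ A A a).lTensor A (H.T₂ (x ⊗ₜ b)) := by
  refine lTensor_mulRight_cancel₂ H fun d => ?_
  rw [assoc_rTensor_mulRight, H.canonFour_mulRight S hS, ← LinearMap.comp_apply
    (LinearMap.lTensor A _) (LinearMap.lTensor A _), ← LinearMap.lTensor_comp]
  have h1 : (LinearMap.mulRight ℂ d).lTensor A ∘ₗ (H.canonFour S).toLinearMap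
      ∘ₗ TensorProduct.mk ℂ A A a = (LinearMap.mulLeft ℂ a).lTensor A ∘ₗ
        (H.T₁.toLinearMap ∘ₗ (TensorProduct.mk ℂ A A).flip d) :=
    LinearMap.ext fun b => H.canonFour_mulRight S hS a b d
  rw [h1, LinearMap.lTensor_comp, LinearMap.comp_apply, ← H.coassoc]
  generalize H.T₁ (b ⊗ₜ d) = t
  induction t with
  | zero => simp
  | add x y hx hy => simp only [map_add, hx, hy]
  | tmul y z =>
    rw [LinearMap.lTensor_tmul, LinearMap.rTensor_tmul, LinearMap.rTensor_tmul]
    generalize (H.T₂.toLinearMap ∘ₗ TensorProduct.mk ℂ A A x) y = t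
    induction t with
    | zero => simp
    | add x y hx hy => simp only [map_add, TensorProduct.add_tmul, hx, hy]
    | tmul u v => simp

/-- Covering the first leg on the left by x turns Δ(b)(c ⊗ 1) into T₂ with a right multiplication,
which reduces the claim to `T₂_canonFour`. -/
theorem canon_coassoc (a b c : A) :
    TensorProduct.assoc ℂ A A A (((H.canonThree S).toLinearMap ∘ₗ
        (TensorProduct.mk ℂ A A).flip c).rTensor A (H.canonFour S (a ⊗ₜ b)))
      = ((H.canonFour S).toLinearMap ∘ₗ TensorProduct.mk ℂ A A a).lTensor A
        (H.canonThree S (b ⊗ₜ c)) := by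
  refine H.rTensor_mulLeft_cancel fun x => ?_
  have h0 : ∀ (f : A →ₗ[ℂ] A) (t : (A ⊗[ℂ] A) ⊗[ℂ] A), f.rTensor (A ⊗[ℂ] A)
      (TensorProduct.assoc ℂ A A A t) = TensorProduct.assoc ℂ A A A ((f.rTensor A).rTensor A t) := by
    intro f t
    rw [LinearMap.rTensor_tensor]; simp
  rw [h0, ← LinearMap.comp_apply (LinearMap.rTensor A _) (LinearMap.rTensor A _),
    ← LinearMap.rTensor_comp]
  have h1 : (LinearMap.mulLeft ℂ x).rTensor A ∘ₗ ((H.canonThree S).toLinearMap ∘ₗ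
        (TensorProduct.mk ℂ A A).flip c) = (LinearMap.mulRight ℂ c).rTensor A ∘ₗ
        (H.T₂.toLinearMap ∘ₗ TensorProduct.mk ℂ A A x) :=
    LinearMap.ext fun b => H.canonThree_mulLeft S hS b c x
  rw [h1, LinearMap.rTensor_comp, LinearMap.comp_apply, ← h0, H.T₂_canonFour S hS]
  rw [← LinearMap.comp_apply, LinearMap.rTensor_comp_lTensor, ← LinearMap.lTensor_comp_rTensor,
    LinearMap.comp_apply, ← H.canonThree_mulLeft S hS, ← LinearMap.comp_apply,
    LinearMap.lTensor_comp_rTensor, ← LinearMap.rTensor_comp_lTensor, LinearMap.comp_apply]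

/-- A multiplier Hopf algebra with a bijective antipode `A → A` is regular. -/
noncomputable def toRegular : RegularMHA A where
  toMultiplierHopfAlgebra := H
  coop :=
    { nondeg_right := H.nondeg_right
      nondeg_left := H.nondeg_left
      Δ :=
        { toFun := fun a => flip (H.Δ a)
          map_smul' := fun c a => by rw [map_smul, flip_smul]; rfl
          map_zero' := by
            rw [map_zero]
            simpa using flip_smul 0 (0 : Multiplier (A ⊗[ℂ] A))
          map_add' := fun a b => by rw [map_add, flip_add]
          map_mul' := fun a b => by rw [map_mul, flip_mul] }
      T₁ := H.canonThree S ≪≫ₗ TensorProduct.comm ℂ A A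
      T₂ := H.canonFour S ≪≫ₗ TensorProduct.comm ℂ A A
      T₁_spec := fun a b => by
        change flip (H.Δ a) * flip (tmulOne (incl b))
          = incl (TensorProduct.comm ℂ A A (H.canonThree S (a ⊗ₜ b)))
        rw [← flip_mul, ← flip_incl]
        congr 1
        refine Multiplier.ext_R H.nondeg_left fun x => ?_
        rw [Multiplier.R_comp, tmulOne_R, incl_R]
        induction x with
        | zero => simp
        | add x y hx hy => simp only [map_add, add_mul, hx, hy]
        | tmul p q =>
          rw [H.Δ_R_tmul, ← lTensor_mulLeft_rTensor_mulLeft, H.canonThree_mulLeft S hS,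
            ← LinearMap.comp_apply, ← LinearMap.comp_apply, LinearMap.lTensor_comp_rTensor,
            LinearMap.rTensor_comp_lTensor]
          rfl
      T₂_spec := fun a b => by
        change tmulOne (incl a) * flip (H.Δ b)
          = incl (TensorProduct.comm ℂ A A (H.canonFour S (a ⊗ₜ b)))
        rw [← flip_flip (tmulOne (incl a)), ← flip_mul, ← flip_incl]
        congr 1
        change oneTmul (incl a) * _ = _
        refine Multiplier.ext_R H.nondeg_left fun x => ?_
        rw [Multiplier.R_comp, oneTmul_R, incl_R]
        induction x with
        | zero => simp
        | add x y hx hy => simp only [map_add, add_mul, hx, hy]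
        | tmul p q =>
          rw [LinearMap.lTensor_tmul, H.Δ_R_tmul, ← lTensor_mulLeft_rTensor_mulLeft,
            H.canonFour_mulLeft S hS, ← LinearMap.comp_apply, ← LinearMap.lTensor_comp]
          congr 2
          ext y; simp
      coassoc := fun a b c => by
        -- Reversing the order of the three legs turns coassociativity of the opposite coproduct
        -- into `canon_coassoc`.
        have h1 : ∀ t : A ⊗[ℂ] A, TensorProduct.assoc ℂ A A A
            ((((H.canonFour S ≪≫ₗ TensorProduct.comm ℂ A A).toLinearMap ∘ₗ
              TensorProduct.mk ℂ A A a)).rTensor A (TensorProduct.comm ℂ A A t))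
            = TensorProduct.assoc ℂ A A A ((TensorProduct.comm ℂ A A).toLinearMap.rTensor A
              (TensorProduct.comm ℂ A (A ⊗[ℂ] A)
              (((H.canonFour S).toLinearMap ∘ₗ TensorProduct.mk ℂ A A a).lTensor A t))) := by
          intro t
          induction t with
          | zero => simp
          | add x y hx hy => simp only [map_add, hx, hy]
          | tmul u v => simp
        have h2 : ∀ t : A ⊗[ℂ] A, (((H.canonThree S ≪≫ₗ TensorProduct.comm ℂ A A).toLinearMap
              ∘ₗ (TensorProduct.mk ℂ A A).flip c)).lTensor A (TensorProduct.comm ℂ A A t)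
            = TensorProduct.assoc ℂ A A A ((TensorProduct.comm ℂ A A).toLinearMap.rTensor A
              (TensorProduct.comm ℂ A (A ⊗[ℂ] A)
              (TensorProduct.assoc ℂ A A A (((H.canonThree S).toLinearMap ∘ₗ
                (TensorProduct.mk ℂ A A).flip c).rTensor A t)))) := by
          intro t
          induction t with
          | zero => simp
          | add x y hx hy => simp only [map_add, hx, hy]
          | tmul u v =>
            simp only [TensorProduct.comm_tmul, LinearMap.lTensor_tmul, LinearMap.rTensor_tmul,
              LinearMap.comp_apply, LinearEquiv.coe_coe, LinearMap.flip_apply,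
              TensorProduct.mk_apply, LinearEquiv.trans_apply]
            generalize H.canonThree S (u ⊗ₜ c) = t
            induction t with
            | zero => simp
            | add x y hx hy =>
              simp only [map_add, TensorProduct.tmul_add, TensorProduct.add_tmul, hx, hy]
            | tmul u v => simp
        rw [LinearEquiv.trans_apply, LinearEquiv.trans_apply, h1, h2, H.canon_coassoc S hS] }
  coop_Δ a := rfl

end ToRegular

end MultiplierHopfAlgebra

end General
end Bicross

namespace Bicross

universe u v w

/-! ### Covered comultiplications and invertibility of the antipode -/

section General

variable {A : Type u} [NonUnitalRing A] [Module ℂ A] [IsScalarTower ℂ A A] [SMulCommClass ℂ A A]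

namespace MultiplierHopfAlgebra

theorem counit_T₂_left (H : MultiplierHopfAlgebra A) (c a : A) :
    TensorProduct.lid ℂ A (H.counit.rTensor A (H.T₂ (c ⊗ₜ a))) = H.counit c • a := by
  rw [← sub_eq_zero]
  refine H.nondeg_right _ fun b => ?_
  have h1 : ∀ t : A ⊗[ℂ] A, TensorProduct.lid ℂ A (H.counit.rTensor A t) * b
      = TensorProduct.lid ℂ A (H.counit.rTensor A ((LinearMap.mulRight ℂ b).lTensor A t)) := by
    intro t
    induction t with
    | zero => simp
    | add x y hx hy => simp only [map_add, add_mul, hx, hy]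
    | tmul u v => simp [smul_mul_assoc]
  have h2 : ∀ t : A ⊗[ℂ] A, TensorProduct.lid ℂ A (H.counit.rTensor A
      ((LinearMap.mulLeft ℂ c).rTensor A t))
      = H.counit c • TensorProduct.lid ℂ A (H.counit.rTensor A t) := by
    intro t
    induction t with
    | zero => simp
    | add x y hx hy => simp only [map_add, smul_add, hx, hy]
    | tmul u v => simp [counit_mul, mul_smul]
  rw [sub_mul, h1, ← H.mulLeft_T₁, h2, H.counit_T₁, LinearMap.mul'_apply, smul_mul_assoc, sub_self]

/-- If ε = 0, the counit identity for T₁ gives ab = 0 for all a and b, so A = 0. The alternative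
lets later arguments normalise by an element with ε(c) = 1. -/
theorem exists_counit_eq_one (H : MultiplierHopfAlgebra A) :
    (∃ c, H.counit c = 1) ∨ ∀ a : A, a = 0 := by
  by_cases h : ∃ c, H.counit c ≠ 0
  · obtain ⟨c, hc⟩ := h
    exact Or.inl ⟨(H.counit c)⁻¹ • c, by simp [hc]⟩
  · push Not at h
    refine Or.inr fun a => H.nondeg_right a fun b => ?_
    have h1 : H.counit = 0 := LinearMap.ext h
    have h2 := H.counit_T₁ (a ⊗ₜ b)
    rw [h1] at h2
    simpa using h2.symm

/-- `ζ(a) = ∑ a₍₁₎ ⊗ θ(a₍₂₎)`, in the sense of `(c ⊗ 1)ζ(a) = (ι ⊗ θ)((c ⊗ 1)Δ(a))`. -/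
def Covers (H : MultiplierHopfAlgebra A) {V : Type w} [AddCommGroup V] [Module ℂ V]
    (ζ : A →ₗ[ℂ] A ⊗[ℂ] V) (θ : A →ₗ[ℂ] V) : Prop :=
  ∀ c a, (LinearMap.mulLeft ℂ c).rTensor V (ζ a) = θ.lTensor A (H.T₂ (c ⊗ₜ a))

/-- Apply ε to the first leg with ε(c) = 1: formally (ε ⊗ ι)(∑ a₍₁₎ ⊗ θ(a₍₂₎)) = θ(a). -/
theorem Covers.counit {H : MultiplierHopfAlgebra A} {V : Type w} [AddCommGroup V] [Module ℂ V]
    {ζ : A →ₗ[ℂ] A ⊗[ℂ] V} {θ : A →ₗ[ℂ] V} (h : H.Covers ζ θ) (a : A) :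
    TensorProduct.lid ℂ V (H.counit.rTensor V (ζ a)) = θ a := by
  obtain ⟨c, hc⟩ | h0 := H.exists_counit_eq_one
  · have h1 := congrArg (fun t => TensorProduct.lid ℂ V (H.counit.rTensor V t)) (h c a)
    have h2 : ∀ t : A ⊗[ℂ] V, TensorProduct.lid ℂ V (H.counit.rTensor V
        ((LinearMap.mulLeft ℂ c).rTensor V t)) = TensorProduct.lid ℂ V (H.counit.rTensor V t) := by
      intro t
      induction t with
      | zero => simp
      | add x y hx hy => simp only [map_add, hx, hy]
      | tmul u v => simp [counit_mul, hc]
    have h3 : ∀ t : A ⊗[ℂ] A, TensorProduct.lid ℂ V (H.counit.rTensor V (θ.lTensor A t))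
        = θ (TensorProduct.lid ℂ A (H.counit.rTensor A t)) := by
      intro t
      induction t with
      | zero => simp
      | add x y hx hy => simp only [map_add, hx, hy]
      | tmul u v => simp
    simp only [h2, h3] at h1
    rw [h1, counit_T₂_left, hc, one_smul]
  · rw [h0 a]; simp

end MultiplierHopfAlgebra

namespace RegularMHA

theorem mulRight_T₄ (H : RegularMHA A) (d e a : A) :
    (LinearMap.mulRight ℂ d).lTensor A (H.T₄ (e ⊗ₜ a))
      = (LinearMap.mulLeft ℂ e).lTensor A (H.T₁ (a ⊗ₜ d)) := by
  apply H.incl_injective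
  rw [← incl_mul_oneTmul, ← oneTmul_mul_incl, ← H.T₄_spec, ← H.T₁_spec, mul_assoc]

theorem mulLeft_T₃ (H : RegularMHA A) (c a b : A) :
    (LinearMap.mulLeft ℂ c).rTensor A (H.T₃ (a ⊗ₜ b))
      = (LinearMap.mulRight ℂ b).rTensor A (H.T₂ (c ⊗ₜ a)) := by
  have k : ∀ x : A ⊗[ℂ] A, incl x * tmulOne (incl b) = incl ((LinearMap.mulRight ℂ b).rTensor A x) :=
    fun x => MultiplierHopfAlgebra.incl_mul _ _
  apply H.incl_injective
  rw [← tmulOne_mul_incl, ← k, ← H.T₃_spec, ← H.T₂_spec, mul_assoc]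

theorem covers_T₄ (H : RegularMHA A) (e : A) :
    H.Covers (H.T₄.toLinearMap ∘ₗ TensorProduct.mk ℂ A A e) (LinearMap.mulLeft ℂ e) :=
  fun c a => H.mulLeft_T₄ c e a

theorem covers_twist (H : RegularMHA A) {B : Type v} [AddCommGroup B] [Module ℂ B]
    (M : RightAction A B) (b : B) : H.Covers (twist H M ∘ₗ TensorProduct.mk ℂ B A b) (M.act b) :=
  fun c a => mulLeft_twist H M c b a

/-- Coassociativity for ζ(a) = ∑ a₍₁₎ ⊗ θ(a₍₂₎): comultiplying the first leg of ζ agrees with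
applying ζ to a₍₂₎. This is how coassociativity of Δ_A is used with maps such as the twist, of which
only the covered values are known. -/
theorem covers_comul {H : RegularMHA A} {V : Type w} [AddCommGroup V] [Module ℂ V]
    {ζ : A →ₗ[ℂ] A ⊗[ℂ] V} {θ : A →ₗ[ℂ] V} (h : H.Covers ζ θ) (c a : A) :
    TensorProduct.assoc ℂ A A V ((H.T₂.toLinearMap ∘ₗ TensorProduct.mk ℂ A A c).rTensor V (ζ a))
      = ζ.lTensor A (H.T₂ (c ⊗ₜ a)) := by
  have hl : ∀ t : A ⊗[ℂ] V, (∀ d : A, (LinearMap.mulLeft ℂ d).rTensor V t = 0) → t = 0 :=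
    fun t ht => H.rTensor_mulLeft_cancel (z' := 0) fun d => by rw [ht, map_zero]
  rw [← sub_eq_zero]
  refine lTensor_cancel (fun d : A => (LinearMap.mulLeft ℂ d).rTensor V) hl _ fun d => ?_
  rw [map_sub, sub_eq_zero]
  -- Both sides are linear in w, and elements w = (p ⊗ 1)Δ(q) span because T₂ is onto; on these,
  -- `coassoc_T₂` applies. The identity is needed at w = c ⊗ d.
  have key : ∀ w : A ⊗[ℂ] A, TensorProduct.assoc ℂ A A V ((mulΔ H w).rTensor V (ζ a))
      = (θ.lTensor A).lTensor A ((T₂flip H).lTensor A (TensorProduct.assoc ℂ A A A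
        ((H.T₂.toLinearMap ∘ₗ (TensorProduct.mk ℂ A A).flip a).rTensor A w))) := by
    intro w
    obtain ⟨s, rfl⟩ := H.T₂.surjective w
    induction s with
    | zero => simp [mulΔ_zero]
    | add x y hx hy =>
      rw [map_add H.T₂, mulΔ_add, LinearMap.rTensor_add, LinearMap.add_apply]
      simp only [map_add, hx, hy]
    | tmul p q =>
      rw [coassoc_T₂, mulΔ_T₂, LinearMap.rTensor_comp_apply, h q a]
      generalize H.T₂ (q ⊗ₜ a) = t
      induction t with
      | zero => simp
      | add x y hx hy => simp only [map_add, hx, hy]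
      | tmul u v =>
        rw [LinearMap.lTensor_tmul, LinearMap.rTensor_tmul, LinearMap.rTensor_tmul]
        generalize (H.T₂.toLinearMap ∘ₗ TensorProduct.mk ℂ A A p) u = t
        induction t with
        | zero => simp
        | add x y hx hy => simp only [map_add, TensorProduct.add_tmul, hx, hy]
        | tmul u v => simp
  have h1 := key (c ⊗ₜ d)
  have h2 : ∀ (f : A →ₗ[ℂ] A ⊗[ℂ] A) (t : A ⊗[ℂ] V), ((LinearMap.mulLeft ℂ d).rTensor V).lTensor A
      (TensorProduct.assoc ℂ A A V (f.rTensor V t))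
      = TensorProduct.assoc ℂ A A V (((LinearMap.mulLeft ℂ d).lTensor A ∘ₗ f).rTensor V t) := by
    intro f t
    induction t with
    | zero => simp
    | add x y hx hy => simp only [map_add, hx, hy]
    | tmul u v =>
      simp only [LinearMap.rTensor_tmul, LinearMap.comp_apply]
      generalize f u = t
      induction t with
      | zero => simp
      | add x y hx hy => simp only [map_add, TensorProduct.add_tmul, hx, hy]
      | tmul u v => simp
  have h3 : (LinearMap.mulLeft ℂ d).lTensor A ∘ₗ H.T₂.toLinearMap ∘ₗ TensorProduct.mk ℂ A A c
      = mulΔ H (c ⊗ₜ d) := LinearMap.ext fun y => (mulΔ_tmul H c d y).symm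
  rw [h2, h3, h1, LinearMap.rTensor_tmul, lTensor_T₂flip, ← LinearMap.lTensor_comp_apply,
    ← LinearMap.lTensor_comp_apply]
  congr 2
  ext x
  exact (h d x).symm

theorem isAntipode (H : RegularMHA A) : H.IsAntipode H.antipode := fun a b => by
  have key : ∀ w : A ⊗[ℂ] A, LinearMap.mul' ℂ A (H.antipode.rTensor A w) = H.antipodeMul w := by
    intro w
    obtain ⟨s, rfl⟩ := H.T₁.surjective w
    induction s with
    | zero => simp
    | add x y hx hy => simp only [map_add, hx, hy]
    | tmul u v =>
      rw [antipode, H.exists_antipode.choose_spec.1 u v]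
      simp [MultiplierHopfAlgebra.antipodeMul]
  simpa using key (a ⊗ₜ b)

theorem antipode_T₁ (H : RegularMHA A) (a b : A) :
    LinearMap.mul' ℂ A (H.antipode.rTensor A (H.T₁ (a ⊗ₜ b))) = H.counit a • b :=
  H.exists_antipode.choose_spec.1 a b

theorem antipode_T₂ (H : RegularMHA A) (a b : A) :
    LinearMap.mul' ℂ A (H.antipode.lTensor A (H.T₂ (a ⊗ₜ b))) = H.counit b • a :=
  H.exists_antipode.choose_spec.2 a b

/-- The identity (ι ⊗ ε)((c ⊗ 1)Δ(a)) = ca, with a right factor b added and c cancelled, shows that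
ε satisfies the defining identity for Δᵒᵖ, so `counit_unique` applies. -/
theorem coop_counit (H : RegularMHA A) : H.coop.counit = H.counit := by
  symm
  refine H.coop.counit_unique _ fun w => ?_
  induction w with
  | zero => simp
  | add x y hx hy => simp only [map_add, hx, hy]
  | tmul a b =>
    have h0 : H.coop.T₁ (a ⊗ₜ b) = TensorProduct.comm ℂ A A (H.T₃ (a ⊗ₜ b)) := by
      simp [T₃]
    have h1 : ∀ t : A ⊗[ℂ] A, TensorProduct.lid ℂ A (H.counit.rTensor A
        (TensorProduct.comm ℂ A A t)) = TensorProduct.rid ℂ A (H.counit.lTensor A t) := by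
      intro t
      induction t with
      | zero => simp
      | add x y hx hy => simp only [map_add, hx, hy]
      | tmul u v => simp
    have h2 : ∀ (f : A →ₗ[ℂ] A) (t : A ⊗[ℂ] A), TensorProduct.rid ℂ A (H.counit.lTensor A
        (f.rTensor A t)) = f (TensorProduct.rid ℂ A (H.counit.lTensor A t)) := by
      intro f t
      induction t with
      | zero => simp
      | add x y hx hy => simp only [map_add, hx, hy]
      | tmul u v => simp
    rw [h0, h1, ← sub_eq_zero]
    refine H.nondeg_left _ fun c => ?_
    have h3 := h2 (LinearMap.mulLeft ℂ c) (H.T₃ (a ⊗ₜ b))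
    rw [LinearMap.mulLeft_apply, H.mulLeft_T₃, h2, H.counit_T₂] at h3
    rw [mul_sub, ← h3]
    simp [mul_assoc]

theorem antipode_T₄ (H : RegularMHA A) (y x : A) :
    LinearMap.mul' ℂ A (H.antipode.lTensor A (H.T₄ (y ⊗ₜ x)))
      = H.counit x • H.antipode y := by
  rw [← sub_eq_zero]
  refine H.nondeg_right _ fun b => ?_
  rw [sub_mul, smul_mul_assoc, H.isAntipode, ← H.mul_antipodeMul_T₄, sub_eq_zero]
  generalize H.T₄ (y ⊗ₜ x) = t
  induction t with
  | zero => simp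
  | add x y hx hy => simp only [map_add, add_mul, hx, hy]
  | tmul u v => simp [mul_assoc, H.isAntipode v b]

/-- The hypothesis is the identity ∑ yx₍₂₎S⁻¹(x₍₁₎) = ε(x)y characteristic of S⁻¹. On T₄(y ⊗ x) = ∑
x₍₁₎ ⊗ yx₍₂₎ both S(f(·))S(·) and (·)S(·) multiply out to ε(x)S(y). As T₄ is onto, S(f(a))S(v) =
aS(v), and S(v) cancels by `IsAntipode.mul_right_cancel`. -/
theorem antipode_leftInverse (H : RegularMHA A) (f : A →ₗ[ℂ] A)
    (hf : ∀ y x, LinearMap.mul' ℂ A (f.lTensor A (TensorProduct.comm ℂ A A (H.T₄ (y ⊗ₜ x))))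
      = H.counit x • y) (a : A) : H.antipode (f a) = a := by
  have h1 : ∀ t : A ⊗[ℂ] A, LinearMap.mul' ℂ A (TensorProduct.map (H.antipode ∘ₗ f) H.antipode t)
      = LinearMap.mul' ℂ A (H.antipode.lTensor A t) := by
    intro t
    obtain ⟨s, rfl⟩ := H.T₄.surjective t
    induction s with
    | zero => simp
    | add x y hx hy => simp only [map_add, hx, hy]
    | tmul y x =>
      rw [H.antipode_T₄, ← map_smul, ← hf]
      generalize H.T₄ (y ⊗ₜ x) = t
      induction t with
      | zero => simp
      | add x y hx hy => simp only [map_add, hx, hy]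
      | tmul u v => simp [H.isAntipode.mul]
  rw [← sub_eq_zero]
  refine H.isAntipode.mul_right_cancel _ fun v => ?_
  rw [sub_mul, sub_eq_zero]
  simpa using h1 (a ⊗ₜ v)

theorem antipode_op_antipode (H : RegularMHA A) (a : A) : H.antipode (H.op.antipode a) = a := by
  refine H.antipode_leftInverse _ (fun y x => ?_) a
  have h := H.op.antipode_T₂ y x
  have h1 : H.op.T₂ (y ⊗ₜ x) = TensorProduct.comm ℂ A A (H.T₄ (y ⊗ₜ x)) := by
    simp [T₄, op]
  have h2 : H.op.counit = H.counit := H.coop_counit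
  rw [h1, h2] at h
  exact h

/-- The antipode as a linear equivalence. -/
noncomputable def antipodeEquiv (H : RegularMHA A) : A ≃ₗ[ℂ] A :=
  LinearEquiv.ofLinearMap H.antipode H.op.antipode (LinearMap.ext H.antipode_op_antipode)
    (LinearMap.ext H.op.antipode_op_antipode)

@[simp] theorem antipodeEquiv_apply (H : RegularMHA A) (a : A) :
    H.antipodeEquiv a = H.antipode a := rfl

@[simp] theorem antipode_antipodeEquiv_symm (H : RegularMHA A) (a : A) :
    H.antipode (H.antipodeEquiv.symm a) = a := H.antipodeEquiv.apply_symm_apply a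

@[simp] theorem antipodeEquiv_symm_antipode (H : RegularMHA A) (a : A) :
    H.antipodeEquiv.symm (H.antipode a) = a := H.antipodeEquiv.symm_apply_apply a

theorem op_antipode (H : RegularMHA A) (a : A) : H.op.antipode a = H.antipodeEquiv.symm a := rfl

theorem antipode_mul (H : RegularMHA A) (p q : A) :
    H.antipode (p * q) = H.antipode q * H.antipode p := H.isAntipode.mul p q

end RegularMHA

end General
end Bicross

namespace Bicross

universe u v w

/-! ### Antipode against coproduct, integrals, and reconstruction from canonical maps -/

section General

variable {A : Type u} [NonUnitalRing A] [Module ℂ A] [IsScalarTower ℂ A A] [SMulCommClass ℂ A A]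

namespace RegularMHA

/-- `y ⊗ a ↦ yΔ(a₍₁₎) ⊗ a₍₂₎`, i.e. `(T₂)₂₃(T₂)₁₃`, with the legs of `y` in the order `1`, `3`. -/
noncomputable def mulComul (H : RegularMHA A) : (A ⊗[ℂ] A) ⊗[ℂ] A ≃ₗ[ℂ] A ⊗[ℂ] (A ⊗[ℂ] A) :=
  TensorProduct.rightComm ℂ A A A ≪≫ₗ TensorProduct.congr H.T₂ (LinearEquiv.refl ℂ A)
    ≪≫ₗ TensorProduct.assoc ℂ A A A
    ≪≫ₗ TensorProduct.congr (LinearEquiv.refl ℂ A) (TensorProduct.comm ℂ A A ≪≫ₗ H.T₂)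

theorem mulComul_tmul (H : RegularMHA A) (w : A ⊗[ℂ] A) (a : A) :
    H.mulComul (w ⊗ₜ a) = (T₂flip H).lTensor A (TensorProduct.assoc ℂ A A A
        ((H.T₂.toLinearMap ∘ₗ (TensorProduct.mk ℂ A A).flip a).rTensor A w)) := by
  induction w with
  | zero => simp
  | add x y hx hy => simp only [map_add, TensorProduct.add_tmul, hx, hy]
  | tmul p q =>
    simp only [mulComul, LinearEquiv.trans_apply, TensorProduct.rightComm_tmul,
      TensorProduct.congr_tmul, LinearMap.rTensor_tmul, LinearMap.comp_apply, LinearMap.flip_apply,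
      TensorProduct.mk_apply, LinearEquiv.coe_coe, LinearEquiv.refl_apply]
    generalize H.T₂ (p ⊗ₜ a) = t
    induction t with
    | zero => simp
    | add x y hx hy => simp only [map_add, TensorProduct.add_tmul, hx, hy]
    | tmul u v => simp [T₂flip]

/-- `y₁ ⊗ y₂ ⊗ a ↦ (y₁ ⊗ y₂)Δ(S(a))`. -/
noncomputable def mulΔAntipode (H : RegularMHA A) : A ⊗[ℂ] (A ⊗[ℂ] A) →ₗ[ℂ] A ⊗[ℂ] A :=
  TensorProduct.lift (LinearMap.mk₂ ℂ (fun w a => (H.Δ (H.antipode a)).R w)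
    (fun _ _ _ => map_add _ _ _) (fun _ _ _ => map_smul _ _ _)
    (fun _ _ _ => by rw [map_add, map_add]; rfl)
    (fun _ _ _ => by rw [map_smul, map_smul]; rfl))
  ∘ₗ (TensorProduct.assoc ℂ A A A).symm.toLinearMap

theorem mulΔAntipode_assoc (H : RegularMHA A) (w : A ⊗[ℂ] A) (a : A) :
    H.mulΔAntipode (TensorProduct.assoc ℂ A A A (w ⊗ₜ a)) = (H.Δ (H.antipode a)).R w := by
  simp only [mulΔAntipode, LinearMap.comp_apply, LinearEquiv.coe_coe,
    LinearEquiv.symm_apply_apply]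
  rfl

/-- `y₁ ⊗ T₂(p ⊗ a) ↦ y₁S(a) ⊗ p`. -/
noncomputable def antipodeMulRight (H : RegularMHA A) : A ⊗[ℂ] (A ⊗[ℂ] A) →ₗ[ℂ] A ⊗[ℂ] A :=
  (LinearMap.mul' ℂ A ∘ₗ H.antipode.lTensor A).rTensor A
    ∘ₗ (TensorProduct.assoc ℂ A A A).symm.toLinearMap
    ∘ₗ ((TensorProduct.comm ℂ A A).toLinearMap ∘ₗ H.T₂.symm.toLinearMap).lTensor A

theorem antipodeMulRight_tmul (H : RegularMHA A) (y : A) (t : A ⊗[ℂ] A) :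
    H.antipodeMulRight (y ⊗ₜ t) = (LinearMap.mulLeft ℂ y ∘ₗ H.antipode).rTensor A
        (TensorProduct.comm ℂ A A (H.T₂.symm t)) := by
  simp only [antipodeMulRight, LinearMap.comp_apply, LinearMap.lTensor_tmul, LinearEquiv.coe_coe]
  generalize H.T₂.symm t = t
  induction t with
  | zero => simp
  | add x y hx hy => simp only [map_add, TensorProduct.tmul_add, hx, hy]
  | tmul u v => simp

/-- For w = (p ⊗ 1)Δ(q) the product is (p ⊗ 1)Δ(q a₍₁₎S(a₍₂₎)), as Δ is multiplicative. -/
theorem mulΔAntipode_mulComul (H : RegularMHA A) (w : A ⊗[ℂ] A) (a : A) :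
    H.mulΔAntipode (H.mulComul (w ⊗ₜ a)) = H.counit a • w := by
  obtain ⟨s, rfl⟩ := H.T₂.surjective w
  induction s with
  | zero => simp
  | add x y hx hy => simp only [map_add, TensorProduct.add_tmul, smul_add, hx, hy]
  | tmul p q =>
    rw [mulComul_tmul, coassoc_T₂, ← map_smul, ← TensorProduct.tmul_smul, ← H.antipode_T₂]
    generalize H.T₂ (q ⊗ₜ a) = t
    induction t with
    | zero => simp
    | add x y hx hy => simp only [map_add, TensorProduct.tmul_add, hx, hy]
    | tmul u v =>
      rw [LinearMap.lTensor_tmul, LinearMap.mul'_apply, H.T₂_mul, LinearMap.rTensor_tmul,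
        mulΔAntipode_assoc]
      rfl

/-- T₂⁻¹ undoes the comultiplication in the second leg, and the first leg becomes p a₍₁₎S(a₍₂₎). -/
theorem antipodeMulRight_mulComul (H : RegularMHA A) (w : A ⊗[ℂ] A) (a : A) :
    H.antipodeMulRight (H.mulComul (w ⊗ₜ a)) = H.counit a • w := by
  induction w with
  | zero => simp
  | add x y hx hy => simp only [map_add, TensorProduct.add_tmul, smul_add, hx, hy]
  | tmul p q =>
    rw [mulComul_tmul, TensorProduct.smul_tmul', ← H.antipode_T₂, LinearMap.rTensor_tmul]
    simp only [LinearMap.comp_apply, LinearMap.flip_apply,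
      TensorProduct.mk_apply, LinearEquiv.coe_coe]
    generalize H.T₂ (p ⊗ₜ a) = t
    induction t with
    | zero => simp
    | add x y hx hy => simp only [map_add, TensorProduct.add_tmul, hx, hy]
    | tmul u v =>
      rw [TensorProduct.assoc_tmul, LinearMap.lTensor_tmul, antipodeMulRight_tmul]
      simp [T₂flip]

/-- Uniqueness of convolution inverses: multiplication by Δ(S(a)) and by the flipped (S ⊗ S)Δ(a)
both give ε(a)w after w ⊗ a ↦ ∑ wΔ(a₍₁₎) ⊗ a₍₂₎, and that map is bijective. -/
theorem Δ_antipode_R (H : RegularMHA A) (y₁ y₂ a : A) :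
    (H.Δ (H.antipode a)).R (y₁ ⊗ₜ y₂)
      = (LinearMap.mulLeft ℂ y₁ ∘ₗ H.antipode).rTensor A
        (TensorProduct.comm ℂ A A (H.T₂.symm (y₂ ⊗ₜ a))) := by
  rw [← antipodeMulRight_tmul, ← mulΔAntipode_assoc, TensorProduct.assoc_tmul]
  obtain ⟨s, hs⟩ := H.mulComul.surjective (y₁ ⊗ₜ (y₂ ⊗ₜ a))
  rw [← hs]
  clear hs
  induction s with
  | zero => simp
  | add x y hx hy => simp only [map_add, hx, hy]
  | tmul w a => rw [mulΔAntipode_mulComul, antipodeMulRight_mulComul]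

/-- The antipode reverses the coproduct. -/
theorem T₂_antipode (H : RegularMHA A) (a b : A) :
    H.T₂ (H.antipode a ⊗ₜ H.antipode b)
      = TensorProduct.comm ℂ A A (TensorProduct.map H.antipode H.antipode (H.T₁ (b ⊗ₜ a))) := by
  refine H.rTensor_mulLeft_cancel fun y₁ => H.lTensor_mulLeft_cancel fun y₂ => ?_
  rw [← H.T₂_mul_left, ← H.Δ_R_tmul, Δ_antipode_R]
  have h1 : ∀ t : A ⊗[ℂ] A, (LinearMap.mulLeft ℂ (y₁ * H.antipode a) ∘ₗ H.antipode).rTensor A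
        (TensorProduct.comm ℂ A A t)
      = (LinearMap.mulLeft ℂ y₁ ∘ₗ H.antipode).rTensor A (TensorProduct.comm ℂ A A
        ((LinearMap.mulRight ℂ a).lTensor A t)) := by
    intro t
    induction t with
    | zero => simp
    | add x y hx hy => simp only [map_add, hx, hy]
    | tmul u v => simp [H.antipode_mul]
  rw [h1, H.isAntipode.mulRight_T₂_symm]
  generalize H.T₁ (b ⊗ₜ a) = t
  induction t with
  | zero => simp
  | add x y hx hy => simp only [map_add, hx, hy]
  | tmul u v => simp

/-- The element (1 ⊗ b)Δ(a)(1 ⊗ d) can be read from either side, and d cancels; one half of the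
invariance implies the other. -/
theorem isRightIntegral_of_right (H : RegularMHA A) {ψ : A →ₗ[ℂ] ℂ} (h0 : ψ ≠ 0)
    (h : ∀ a b : A, TensorProduct.lid ℂ A (ψ.rTensor A (H.T₁ (a ⊗ₜ b))) = ψ a • b) :
    H.IsRightIntegral ψ where
  ne_zero := h0
  right := h
  left a b := by
    have key : ∀ (f : A →ₗ[ℂ] A) (t : A ⊗[ℂ] A), TensorProduct.lid ℂ A (ψ.rTensor A
        (f.lTensor A t)) = f (TensorProduct.lid ℂ A (ψ.rTensor A t)) := by
      intro f t
      induction t with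
      | zero => simp
      | add x y hx hy => simp only [map_add, hx, hy]
      | tmul u v => simp
    rw [← sub_eq_zero]
    refine H.nondeg_right _ fun d => ?_
    have h1 := key (LinearMap.mulRight ℂ d) (H.T₄ (b ⊗ₜ a))
    rw [H.mulRight_T₄, key, h] at h1
    rw [sub_mul, sub_eq_zero]
    simpa [smul_mul_assoc] using h1.symm

theorem isLeftIntegral_of_left (H : RegularMHA A) {φ : A →ₗ[ℂ] ℂ} (h0 : φ ≠ 0)
    (h : ∀ a b : A, TensorProduct.rid ℂ A (φ.lTensor A (H.T₂ (b ⊗ₜ a))) = φ a • b) :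
    H.IsLeftIntegral φ where
  ne_zero := h0
  left := h
  right a b := by
    have key : ∀ (f : A →ₗ[ℂ] A) (t : A ⊗[ℂ] A), TensorProduct.rid ℂ A (φ.lTensor A
        (f.rTensor A t)) = f (TensorProduct.rid ℂ A (φ.lTensor A t)) := by
      intro f t
      induction t with
      | zero => simp
      | add x y hx hy => simp only [map_add, hx, hy]
      | tmul u v => simp
    rw [← sub_eq_zero]
    refine H.nondeg_left _ fun d => ?_
    have h1 := key (LinearMap.mulLeft ℂ d) (H.T₃ (a ⊗ₜ b))
    rw [H.mulLeft_T₃, key, h] at h1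
    rw [mul_sub, sub_eq_zero]
    simpa [mul_smul_comm] using h1.symm

/-- S is bijective and reverses the coproduct, so it exchanges right and left invariance. -/
theorem IsRightIntegral.isLeftIntegral {H : RegularMHA A} {ψ : A →ₗ[ℂ] ℂ}
    (h : H.IsRightIntegral ψ) : H.IsLeftIntegral (ψ ∘ₗ H.antipodeEquiv.symm.toLinearMap) := by
  refine H.isLeftIntegral_of_left (fun h0 => h.ne_zero (LinearMap.ext fun a => ?_)) fun a b => ?_
  · simpa using LinearMap.congr_fun h0 (H.antipode a)
  · obtain ⟨a, rfl⟩ := H.antipodeEquiv.surjective a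
    obtain ⟨b, rfl⟩ := H.antipodeEquiv.surjective b
    rw [antipodeEquiv_apply, antipodeEquiv_apply, T₂_antipode]
    have key : ∀ t : A ⊗[ℂ] A, TensorProduct.rid ℂ A ((ψ ∘ₗ H.antipodeEquiv.symm.toLinearMap).lTensor
        A (TensorProduct.comm ℂ A A (TensorProduct.map H.antipode H.antipode t)))
        = H.antipode (TensorProduct.lid ℂ A (ψ.rTensor A t)) := by
      intro t
      induction t with
      | zero => simp
      | add x y hx hy => simp only [map_add, hx, hy]
      | tmul u v => simp
    rw [key, h.right]
    simp

theorem isAlgebraicQuantumGroup_of_right (H : RegularMHA A) {ψ : A →ₗ[ℂ] ℂ}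
    (h : H.IsRightIntegral ψ) : H.IsAlgebraicQuantumGroup := ⟨⟨_, h.isLeftIntegral⟩, ψ, h⟩

end RegularMHA

/-- `p ⊗ q ↦ (1 ⊗ q)T(p ⊗ y)`; this is `x ↦ xΔ(y)` if `T = T₂`. -/
noncomputable def canonMul (T : A ⊗[ℂ] A →ₗ[ℂ] A ⊗[ℂ] A) (y : A) : A ⊗[ℂ] A →ₗ[ℂ] A ⊗[ℂ] A :=
  TensorProduct.lift (LinearMap.mk₂ ℂ (fun p q => (LinearMap.mulLeft ℂ q).lTensor A (T (p ⊗ₜ y)))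
    (fun _ _ _ => by rw [TensorProduct.add_tmul, map_add, map_add])
    (fun _ _ _ => by rw [← TensorProduct.smul_tmul', map_smul, map_smul])
    (fun _ q q' => by
      have : LinearMap.mulLeft ℂ (q + q') = LinearMap.mulLeft ℂ q + LinearMap.mulLeft ℂ q' := by
        ext; simp [add_mul]
      rw [this, LinearMap.lTensor_add, LinearMap.add_apply])
    (fun c _ q => by
      have : LinearMap.mulLeft ℂ (c • q) = c • LinearMap.mulLeft ℂ q := by
        ext; simp [smul_mul_assoc]
      rw [this, LinearMap.lTensor_smul, LinearMap.smul_apply]))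

@[simp] theorem canonMul_tmul (T : A ⊗[ℂ] A →ₗ[ℂ] A ⊗[ℂ] A) (y p q : A) :
    canonMul T y (p ⊗ₜ q) = (LinearMap.mulLeft ℂ q).lTensor A (T (p ⊗ₜ y)) := by
  simp [canonMul]

theorem canonMul_mul (T : A ⊗[ℂ] A →ₗ[ℂ] A ⊗[ℂ] A)
    (h : ∀ c a b : A, T ((c * a) ⊗ₜ b) = (LinearMap.mulLeft ℂ c).rTensor A (T (a ⊗ₜ b)))
    (y : A) (x x' : A ⊗[ℂ] A) : canonMul T y (x * x') = x * canonMul T y x' := by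
  induction x' with
  | zero => simp
  | add s t hs ht => simp only [map_add, mul_add, hs, ht]
  | tmul r s =>
    induction x with
    | zero => simp
    | add x y hx hy => simp only [map_add, add_mul, hx, hy]
    | tmul p q =>
      rw [Algebra.TensorProduct.tmul_mul_tmul, canonMul_tmul, canonMul_tmul, h,
        ← MultiplierHopfAlgebra.lTensor_mulLeft_rTensor_mulLeft, rTensor_lTensor_comm,
        ← LinearMap.lTensor_comp_apply]
      congr 2
      ext z; simp

/-- `p ⊗ q ↦ T(y ⊗ q)(p ⊗ 1)`; this is `x ↦ Δ(y)x` if `T = T₁`. -/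
noncomputable def canonMul' (T : A ⊗[ℂ] A →ₗ[ℂ] A ⊗[ℂ] A) (y : A) : A ⊗[ℂ] A →ₗ[ℂ] A ⊗[ℂ] A :=
  TensorProduct.lift (LinearMap.mk₂ ℂ (fun p q => (LinearMap.mulRight ℂ p).rTensor A (T (y ⊗ₜ q)))
    (fun p p' _ => by
      have : LinearMap.mulRight ℂ (p + p') = LinearMap.mulRight ℂ p + LinearMap.mulRight ℂ p' := by
        ext; simp [mul_add]
      rw [this, LinearMap.rTensor_add, LinearMap.add_apply])
    (fun c p _ => by
      have : LinearMap.mulRight ℂ (c • p) = c • LinearMap.mulRight ℂ p := by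
        ext; simp [mul_smul_comm]
      rw [this, LinearMap.rTensor_smul, LinearMap.smul_apply])
    (fun _ _ _ => by rw [TensorProduct.tmul_add, map_add, map_add])
    (fun _ _ _ => by rw [TensorProduct.tmul_smul, map_smul, map_smul]))

@[simp] theorem canonMul'_tmul (T : A ⊗[ℂ] A →ₗ[ℂ] A ⊗[ℂ] A) (y p q : A) :
    canonMul' T y (p ⊗ₜ q) = (LinearMap.mulRight ℂ p).rTensor A (T (y ⊗ₜ q)) := by
  simp [canonMul']

theorem canonMul'_mul (T : A ⊗[ℂ] A →ₗ[ℂ] A ⊗[ℂ] A)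
    (h : ∀ a b c : A, T (a ⊗ₜ (b * c)) = (LinearMap.mulRight ℂ c).lTensor A (T (a ⊗ₜ b)))
    (y : A) (x x' : A ⊗[ℂ] A) : canonMul' T y (x * x') = canonMul' T y x * x' := by
  induction x with
  | zero => simp
  | add s t hs ht => simp only [map_add, add_mul, hs, ht]
  | tmul r s =>
    induction x' with
    | zero => simp
    | add x y hx hy => simp only [map_add, mul_add, hx, hy]
    | tmul p q =>
      rw [Algebra.TensorProduct.tmul_mul_tmul, canonMul'_tmul, canonMul'_tmul, h,
        ← lTensor_mulRight_rTensor_mulRight, rTensor_lTensor_comm, ← LinearMap.rTensor_comp_apply]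
      congr 2
      ext z; simp [mul_assoc]

/-- A multiplier Hopf algebra from its canonical maps `T₁` and `T₂`. -/
noncomputable def MultiplierHopfAlgebra.ofCanonicalMaps
    (hr : ∀ a : A, (∀ b, a * b = 0) → a = 0) (hl : ∀ a : A, (∀ b, b * a = 0) → a = 0)
    (T₁ T₂ : (A ⊗[ℂ] A) ≃ₗ[ℂ] (A ⊗[ℂ] A))
    (h : ∀ x y z : A, (LinearMap.mulLeft ℂ x).rTensor A (T₁ (y ⊗ₜ z))
      = (LinearMap.mulRight ℂ z).lTensor A (T₂ (x ⊗ₜ y)))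
    (hmul : ∀ w x y : A, T₂ (w ⊗ₜ (x * y)) = canonMul T₂.toLinearMap y (T₂ (w ⊗ₜ x)))
    (hco : ∀ a b c : A,
      TensorProduct.assoc ℂ A A A
        ((T₂.toLinearMap ∘ₗ TensorProduct.mk ℂ A A a).rTensor A (T₁ (b ⊗ₜ[ℂ] c)))
      = (T₁.toLinearMap ∘ₗ (TensorProduct.mk ℂ A A).flip c).lTensor A (T₂ (a ⊗ₜ[ℂ] b))) :
    MultiplierHopfAlgebra A :=
  have rc : ∀ z z' : A ⊗[ℂ] A, (∀ c, (LinearMap.mulLeft ℂ c).rTensor A z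
      = (LinearMap.mulLeft ℂ c).rTensor A z') → z = z' := fun z z' hz => by
    rw [← sub_eq_zero]
    exact rTensor_cancel (fun c => LinearMap.mulLeft ℂ c) hl _
      fun c => by rw [map_sub, hz, sub_self]
  have lc : ∀ z z' : A ⊗[ℂ] A, (∀ c, (LinearMap.mulRight ℂ c).lTensor A z
      = (LinearMap.mulRight ℂ c).lTensor A z') → z = z' := fun z z' hz => by
    rw [← sub_eq_zero]
    exact lTensor_cancel (fun c => LinearMap.mulRight ℂ c) hr _
      fun c => by rw [map_sub, hz, sub_self]
  -- Linearity of T₁ in its last leg, and of T₂ in its first, already follows from the link `h`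
  -- between them: cover the other leg and cancel.
  have h₁ : ∀ a b c : A, T₁ (a ⊗ₜ (b * c)) = (LinearMap.mulRight ℂ c).lTensor A (T₁ (a ⊗ₜ b)) :=
    fun a b c => rc _ _ fun d => by
      rw [h, rTensor_lTensor_comm, h, ← LinearMap.lTensor_comp_apply]
      congr 2
      ext x; simp [mul_assoc]
  have h₂ : ∀ c a b : A, T₂ ((c * a) ⊗ₜ b) = (LinearMap.mulLeft ℂ c).rTensor A (T₂ (a ⊗ₜ b)) :=
    fun c a b => lc _ _ fun d => by
      rw [← h, ← rTensor_lTensor_comm, ← h, ← LinearMap.rTensor_comp_apply]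
      congr 2
      ext x; simp
  -- The compatibility s(Δ(y)t) = (sΔ(y))t, which makes the operators read off from T₁ and T₂ into a
  -- single multiplier.
  have h₃ : ∀ (y : A) (s t : A ⊗[ℂ] A), s * canonMul' T₁.toLinearMap y t
      = canonMul T₂.toLinearMap y s * t := fun y s t => by
    induction s with
    | zero => simp
    | add x y hx hy => simp only [map_add, add_mul, hx, hy]
    | tmul p q =>
      induction t with
      | zero => simp
      | add x y hx hy => simp only [map_add, mul_add, hx, hy]
      | tmul r s =>
        have e1 : ∀ t : A ⊗[ℂ] A, (LinearMap.mulLeft ℂ p).rTensor A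
            ((LinearMap.mulRight ℂ r).rTensor A t)
            = (LinearMap.mulRight ℂ r).rTensor A ((LinearMap.mulLeft ℂ p).rTensor A t) := by
          intro t
          rw [← LinearMap.rTensor_comp_apply, ← LinearMap.rTensor_comp_apply]
          congr 2
          ext x; simp [mul_assoc]
        have e2 : ∀ t : A ⊗[ℂ] A, (LinearMap.mulLeft ℂ q).lTensor A
            ((LinearMap.mulRight ℂ s).lTensor A t)
            = (LinearMap.mulRight ℂ s).lTensor A ((LinearMap.mulLeft ℂ q).lTensor A t) := by
          intro t
          rw [← LinearMap.lTensor_comp_apply, ← LinearMap.lTensor_comp_apply]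
          congr 2
          ext x; simp [mul_assoc]
        rw [canonMul'_tmul, canonMul_tmul,
          ← MultiplierHopfAlgebra.lTensor_mulLeft_rTensor_mulLeft,
          ← lTensor_mulRight_rTensor_mulRight, LinearEquiv.coe_coe, LinearEquiv.coe_coe, e1, h,
          rTensor_lTensor_comm, e2, rTensor_lTensor_comm]
  let Δ : A → Multiplier (A ⊗[ℂ] A) := fun y =>
    Multiplier.ofMaps (canonMul' T₁.toLinearMap y) (canonMul T₂.toLinearMap y)
      (canonMul'_mul _ h₁ y) (canonMul_mul _ h₂ y) (h₃ y)
  have hΔR : ∀ y p q, (Δ y).R (p ⊗ₜ q) = (LinearMap.mulLeft ℂ q).lTensor A (T₂ (p ⊗ₜ y)) :=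
    fun y p q => canonMul_tmul _ _ _ _
  have hΔL : ∀ y p q, (Δ y).L (p ⊗ₜ q) = (LinearMap.mulRight ℂ p).rTensor A (T₁ (y ⊗ₜ q)) :=
    fun y p q => canonMul'_tmul _ _ _ _
  { nondeg_right := hr
    nondeg_left := hl
    Δ :=
      { toFun := Δ
        map_smul' := fun c x => Multiplier.ext_R hl fun t => by
          change (Δ (c • x)).R t = c • (Δ x).R t
          induction t with
          | zero => simp
          | add s t hs ht => simp only [map_add, smul_add, hs, ht]
          | tmul p q => rw [hΔR, hΔR, TensorProduct.tmul_smul, map_smul, map_smul]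
        map_zero' := Multiplier.ext_R hl fun t => by
          change (Δ 0).R t = 0
          induction t with
          | zero => simp
          | add s t hs ht => simp only [map_add, hs, ht, add_zero]
          | tmul p q => rw [hΔR, TensorProduct.tmul_zero, map_zero, map_zero]
        map_add' := fun x y => Multiplier.ext_R hl fun t => by
          change (Δ (x + y)).R t = (Δ x).R t + (Δ y).R t
          induction t with
          | zero => simp
          | add s t hs ht => simp only [map_add, hs, ht]; abel
          | tmul p q => rw [hΔR, hΔR, hΔR, TensorProduct.tmul_add, map_add, map_add]
        map_mul' := fun x y => Multiplier.ext_R hl fun t => by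
          rw [Multiplier.R_comp]
          induction t with
          | zero => simp
          | add s t hs ht => simp only [map_add, hs, ht]
          | tmul p q =>
            rw [hΔR, hΔR, hmul]
            change _ = canonMul T₂.toLinearMap y _
            generalize T₂ (p ⊗ₜ x) = t
            induction t with
            | zero => simp
            | add s t hs ht => simp only [map_add, hs, ht]
            | tmul r s =>
              rw [LinearMap.lTensor_tmul, canonMul_tmul, canonMul_tmul,
                ← LinearMap.lTensor_comp_apply]
              congr 2
              ext z; simp }
    T₁ := T₁
    T₂ := T₂
    T₁_spec := fun a b => Multiplier.ext_L hr fun t => by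
      change (Δ a * oneTmul (incl b)).L t = _
      rw [Multiplier.L_comp, oneTmul_L, incl_L]
      induction t with
      | zero => simp
      | add s t hs ht => simp only [map_add, mul_add, hs, ht]
      | tmul p q =>
        rw [LinearMap.lTensor_tmul, hΔL, ← lTensor_mulRight_rTensor_mulRight]
        change (LinearMap.mulRight ℂ p).rTensor A (T₁ (a ⊗ₜ (b * q))) = _
        rw [h₁, rTensor_lTensor_comm]
    T₂_spec := fun a b => Multiplier.ext_R hl fun t => by
      change (tmulOne (incl a) * Δ b).R t = _
      rw [Multiplier.R_comp, tmulOne_R, incl_R]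
      induction t with
      | zero => simp
      | add s t hs ht => simp only [map_add, add_mul, hs, ht]
      | tmul p q =>
        rw [LinearMap.rTensor_tmul, hΔR, ← MultiplierHopfAlgebra.lTensor_mulLeft_rTensor_mulLeft]
        change (LinearMap.mulLeft ℂ q).lTensor A (T₂ ((p * a) ⊗ₜ b)) = _
        rw [h₂]
    coassoc := hco }

end General
end Bicross

namespace Bicross

universe u v w

/-! ### The twist map R of the action and its inverse -/

section Twist

variable {A : Type u} [NonUnitalRing A] [Module ℂ A] [IsScalarTower ℂ A A] [SMulCommClass ℂ A A]
  {B : Type v} [AddCommGroup B] [Module ℂ B]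

/-- Scalars are absorbed by c(d ◁ e) = d ◁ (ce), so sums of elements d ◁ e already exhaust B. -/
theorem RightAction.induction (M : RightAction A B) {p : B → Prop}
    (act : ∀ b a, p (M.act b a)) (zero : p 0) (add : ∀ x y, p x → p y → p (x + y)) (b : B) :
    p b := by
  have hb : b ∈ Submodule.span ℂ {x | ∃ b a, x = M.act b a} := by
    rw [M.unital]; trivial
  rw [← Submodule.mem_toAddSubmonoid, Submodule.span_eq_closure] at hb
  refine AddSubmonoid.closure_induction ?_ zero (fun x y _ _ hx hy => add x y hx hy) hb
  rintro _ ⟨c, -, _, ⟨d, e, rfl⟩, rfl⟩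
  change p (c • M.act d e)
  rw [← map_smul]
  exact act _ _

/-- On d ◁ e the element e itself covers the second leg of Δ(a), so R takes a closed form there.
Together with `RightAction.induction` this is the working description of R. -/
theorem twist_act (H : RegularMHA A) (M : RightAction A B) (d : B) (e a : A) :
    twist H M (M.act d e ⊗ₜ a) = (M.act d).lTensor A (H.T₄ (e ⊗ₜ a)) := by
  refine H.rTensor_mulLeft_cancel fun c => ?_
  rw [mulLeft_twist, rTensor_lTensor_comm, H.mulLeft_T₄, ← LinearMap.lTensor_comp_apply]
  congr 2
  ext x; simp [M.act_mul]

theorem twistOp_act (H : RegularMHA A) (M : RightAction A B) (d : B) (e a : A) :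
    twistOp H M (M.act d e ⊗ₜ a)
      = (M.act d).lTensor A (TensorProduct.comm ℂ A A (H.T₂ (e ⊗ₜ a))) :=
  twist_act H.op M d e a

/-- a ⊗ (d ◁ e) is the image under ι ⊗ (d ◁ ·) of T₄(T₄⁻¹(a ⊗ e)), a sum of values of R on elements
(d ◁ u) ⊗ v. -/
theorem twist_surjective (H : RegularMHA A) (M : RightAction A B) :
    Function.Surjective (twist H M) := by
  intro t
  induction t with
  | zero => exact ⟨0, map_zero _⟩
  | add x y hx hy =>
    obtain ⟨x, rfl⟩ := hx
    obtain ⟨y, rfl⟩ := hy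
    exact ⟨x + y, map_add _ _ _⟩
  | tmul a b =>
    induction b using M.induction with
    | act d e =>
      have key : ∀ s : A ⊗[ℂ] A, ∃ r, twist H M r = (M.act d).lTensor A (H.T₄ s) := by
        intro s
        induction s with
        | zero => exact ⟨0, by simp⟩
        | add x y hx hy =>
          obtain ⟨u, hu⟩ := hx
          obtain ⟨v, hv⟩ := hy
          exact ⟨u + v, by simp only [map_add, hu, hv]⟩
        | tmul u v => exact ⟨_, twist_act H M d u v⟩
      obtain ⟨r, hr⟩ := key (H.T₄.symm (a ⊗ₜ e))
      exact ⟨r, by rw [hr]; simp⟩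
    | zero => exact ⟨0, by simp⟩
    | add x y hx hy =>
      obtain ⟨u, hu⟩ := hx
      obtain ⟨v, hv⟩ := hy
      exact ⟨u + v, by rw [map_add, hu, hv, TensorProduct.tmul_add]⟩

/-- `R⁻¹(x ⊗ b)(1 ⊗ k) = ∑ (b ◁ S⁻¹(x₍₂₎)) ⊗ x₍₁₎k`. -/
noncomputable def twistInvMul (H : RegularMHA A) (M : RightAction A B) (k : A) :
    A ⊗[ℂ] B →ₗ[ℂ] B ⊗[ℂ] A :=
  TensorProduct.lift (LinearMap.mk₂ ℂ
    (fun x b => (M.act b ∘ₗ H.op.antipode).rTensor A (H.coop.T₁ (x ⊗ₜ k)))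
    (fun _ _ _ => by rw [TensorProduct.add_tmul, map_add, map_add])
    (fun _ _ _ => by rw [← TensorProduct.smul_tmul', map_smul, map_smul])
    (fun _ _ _ => by rw [map_add, LinearMap.add_comp, LinearMap.rTensor_add, LinearMap.add_apply])
    (fun _ _ _ => by
      rw [map_smul, LinearMap.smul_comp, LinearMap.rTensor_smul, LinearMap.smul_apply]))

@[simp] theorem twistInvMul_tmul (H : RegularMHA A) (M : RightAction A B) (k x : A) (b : B) :
    twistInvMul H M k (x ⊗ₜ b)
      = (M.act b ∘ₗ H.op.antipode).rTensor A (H.coop.T₁ (x ⊗ₜ k)) := by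
  simp [twistInvMul]

/-- The inverse of R involves S⁻¹ and is explicit only after a right multiplication by k. That
suffices for injectivity, and later for computing adjoints in the smash product. -/
theorem twistInvMul_twist (H : RegularMHA A) (M : RightAction A B) (k : A) (t : B ⊗[ℂ] A) :
    twistInvMul H M k (twist H M t) = (LinearMap.mulRight ℂ k).lTensor B t := by
  induction t with
  | zero => simp
  | add x y hx hy => simp only [map_add, hx, hy]
  | tmul b a =>
    induction b using M.induction with
    | zero => simp
    | act d e =>
      have h1 : ∀ s : A ⊗[ℂ] A, twistInvMul H M k ((M.act d).lTensor A (H.T₄ s))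
          = (M.act d).rTensor A ((LinearMap.mulRight ℂ k).lTensor A s) := by
        intro s
        obtain ⟨r, rfl⟩ := H.T₄.symm.surjective s
        induction r with
        | zero => simp
        | add x y hx hy => simp only [map_add, hx, hy]
        | tmul x y =>
          -- S⁻¹ is the antipode of the opposite coproduct, for which T₄ is the second canonical map
          -- up to a flip.
          have h2 := H.op.isAntipode.mulRight_T₂_symm k x y
          have h3 : H.T₄.symm (x ⊗ₜ y) = H.coop.T₂.symm (y ⊗ₜ x) := rfl
          rw [LinearEquiv.apply_symm_apply, h3, LinearMap.lTensor_tmul, twistInvMul_tmul]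
          refine Eq.trans ?_ (congrArg ((M.act d).rTensor A) h2).symm
          rw [← LinearMap.rTensor_comp_apply]
          congr 2
          ext z; simp [M.act_mul]
      rw [twist_act, h1]
      simp
    | add x y hx hy => rw [TensorProduct.add_tmul, map_add, map_add, map_add, hx, hy]

theorem twist_injective (H : RegularMHA A) (M : RightAction A B) :
    Function.Injective (twist H M) := by
  refine (injective_iff_map_eq_zero _).2 fun t ht => ?_
  refine H.lTensor_mulRight_cancel fun k => ?_
  rw [← twistInvMul_twist H M, ht]
  simp

/-- The twist map as a linear equivalence. -/
noncomputable def twistEquiv (H : RegularMHA A) (M : RightAction A B) : B ⊗[ℂ] A ≃ₗ[ℂ] A ⊗[ℂ] B :=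
  LinearEquiv.ofBijective (twist H M) ⟨twist_injective H M, twist_surjective H M⟩

@[simp] theorem twistEquiv_apply (H : RegularMHA A) (M : RightAction A B) (t : B ⊗[ℂ] A) :
    twistEquiv H M t = twist H M t := rfl

/-- On b = d ◁ e this is invariance of ψ on (1 ⊗ e)Δ(a), carried through d ◁ (·). -/
theorem integral_twist (H : RegularMHA A) (M : RightAction A B) {ψ : A →ₗ[ℂ] ℂ}
    (hψ : H.IsRightIntegral ψ) (b : B) (a : A) :
    TensorProduct.lid ℂ B (ψ.rTensor B (twist H M (b ⊗ₜ a))) = ψ a • b := by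
  induction b using M.induction with
  | zero => simp
  | act d e =>
    have key : ∀ t : A ⊗[ℂ] A, TensorProduct.lid ℂ B (ψ.rTensor B ((M.act d).lTensor A t))
        = M.act d (TensorProduct.lid ℂ A (ψ.rTensor A t)) := by
      intro t
      induction t with
      | zero => simp
      | add x y hx hy => simp only [map_add, hx, hy]
      | tmul u v => simp
    rw [twist_act, key, hψ.left, map_smul]
  | add x y hx hy => simp only [TensorProduct.add_tmul, map_add, hx, hy, smul_add]

/-- The opposite twist map commutes with maps of the form `a ↦ ∑ a₍₁₎ ⊗ θ(a₍₂₎)`. -/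
theorem twistOp_covers {H : RegularMHA A} (M : RightAction A B) {V : Type w} [AddCommGroup V]
    [Module ℂ V] {ζ : A →ₗ[ℂ] A ⊗[ℂ] V} {θ : A →ₗ[ℂ] V} (h : H.Covers ζ θ) (c : B) (a : A) :
    TensorProduct.assoc ℂ B A V (((TensorProduct.comm ℂ A B).toLinearMap ∘ₗ twistOp H M
        ∘ₗ TensorProduct.mk ℂ B A c).rTensor V (ζ a))
      = ζ.lTensor B (TensorProduct.comm ℂ A B (twistOp H M (c ⊗ₜ a))) := by
  induction c using M.induction with
  | zero => simp [LinearMap.rTensor_zero]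
  | act d e =>
    have h1 := congrArg ((M.act d).rTensor (A ⊗[ℂ] V)) (H.covers_comul h e a)
    rw [twistOp_act]
    have h2 : ∀ t : A ⊗[ℂ] A, TensorProduct.comm ℂ A B ((M.act d).lTensor A
        (TensorProduct.comm ℂ A A t)) = (M.act d).rTensor A t := by
      intro t
      induction t with
      | zero => simp
      | add x y hx hy => simp only [map_add, hx, hy]
      | tmul u v => simp
    rw [h2, ← rTensor_lTensor_comm, ← h1]
    generalize ζ a = t
    induction t with
    | zero => simp
    | add x y hx hy => simp only [map_add, hx, hy]
    | tmul u v =>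
      simp only [LinearMap.rTensor_tmul, LinearMap.comp_apply, TensorProduct.mk_apply,
        LinearEquiv.coe_coe, twistOp_act, h2]
      generalize H.T₂ (e ⊗ₜ u) = t
      induction t with
      | zero => simp
      | add x y hx hy => simp only [map_add, TensorProduct.add_tmul, hx, hy]
      | tmul u v => simp
  | add x y hx hy =>
    simp only [map_add, TensorProduct.add_tmul, LinearMap.comp_add, LinearMap.rTensor_add,
      LinearMap.add_apply, hx, hy]

end Twist

end Bicross

namespace Bicross

universe u v w

/-! ### Operators acting on two of three legs -/

section Leg

variable {X Y P Q Z Z' X' Y' : Type*} [AddCommGroup X] [Module ℂ X]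
  [AddCommGroup Y] [Module ℂ Y] [AddCommGroup P] [Module ℂ P] [AddCommGroup Q] [Module ℂ Q]
  [AddCommGroup Z] [Module ℂ Z] [AddCommGroup Z'] [Module ℂ Z'] [AddCommGroup X'] [Module ℂ X']
  [AddCommGroup Y'] [Module ℂ Y']

@[simp] theorem leg₁₂_tmul (f : X ⊗[ℂ] Y →ₗ[ℂ] P ⊗[ℂ] Q) (x : X) (y : Y) (z : Z) :
    leg₁₂ Z f (x ⊗ₜ (y ⊗ₜ z)) = TensorProduct.assoc ℂ P Q Z (f (x ⊗ₜ y) ⊗ₜ z) := by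
  simp [leg₁₂]

theorem leg₁₂_assoc (f : X ⊗[ℂ] Y →ₗ[ℂ] P ⊗[ℂ] Q) (t : X ⊗[ℂ] Y) (z : Z) :
    leg₁₂ Z f (TensorProduct.assoc ℂ X Y Z (t ⊗ₜ z)) = TensorProduct.assoc ℂ P Q Z (f t ⊗ₜ z) := by
  simp [leg₁₂]

theorem leg₁₂_comp (g : P ⊗[ℂ] Q →ₗ[ℂ] X' ⊗[ℂ] Y') (f : X ⊗[ℂ] Y →ₗ[ℂ] P ⊗[ℂ] Q)
    (t : X ⊗[ℂ] (Y ⊗[ℂ] Z)) : leg₁₂ Z (g ∘ₗ f) t = leg₁₂ Z g (leg₁₂ Z f t) := by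
  simp [leg₁₂, LinearMap.rTensor_comp]

theorem leg₁₂_lTensor (f : X ⊗[ℂ] Y →ₗ[ℂ] P ⊗[ℂ] Q) (g : Z →ₗ[ℂ] Z')
    (t : X ⊗[ℂ] (Y ⊗[ℂ] Z)) :
    leg₁₂ Z' f ((g.lTensor Y).lTensor X t) = (g.lTensor Q).lTensor P (leg₁₂ Z f t) := by
  have key : ∀ (s : P ⊗[ℂ] Q) (z : Z), (g.lTensor Q).lTensor P (TensorProduct.assoc ℂ P Q Z (s ⊗ₜ z))
      = TensorProduct.assoc ℂ P Q Z' (s ⊗ₜ g z) := by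
    intro s z
    induction s with
    | zero => simp
    | add x y hx hy => simp only [map_add, TensorProduct.add_tmul, hx, hy]
    | tmul u v => simp
  induction t with
  | zero => simp
  | add x y hx hy => simp only [map_add, hx, hy]
  | tmul x t =>
    induction t with
    | zero => simp
    | add x y hx hy => simp only [map_add, TensorProduct.tmul_add, hx, hy]
    | tmul y z => simp [key]

/-- `leg₁₂` of an equivalence. -/
noncomputable def legEquiv (Z : Type*) [AddCommGroup Z] [Module ℂ Z]
    (f : X ⊗[ℂ] Y ≃ₗ[ℂ] P ⊗[ℂ] Q) : X ⊗[ℂ] (Y ⊗[ℂ] Z) ≃ₗ[ℂ] P ⊗[ℂ] (Q ⊗[ℂ] Z) :=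
  (TensorProduct.assoc ℂ X Y Z).symm ≪≫ₗ TensorProduct.congr f (LinearEquiv.refl ℂ Z)
    ≪≫ₗ TensorProduct.assoc ℂ P Q Z

theorem legEquiv_apply (f : X ⊗[ℂ] Y ≃ₗ[ℂ] P ⊗[ℂ] Q) (t : X ⊗[ℂ] (Y ⊗[ℂ] Z)) :
    legEquiv Z f t = leg₁₂ Z f.toLinearMap t := rfl

end Leg

theorem RegularMHA.mulRight_T₃ {B : Type v} [NonUnitalRing B] [Module ℂ B] [IsScalarTower ℂ B B]
    [SMulCommClass ℂ B B] (H : RegularMHA B) (d a b : B) :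
    (LinearMap.mulRight ℂ d).lTensor B (H.T₃ (a ⊗ₜ b))
      = (LinearMap.mulRight ℂ b).rTensor B (H.T₁ (a ⊗ₜ d)) := by
  have k : ∀ x : B ⊗[ℂ] B, incl x * tmulOne (incl b) = incl ((LinearMap.mulRight ℂ b).rTensor B x) :=
    fun x => MultiplierHopfAlgebra.incl_mul _ _
  apply H.incl_injective
  rw [← incl_mul_oneTmul, ← k, ← H.T₃_spec, ← H.T₁_spec, mul_assoc, tmulOne_mul_oneTmul, mul_assoc]

/-! ### Counit property of a coaction and bijectivity of the opposite cotwist Tᵒᵖ -/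

section Cotwist

variable {A : Type u} {B : Type v} [NonUnitalRing B] [Module ℂ B] [IsScalarTower ℂ B B]
  [SMulCommClass ℂ B B] [AddCommGroup A] [Module ℂ A]

theorem cotwistOp_mul (Γ : A →ₗ[ℂ] CompletedModule B A) (a : A) (b b' : B) :
    cotwistOp Γ (a ⊗ₜ (b * b')) = (LinearMap.mulLeft ℂ b).rTensor A (cotwistOp Γ (a ⊗ₜ b')) :=
  (Γ a).2.1 b b'

theorem mulLeft_cotwist (Γ : A →ₗ[ℂ] CompletedModule B A) (a : A) (b b' : B) :
    (LinearMap.mulLeft ℂ b).rTensor A (cotwist Γ (a ⊗ₜ b'))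
      = (LinearMap.mulRight ℂ b').rTensor A (cotwistOp Γ (a ⊗ₜ b)) :=
  (Γ a).2.2.2 b b'

namespace LeftCoaction

variable {HB : RegularMHA B} (C : LeftCoaction HB A)

/-- Γ is injective, and the bimodule relation (b ⊗ 1)(y(b' ⊗ 1)) = ((b ⊗ 1)y)(b' ⊗ 1) lets left
multiplications determine right ones. -/
theorem eq_of_cotwistOp {a a' : A}
    (h : ∀ b, cotwistOp C.Γ (a ⊗ₜ b) = cotwistOp C.Γ (a' ⊗ₜ b)) : a = a' := by
  refine C.injective (Subtype.ext (Prod.ext (LinearMap.ext h) (LinearMap.ext fun b' => ?_)))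
  refine HB.rTensor_mulLeft_cancel fun b => ?_
  refine (mulLeft_cotwist C.Γ a b b').trans (Eq.trans ?_ (mulLeft_cotwist C.Γ a' b b').symm)
  rw [h]

/-- ε is multiplicative, so applying it to (b ⊗ 1)Γ(a)(b' ⊗ 1), read in two ways, shows that (ε ⊗
ι)Γ(a) is a well-defined element θ(a) of A. -/
theorem exists_counit : ∃ θ : A →ₗ[ℂ] A, ∀ a b,
    TensorProduct.lid ℂ A (HB.counit.rTensor A (cotwistOp C.Γ (a ⊗ₜ b))) = HB.counit b • θ a ∧
    TensorProduct.lid ℂ A (HB.counit.rTensor A (cotwist C.Γ (a ⊗ₜ b))) = HB.counit b • θ a := by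
  have h1 : ∀ (b : B) (t : B ⊗[ℂ] A), TensorProduct.lid ℂ A (HB.counit.rTensor A
      ((LinearMap.mulLeft ℂ b).rTensor A t))
      = HB.counit b • TensorProduct.lid ℂ A (HB.counit.rTensor A t) := by
    intro b t
    induction t with
    | zero => simp
    | add x y hx hy => simp only [map_add, smul_add, hx, hy]
    | tmul u v => simp [HB.counit_mul, mul_smul]
  have h2 : ∀ (b : B) (t : B ⊗[ℂ] A), TensorProduct.lid ℂ A (HB.counit.rTensor A
      ((LinearMap.mulRight ℂ b).rTensor A t))
      = HB.counit b • TensorProduct.lid ℂ A (HB.counit.rTensor A t) := by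
    intro b t
    induction t with
    | zero => simp
    | add x y hx hy => simp only [map_add, smul_add, hx, hy]
    | tmul u v => simp [HB.counit_mul, mul_comm (HB.counit u), mul_smul]
  have h3 : ∀ a b b', HB.counit b • TensorProduct.lid ℂ A
      (HB.counit.rTensor A (cotwist C.Γ (a ⊗ₜ b')))
      = HB.counit b' • TensorProduct.lid ℂ A
        (HB.counit.rTensor A (cotwistOp C.Γ (a ⊗ₜ b))) := fun a b b' => by
    rw [← h1, mulLeft_cotwist, h2]
  obtain ⟨e, he⟩ | h0 := HB.exists_counit_eq_one
  -- Normalising by e with ε(e) = 1 extracts θ from T.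
  · refine ⟨(TensorProduct.lid ℂ A).toLinearMap ∘ₗ HB.counit.rTensor A ∘ₗ cotwist C.Γ
      ∘ₗ (TensorProduct.mk ℂ A B).flip e, fun a b => ?_⟩
    have h4 : ∀ b, TensorProduct.lid ℂ A (HB.counit.rTensor A (cotwistOp C.Γ (a ⊗ₜ b)))
        = HB.counit b • TensorProduct.lid ℂ A
          (HB.counit.rTensor A (cotwist C.Γ (a ⊗ₜ e))) := fun b => by
      rw [h3, he, one_smul]
    refine ⟨h4 b, ?_⟩
    have h5 := h3 a e b
    rw [he, one_smul] at h5
    rw [h5, h4, he, one_smul]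
    rfl
  · exact ⟨0, fun a b => by rw [h0 b]; simp⟩

/-- Applying ε to the first leg of coassociativity gives Γ(θ(a)) = Γ(a), and Γ is injective. -/
theorem counit_cotwistOp_aux (θ : A →ₗ[ℂ] A) (hθ : ∀ a b,
    TensorProduct.lid ℂ A (HB.counit.rTensor A (cotwistOp C.Γ (a ⊗ₜ b))) = HB.counit b • θ a)
    (a : A) : θ a = a := by
  refine C.eq_of_cotwistOp fun q => ?_
  have h := fun p => congrArg (fun t => TensorProduct.lid ℂ (B ⊗[ℂ] A)
    (HB.counit.rTensor (B ⊗[ℂ] A) t)) (C.coassoc_left a p q)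
  have h1 : ∀ p, TensorProduct.lid ℂ (B ⊗[ℂ] A) (HB.counit.rTensor (B ⊗[ℂ] A)
      (TensorProduct.assoc ℂ B B A
        ((HB.T₂.toLinearMap ∘ₗ TensorProduct.mk ℂ B B p).rTensor A (cotwistOp C.Γ (a ⊗ₜ q)))))
      = HB.counit p • cotwistOp C.Γ (a ⊗ₜ q) := by
    intro p
    generalize cotwistOp C.Γ (a ⊗ₜ q) = t
    induction t with
    | zero => simp
    | add x y hx hy => simp only [map_add, smul_add, hx, hy]
    | tmul u v =>
      have h2 := HB.counit_T₂_left p u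
      simp only [LinearMap.rTensor_tmul, LinearMap.comp_apply, TensorProduct.mk_apply,
        LinearEquiv.coe_coe]
      rw [TensorProduct.smul_tmul', ← h2]
      generalize HB.T₂ (p ⊗ₜ u) = t
      induction t with
      | zero => simp
      | add x y hx hy => simp only [map_add, TensorProduct.add_tmul, hx, hy]
      | tmul r s => simp [TensorProduct.smul_tmul']
  have h2 : ∀ s : B ⊗[ℂ] B, TensorProduct.lid ℂ (B ⊗[ℂ] A) (HB.counit.rTensor (B ⊗[ℂ] A)
      ((cotwistOp C.Γ).lTensor B (TensorProduct.assoc ℂ B A B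
        ((cotwistOp C.Γ ∘ₗ TensorProduct.mk ℂ A B a).rTensor B s))))
      = cotwistOp C.Γ (θ a ⊗ₜ TensorProduct.lid ℂ B (HB.counit.rTensor B s)) := by
    intro s
    induction s with
    | zero => simp
    | add x y hx hy => simp only [map_add, TensorProduct.tmul_add, hx, hy]
    | tmul u v =>
      have h3 := hθ a u
      simp only [LinearMap.rTensor_tmul, LinearMap.comp_apply, TensorProduct.mk_apply,
        TensorProduct.lid_tmul]
      rw [TensorProduct.tmul_smul, TensorProduct.smul_tmul', ← h3]
      generalize cotwistOp C.Γ (a ⊗ₜ u) = t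
      induction t with
      | zero => simp
      | add x y hx hy => simp only [map_add, TensorProduct.add_tmul, hx, hy]
      | tmul r s =>
        rw [TensorProduct.assoc_tmul, LinearMap.lTensor_tmul, LinearMap.rTensor_tmul,
          LinearMap.rTensor_tmul, TensorProduct.lid_tmul, TensorProduct.lid_tmul,
          ← TensorProduct.smul_tmul', map_smul]
  simp only [h1, h2, HB.counit_T₂_left] at h
  obtain ⟨e, he⟩ | h0 := HB.exists_counit_eq_one
  · have h3 := h e
    rwa [he, one_smul, one_smul] at h3
  · rw [h0 q]; simp

theorem counit_cotwistOp (a : A) (b : B) :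
    TensorProduct.lid ℂ A (HB.counit.rTensor A (cotwistOp C.Γ (a ⊗ₜ b))) = HB.counit b • a := by
  obtain ⟨θ, hθ⟩ := C.exists_counit
  rw [(hθ a b).1, C.counit_cotwistOp_aux θ fun a b => (hθ a b).1]

theorem counit_cotwist (a : A) (b : B) :
    TensorProduct.lid ℂ A (HB.counit.rTensor A (cotwist C.Γ (a ⊗ₜ b))) = HB.counit b • a := by
  obtain ⟨θ, hθ⟩ := C.exists_counit
  rw [(hθ a b).2, C.counit_cotwistOp_aux θ fun a b => (hθ a b).1]

/-- `(Tᵒᵖ)₂₃(Tᵒᵖ)₁₂ = (T₂)₁₂(Tᵒᵖ)₁₃(T₂)₂₃⁻¹` on `A ⊗ B ⊗ B`, applied to `a ⊗ T₂(s)`. -/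
theorem coassoc_left' (a : A) (s : B ⊗[ℂ] B) :
    (cotwistOp C.Γ).lTensor B (TensorProduct.assoc ℂ B A B
        ((cotwistOp C.Γ ∘ₗ TensorProduct.mk ℂ A B a).rTensor B (HB.T₂ s)))
      = leg₁₂ A HB.T₂.toLinearMap ((cotwistOp C.Γ ∘ₗ TensorProduct.mk ℂ A B a).lTensor B s) := by
  induction s with
  | zero => simp
  | add x y hx hy => simp only [map_add, hx, hy]
  | tmul p q =>
    rw [C.coassoc_left, LinearMap.lTensor_tmul, LinearMap.comp_apply, TensorProduct.mk_apply]
    generalize cotwistOp C.Γ (a ⊗ₜ q) = t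
    induction t with
    | zero => simp
    | add x y hx hy => simp only [map_add, TensorProduct.tmul_add, hx, hy]
    | tmul u v => simp

/-- Coassociativity determines (Tᵒᵖ)₂₃(Tᵒᵖ)₁₂ on a ⊗ b ⊗ q. Undoing the T₂ of B and applying ε
recovers a ⊗ bS(q) from Tᵒᵖ(a ⊗ b), because T₂⁻¹(b ⊗ q) = ∑ bS(q₍₁₎) ⊗ q₍₂₎. Then S(q) is cancelled
on the right. -/
theorem cotwistOp_injective : Function.Injective (cotwistOp C.Γ) := by
  refine (injective_iff_map_eq_zero _).2 fun t ht => ?_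
  refine sub_eq_zero.1 ?_
  rw [sub_zero]
  refine lTensor_cancel (fun q => HB.mulAntipode ∘ₗ (TensorProduct.mk ℂ B B).flip q)
    (fun b hb => HB.isAntipode.mul_right_cancel b fun q => ?_) _ fun q => ?_
  · rw [← HB.isAntipode.mulAntipode_eq]; exact hb q
  · have h1 : ∀ t : A ⊗[ℂ] B, leg₁₂ B (cotwistOp C.Γ) (TensorProduct.assoc ℂ A B B (t ⊗ₜ q))
        = TensorProduct.assoc ℂ B A B (cotwistOp C.Γ t ⊗ₜ q) := fun t => leg₁₂_assoc _ _ _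
    have h2 : ∀ t : A ⊗[ℂ] B, TensorProduct.comm ℂ B A ((TensorProduct.lid ℂ A ∘ₗ
        HB.counit.rTensor A).lTensor B (leg₁₂ A HB.T₂.symm.toLinearMap
          ((cotwistOp C.Γ).lTensor B (TensorProduct.assoc ℂ B A B (cotwistOp C.Γ t ⊗ₜ q)))))
        = (HB.mulAntipode ∘ₗ (TensorProduct.mk ℂ B B).flip q).lTensor A t := by
      intro t
      induction t with
      | zero => simp
      | add x y hx hy => simp only [map_add, TensorProduct.add_tmul, hx, hy]
      | tmul a b =>
        have h3 := C.coassoc_left' a (HB.T₂.symm (b ⊗ₜ q))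
        rw [LinearEquiv.apply_symm_apply, LinearMap.rTensor_tmul] at h3
        simp only [LinearMap.comp_apply, TensorProduct.mk_apply] at h3
        rw [h3, ← leg₁₂_comp]
        have h4 : HB.T₂.symm.toLinearMap ∘ₗ HB.T₂.toLinearMap = LinearMap.id := by ext; simp
        rw [h4]
        have h5 : ∀ t : B ⊗[ℂ] (B ⊗[ℂ] A), leg₁₂ A (LinearMap.id (R := ℂ) (M := B ⊗[ℂ] B)) t = t := by
          intro t; simp [leg₁₂]
        rw [h5]
        simp only [LinearMap.lTensor_tmul, LinearMap.comp_apply, LinearMap.flip_apply,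
          TensorProduct.mk_apply, MultiplierHopfAlgebra.mulAntipode, LinearEquiv.coe_coe]
        generalize HB.T₂.symm (b ⊗ₜ q) = s
        induction s with
        | zero => simp
        | add x y hx hy => simp only [map_add, TensorProduct.tmul_add, hx, hy]
        | tmul p r => simp [counit_cotwistOp]
    rw [← h2, ht]; simp

/-- The range I is a left B-module. For x = Tᵒᵖ(a ⊗ q), coassociativity puts ∑ x₍₁₎k ⊗ x₍₂₎ (with
the A-leg of x carried along) in B ⊗ I. Multiplying S of the first leg into the second gives
S(k)S(x₍₁₎)x₍₂₎, so ε(q)S(k) ⊗ a lies in I, and S is onto. -/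
theorem cotwistOp_surjective : Function.Surjective (cotwistOp C.Γ) := by
  rw [← LinearMap.range_eq_top]
  set I := LinearMap.range (cotwistOp C.Γ) with hI
  -- `T₃(x ⊗ k)₁₂ ∈ B ⊗ I` for `x = Tᵒᵖ(a ⊗ q)`
  have hex : Function.Exact ((cotwistOp C.Γ).lTensor B) (I.mkQ.lTensor B) :=
    lTensor_exact B (LinearMap.exact_iff.2 (by rw [Submodule.ker_mkQ])) (Submodule.mkQ_surjective I)
  have hmem : ∀ a q k, ∃ s : B ⊗[ℂ] (A ⊗[ℂ] B), (cotwistOp C.Γ).lTensor B s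
      = TensorProduct.assoc ℂ B B A ((HB.T₃.toLinearMap ∘ₗ (TensorProduct.mk ℂ B B).flip k).rTensor A
        (cotwistOp C.Γ (a ⊗ₜ q))) := by
    intro a q k
    -- Membership in the image of B ⊗ A ⊗ B is vanishing modulo I in the last two legs. This can be
    -- tested after left multiplication by p, where left coassociativity applies.
    refine (hex _).1 ?_
    refine HB.rTensor_mulLeft_cancel fun p => ?_
    rw [map_zero, rTensor_lTensor_comm]
    have h1 : ∀ t : B ⊗[ℂ] A, (LinearMap.mulLeft ℂ p).rTensor (B ⊗[ℂ] A) (TensorProduct.assoc ℂ B B A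
        ((HB.T₃.toLinearMap ∘ₗ (TensorProduct.mk ℂ B B).flip k).rTensor A t))
        = (LinearMap.mulRight ℂ k).rTensor (B ⊗[ℂ] A) (TensorProduct.assoc ℂ B B A
        ((HB.T₂.toLinearMap ∘ₗ TensorProduct.mk ℂ B B p).rTensor A t)) := by
      have h0 : ∀ (f : B →ₗ[ℂ] B) (s : B ⊗[ℂ] B) (v : A), f.rTensor (B ⊗[ℂ] A)
          (TensorProduct.assoc ℂ B B A (s ⊗ₜ v))
          = TensorProduct.assoc ℂ B B A (f.rTensor B s ⊗ₜ v) := by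
        intro f s v
        induction s with
        | zero => simp
        | add x y hx hy => simp only [map_add, TensorProduct.add_tmul, hx, hy]
        | tmul u v => simp
      intro t
      induction t with
      | zero => simp
      | add x y hx hy => simp only [map_add, hx, hy]
      | tmul u v =>
        simp only [LinearMap.rTensor_tmul, LinearMap.comp_apply, TensorProduct.mk_apply,
          LinearEquiv.coe_coe, LinearMap.flip_apply, h0, HB.mulLeft_T₃]
    rw [h1, ← rTensor_lTensor_comm, ← C.coassoc_left, ← LinearMap.lTensor_comp_apply,
      LinearMap.range_mkQ_comp]
    simp
  -- apply `u ⊗ y ↦ S(u)y`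
  have hS : ∀ (a : A) (k : B), HB.antipode k ⊗ₜ a ∈ I := by
    intro a k
    obtain ⟨q, hq⟩ | h0 := HB.exists_counit_eq_one
    · obtain ⟨s, hs⟩ := hmem a q k
      let Ψ : B ⊗[ℂ] (B ⊗[ℂ] A) →ₗ[ℂ] B ⊗[ℂ] A :=
        (LinearMap.mul' ℂ B ∘ₗ HB.antipode.rTensor B).rTensor A
          ∘ₗ (TensorProduct.assoc ℂ B B A).symm.toLinearMap
      have h1 : ∀ s : B ⊗[ℂ] (A ⊗[ℂ] B), Ψ ((cotwistOp C.Γ).lTensor B s) ∈ I := by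
        intro s
        induction s with
        | zero => simp
        | add x y hx hy => rw [map_add, map_add]; exact I.add_mem hx hy
        | tmul u t =>
          induction t with
          | zero => simp
          | add x y hx hy => rw [TensorProduct.tmul_add, map_add, map_add]; exact I.add_mem hx hy
          | tmul a b =>
            refine ⟨a ⊗ₜ (HB.antipode u * b), ?_⟩
            rw [cotwistOp_mul, LinearMap.lTensor_tmul]
            generalize cotwistOp C.Γ (a ⊗ₜ b) = t
            induction t with
            | zero => simp
            | add x y hx hy => simp only [map_add, TensorProduct.tmul_add, hx, hy]
            | tmul x y => simp [Ψ]
      have h2 : ∀ t : B ⊗[ℂ] A, Ψ (TensorProduct.assoc ℂ B B A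
          ((HB.T₃.toLinearMap ∘ₗ (TensorProduct.mk ℂ B B).flip k).rTensor A t))
          = HB.antipode k ⊗ₜ TensorProduct.lid ℂ A (HB.counit.rTensor A t) := by
        intro t
        induction t with
        | zero => simp
        | add x y hx hy => simp only [map_add, TensorProduct.tmul_add, hx, hy]
        | tmul x a =>
          simp only [Ψ, LinearMap.rTensor_tmul, LinearMap.comp_apply, LinearMap.flip_apply,
            TensorProduct.mk_apply, LinearEquiv.coe_coe, LinearEquiv.symm_apply_apply,
            TensorProduct.lid_tmul]
          rw [TensorProduct.tmul_smul, TensorProduct.smul_tmul']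
          congr 1
          refine sub_eq_zero.1 (HB.nondeg_right _ fun d => ?_)
          rw [sub_mul, sub_eq_zero, smul_mul_assoc, ← mul_smul_comm, ← HB.antipode_T₁]
          have h3 := congrArg (fun t => LinearMap.mul' ℂ B (HB.antipode.rTensor B t))
            (HB.mulRight_T₃ d x k)
          have h4 : ∀ t : B ⊗[ℂ] B, LinearMap.mul' ℂ B (HB.antipode.rTensor B t) * d
              = LinearMap.mul' ℂ B (HB.antipode.rTensor B ((LinearMap.mulRight ℂ d).lTensor B t)) := by
            intro t
            induction t with
            | zero => simp
            | add x y hx hy => simp only [map_add, add_mul, hx, hy]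
            | tmul u v => simp [mul_assoc]
          have h5 : ∀ t : B ⊗[ℂ] B, LinearMap.mul' ℂ B (HB.antipode.rTensor B
              ((LinearMap.mulRight ℂ k).rTensor B t))
              = HB.antipode k * LinearMap.mul' ℂ B (HB.antipode.rTensor B t) := by
            intro t
            induction t with
            | zero => simp
            | add x y hx hy => simp only [map_add, mul_add, hx, hy]
            | tmul u v => simp [mul_assoc, HB.antipode_mul]
          rw [h4, ← h5]
          exact h3
      have h3 := h1 s
      rwa [hs, h2, counit_cotwistOp, hq, one_smul] at h3
    · rw [h0 (HB.antipode k), TensorProduct.zero_tmul]; exact I.zero_mem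
  rw [eq_top_iff]
  rintro t -
  induction t with
  | zero => exact I.zero_mem
  | add x y hx hy => exact I.add_mem hx hy
  | tmul b a =>
    have := hS a (HB.antipodeEquiv.symm b)
    rwa [RegularMHA.antipode_antipodeEquiv_symm] at this

end LeftCoaction

end Cotwist

end Bicross

namespace Bicross

universe u v w

/-! ### Bijectivity of P and T, and the comultiplied cotwist -/

section Operators

variable {A : Type u} [NonUnitalRing A] [Module ℂ A] [IsScalarTower ℂ A A] [SMulCommClass ℂ A A]
  {B : Type v} [NonUnitalRing B] [Module ℂ B] [IsScalarTower ℂ B B] [SMulCommClass ℂ B B]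
  {HA : RegularMHA A} {HB : RegularMHA B} {M : RightModuleAlgebra HA B}
  {C : LeftComoduleCoalgebra HA HB}

theorem mapP_bijective (M : RightModuleAlgebra HA B) (C : LeftComoduleCoalgebra HA HB) :
    Function.Bijective (mapP M C) :=
  (show Function.Bijective (cotwistOp C.Γ) from
    ⟨C.cotwistOp_injective, C.cotwistOp_surjective⟩).comp
    ⟨twist_injective HA.op M.toRightAction, twist_surjective HA.op M.toRightAction⟩

/-- The map `P` as a linear equivalence. -/
noncomputable def mapPEquiv (M : RightModuleAlgebra HA B) (C : LeftComoduleCoalgebra HA HB) :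
    B ⊗[ℂ] A ≃ₗ[ℂ] B ⊗[ℂ] A :=
  LinearEquiv.ofBijective (mapP M C) (mapP_bijective M C)

@[simp] theorem mapPEquiv_apply (t : B ⊗[ℂ] A) : mapPEquiv M C t = mapP M C t := rfl

namespace Compatible

variable (hMC : Compatible M C)
include hMC

theorem cotwist_twist (t : B ⊗[ℂ] A) :
    cotwist C.Γ (twist HA M.toRightAction t) = mapP M C t :=
  LinearMap.congr_fun hMC.twist_cotwist t

/-- T = P∘R⁻¹ by the third compatibility relation. This is the only source of bijectivity for T
itself. -/
theorem cotwist_bijective : Function.Bijective (cotwist C.Γ) := by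
  have h : cotwist C.Γ = mapP M C ∘ₗ (twistEquiv HA M.toRightAction).symm.toLinearMap := by
    refine LinearMap.ext fun t => ?_
    obtain ⟨s, rfl⟩ := (twistEquiv HA M.toRightAction).surjective t
    rw [LinearMap.comp_apply, LinearEquiv.coe_coe, LinearEquiv.symm_apply_apply,
      twistEquiv_apply, hMC.cotwist_twist]
  rw [h]
  exact (mapP_bijective M C).comp (twistEquiv HA M.toRightAction).symm.bijective

end Compatible

/-- The cotwist map as a linear equivalence. -/
noncomputable def cotwistEquiv (hMC : Compatible M C) : A ⊗[ℂ] B ≃ₗ[ℂ] B ⊗[ℂ] A :=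
  LinearEquiv.ofBijective (cotwist C.Γ) hMC.cotwist_bijective

@[simp] theorem cotwistEquiv_apply (hMC : Compatible M C) (t : A ⊗[ℂ] B) :
    cotwistEquiv hMC t = cotwist C.Γ t := rfl

/-- `a ↦ aw`, for `w ∈ A ⊗ Y`. -/
noncomputable def mulTensor {Y : Type*} [AddCommGroup Y] [Module ℂ Y] (w : A ⊗[ℂ] Y) :
    A →ₗ[ℂ] A ⊗[ℂ] Y :=
  (LinearMap.mul' ℂ A).rTensor Y ∘ₗ (TensorProduct.assoc ℂ A A Y).symm.toLinearMap
    ∘ₗ (TensorProduct.mk ℂ A (A ⊗[ℂ] Y)).flip w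

section

variable {Y : Type*} [AddCommGroup Y] [Module ℂ Y]

theorem mulTensor_apply (w : A ⊗[ℂ] Y) (v : A) :
    mulTensor w v = (LinearMap.mulLeft ℂ v).rTensor Y w := by
  simp only [mulTensor, LinearMap.comp_apply, LinearMap.flip_apply, TensorProduct.mk_apply,
    LinearEquiv.coe_coe]
  induction w with
  | zero => simp
  | add x y hx hy => simp only [map_add, TensorProduct.tmul_add, hx, hy]
  | tmul x y => simp

theorem mulTensor_zero : mulTensor (0 : A ⊗[ℂ] Y) = 0 := by
  ext v; simp [mulTensor_apply]

theorem mulTensor_add (w w' : A ⊗[ℂ] Y) : mulTensor (w + w') = mulTensor w + mulTensor w' := by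
  ext v; simp [mulTensor_apply]

theorem mulTensor_tmul (e : A) (y : Y) :
    mulTensor (e ⊗ₜ[ℂ] y) = (TensorProduct.mk ℂ A Y).flip y ∘ₗ LinearMap.mulRight ℂ e := by
  ext v; simp [mulTensor_apply]

/-- `a ⊗ b ⊗ w ↦ ∑ a₍₁₎ ⊗ T(a₍₂₎ ⊗ b)(1 ⊗ w)`. -/
noncomputable def cotwistComul (hMC : Compatible M C) (Y : Type*) [AddCommGroup Y] [Module ℂ Y] :
    A ⊗[ℂ] (B ⊗[ℂ] (A ⊗[ℂ] Y)) ≃ₗ[ℂ] A ⊗[ℂ] (B ⊗[ℂ] (A ⊗[ℂ] Y)) :=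
  legEquiv (A ⊗[ℂ] Y) (cotwistEquiv hMC)
    ≪≫ₗ TensorProduct.congr (LinearEquiv.refl ℂ B) (legEquiv Y HA.T₁)
    ≪≫ₗ (legEquiv (A ⊗[ℂ] Y) (cotwistEquiv hMC)).symm

theorem leg₁₂_cotwistComul (hMC : Compatible M C) (t : A ⊗[ℂ] (B ⊗[ℂ] (A ⊗[ℂ] Y))) :
    leg₁₂ (A ⊗[ℂ] Y) (cotwist C.Γ) (cotwistComul hMC Y t)
      = (leg₁₂ Y HA.T₁.toLinearMap).lTensor B (leg₁₂ (A ⊗[ℂ] Y) (cotwist C.Γ) t) :=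
  (legEquiv (A ⊗[ℂ] Y) (cotwistEquiv hMC)).apply_symm_apply _

theorem leg₁₂_cotwist_injective (hMC : Compatible M C) {Z : Type*} [AddCommGroup Z] [Module ℂ Z] :
    Function.Injective (leg₁₂ Z (cotwist C.Γ)) := (legEquiv Z (cotwistEquiv hMC)).injective

/-- This is the comodule coalgebra condition. The element of A ⊗ B ⊗ A supplied by `covered_right`
and the conjugate of T₁ by T have the same image under T on the first two legs, which is injective.
-/
theorem cotwistComul_covers_tmul (hMC : Compatible M C) (b : B) (w : A ⊗[ℂ] Y) :
    HA.Covers ((cotwistComul hMC Y).toLinearMap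
        ∘ₗ (TensorProduct.mk ℂ A (B ⊗[ℂ] (A ⊗[ℂ] Y))).flip (b ⊗ₜ w))
      ((mulTensor w).lTensor B ∘ₗ cotwist C.Γ ∘ₗ (TensorProduct.mk ℂ A B).flip b) := by
  intro c a
  induction w with
  | zero => simp [mulTensor_zero]
  | add x y hx hy =>
    simp only [LinearMap.comp_apply, LinearMap.flip_apply, TensorProduct.mk_apply] at hx hy ⊢
    simp only [TensorProduct.tmul_add, map_add, hx, hy, mulTensor_add, LinearMap.lTensor_add,
      LinearMap.add_comp, LinearMap.add_apply]
  | tmul e y =>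
    obtain ⟨z, hz⟩ := C.covered_right a e b
    have h1 := C.comul_right a e b z hz
    have h2 : cotwistComul hMC Y (a ⊗ₜ (b ⊗ₜ (e ⊗ₜ y)))
        = (((TensorProduct.mk ℂ A Y).flip y).lTensor B).lTensor A z := by
      refine leg₁₂_cotwist_injective hMC ?_
      rw [leg₁₂_cotwistComul, leg₁₂_lTensor, h1, leg₁₂_tmul]
      generalize cotwist C.Γ (a ⊗ₜ b) = t
      induction t with
      | zero => simp
      | add x y hx hy => simp only [map_add, TensorProduct.add_tmul, hx, hy]
      | tmul u v =>
        simp only [TensorProduct.assoc_tmul, LinearMap.lTensor_tmul, leg₁₂_tmul,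
          LinearMap.comp_apply, LinearMap.flip_apply, TensorProduct.mk_apply, LinearEquiv.coe_coe]
        generalize HA.T₁ (v ⊗ₜ e) = t
        induction t with
        | zero => simp
        | add x y hx hy => simp only [map_add, TensorProduct.tmul_add, TensorProduct.add_tmul, hx, hy]
        | tmul u v => simp
    simp only [LinearMap.comp_apply, LinearMap.flip_apply, TensorProduct.mk_apply,
      LinearEquiv.coe_coe]
    rw [h2, rTensor_lTensor_comm, hz.1 c, mulTensor_tmul]
    simp only [LinearMap.lTensor_comp, LinearMap.comp_apply]

/-- For coassociativity arguments it matters only that some covered map θ exists. -/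
theorem cotwistComul_covers (hMC : Compatible M C) (y : B ⊗[ℂ] (A ⊗[ℂ] Y)) :
    ∃ θ, HA.Covers ((cotwistComul hMC Y).toLinearMap
        ∘ₗ (TensorProduct.mk ℂ A (B ⊗[ℂ] (A ⊗[ℂ] Y))).flip y) θ := by
  induction y with
  | zero => exact ⟨0, fun c a => by simp⟩
  | add x y hx hy =>
    obtain ⟨θ, hθ⟩ := hx
    obtain ⟨θ', hθ'⟩ := hy
    refine ⟨θ + θ', fun c a => ?_⟩
    rw [LinearMap.lTensor_add, LinearMap.add_apply, ← hθ, ← hθ', ← map_add]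
    simp
  | tmul b w => exact ⟨_, cotwistComul_covers_tmul hMC b w⟩

theorem counit_cotwistComul (hMC : Compatible M C) (a : A) (b : B) (w : A ⊗[ℂ] Y) :
    TensorProduct.lid ℂ _ (HA.counit.rTensor _ (cotwistComul hMC Y (a ⊗ₜ (b ⊗ₜ w))))
      = (mulTensor w).lTensor B (cotwist C.Γ (a ⊗ₜ b)) :=
  (cotwistComul_covers_tmul hMC b w).counit a

end

/-- `Tᵒᵖ` and `T₂` of `B` give the same element as `T` and `Δ_B`:
`T₂₃(T₂)₁₃(Tᵒᵖ)₁₂ = (T₂)₁₂T₂₃`. -/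
theorem LeftCoaction.coassoc_mixed {A : Type u} [AddCommGroup A] [Module ℂ A]
    (C : LeftCoaction HB A) (c b : B) (a : A) :
    ((cotwist C.Γ).lTensor B) ((TensorProduct.leftComm ℂ A B B)
      ((HB.T₂.toLinearMap.lTensor A) (TensorProduct.leftComm ℂ B A B
        (TensorProduct.assoc ℂ B A B (cotwistOp C.Γ (a ⊗ₜ c) ⊗ₜ b)))))
      = leg₁₂ A HB.T₂.toLinearMap (c ⊗ₜ cotwist C.Γ (a ⊗ₜ b)) := by
  have hl : ∀ t : B ⊗[ℂ] A, (∀ d : B, (LinearMap.mulLeft ℂ d).rTensor A t = 0) → t = 0 :=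
    fun t ht => HB.rTensor_mulLeft_cancel (z' := 0) fun d => by rw [ht, map_zero]
  rw [← sub_eq_zero]
  refine lTensor_cancel (fun d : B => (LinearMap.mulLeft ℂ d).rTensor A) hl _ fun d => ?_
  rw [map_sub, sub_eq_zero]
  -- the operator `x ↦ xΔ(b)` on the first two legs
  let D : B ⊗[ℂ] (B ⊗[ℂ] A) →ₗ[ℂ] B ⊗[ℂ] (B ⊗[ℂ] A) := leg₁₂ A (HB.Δ b).R
  -- Left multiplication by d in the second leg replaces T by Tᵒᵖ and lets the multiplication by
  -- Δ_B(b) move to the outside.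
  have h1 : ∀ s : B ⊗[ℂ] A, ((LinearMap.mulLeft ℂ d).rTensor A).lTensor B ((cotwist C.Γ).lTensor B
      ((TensorProduct.leftComm ℂ A B B) ((HB.T₂.toLinearMap.lTensor A)
        (TensorProduct.leftComm ℂ B A B (TensorProduct.assoc ℂ B A B (s ⊗ₜ b))))))
      = D ((cotwistOp C.Γ).lTensor B (TensorProduct.assoc ℂ B A B (s ⊗ₜ d))) := by
    intro s
    induction s with
    | zero => simp
    | add x y hx hy => simp only [map_add, TensorProduct.add_tmul, hx, hy]
    | tmul x y =>
      simp only [TensorProduct.assoc_tmul, TensorProduct.leftComm_tmul, LinearMap.lTensor_tmul,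
        LinearEquiv.coe_coe]
      let G : B ⊗[ℂ] A →ₗ[ℂ] B →ₗ[ℂ] B ⊗[ℂ] A :=
        (LinearMap.rTensorHom A ∘ₗ (LinearMap.mul ℂ B).flip).flip
      have hG : ∀ t v, G t v = (LinearMap.mulRight ℂ v).rTensor A t := fun t v => rfl
      have h2 : ∀ t : B ⊗[ℂ] A, D (x ⊗ₜ t) = (G t).lTensor B (HB.T₂ (x ⊗ₜ b)) := by
        intro t
        induction t with
        | zero => simp
        | add s t hs ht =>
          simp only [map_add, TensorProduct.tmul_add, hs, ht, LinearMap.lTensor_add,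
            LinearMap.add_apply]
        | tmul r z =>
          simp only [D, leg₁₂_tmul, HB.Δ_R_tmul]
          generalize HB.T₂ (x ⊗ₜ b) = t
          induction t with
          | zero => simp
          | add x y hx hy => simp only [map_add, TensorProduct.add_tmul, hx, hy]
          | tmul u v => simp [hG]
      rw [h2]
      generalize HB.T₂ (x ⊗ₜ b) = t
      induction t with
      | zero => simp
      | add x y hx hy => simp only [map_add, TensorProduct.tmul_add, hx, hy]
      | tmul u v => simp [hG, mulLeft_cotwist]
  -- By linearity w may be taken of the form (p ⊗ 1)Δ_B(q), where left coassociativity of Γ applies;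
  -- the case needed is w = c ⊗ d.
  have h2 : ∀ w : B ⊗[ℂ] B, D ((cotwistOp C.Γ).lTensor B (TensorProduct.assoc ℂ B A B
        ((cotwistOp C.Γ ∘ₗ TensorProduct.mk ℂ A B a).rTensor B w)))
      = TensorProduct.assoc ℂ B B A ((mulΔ HB w).rTensor A (cotwist C.Γ (a ⊗ₜ b))) := by
    intro w
    obtain ⟨s, rfl⟩ := HB.T₂.surjective w
    induction s with
    | zero => simp [mulΔ_zero]
    | add x y hx hy =>
      simp only [map_add, hx, hy, mulΔ_add, LinearMap.rTensor_add, LinearMap.add_apply]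
    | tmul p q =>
      rw [C.coassoc_left', mulΔ_T₂, LinearMap.rTensor_comp_apply, mulLeft_cotwist,
        LinearMap.lTensor_tmul, LinearMap.comp_apply, TensorProduct.mk_apply]
      generalize cotwistOp C.Γ (a ⊗ₜ q) = t
      induction t with
      | zero => simp
      | add x y hx hy => simp only [map_add, TensorProduct.tmul_add, hx, hy]
      | tmul u v =>
        rw [leg₁₂_tmul, leg₁₂_assoc, LinearMap.rTensor_tmul, LinearMap.rTensor_tmul]
        simp [HB.T₂_mul]
  have h3 : ∀ t : B ⊗[ℂ] A, ((LinearMap.mulLeft ℂ d).rTensor A).lTensor B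
      (leg₁₂ A HB.T₂.toLinearMap (c ⊗ₜ t))
      = TensorProduct.assoc ℂ B B A ((mulΔ HB (c ⊗ₜ d)).rTensor A t) := by
    intro t
    induction t with
    | zero => simp
    | add x y hx hy => simp only [map_add, TensorProduct.tmul_add, hx, hy]
    | tmul u v =>
      rw [leg₁₂_tmul, LinearMap.rTensor_tmul, mulΔ_tmul, LinearEquiv.coe_coe]
      generalize HB.T₂ (c ⊗ₜ u) = t
      induction t with
      | zero => simp
      | add x y hx hy => simp only [map_add, TensorProduct.add_tmul, hx, hy]
      | tmul u v => simp
  rw [h1, h3, ← h2]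
  simp

end Operators

end Bicross

namespace Bicross

universe u v w

/-! ### The canonical maps T₁ and T₂ of the smash product -/

section Canonical

variable {A : Type u} [NonUnitalRing A] [Module ℂ A] [IsScalarTower ℂ A A] [SMulCommClass ℂ A A]
  {B : Type v} [NonUnitalRing B] [Module ℂ B] [IsScalarTower ℂ B B] [SMulCommClass ℂ B B]
  {HA : RegularMHA A} {HB : RegularMHA B} {M : RightModuleAlgebra HA B}
  {C : LeftComoduleCoalgebra HA HB}

/-- `b ⊗ b'a' ↦ Δ_B(b)(1 ⊗ b'a')`, with `b'a' = R(b' ⊗ a')`. -/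
noncomputable def twistComul (HB : RegularMHA B) (M : RightModuleAlgebra HA B) :
    B ⊗[ℂ] (A ⊗[ℂ] B) ≃ₗ[ℂ] B ⊗[ℂ] (A ⊗[ℂ] B) :=
  TensorProduct.congr (LinearEquiv.refl ℂ B) (twistEquiv HA M.toRightAction).symm
    ≪≫ₗ legEquiv A HB.T₁
    ≪≫ₗ TensorProduct.congr (LinearEquiv.refl ℂ B) (twistEquiv HA M.toRightAction)

theorem twistComul_twist (b b' : B) (a' : A) :
    twistComul HB M (b ⊗ₜ twist HA M.toRightAction (b' ⊗ₜ a'))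
      = (twist HA M.toRightAction ∘ₗ (TensorProduct.mk ℂ B A).flip a').lTensor B
        (HB.T₁ (b ⊗ₜ b')) := by
  simp only [twistComul, LinearEquiv.trans_apply, TensorProduct.congr_tmul,
    LinearEquiv.refl_apply, legEquiv_apply]
  rw [← twistEquiv_apply, LinearEquiv.symm_apply_apply, leg₁₂_tmul, LinearEquiv.coe_coe]
  generalize HB.T₁ (b ⊗ₜ b') = t
  induction t with
  | zero => simp
  | add x y hx hy => simp only [map_add, TensorProduct.add_tmul, hx, hy]
  | tmul u v => simp

/-- The canonical map `T₁` of the smash product: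
`ab ⊗ w ↦ Δ_#(ab)(1 ⊗ w) = ∑ a₍₁₎ ⊗ T(a₍₂₎ ⊗ b₍₁₎)(1 ⊗ b₍₂₎w)`. -/
noncomputable def smashT₁ (hMC : Compatible M C) :
    A ⊗[ℂ] (B ⊗[ℂ] (A ⊗[ℂ] B)) ≃ₗ[ℂ] A ⊗[ℂ] (B ⊗[ℂ] (A ⊗[ℂ] B)) :=
  TensorProduct.congr (LinearEquiv.refl ℂ A) (twistComul HB M) ≪≫ₗ cotwistComul hMC B

theorem smashT₁_tmul (hMC : Compatible M C) (a : A) (y : B ⊗[ℂ] (A ⊗[ℂ] B)) :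
    smashT₁ hMC (a ⊗ₜ y) = cotwistComul hMC B (a ⊗ₜ twistComul HB M y) := by
  simp [smashT₁]

/-- `c ⊗ ab ↦ c''⊗ a'b'`, where `P(c ⊗ a) = c' ⊗ a'` and `(c' ⊗ 1)Δ_B(b) = c'' ⊗ b'`. -/
noncomputable def smashSigma (M : RightModuleAlgebra HA B) (C : LeftComoduleCoalgebra HA HB) :
    B ⊗[ℂ] (A ⊗[ℂ] B) ≃ₗ[ℂ] B ⊗[ℂ] (A ⊗[ℂ] B) :=
  legEquiv B (mapPEquiv M C) ≪≫ₗ TensorProduct.leftComm ℂ B A B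
    ≪≫ₗ TensorProduct.congr (LinearEquiv.refl ℂ A) HB.T₂ ≪≫ₗ TensorProduct.leftComm ℂ A B B

/-- `c' ⊗ a' ⊗ b ↦ c'' ⊗ a' ⊗ b'`, where `(c' ⊗ 1)Δ_B(b) = c'' ⊗ b'`. -/
noncomputable def outerT₂ (HB : RegularMHA B) (A : Type u) [AddCommGroup A] [Module ℂ A] :
    B ⊗[ℂ] (A ⊗[ℂ] B) →ₗ[ℂ] B ⊗[ℂ] (A ⊗[ℂ] B) :=
  (TensorProduct.leftComm ℂ A B B).toLinearMap ∘ₗ HB.T₂.toLinearMap.lTensor A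
    ∘ₗ (TensorProduct.leftComm ℂ B A B).toLinearMap

theorem outerT₂_tmul (c b : B) (a : A) : outerT₂ HB A (c ⊗ₜ (a ⊗ₜ b))
    = (TensorProduct.mk ℂ A B a).lTensor B (HB.T₂ (c ⊗ₜ b)) := by
  simp only [outerT₂, LinearMap.comp_apply, LinearEquiv.coe_coe, TensorProduct.leftComm_tmul,
    LinearMap.lTensor_tmul]
  generalize HB.T₂ (c ⊗ₜ b) = t
  induction t with
  | zero => simp
  | add x y hx hy => simp only [map_add, TensorProduct.tmul_add, hx, hy]
  | tmul u v => simp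

theorem smashSigma_apply (t : B ⊗[ℂ] (A ⊗[ℂ] B)) :
    smashSigma M C t = outerT₂ HB A (leg₁₂ B (mapP M C) t) := rfl

theorem smashSigma_tmul (c b : B) (a : A) : smashSigma M C (c ⊗ₜ (a ⊗ₜ b))
    = outerT₂ HB A (TensorProduct.assoc ℂ B A B (mapP M C (c ⊗ₜ a) ⊗ₜ b)) := by
  rw [smashSigma_apply, leg₁₂_tmul]

/-- `coassoc_mixed`, made linear in a ⊗ c so that it can be applied to values of Rᵒᵖ. -/
theorem cotwist_outerT₂ (b : B) (t : A ⊗[ℂ] B) :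
    (cotwist C.Γ).lTensor B (outerT₂ HB A
        (TensorProduct.assoc ℂ B A B (cotwistOp C.Γ t ⊗ₜ b)))
      = leg₁₂ A HB.T₂.toLinearMap ((cotwist C.Γ ∘ₗ (TensorProduct.mk ℂ A B).flip b).lTensor B
        (TensorProduct.comm ℂ A B t)) := by
  induction t with
  | zero => simp
  | add x y hx hy => simp only [map_add, TensorProduct.add_tmul, hx, hy]
  | tmul a c =>
    refine (C.coassoc_mixed c b a).trans ?_
    simp

/-- The canonical map `T₂` of the smash product, `pc ⊗ ab ↦ (pc ⊗ 1)Δ_#(ab)`. -/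
noncomputable def smashT₂ (M : RightModuleAlgebra HA B) (C : LeftComoduleCoalgebra HA HB) :
    A ⊗[ℂ] (B ⊗[ℂ] (A ⊗[ℂ] B)) ≃ₗ[ℂ] A ⊗[ℂ] (B ⊗[ℂ] (A ⊗[ℂ] B)) :=
  TensorProduct.congr (LinearEquiv.refl ℂ A) (TensorProduct.leftComm ℂ B A B)
    ≪≫ₗ legEquiv (B ⊗[ℂ] B) HA.T₂
    ≪≫ₗ TensorProduct.congr (LinearEquiv.refl ℂ A) (TensorProduct.leftComm ℂ A B B)
    ≪≫ₗ TensorProduct.congr (LinearEquiv.refl ℂ A) (smashSigma M C)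

theorem smashT₂_tmul (p a : A) (c b : B) :
    smashT₂ M C (p ⊗ₜ (c ⊗ₜ (a ⊗ₜ b)))
      = ((smashSigma M C).toLinearMap ∘ₗ TensorProduct.mk ℂ B (A ⊗[ℂ] B) c
        ∘ₗ (TensorProduct.mk ℂ A B).flip b).lTensor A (HA.T₂ (p ⊗ₜ a)) := by
  simp only [smashT₂, LinearEquiv.trans_apply, TensorProduct.congr_tmul,
    LinearEquiv.refl_apply, legEquiv_apply, TensorProduct.leftComm_tmul, leg₁₂_tmul,
    LinearEquiv.coe_coe]
  generalize HA.T₂ (p ⊗ₜ a) = t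
  induction t with
  | zero => simp
  | add x y hx hy => simp only [map_add, TensorProduct.add_tmul, hx, hy]
  | tmul u v => simp

/-! ### Coassociativity of the smash coproduct -/

section Coassoc

variable {W : Type*} [AddCommGroup W] [Module ℂ W]

/-- `a ⊗ b ⊗ w ↦ smashSigma (c ⊗ a ⊗ b) ⊗ w`. -/
noncomputable def sigmaLeft (M : RightModuleAlgebra HA B) (C : LeftComoduleCoalgebra HA HB)
    (W : Type*) [AddCommGroup W] [Module ℂ W] (c : B) :
    A ⊗[ℂ] (B ⊗[ℂ] W) →ₗ[ℂ] B ⊗[ℂ] (A ⊗[ℂ] (B ⊗[ℂ] W)) :=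
  (TensorProduct.assoc ℂ A B W).toLinearMap.lTensor B
    ∘ₗ (TensorProduct.assoc ℂ B (A ⊗[ℂ] B) W).toLinearMap
    ∘ₗ ((smashSigma M C).toLinearMap ∘ₗ TensorProduct.mk ℂ B (A ⊗[ℂ] B) c).rTensor W
    ∘ₗ (TensorProduct.assoc ℂ A B W).symm.toLinearMap

theorem sigmaLeft_tmul (c : B) (a : A) (b : B) (w : W) :
    sigmaLeft M C W c (a ⊗ₜ (b ⊗ₜ w))
      = (((TensorProduct.mk ℂ B W).flip w).lTensor A).lTensor B
        (smashSigma M C (c ⊗ₜ (a ⊗ₜ b))) := by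
  simp only [sigmaLeft, LinearMap.comp_apply, LinearEquiv.coe_coe, TensorProduct.assoc_symm_tmul,
    LinearMap.rTensor_tmul, TensorProduct.mk_apply]
  generalize smashSigma M C (c ⊗ₜ (a ⊗ₜ b)) = t
  induction t with
  | zero => simp
  | add x y hx hy => simp only [map_add, TensorProduct.add_tmul, hx, hy]
  | tmul u t =>
    induction t with
    | zero => simp
    | add x y hx hy => simp only [map_add, TensorProduct.add_tmul, TensorProduct.tmul_add, hx, hy]
    | tmul v w => simp

/-- `a ⊗ x ↦ ∑ (c ◁ a₍₁₎) ⊗ a₍₂₎ ⊗ x`. -/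
noncomputable def actComul (M : RightModuleAlgebra HA B) (X : Type*) [AddCommGroup X] [Module ℂ X]
    (c : B) : A ⊗[ℂ] X →ₗ[ℂ] B ⊗[ℂ] (A ⊗[ℂ] X) :=
  (TensorProduct.assoc ℂ B A X).toLinearMap ∘ₗ ((TensorProduct.comm ℂ A B).toLinearMap
    ∘ₗ twistOp HA M.toRightAction ∘ₗ TensorProduct.mk ℂ B A c).rTensor X

theorem actComul_tmul {X : Type*} [AddCommGroup X] [Module ℂ X] (c : B) (a : A) (x : X) :
    actComul M X c (a ⊗ₜ x) = ((TensorProduct.mk ℂ A X).flip x).lTensor B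
      (TensorProduct.comm ℂ A B (twistOp HA M.toRightAction (c ⊗ₜ a))) := by
  simp only [actComul, LinearMap.comp_apply, LinearEquiv.coe_coe,
    LinearMap.rTensor_tmul, TensorProduct.mk_apply]
  generalize twistOp HA M.toRightAction (c ⊗ₜ a) = t
  induction t with
  | zero => simp
  | add x y hx hy => simp only [map_add, TensorProduct.add_tmul, hx, hy]
  | tmul u v => simp

/-- P is TᵒᵖRᵒᵖ, and `cotwist_outerT₂` trades Tᵒᵖ for the T₂ of B once T is applied. What remains is
the action comultiplication, T and then T₂ of B, each of which visibly passes the canonical map T₁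
of A. -/
theorem cotwist_sigmaLeft (c : B) (x : A ⊗[ℂ] (B ⊗[ℂ] W)) :
    (leg₁₂ W (cotwist C.Γ)).lTensor B (sigmaLeft M C W c x)
      = leg₁₂ (A ⊗[ℂ] W) HB.T₂.toLinearMap ((leg₁₂ W (cotwist C.Γ)).lTensor B
        (actComul M (B ⊗[ℂ] W) c x)) := by
  induction x with
  | zero => simp
  | add x y hx hy => simp only [map_add, hx, hy]
  | tmul a y =>
    induction y with
    | zero => simp
    | add x y hx hy => simp only [map_add, TensorProduct.tmul_add, hx, hy]
    | tmul b w =>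
      have h1 : leg₁₂ W (cotwist C.Γ) ∘ₗ ((TensorProduct.mk ℂ B W).flip w).lTensor A
          = ((TensorProduct.mk ℂ A W).flip w).lTensor B ∘ₗ cotwist C.Γ := by
        refine TensorProduct.ext' fun u v => ?_
        simp only [LinearMap.comp_apply, LinearMap.lTensor_tmul, LinearMap.flip_apply,
          TensorProduct.mk_apply, leg₁₂_tmul]
        generalize cotwist C.Γ (u ⊗ₜ v) = t
        induction t with
        | zero => simp
        | add x y hx hy => simp only [map_add, TensorProduct.add_tmul, hx, hy]
        | tmul u v => simp
      rw [sigmaLeft_tmul, ← LinearMap.lTensor_comp_apply, h1, LinearMap.lTensor_comp_apply,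
        smashSigma_tmul]
      change (((TensorProduct.mk ℂ A W).flip w).lTensor B).lTensor B
        ((cotwist C.Γ).lTensor B (outerT₂ HB A (TensorProduct.assoc ℂ B A B
        (cotwistOp C.Γ (twistOp HA M.toRightAction (c ⊗ₜ a)) ⊗ₜ b)))) = _
      rw [cotwist_outerT₂, ← leg₁₂_lTensor, actComul_tmul]
      congr 1
      rw [← LinearMap.lTensor_comp_apply, ← LinearMap.lTensor_comp_apply]
      congr 2
      refine LinearMap.ext fun u => ?_
      exact (LinearMap.congr_fun h1 (u ⊗ₜ b)).symm

/-- Tested after T, which is injective and conjugates `cotwistComul` into the T₁ of A. That map does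
not touch the legs of T₂, while Rᵒᵖ commutes with anything of the form ∑ a₍₁₎ ⊗ θ(a₍₂₎). -/
theorem sigmaLeft_cotwistComul (hMC : Compatible M C) {Y : Type*} [AddCommGroup Y] [Module ℂ Y]
    (c : B) (x : A ⊗[ℂ] (B ⊗[ℂ] (A ⊗[ℂ] Y))) :
    sigmaLeft M C (A ⊗[ℂ] Y) c (cotwistComul hMC Y x)
      = (cotwistComul hMC Y).toLinearMap.lTensor B (sigmaLeft M C (A ⊗[ℂ] Y) c x) := by
  have h1 : actComul M (B ⊗[ℂ] (A ⊗[ℂ] Y)) c (cotwistComul hMC Y x)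
      = (cotwistComul hMC Y).toLinearMap.lTensor B (actComul M (B ⊗[ℂ] (A ⊗[ℂ] Y)) c x) := by
    induction x with
    | zero => simp
    | add x y hx hy => simp only [map_add, hx, hy]
    | tmul a y =>
      obtain ⟨θ, hθ⟩ := cotwistComul_covers hMC y
      refine (twistOp_covers M.toRightAction hθ c a).trans ?_
      rw [actComul_tmul, LinearMap.lTensor_comp_apply]
  have h2 : leg₁₂ (A ⊗[ℂ] Y) (cotwist C.Γ) ∘ₗ (cotwistComul hMC Y).toLinearMap
      = (leg₁₂ Y HA.T₁.toLinearMap).lTensor B ∘ₗ leg₁₂ (A ⊗[ℂ] Y) (cotwist C.Γ) :=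
    LinearMap.ext fun t => leg₁₂_cotwistComul hMC t
  have hinj : Function.Injective ((leg₁₂ (A ⊗[ℂ] Y) (cotwist C.Γ)).lTensor B) :=
    (TensorProduct.congr (LinearEquiv.refl ℂ B) (legEquiv (A ⊗[ℂ] Y) (cotwistEquiv hMC))).injective
  apply hinj
  rw [cotwist_sigmaLeft, h1, ← LinearMap.lTensor_comp_apply, h2, LinearMap.lTensor_comp_apply,
    leg₁₂_lTensor, ← cotwist_sigmaLeft, ← LinearMap.lTensor_comp_apply,
    ← LinearMap.lTensor_comp_apply, h2]

theorem sigmaLeft_tmul' (c : B) (a : A) (y : B ⊗[ℂ] W) :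
    sigmaLeft M C W c (a ⊗ₜ y)
      = ((TensorProduct.leftComm ℂ A B (B ⊗[ℂ] W)).toLinearMap
          ∘ₗ (leg₁₂ W HB.T₂.toLinearMap).lTensor A
          ∘ₗ (TensorProduct.leftComm ℂ B A (B ⊗[ℂ] W)).toLinearMap)
        (TensorProduct.assoc ℂ B A (B ⊗[ℂ] W) (mapP M C (c ⊗ₜ a) ⊗ₜ y)) := by
  induction y with
  | zero => simp
  | add x y hx hy => simp only [map_add, TensorProduct.tmul_add, hx, hy]
  | tmul b w =>
    rw [sigmaLeft_tmul, smashSigma_tmul]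
    generalize mapP M C (c ⊗ₜ a) = t
    induction t with
    | zero => simp
    | add x y hx hy => simp only [map_add, TensorProduct.add_tmul, hx, hy]
    | tmul c a =>
      simp only [TensorProduct.assoc_tmul, outerT₂_tmul, LinearMap.comp_apply, LinearEquiv.coe_coe,
        TensorProduct.leftComm_tmul, LinearMap.lTensor_tmul, leg₁₂_tmul]
      generalize HB.T₂ (c ⊗ₜ b) = t
      induction t with
      | zero => simp
      | add x y hx hy => simp only [map_add, TensorProduct.add_tmul, TensorProduct.tmul_add, hx, hy]
      | tmul u v => simp

/-- Coassociativity of Δ_B, transported by R in the last two legs. -/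
theorem twistComul_T₂ (c : B) (y : B ⊗[ℂ] (A ⊗[ℂ] B)) :
    leg₁₂ (A ⊗[ℂ] B) HB.T₂.toLinearMap (c ⊗ₜ twistComul HB M y)
      = (twistComul HB M).toLinearMap.lTensor B
        (leg₁₂ (A ⊗[ℂ] B) HB.T₂.toLinearMap (c ⊗ₜ y)) := by
  induction y with
  | zero => simp
  | add x y hx hy => simp only [map_add, TensorProduct.tmul_add, hx, hy]
  | tmul b w =>
    obtain ⟨w, rfl⟩ := twist_surjective HA M.toRightAction w
    induction w with
    | zero => simp
    | add x y hx hy => simp only [map_add, TensorProduct.tmul_add, hx, hy]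
    | tmul b' a' =>
      rw [twistComul_twist, leg₁₂_tmul]
      have h1 : ∀ s : B ⊗[ℂ] B, leg₁₂ (A ⊗[ℂ] B) HB.T₂.toLinearMap (c ⊗ₜ
          (twist HA M.toRightAction ∘ₗ (TensorProduct.mk ℂ B A).flip a').lTensor B s)
          = ((twist HA M.toRightAction ∘ₗ (TensorProduct.mk ℂ B A).flip a').lTensor B).lTensor B
            (TensorProduct.assoc ℂ B B B
              ((HB.T₂.toLinearMap ∘ₗ TensorProduct.mk ℂ B B c).rTensor B s)) := by
        intro s
        induction s with
        | zero => simp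
        | add x y hx hy => simp only [map_add, TensorProduct.tmul_add, hx, hy]
        | tmul u v =>
          simp only [LinearMap.lTensor_tmul, leg₁₂_tmul, LinearMap.rTensor_tmul,
            LinearMap.comp_apply, TensorProduct.mk_apply, LinearMap.flip_apply]
          generalize HB.T₂.toLinearMap (c ⊗ₜ u) = t
          induction t with
          | zero => simp
          | add x y hx hy => simp only [map_add, TensorProduct.add_tmul, hx, hy]
          | tmul u v => simp
      rw [h1, HB.coassoc, LinearEquiv.coe_coe]
      generalize HB.T₂ (c ⊗ₜ b) = t
      induction t with
      | zero => simp
      | add x y hx hy => simp only [map_add, TensorProduct.add_tmul, hx, hy]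
      | tmul u v =>
        simp only [TensorProduct.assoc_tmul, LinearMap.lTensor_tmul, LinearEquiv.coe_coe,
          twistComul_twist, LinearMap.comp_apply, TensorProduct.mk_apply, LinearMap.flip_apply]

theorem sigmaLeft_twistComul (c : B) (x : A ⊗[ℂ] (B ⊗[ℂ] (A ⊗[ℂ] B))) :
    sigmaLeft M C (A ⊗[ℂ] B) c ((twistComul HB M).toLinearMap.lTensor A x)
      = ((twistComul HB M).toLinearMap.lTensor A).lTensor B (sigmaLeft M C (A ⊗[ℂ] B) c x) := by
  induction x with
  | zero => simp
  | add x y hx hy => simp only [map_add, hx, hy]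
  | tmul a y =>
    rw [LinearMap.lTensor_tmul, LinearEquiv.coe_coe, sigmaLeft_tmul', sigmaLeft_tmul']
    generalize mapP M C (c ⊗ₜ a) = t
    induction t with
    | zero => simp
    | add x y hx hy => simp only [map_add, TensorProduct.add_tmul, hx, hy]
    | tmul c a =>
      simp only [TensorProduct.assoc_tmul, LinearMap.comp_apply, LinearEquiv.coe_coe,
        TensorProduct.leftComm_tmul, LinearMap.lTensor_tmul, twistComul_T₂]
      generalize leg₁₂ (A ⊗[ℂ] B) HB.T₂.toLinearMap (c ⊗ₜ y) = t
      induction t with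
      | zero => simp
      | add x y hx hy => simp only [map_add, TensorProduct.tmul_add, hx, hy]
      | tmul u v => simp

theorem sigmaLeft_smashT₁ (hMC : Compatible M C) (c : B) (x : A ⊗[ℂ] (B ⊗[ℂ] (A ⊗[ℂ] B))) :
    sigmaLeft M C (A ⊗[ℂ] B) c (smashT₁ hMC x)
      = (smashT₁ hMC).toLinearMap.lTensor B (sigmaLeft M C (A ⊗[ℂ] B) c x) := by
  have h : (smashT₁ hMC).toLinearMap
      = (cotwistComul hMC B).toLinearMap ∘ₗ (twistComul HB M).toLinearMap.lTensor A := rfl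
  rw [h, LinearMap.lTensor_comp_apply, ← sigmaLeft_twistComul, ← sigmaLeft_cotwistComul]
  rfl

/-- `a ⊗ x ↦ ((p ⊗ 1)Δ_A(a))₁₂ ⊗ x`. -/
noncomputable def comulLeft (HA : RegularMHA A) (X : Type*) [AddCommGroup X] [Module ℂ X] (p : A) :
    A ⊗[ℂ] X →ₗ[ℂ] A ⊗[ℂ] (A ⊗[ℂ] X) :=
  (TensorProduct.assoc ℂ A A X).toLinearMap
    ∘ₗ (HA.T₂.toLinearMap ∘ₗ TensorProduct.mk ℂ A A p).rTensor X

theorem comulLeft_tmul {X : Type*} [AddCommGroup X] [Module ℂ X] (p a : A) (x : X) :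
    comulLeft HA X p (a ⊗ₜ x)
      = ((TensorProduct.mk ℂ A X).flip x).lTensor A (HA.T₂ (p ⊗ₜ a)) := by
  simp only [comulLeft, LinearMap.comp_apply, LinearEquiv.coe_coe,
    LinearMap.rTensor_tmul, TensorProduct.mk_apply]
  generalize HA.T₂ (p ⊗ₜ a) = t
  induction t with
  | zero => simp
  | add x y hx hy => simp only [map_add, TensorProduct.add_tmul, hx, hy]
  | tmul u v => simp

/-- Coassociativity of Δ_A: T₁ of the smash product has the form ∑ a₍₁₎ ⊗ θ(a₍₂₎) in its first
argument. -/
theorem comulLeft_smashT₁ (hMC : Compatible M C) (p : A) (x : A ⊗[ℂ] (B ⊗[ℂ] (A ⊗[ℂ] B))) :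
    comulLeft HA _ p (smashT₁ hMC x)
      = (smashT₁ hMC).toLinearMap.lTensor A (comulLeft HA _ p x) := by
  induction x with
  | zero => simp
  | add x y hx hy => simp only [map_add, hx, hy]
  | tmul a y =>
    obtain ⟨θ, hθ⟩ := cotwistComul_covers hMC (twistComul HB M y)
    rw [smashT₁_tmul]
    refine (RegularMHA.covers_comul hθ p a).trans ?_
    rw [comulLeft_tmul, ← LinearMap.lTensor_comp_apply]
    congr 2

theorem smashT₂_tmul_tmul (p : A) (c : B) (x : A ⊗[ℂ] B) (w : W) :
    (((TensorProduct.assoc ℂ A B W).toLinearMap.lTensor B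
      ∘ₗ (TensorProduct.assoc ℂ B (A ⊗[ℂ] B) W).toLinearMap).lTensor A)
      (TensorProduct.assoc ℂ A (B ⊗[ℂ] (A ⊗[ℂ] B)) W (smashT₂ M C (p ⊗ₜ (c ⊗ₜ x)) ⊗ₜ w))
      = (sigmaLeft M C W c).lTensor A
        (comulLeft HA _ p (TensorProduct.assoc ℂ A B W (x ⊗ₜ w))) := by
  induction x with
  | zero => simp
  | add x y hx hy => simp only [map_add, TensorProduct.tmul_add, TensorProduct.add_tmul, hx, hy]
  | tmul a b =>
    rw [TensorProduct.assoc_tmul, comulLeft_tmul, smashT₂_tmul]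
    generalize HA.T₂ (p ⊗ₜ a) = t
    induction t with
    | zero => simp
    | add x y hx hy => simp only [map_add, TensorProduct.add_tmul, hx, hy]
    | tmul u v =>
      simp [sigmaLeft]

end Coassoc

/-- The canonical map `T₁` on `(A ⊗ B) ⊗ (A ⊗ B)`. -/
noncomputable def smashCanonOne (hMC : Compatible M C) :
    (A ⊗[ℂ] B) ⊗[ℂ] (A ⊗[ℂ] B) ≃ₗ[ℂ] (A ⊗[ℂ] B) ⊗[ℂ] (A ⊗[ℂ] B) :=
  TensorProduct.assoc ℂ A B (A ⊗[ℂ] B) ≪≫ₗ smashT₁ hMC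
    ≪≫ₗ (TensorProduct.assoc ℂ A B (A ⊗[ℂ] B)).symm

/-- The canonical map `T₂` on `(A ⊗ B) ⊗ (A ⊗ B)`. -/
noncomputable def smashCanonTwo (M : RightModuleAlgebra HA B) (C : LeftComoduleCoalgebra HA HB) :
    (A ⊗[ℂ] B) ⊗[ℂ] (A ⊗[ℂ] B) ≃ₗ[ℂ] (A ⊗[ℂ] B) ⊗[ℂ] (A ⊗[ℂ] B) :=
  TensorProduct.assoc ℂ A B (A ⊗[ℂ] B) ≪≫ₗ smashT₂ M C
    ≪≫ₗ (TensorProduct.assoc ℂ A B (A ⊗[ℂ] B)).symm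

/-- Multiplying by pc on the left of Δ_# factors as `comulLeft` for p followed by `sigmaLeft` for c.
Each factor commutes with T₁, hence so does their composite. -/
theorem smashCanon_coassoc (hMC : Compatible M C) (x y z : A ⊗[ℂ] B) :
    TensorProduct.assoc ℂ (A ⊗[ℂ] B) (A ⊗[ℂ] B) (A ⊗[ℂ] B)
        (((smashCanonTwo M C).toLinearMap ∘ₗ TensorProduct.mk ℂ (A ⊗[ℂ] B) (A ⊗[ℂ] B) x).rTensor
          (A ⊗[ℂ] B) (smashCanonOne hMC (y ⊗ₜ z)))
      = ((smashCanonOne hMC).toLinearMap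
          ∘ₗ (TensorProduct.mk ℂ (A ⊗[ℂ] B) (A ⊗[ℂ] B)).flip z).lTensor (A ⊗[ℂ] B)
        (smashCanonTwo M C (x ⊗ₜ y)) := by
  induction x with
  | zero => simp [LinearMap.rTensor_zero]
  | add x y hx hy =>
    simp only [map_add, TensorProduct.add_tmul, LinearMap.comp_add, LinearMap.rTensor_add,
      LinearMap.add_apply, hx, hy]
  | tmul p c =>
    -- the regrouping of the legs
    let e : (A ⊗[ℂ] B) ⊗[ℂ] ((A ⊗[ℂ] B) ⊗[ℂ] (A ⊗[ℂ] B)) ≃ₗ[ℂ]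
        A ⊗[ℂ] (B ⊗[ℂ] (A ⊗[ℂ] (B ⊗[ℂ] (A ⊗[ℂ] B)))) :=
      TensorProduct.assoc ℂ A B _ ≪≫ₗ TensorProduct.congr (LinearEquiv.refl ℂ A)
        (TensorProduct.congr (LinearEquiv.refl ℂ B) (TensorProduct.assoc ℂ A B (A ⊗[ℂ] B)))
    have h1 : ∀ s : (A ⊗[ℂ] B) ⊗[ℂ] (A ⊗[ℂ] B), e (TensorProduct.assoc ℂ _ _ _
        (((smashCanonTwo M C).toLinearMap ∘ₗ TensorProduct.mk ℂ (A ⊗[ℂ] B) (A ⊗[ℂ] B)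
          (p ⊗ₜ c)).rTensor (A ⊗[ℂ] B) s))
        = (sigmaLeft M C (A ⊗[ℂ] B) c).lTensor A
          (comulLeft HA _ p (TensorProduct.assoc ℂ A B (A ⊗[ℂ] B) s)) := by
      intro s
      induction s with
      | zero => simp
      | add x y hx hy => simp only [map_add, hx, hy]
      | tmul x w =>
        rw [← smashT₂_tmul_tmul, LinearMap.rTensor_tmul, LinearMap.comp_apply,
          TensorProduct.mk_apply, LinearEquiv.coe_coe]
        simp only [smashCanonTwo, LinearEquiv.trans_apply, TensorProduct.assoc_tmul]
        generalize smashT₂ M C (p ⊗ₜ (c ⊗ₜ x)) = t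
        induction t with
        | zero => simp
        | add x y hx hy => simp only [map_add, TensorProduct.add_tmul, hx, hy]
        | tmul u t =>
          induction t with
          | zero => simp
          | add x y hx hy =>
            simp only [map_add, TensorProduct.tmul_add, TensorProduct.add_tmul, hx, hy]
          | tmul v t => simp [e]
    have h2 : ∀ s : (A ⊗[ℂ] B) ⊗[ℂ] (A ⊗[ℂ] B), e (((smashCanonOne hMC).toLinearMap
          ∘ₗ (TensorProduct.mk ℂ (A ⊗[ℂ] B) (A ⊗[ℂ] B)).flip z).lTensor (A ⊗[ℂ] B) s)
        = ((smashT₁ hMC).toLinearMap.lTensor B).lTensor A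
          (e (TensorProduct.assoc ℂ _ _ _ (s ⊗ₜ z))) := by
      intro s
      induction s with
      | zero => simp
      | add x y hx hy => simp only [map_add, TensorProduct.add_tmul, hx, hy]
      | tmul x w =>
        induction x with
        | zero => simp
        | add x y hx hy => simp only [map_add, TensorProduct.add_tmul, hx, hy]
        | tmul u v => simp [e, smashCanonOne]
    apply e.injective
    have h3 := h1 (y ⊗ₜ z)
    rw [LinearMap.rTensor_tmul, LinearMap.comp_apply, TensorProduct.mk_apply,
      LinearEquiv.coe_coe] at h3
    rw [h1, h2, h3]
    simp only [smashCanonOne, LinearEquiv.trans_apply, LinearEquiv.apply_symm_apply]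
    rw [comulLeft_smashT₁, ← LinearMap.lTensor_comp_apply, ← LinearMap.lTensor_comp_apply]
    congr 2
    exact LinearMap.ext fun t => sigmaLeft_smashT₁ hMC c t

end Canonical

end Bicross

namespace Bicross

universe u v w

/-! ### P against the product and the coproduct of B -/

section Multiplicative

variable {A : Type u} [NonUnitalRing A] [Module ℂ A] [IsScalarTower ℂ A A] [SMulCommClass ℂ A A]
  {B : Type v} [NonUnitalRing B] [Module ℂ B] [IsScalarTower ℂ B B] [SMulCommClass ℂ B B]
  {HA : RegularMHA A} {HB : RegularMHA B} {M : RightModuleAlgebra HA B}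
  {C : LeftComoduleCoalgebra HA HB}

theorem actComul_covers {V : Type*} [AddCommGroup V] [Module ℂ V] {ζ : A →ₗ[ℂ] A ⊗[ℂ] V}
    {θ : A →ₗ[ℂ] V} (h : HA.Covers ζ θ) (c : B) (a : A) :
    actComul M V c (ζ a)
      = ζ.lTensor B (TensorProduct.comm ℂ A B (twistOp HA M.toRightAction (c ⊗ₜ a))) :=
  twistOp_covers M.toRightAction h c a

theorem comulLeft_covers {V : Type*} [AddCommGroup V] [Module ℂ V] {ζ : A →ₗ[ℂ] A ⊗[ℂ] V}
    {θ : A →ₗ[ℂ] V} (h : HA.Covers ζ θ) (p a : A) :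
    comulLeft HA V p (ζ a) = ζ.lTensor A (HA.T₂ (p ⊗ₜ a)) :=
  RegularMHA.covers_comul h p a

/-- `b ⊗ a ⊗ c ↦ (c ⊗ 1)P(b ⊗ a)`. -/
noncomputable def mulMapP (M : RightModuleAlgebra HA B) (C : LeftComoduleCoalgebra HA HB) :
    B ⊗[ℂ] (A ⊗[ℂ] B) →ₗ[ℂ] B ⊗[ℂ] A :=
  (LinearMap.mul' ℂ B).rTensor A ∘ₗ (TensorProduct.assoc ℂ B B A).symm.toLinearMap
    ∘ₗ (TensorProduct.comm ℂ (B ⊗[ℂ] A) B).toLinearMap ∘ₗ (mapP M C).rTensor B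
    ∘ₗ (TensorProduct.assoc ℂ B A B).symm.toLinearMap

theorem mulMapP_tmul (b c : B) (a : A) :
    mulMapP M C (b ⊗ₜ (a ⊗ₜ c)) = (LinearMap.mulLeft ℂ c).rTensor A (mapP M C (b ⊗ₜ a)) := by
  simp only [mulMapP, LinearMap.comp_apply, LinearEquiv.coe_coe, TensorProduct.assoc_symm_tmul,
    LinearMap.rTensor_tmul, TensorProduct.comm_tmul]
  generalize mapP M C (b ⊗ₜ a) = t
  induction t with
  | zero => simp
  | add x y hx hy => simp only [map_add, TensorProduct.tmul_add, hx, hy]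
  | tmul u v => simp

/-- The module algebra rule, (cb) ◁ a₍₁₎ ⊗ a₍₂₎ = (c ◁ a₍₁₎)(b ◁ a₍₂₎) ⊗ a₍₃₎. For c = d ◁ e and
after covering the last leg by k, both sides are images of the same threefold comultiplication. -/
theorem twistOp_mul (c b : B) (a : A) :
    twistOp HA M.toRightAction ((c * b) ⊗ₜ a)
      = ((LinearMap.mul' ℂ B).lTensor A ∘ₗ (TensorProduct.comm ℂ B B).toLinearMap.lTensor A
          ∘ₗ (TensorProduct.assoc ℂ A B B).toLinearMap
          ∘ₗ (twistOp HA M.toRightAction ∘ₗ TensorProduct.mk ℂ B A b).rTensor B)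
        (twistOp HA M.toRightAction (c ⊗ₜ a)) := by
  induction c using M.induction with
  | zero => simp
  | add x y hx hy => simp only [add_mul, TensorProduct.add_tmul, map_add, hx, hy]
  | act d e =>
    refine HA.op.rTensor_mulLeft_cancel fun k => ?_
    have hk := mulLeft_twist HA.op M.toRightAction k (M.act d e * b) a
    change (LinearMap.mulLeft ℂ k).rTensor B (twistOp HA M.toRightAction _) = _ at hk
    rw [hk]
    have h0 : ∀ x, HA.op.T₂ (k ⊗ₜ x) = TensorProduct.comm ℂ A A (HA.T₄ (k ⊗ₜ x)) := by
      intro x; simp [RegularMHA.T₄, RegularMHA.op]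
    have h1 := RegularMHA.covers_comul (HA.covers_T₄ k) e a
    simp only [LinearMap.comp_apply, TensorProduct.mk_apply, LinearEquiv.coe_coe] at h1
    rw [h0, twistOp_act]
    -- both sides are images of `(T₂)₁₂(T₄)₂₃`
    let F : A ⊗[ℂ] (A ⊗[ℂ] A) →ₗ[ℂ] A ⊗[ℂ] B :=
      (TensorProduct.comm ℂ B A).toLinearMap ∘ₗ
        (LinearMap.mul' ℂ B ∘ₗ TensorProduct.map (M.act d) (M.act b)).rTensor A
        ∘ₗ (TensorProduct.assoc ℂ A A A).symm.toLinearMap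
    have h2 : ∀ t : A ⊗[ℂ] A, (M.act (M.act d e * b)).lTensor A (TensorProduct.comm ℂ A A t)
        = F (TensorProduct.assoc ℂ A A A
          ((HA.T₂.toLinearMap ∘ₗ TensorProduct.mk ℂ A A e).rTensor A t)) := by
      intro t
      induction t with
      | zero => simp
      | add x y hx hy => simp only [map_add, hx, hy]
      | tmul u v => simp [F, M.act_algebra]
    rw [h2, h1]
    generalize HA.T₂ (e ⊗ₜ a) = t
    induction t with
    | zero => simp
    | add x y hx hy => simp only [map_add, hx, hy]
    | tmul u v =>
      simp only [LinearMap.lTensor_tmul, TensorProduct.comm_tmul, LinearMap.comp_apply,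
        LinearMap.rTensor_tmul, TensorProduct.mk_apply, LinearEquiv.coe_coe]
      have h3 := mulLeft_twist HA.op M.toRightAction k b v
      rw [h0] at h3
      change (LinearMap.mulLeft ℂ k).rTensor B (twistOp HA M.toRightAction (b ⊗ₜ v)) = _ at h3
      have h4 : ∀ s : A ⊗[ℂ] B, (LinearMap.mulLeft ℂ k).rTensor B ((LinearMap.mul' ℂ B).lTensor A
          ((TensorProduct.comm ℂ B B).toLinearMap.lTensor A
            (TensorProduct.assoc ℂ A B B (s ⊗ₜ M.act d u))))
          = (LinearMap.mulLeft ℂ (M.act d u)).lTensor A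
            ((LinearMap.mulLeft ℂ k).rTensor B s) := by
        intro s
        induction s with
        | zero => simp
        | add x y hx hy => simp only [map_add, TensorProduct.add_tmul, hx, hy]
        | tmul u v => simp
      rw [h4, h3]
      generalize HA.T₄ (k ⊗ₜ v) = t
      induction t with
      | zero => simp
      | add x y hx hy => simp only [map_add, TensorProduct.tmul_add, hx, hy]
      | tmul u v => simp [F]

/-- Formally P(cb ⊗ a) = ∑ ((c ◁ a₍₁₎) ⊗ 1)P(b ⊗ a₍₂₎), because Tᵒᵖ is left B-linear. -/
theorem mapP_mul (c b : B) (a : A) :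
    mapP M C ((c * b) ⊗ₜ a) = mulMapP M C (b ⊗ₜ twistOp HA M.toRightAction (c ⊗ₜ a)) := by
  rw [mapP, LinearMap.comp_apply, twistOp_mul]
  generalize twistOp HA M.toRightAction (c ⊗ₜ a) = t
  induction t with
  | zero => simp
  | add x y hx hy => simp only [map_add, TensorProduct.tmul_add, hx, hy]
  | tmul a c =>
    rw [mulMapP_tmul, mapP]
    simp only [LinearMap.comp_apply, LinearMap.rTensor_tmul, TensorProduct.mk_apply]
    generalize twistOp HA M.toRightAction (b ⊗ₜ a) = t
    induction t with
    | zero => simp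
    | add x y hx hy => simp only [map_add, TensorProduct.add_tmul, hx, hy]
    | tmul u v => simp [cotwistOp_mul]

/-- `P₁₃` on `B ⊗ B ⊗ A`. -/
noncomputable def outerP (M : RightModuleAlgebra HA B) (C : LeftComoduleCoalgebra HA HB) :
    B ⊗[ℂ] (B ⊗[ℂ] A) →ₗ[ℂ] B ⊗[ℂ] (B ⊗[ℂ] A) :=
  (TensorProduct.leftComm ℂ B B A).toLinearMap ∘ₗ (mapP M C).lTensor B
    ∘ₗ (TensorProduct.leftComm ℂ B B A).toLinearMap

theorem outerP_tmul (c b : B) (a : A) : outerP M C (c ⊗ₜ (b ⊗ₜ a))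
    = (TensorProduct.mk ℂ B A b).lTensor B (mapP M C (c ⊗ₜ a)) := by
  simp only [outerP, LinearMap.comp_apply, LinearEquiv.coe_coe, TensorProduct.leftComm_tmul,
    LinearMap.lTensor_tmul]
  generalize mapP M C (c ⊗ₜ a) = t
  induction t with
  | zero => simp
  | add x y hx hy => simp only [map_add, TensorProduct.tmul_add, hx, hy]
  | tmul u v => simp

/-- `P₂₃P₁₃(T₂)₁₂ = (T₂)₁₂P₂₃(Rᵒᵖ)₁₃`. -/
theorem Compatible.mapP_comul (hMC : Compatible M C) (c b : B) (a : A) :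
    (mapP M C).lTensor B (outerP M C (TensorProduct.assoc ℂ B B A (HB.T₂ (c ⊗ₜ b) ⊗ₜ a)))
      = leg₁₂ A HB.T₂.toLinearMap ((mapP M C ∘ₗ TensorProduct.mk ℂ B A b).lTensor B
        (TensorProduct.comm ℂ A B (twistOp HA M.toRightAction (c ⊗ₜ a)))) := by
  -- The relation for (Δ_B ⊗ ι)P is available only after left multiplication by elements of B.
  -- Extended linearly and taken at s = Rᵒᵖ(c ⊗ a), the multiplying elements become c ◁ a₍₁₎, and
  -- `mapP_mul` absorbs them into P₁₃ applied to (c ⊗ 1)Δ_B(b).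
  have key : ∀ s : A ⊗[ℂ] B, ∃ z : B ⊗[ℂ] (B ⊗[ℂ] A),
      (∀ d, ((LinearMap.mulLeft ℂ d).rTensor A).lTensor B z
        = TensorProduct.leftComm ℂ B B A ((mulMapP M C).lTensor B
          (TensorProduct.assoc ℂ B B (A ⊗[ℂ] B)
            (TensorProduct.comm ℂ B B (HB.T₄ (d ⊗ₜ b)) ⊗ₜ s)))) ∧
      (mapP M C).lTensor B z = leg₁₂ A HB.T₂.toLinearMap
        ((mapP M C ∘ₗ TensorProduct.mk ℂ B A b).lTensor B (TensorProduct.comm ℂ A B s)) := by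
    intro s
    induction s with
    | zero => exact ⟨0, fun d => by simp, by simp⟩
    | add x y hx hy =>
      obtain ⟨z, hz, hz'⟩ := hx
      obtain ⟨w, hw, hw'⟩ := hy
      exact ⟨z + w, fun d => by simp only [map_add, TensorProduct.tmul_add, hz, hw],
        by simp only [map_add, hz', hw']⟩
    | tmul a c =>
      obtain ⟨z, hz, hz'⟩ := hMC.comul c b a
      refine ⟨z, fun d => (hz d).trans ?_, hz'.trans ?_⟩
      · change (LinearMap.mulLeft ℂ c).rTensor (B ⊗[ℂ] A) (outerP M C _) = _
        generalize HB.T₄ (d ⊗ₜ b) = t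
        induction t with
        | zero => simp
        | add x y hx hy => simp only [map_add, TensorProduct.add_tmul, hx, hy]
        | tmul u v =>
          simp only [TensorProduct.assoc_tmul, outerP_tmul, TensorProduct.comm_tmul,
            LinearMap.lTensor_tmul, mulMapP_tmul]
          generalize mapP M C (u ⊗ₜ a) = t
          induction t with
          | zero => simp
          | add x y hx hy => simp only [map_add, TensorProduct.tmul_add, hx, hy]
          | tmul u v => simp
      · rw [TensorProduct.comm_tmul, LinearMap.lTensor_tmul, LinearMap.comp_apply,
          TensorProduct.mk_apply]
        generalize mapP M C (b ⊗ₜ a) = t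
        induction t with
        | zero => simp
        | add x y hx hy => simp only [map_add, TensorProduct.tmul_add, hx, hy]
        | tmul u v => simp
  obtain ⟨z, hz, hz'⟩ := key (twistOp HA M.toRightAction (c ⊗ₜ a))
  rw [← hz']
  congr 1
  have hl : ∀ t : B ⊗[ℂ] A, (∀ d : B, (LinearMap.mulLeft ℂ d).rTensor A t = 0) → t = 0 :=
    fun t ht => HB.rTensor_mulLeft_cancel (z' := 0) fun d => by rw [ht, map_zero]
  rw [← sub_eq_zero]
  refine lTensor_cancel (fun d : B => (LinearMap.mulLeft ℂ d).rTensor A) hl _ fun d => ?_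
  rw [map_sub, sub_eq_zero, hz]
  have h1 : ∀ t : B ⊗[ℂ] B, ((LinearMap.mulLeft ℂ d).rTensor A).lTensor B
      (outerP M C (TensorProduct.assoc ℂ B B A (t ⊗ₜ a)))
      = outerP M C (TensorProduct.assoc ℂ B B A ((LinearMap.mulLeft ℂ d).lTensor B t ⊗ₜ a)) := by
    intro t
    induction t with
    | zero => simp
    | add x y hx hy => simp only [map_add, TensorProduct.add_tmul, hx, hy]
    | tmul u v =>
      simp only [LinearMap.lTensor_tmul, TensorProduct.assoc_tmul, outerP_tmul]
      rw [← LinearMap.lTensor_comp_apply]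
      congr 2
  rw [h1, ← HB.mulLeft_T₄]
  generalize HB.T₄ (d ⊗ₜ b) = t
  induction t with
  | zero => simp
  | add x y hx hy => simp only [map_add, TensorProduct.add_tmul, hx, hy]
  | tmul u v =>
    simp only [LinearMap.rTensor_tmul, LinearMap.mulLeft_apply, TensorProduct.assoc_tmul,
      outerP_tmul, mapP_mul, TensorProduct.comm_tmul, LinearMap.lTensor_tmul]
    generalize mulMapP M C (u ⊗ₜ twistOp HA M.toRightAction (c ⊗ₜ a)) = t
    induction t with
    | zero => simp
    | add x y hx hy => simp only [map_add, TensorProduct.tmul_add, hx, hy]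
    | tmul u v => simp

theorem cotwist_smashSigma (c : B) (x : A ⊗[ℂ] B) :
    (cotwist C.Γ).lTensor B (smashSigma M C (c ⊗ₜ x))
      = leg₁₂ A HB.T₂.toLinearMap ((cotwist C.Γ).lTensor B (actComul M B c x)) := by
  induction x with
  | zero => simp
  | add x y hx hy => simp only [map_add, TensorProduct.tmul_add, hx, hy]
  | tmul a b =>
    rw [smashSigma_tmul]
    refine (cotwist_outerT₂ b (twistOp HA M.toRightAction (c ⊗ₜ a))).trans ?_
    rw [actComul_tmul, ← LinearMap.lTensor_comp_apply]

/-- `(T₂)P₁₂R₃₂ = R₃₂P₁₂(T₂)` on the legs `c`, `b`, `a`. -/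
theorem smashSigma_twist (hMC : Compatible M C) (c b : B) (a : A) :
    smashSigma M C (c ⊗ₜ twist HA M.toRightAction (b ⊗ₜ a))
      = (twist HA M.toRightAction).lTensor B
        (outerP M C (TensorProduct.assoc ℂ B B A (HB.T₂ (c ⊗ₜ b) ⊗ₜ a))) := by
  have hinj : Function.Injective ((cotwist C.Γ).lTensor B) :=
    (TensorProduct.congr (LinearEquiv.refl ℂ B) (cotwistEquiv hMC)).injective
  have h1 : cotwist C.Γ ∘ₗ twist HA M.toRightAction = mapP M C := hMC.twist_cotwist
  -- After T on the last two legs, T∘R becomes P and the claim becomes `mapP_comul`.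
  apply hinj
  have h3 : ∀ t, (cotwist C.Γ).lTensor B ((twist HA M.toRightAction).lTensor B t)
      = (mapP M C).lTensor B t := fun t => by rw [← h1, LinearMap.lTensor_comp_apply]
  rw [cotwist_smashSigma, h3, hMC.mapP_comul]
  have h2 := actComul_covers (M := M) (HA.covers_twist M.toRightAction b) c a
  simp only [LinearMap.comp_apply, TensorProduct.mk_apply] at h2
  rw [h2, ← LinearMap.lTensor_comp_apply, ← LinearMap.comp_assoc, h1]

theorem smashT₂_apply (p : A) (c : B) (x : A ⊗[ℂ] B) :
    smashT₂ M C (p ⊗ₜ (c ⊗ₜ x))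
      = ((smashSigma M C).toLinearMap ∘ₗ TensorProduct.mk ℂ B (A ⊗[ℂ] B) c).lTensor A
        (comulLeft HA B p x) := by
  induction x with
  | zero => simp
  | add x y hx hy => simp only [map_add, TensorProduct.tmul_add, hx, hy]
  | tmul a b =>
    rw [smashT₂_tmul, comulLeft_tmul, ← LinearMap.lTensor_comp_apply, LinearMap.comp_assoc]

/-- On ba = R(b ⊗ a) the coproduct appears as Δ_B(b) followed by Δ_#(a), so the T₂ of B acts before
P, in contrast with its action on ab. This reversal is the core of multiplicativity. -/
theorem smashT₂_twist (hMC : Compatible M C) (p : A) (c b : B) (a : A) :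
    smashT₂ M C (p ⊗ₜ (c ⊗ₜ twist HA M.toRightAction (b ⊗ₜ a)))
      = ((twist HA M.toRightAction).lTensor B ∘ₗ outerP M C
          ∘ₗ (TensorProduct.assoc ℂ B B A).toLinearMap
          ∘ₗ TensorProduct.mk ℂ (B ⊗[ℂ] B) A (HB.T₂ (c ⊗ₜ b))).lTensor A (HA.T₂ (p ⊗ₜ a)) := by
  have h2 := comulLeft_covers (HA.covers_twist M.toRightAction b) p a
  simp only [LinearMap.comp_apply, TensorProduct.mk_apply] at h2
  rw [smashT₂_apply, h2, ← LinearMap.lTensor_comp_apply]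
  congr 2
  exact LinearMap.ext fun x => smashSigma_twist hMC c b x

end Multiplicative

end Bicross

namespace Bicross

universe u v w

/-! ### Multiplicativity of the smash coproduct -/

section Product

variable {A : Type u} [NonUnitalRing A] [Module ℂ A] [IsScalarTower ℂ A A] [SMulCommClass ℂ A A]
  {B : Type v} [NonUnitalRing B] [Module ℂ B] [IsScalarTower ℂ B B] [SMulCommClass ℂ B B]
  {HA : RegularMHA A} {HB : RegularMHA B} {M : RightModuleAlgebra HA B}
  {C : LeftComoduleCoalgebra HA HB}

/-- `c ⊗ a ↦ (1 ⊗ a)P(c ⊗ y)`. -/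
noncomputable def mapPMul (M : RightModuleAlgebra HA B) (C : LeftComoduleCoalgebra HA HB) (y : A) :
    B ⊗[ℂ] A →ₗ[ℂ] B ⊗[ℂ] A :=
  (LinearMap.mul' ℂ A).lTensor B ∘ₗ (TensorProduct.comm ℂ A A).toLinearMap.lTensor B
    ∘ₗ (TensorProduct.assoc ℂ B A A).toLinearMap
    ∘ₗ (mapP M C ∘ₗ (TensorProduct.mk ℂ B A).flip y).rTensor A

theorem mapPMul_tmul (y : A) (c : B) (a : A) :
    mapPMul M C y (c ⊗ₜ a) = (LinearMap.mulLeft ℂ a).lTensor B (mapP M C (c ⊗ₜ y)) := by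
  simp only [mapPMul, LinearMap.comp_apply, LinearMap.rTensor_tmul, LinearMap.flip_apply,
    TensorProduct.mk_apply, LinearEquiv.coe_coe]
  generalize mapP M C (c ⊗ₜ y) = t
  induction t with
  | zero => simp
  | add x y hx hy => simp only [map_add, TensorProduct.add_tmul, hx, hy]
  | tmul u v => simp

theorem Compatible.mapP_mul_right (hMC : Compatible M C) (c : B) (a y : A) :
    mapP M C (c ⊗ₜ (a * y)) = mapPMul M C y (mapP M C (c ⊗ₜ a)) := by
  have h := LinearMap.congr_fun hMC.mul (c ⊗ₜ (a ⊗ₜ y))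
  simp only [LinearMap.comp_apply, LinearMap.lTensor_tmul, LinearMap.mul'_apply, leg₁₂_tmul] at h
  rw [h]
  generalize mapP M C (c ⊗ₜ a) = t
  induction t with
  | zero => simp
  | add x y hx hy => simp only [map_add, TensorProduct.add_tmul, hx, hy]
  | tmul u v =>
    simp only [TensorProduct.assoc_tmul, LinearMap.lTensor_tmul, LinearEquiv.coe_coe,
      TensorProduct.comm_tmul, leg₁₂_tmul, mapPMul_tmul]
    generalize mapP M C (u ⊗ₜ y) = t
    induction t with
    | zero => simp
    | add x y hx hy => simp only [map_add, TensorProduct.add_tmul, hx, hy]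
    | tmul u v => simp

theorem outerT₂_mulLeft (a : A) (b : B) (t : B ⊗[ℂ] A) :
    outerT₂ HB A (TensorProduct.assoc ℂ B A B ((LinearMap.mulLeft ℂ a).lTensor B t ⊗ₜ b))
      = ((LinearMap.mulLeft ℂ a).rTensor B).lTensor B
        (outerT₂ HB A (TensorProduct.assoc ℂ B A B (t ⊗ₜ b))) := by
  induction t with
  | zero => simp
  | add x y hx hy => simp only [map_add, TensorProduct.add_tmul, hx, hy]
  | tmul u v =>
    simp only [LinearMap.lTensor_tmul, TensorProduct.assoc_tmul, outerT₂_tmul]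
    rw [← LinearMap.lTensor_comp_apply]
    congr 2

/-- `c ⊗ a ⊗ w ↦ (1 ⊗ 1 ⊗ a)(ι ⊗ smashSigma)(w₁ ⊗ c ⊗ w₂ ⊗ s)`. -/
noncomputable def mulSigma (M : RightModuleAlgebra HA B) (C : LeftComoduleCoalgebra HA HB) (s : B) :
    B ⊗[ℂ] A →ₗ[ℂ] A ⊗[ℂ] A →ₗ[ℂ] A ⊗[ℂ] (B ⊗[ℂ] (A ⊗[ℂ] B)) :=
  TensorProduct.lift (LinearMap.mk₂ ℂ
    (fun c a => (((LinearMap.mul ℂ A a).rTensor B).lTensor B ∘ₗ (smashSigma M C).toLinearMap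
      ∘ₗ TensorProduct.mk ℂ B (A ⊗[ℂ] B) c ∘ₗ (TensorProduct.mk ℂ A B).flip s).lTensor A)
    (fun _ _ _ => by
      simp only [map_add, LinearMap.comp_add, LinearMap.add_comp, LinearMap.lTensor_add])
    (fun _ _ _ => by
      simp only [map_smul, LinearMap.comp_smul, LinearMap.smul_comp, LinearMap.lTensor_smul])
    (fun _ _ _ => by
      simp only [map_add, LinearMap.add_comp, LinearMap.rTensor_add, LinearMap.lTensor_add])
    (fun _ _ _ => by
      simp only [map_smul, LinearMap.smul_comp, LinearMap.rTensor_smul, LinearMap.lTensor_smul]))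

theorem mulSigma_tmul (s c : B) (a : A) :
    mulSigma M C s (c ⊗ₜ a)
      = (((LinearMap.mulLeft ℂ a).rTensor B).lTensor B ∘ₗ (smashSigma M C).toLinearMap
      ∘ₗ TensorProduct.mk ℂ B (A ⊗[ℂ] B) c ∘ₗ (TensorProduct.mk ℂ A B).flip s).lTensor A := rfl

/-- The first compatibility relation: carrying c past ay amounts to carrying it past a and then past
y. -/
theorem mulSigma_mapP (hMC : Compatible M C) (s c : B) (a : A) (w : A ⊗[ℂ] A) :
    mulSigma M C s (mapP M C (c ⊗ₜ a)) w
      = ((smashSigma M C).toLinearMap ∘ₗ TensorProduct.mk ℂ B (A ⊗[ℂ] B) c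
        ∘ₗ (TensorProduct.mk ℂ A B).flip s ∘ₗ LinearMap.mulLeft ℂ a).lTensor A w := by
  induction w with
  | zero => simp
  | add x y hx hy => simp only [map_add, hx, hy]
  | tmul q y =>
    simp only [LinearMap.lTensor_tmul, LinearMap.comp_apply, LinearMap.flip_apply,
      TensorProduct.mk_apply, LinearMap.mulLeft_apply, LinearEquiv.coe_coe]
    rw [smashSigma_tmul, hMC.mapP_mul_right]
    generalize mapP M C (c ⊗ₜ a) = t
    induction t with
    | zero => simp
    | add x y hx hy =>
      simp only [map_add, LinearMap.add_apply, TensorProduct.add_tmul, TensorProduct.tmul_add,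
        hx, hy]
    | tmul c a =>
      rw [mulSigma_tmul, LinearMap.lTensor_tmul, mapPMul_tmul, outerT₂_mulLeft]
      simp only [LinearMap.comp_apply, LinearMap.flip_apply, TensorProduct.mk_apply,
        LinearEquiv.coe_coe, smashSigma_tmul]

/-- `p ⊗ c ⊗ a ↦ (1 ⊗ a)T₂(pc ⊗ x)`. -/
noncomputable def smashT₂Mul (M : RightModuleAlgebra HA B) (C : LeftComoduleCoalgebra HA HB)
    (x : A ⊗[ℂ] B) : A ⊗[ℂ] (B ⊗[ℂ] A) →ₗ[ℂ] A ⊗[ℂ] (B ⊗[ℂ] (A ⊗[ℂ] B)) :=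
  TensorProduct.lift ((LinearMap.lTensorHom A ∘ₗ LinearMap.lTensorHom B ∘ₗ LinearMap.rTensorHom B
      ∘ₗ LinearMap.mul ℂ A).flip ∘ₗ (smashT₂ M C).toLinearMap
      ∘ₗ (TensorProduct.assoc ℂ A B (A ⊗[ℂ] B)).toLinearMap
      ∘ₗ (TensorProduct.mk ℂ (A ⊗[ℂ] B) (A ⊗[ℂ] B)).flip x)
    ∘ₗ (TensorProduct.assoc ℂ A B A).symm.toLinearMap

theorem smashT₂Mul_tmul (x : A ⊗[ℂ] B) (p a : A) (c : B) :
    smashT₂Mul M C x (p ⊗ₜ (c ⊗ₜ a))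
      = (((LinearMap.mulLeft ℂ a).rTensor B).lTensor B).lTensor A
        (smashT₂ M C (p ⊗ₜ (c ⊗ₜ x))) := rfl

theorem smashT₂Mul_zero : smashT₂Mul M C 0 = 0 := by
  refine TensorProduct.ext_threefold' fun p c a => ?_
  simp [smashT₂Mul_tmul]

theorem smashT₂Mul_add (x y : A ⊗[ℂ] B) :
    smashT₂Mul M C (x + y) = smashT₂Mul M C x + smashT₂Mul M C y := by
  refine TensorProduct.ext_threefold' fun p c a => ?_
  simp only [smashT₂Mul_tmul, TensorProduct.tmul_add, map_add, LinearMap.add_apply]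

/-- Δ_A is multiplicative, and P records how c passes the second leg of Δ_A(a); so a left factor a
in A contributes its own coproduct. -/
theorem smashT₂_mulLeft (hMC : Compatible M C) (p a : A) (c : B) (x : A ⊗[ℂ] B) :
    smashT₂ M C (p ⊗ₜ (c ⊗ₜ (LinearMap.mulLeft ℂ a).rTensor B x))
      = smashT₂Mul M C x ((mapP M C ∘ₗ TensorProduct.mk ℂ B A c).lTensor A (HA.T₂ (p ⊗ₜ a))) := by
  induction x with
  | zero => simp [smashT₂Mul_zero]
  | add x y hx hy =>
    simp only [map_add, TensorProduct.tmul_add, hx, hy, smashT₂Mul_add, LinearMap.add_apply]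
  | tmul r s =>
    rw [LinearMap.rTensor_tmul, smashT₂_tmul, LinearMap.mulLeft_apply, HA.T₂_mul]
    generalize HA.T₂ (p ⊗ₜ a) = t
    induction t with
    | zero => simp
    | add x y hx hy => simp only [map_add, hx, hy]
    | tmul p a =>
      have h := mulSigma_mapP hMC s c a (HA.T₂ (p ⊗ₜ r))
      rw [HA.Δ_R_tmul, ← LinearMap.lTensor_comp_apply, LinearMap.lTensor_tmul,
        LinearMap.comp_apply, TensorProduct.mk_apply]
      refine h.symm.trans ?_
      generalize mapP M C (c ⊗ₜ a) = t
      induction t with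
      | zero => simp
      | add x y hx hy => simp only [map_add, LinearMap.add_apply, TensorProduct.tmul_add, hx, hy]
      | tmul c a =>
        rw [mulSigma_tmul, smashT₂Mul_tmul, smashT₂_tmul, ← LinearMap.lTensor_comp_apply]

/-- `c ⊗ x ↦ (c ⊗ x)Δ_B(b)`. -/
noncomputable def mulComulB (HB : RegularMHA B) (A : Type u) [AddCommGroup A] [Module ℂ A] (b : B) :
    B ⊗[ℂ] (A ⊗[ℂ] B) →ₗ[ℂ] B ⊗[ℂ] (A ⊗[ℂ] B) :=
  (TensorProduct.leftComm ℂ A B B).toLinearMap ∘ₗ (HB.Δ b).R.lTensor A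
    ∘ₗ (TensorProduct.leftComm ℂ B A B).toLinearMap

theorem mulComulB_tmul (b c d : B) (a : A) : mulComulB HB A b (c ⊗ₜ (a ⊗ₜ d))
    = ((LinearMap.mulLeft ℂ d).lTensor A).lTensor B (outerT₂ HB A (c ⊗ₜ (a ⊗ₜ b))) := by
  simp only [mulComulB, outerT₂, LinearMap.comp_apply, LinearEquiv.coe_coe,
    TensorProduct.leftComm_tmul, LinearMap.lTensor_tmul, HB.Δ_R_tmul]
  generalize HB.T₂ (c ⊗ₜ b) = t
  induction t with
  | zero => simp
  | add x y hx hy => simp only [map_add, TensorProduct.tmul_add, hx, hy]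
  | tmul u v => simp

/-- A right factor b in B only meets the T₂ of B, where Δ_B is multiplicative. -/
theorem smashT₂_mulRight (p : A) (c b : B) (x : A ⊗[ℂ] B) :
    smashT₂ M C (p ⊗ₜ (c ⊗ₜ (LinearMap.mulRight ℂ b).lTensor A x))
      = (mulComulB HB A b).lTensor A (smashT₂ M C (p ⊗ₜ (c ⊗ₜ x))) := by
  have h1 : ∀ (t : B ⊗[ℂ] A) (d : B), outerT₂ HB A (TensorProduct.assoc ℂ B A B (t ⊗ₜ (d * b)))
      = mulComulB HB A b (outerT₂ HB A (TensorProduct.assoc ℂ B A B (t ⊗ₜ d))) := by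
    intro t d
    induction t with
    | zero => simp
    | add x y hx hy => simp only [map_add, TensorProduct.add_tmul, hx, hy]
    | tmul u v =>
      simp only [outerT₂, mulComulB, TensorProduct.assoc_tmul, LinearMap.comp_apply,
        LinearEquiv.coe_coe, TensorProduct.leftComm_tmul, LinearMap.lTensor_tmul, HB.T₂_mul]
      generalize HB.T₂ (u ⊗ₜ d) = t
      induction t with
      | zero => simp
      | add x y hx hy => simp only [map_add, TensorProduct.tmul_add, hx, hy]
      | tmul u v => simp
  induction x with
  | zero => simp
  | add x y hx hy => simp only [map_add, TensorProduct.tmul_add, hx, hy]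
  | tmul r s =>
    rw [LinearMap.lTensor_tmul, smashT₂_tmul, smashT₂_tmul, ← LinearMap.lTensor_comp_apply]
    congr 2
    refine LinearMap.ext fun y => ?_
    simp only [LinearMap.comp_apply, LinearMap.flip_apply, TensorProduct.mk_apply,
      LinearEquiv.coe_coe, smashSigma_tmul, LinearMap.mulRight_apply, h1]

/-- The product is a · R(b ⊗ a') · b'. The outer factors are handled by `smashT₂_mulLeft` and
`smashT₂_mulRight`, the middle one by `smashT₂_twist`; expanding leg by leg then reassembles two
successive applications of T₂. -/
theorem smashT₂_mul (hMC : Compatible M C) (p a a' : A) (c b b' : B) :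
    smashT₂ M C (p ⊗ₜ (c ⊗ₜ smashMul HA M.toRightAction ((a ⊗ₜ b) ⊗ₜ (a' ⊗ₜ b'))))
      = TensorProduct.assoc ℂ A B (A ⊗[ℂ] B) (TensorProduct.lift
        ((LinearMap.lTensorHom (A ⊗[ℂ] B) ∘ₗ TensorProduct.curry (smashMul HA M.toRightAction)).flip
          ∘ₗ (smashCanonTwo M C).toLinearMap
          ∘ₗ (TensorProduct.mk ℂ (A ⊗[ℂ] B) (A ⊗[ℂ] B)).flip (a' ⊗ₜ b'))
        (smashCanonTwo M C ((p ⊗ₜ c) ⊗ₜ (a ⊗ₜ b)))) := by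
  rw [smashMul_tmul_right, smashRightA_tmul, smashT₂_mulRight, smashT₂_mulLeft hMC, smashCanonTwo]
  simp only [LinearEquiv.trans_apply, TensorProduct.assoc_tmul]
  rw [smashT₂_tmul]
  have h0 : (smashSigma M C).toLinearMap ∘ₗ TensorProduct.mk ℂ B (A ⊗[ℂ] B) c
        ∘ₗ (TensorProduct.mk ℂ A B).flip b
      = (outerT₂ HB A ∘ₗ (TensorProduct.assoc ℂ B A B).toLinearMap
        ∘ₗ (TensorProduct.mk ℂ (B ⊗[ℂ] A) B).flip b) ∘ₗ mapP M C ∘ₗ TensorProduct.mk ℂ B A c :=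
    LinearMap.ext fun y => smashSigma_tmul c b y
  rw [h0, LinearMap.lTensor_comp_apply A (outerT₂ HB A ∘ₗ _) (mapP M C ∘ₗ TensorProduct.mk ℂ B A c)]
  generalize (mapP M C ∘ₗ TensorProduct.mk ℂ B A c).lTensor A (HA.T₂ (p ⊗ₜ a)) = t
  induction t with
  | zero => simp
  | add x y hx hy => simp only [map_add, hx, hy]
  | tmul p t =>
    induction t with
    | zero => simp
    | add x y hx hy => simp only [map_add, TensorProduct.tmul_add, hx, hy]
    | tmul c a =>
      rw [smashT₂Mul_tmul, smashT₂_twist hMC]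
      simp only [LinearMap.lTensor_tmul, LinearMap.comp_apply, LinearMap.flip_apply,
        TensorProduct.mk_apply, LinearEquiv.coe_coe, TensorProduct.assoc_tmul, outerT₂_tmul]
      generalize HB.T₂ (c ⊗ₜ b) = t
      induction t with
      | zero => simp [LinearMap.comp_zero, LinearMap.lTensor_zero]
      | add x y hx hy =>
        simp only [map_add, TensorProduct.tmul_add, LinearMap.comp_add, LinearMap.lTensor_add,
          LinearMap.add_apply, hx, hy]
      | tmul c b =>
        simp only [LinearMap.lTensor_tmul, TensorProduct.mk_apply, TensorProduct.assoc_symm_tmul,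
          TensorProduct.lift.tmul, LinearMap.comp_apply, LinearMap.flip_apply, LinearEquiv.coe_coe,
          LinearEquiv.trans_apply, TensorProduct.assoc_tmul]
        rw [smashT₂_tmul]
        generalize HA.T₂ (p ⊗ₜ a') = t
        induction t with
        | zero => simp
        | add x y hx hy => simp only [map_add, hx, hy]
        | tmul p x =>
          simp only [LinearMap.lTensor_tmul, TensorProduct.mk_apply, LinearMap.comp_apply,
            LinearMap.flip_apply, LinearEquiv.coe_coe, smashSigma_tmul, outerP_tmul,
            TensorProduct.assoc_tmul]
          generalize mapP M C (c ⊗ₜ x) = t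
          induction t with
          | zero => simp
          | add x y hx hy =>
            simp only [map_add, TensorProduct.tmul_add, TensorProduct.add_tmul, hx, hy]
          | tmul c x =>
            simp only [LinearMap.lTensor_tmul, TensorProduct.mk_apply, TensorProduct.assoc_tmul]
            rw [outerT₂_tmul]
            have h1 : ∀ r : A ⊗[ℂ] B, mulComulB HB A b'
                (c ⊗ₜ (LinearMap.mulLeft ℂ a).rTensor B r)
                = ((LinearMap.mulLeft ℂ a).rTensor B).lTensor B
                  (((LinearMap.lTensorHom A ∘ₗ (LinearMap.mul ℂ B).flip).flip r).lTensor B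
                    (HB.T₂ (c ⊗ₜ b'))) := by
              intro r
              induction r with
              | zero => simp [LinearMap.lTensor_zero]
              | add x y hx hy =>
                simp only [map_add, TensorProduct.tmul_add, LinearMap.lTensor_add,
                  LinearMap.add_apply, hx, hy]
              | tmul r s =>
                rw [LinearMap.rTensor_tmul, mulComulB_tmul, outerT₂_tmul,
                  ← LinearMap.lTensor_comp_apply, ← LinearMap.lTensor_comp_apply]
                congr 2
            rw [h1]
            generalize HB.T₂ (c ⊗ₜ b') = t
            induction t with
            | zero => simp
            | add x y hx hy => simp only [map_add, TensorProduct.tmul_add, hx, hy]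
            | tmul c d =>
              simp only [LinearMap.lTensor_tmul, TensorProduct.mk_apply,
                TensorProduct.assoc_symm_tmul]
              change _ = TensorProduct.assoc ℂ A B (A ⊗[ℂ] B) ((p ⊗ₜ c) ⊗ₜ
                smashMul HA M.toRightAction ((a ⊗ₜ b) ⊗ₜ (x ⊗ₜ d)))
              rw [smashMul_tmul_tmul, TensorProduct.assoc_tmul,
                ← LinearMap.rTensor_comp_lTensor]
              rfl

end Product

end Bicross

namespace Bicross

universe u v w

/-! ### The link between T₁ and T₂ -/

section Cover

variable {A : Type u} [NonUnitalRing A] [Module ℂ A] [IsScalarTower ℂ A A] [SMulCommClass ℂ A A]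
  {B : Type v} [NonUnitalRing B] [Module ℂ B] [IsScalarTower ℂ B B] [SMulCommClass ℂ B B]
  {HA : RegularMHA A} {HB : RegularMHA B} {M : RightModuleAlgebra HA B}
  {C : LeftComoduleCoalgebra HA HB} {W : Type*} [AddCommGroup W] [Module ℂ W]

/-- `x ⊗ u ⊗ w ↦ (c ◁ x)u ⊗ w`. -/
noncomputable def actMul (M : RightModuleAlgebra HA B) (W : Type*) [AddCommGroup W] [Module ℂ W]
    (c : B) : A ⊗[ℂ] (B ⊗[ℂ] W) →ₗ[ℂ] B ⊗[ℂ] W :=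
  (LinearMap.mul' ℂ B).rTensor W ∘ₗ (TensorProduct.assoc ℂ B B W).symm.toLinearMap
    ∘ₗ (M.act c).rTensor (B ⊗[ℂ] W)

theorem actMul_tmul (c : B) (x : A) (t : B ⊗[ℂ] W) :
    actMul M W c (x ⊗ₜ t) = (LinearMap.mulLeft ℂ (M.act c x)).rTensor W t := by
  simp only [actMul, LinearMap.comp_apply, LinearMap.rTensor_tmul, LinearEquiv.coe_coe]
  induction t with
  | zero => simp
  | add x y hx hy => simp only [map_add, TensorProduct.tmul_add, hx, hy]
  | tmul u v => simp

theorem actMul_add (c c' : B) (t : A ⊗[ℂ] (B ⊗[ℂ] W)) :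
    actMul M W (c + c') t = actMul M W c t + actMul M W c' t := by
  simp [actMul, LinearMap.rTensor_add]

theorem actMul_act (d : B) (e : A) (t : A ⊗[ℂ] (B ⊗[ℂ] W)) :
    actMul M W (M.act d e) t = actMul M W d ((LinearMap.mulLeft ℂ e).rTensor _ t) := by
  rw [actMul, actMul, LinearMap.comp_apply, LinearMap.comp_apply, LinearMap.comp_apply,
    LinearMap.comp_apply, ← LinearMap.rTensor_comp_apply]
  congr 4
  exact LinearMap.ext fun x => (M.act_mul d e x).symm

/-- Left multiplication by pc in AB sends s to (p ⊗ 1)Δ_A(s) with c acted on by the second leg. -/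
theorem smashMul_rTensor (p : A) (c : B) (t : A ⊗[ℂ] (B ⊗[ℂ] W)) :
    TensorProduct.assoc ℂ A B W ((TensorProduct.curry (smashMul HA M.toRightAction)
        (p ⊗ₜ c)).rTensor W ((TensorProduct.assoc ℂ A B W).symm t))
      = (actMul M W c).lTensor A (comulLeft HA (B ⊗[ℂ] W) p t) := by
  induction t with
  | zero => simp
  | add x y hx hy => simp only [map_add, hx, hy]
  | tmul s t =>
    induction t with
    | zero => simp
    | add x y hx hy => simp only [map_add, TensorProduct.tmul_add, hx, hy]
    | tmul u w =>
      rw [TensorProduct.assoc_symm_tmul, LinearMap.rTensor_tmul, TensorProduct.curry_apply,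
        smashMul_tmul_tmul, ← LinearMap.lTensor_comp_rTensor, LinearMap.comp_apply, mulLeft_twist,
        comulLeft_tmul]
      generalize HA.T₂ (p ⊗ₜ s) = t
      induction t with
      | zero => simp
      | add x y hx hy => simp only [map_add, TensorProduct.add_tmul, hx, hy]
      | tmul q r => simp [actMul_tmul]

/-- For c = d ◁ e the element e covers the first leg. The factor d ◁ (ex₍₁₎) in front of T then
turns T into Tᵒᵖ by the bimodule relation, which produces P(c ⊗ x). -/
theorem actMul_cotwistComul (hMC : Compatible M C) {Y : Type*} [AddCommGroup Y] [Module ℂ Y]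
    (c u : B) (x : A) (w : A ⊗[ℂ] Y) :
    actMul M (A ⊗[ℂ] Y) c (cotwistComul hMC Y (x ⊗ₜ (u ⊗ₜ w)))
      = (mulTensor w).lTensor B ((LinearMap.mulRight ℂ u).rTensor A (mapP M C (c ⊗ₜ x))) := by
  induction c using M.induction with
  | zero => simp [actMul]
  | add x y hx hy => simp only [actMul_add, TensorProduct.add_tmul, map_add, hx, hy]
  | act d e =>
    have h := cotwistComul_covers_tmul hMC u w e x
    simp only [LinearMap.comp_apply, LinearMap.flip_apply, TensorProduct.mk_apply,
      LinearEquiv.coe_coe] at h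
    rw [actMul_act, h, mapP, LinearMap.comp_apply, twistOp_act]
    generalize HA.T₂ (e ⊗ₜ x) = t
    induction t with
    | zero => simp
    | add x y hx hy => simp only [map_add, hx, hy]
    | tmul q r =>
      simp only [LinearMap.lTensor_tmul, LinearMap.comp_apply, LinearMap.flip_apply,
        TensorProduct.mk_apply, TensorProduct.comm_tmul, actMul_tmul]
      rw [← mulLeft_cotwist, rTensor_lTensor_comm]

/-- Moving p into Δ_A(a) is coassociativity of Δ_A, moving c past the result is
`actMul_cotwistComul`, and what remains is the corresponding link (r ⊗ 1)T₁ = T₂(1 ⊗ ·) for B. -/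
theorem smashMul_smashT₁ (hMC : Compatible M C) (p a : A) (c b : B) (z : A ⊗[ℂ] B) :
    TensorProduct.assoc ℂ A B (A ⊗[ℂ] B) ((TensorProduct.curry (smashMul HA M.toRightAction)
        (p ⊗ₜ c)).rTensor (A ⊗[ℂ] B) (smashCanonOne hMC ((a ⊗ₜ b) ⊗ₜ z)))
      = TensorProduct.assoc ℂ A B (A ⊗[ℂ] B)
        (((TensorProduct.curry (smashMul HA M.toRightAction)).flip z).lTensor (A ⊗[ℂ] B)
          (smashCanonTwo M C ((p ⊗ₜ c) ⊗ₜ (a ⊗ₜ b)))) := by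
  simp only [smashCanonOne, smashCanonTwo, LinearEquiv.trans_apply, TensorProduct.assoc_tmul]
  rw [smashMul_rTensor, smashT₁_tmul]
  obtain ⟨θ, hθ⟩ := cotwistComul_covers hMC (twistComul HB M (b ⊗ₜ z))
  have h1 := comulLeft_covers hθ p a
  simp only [LinearMap.comp_apply, LinearMap.flip_apply, TensorProduct.mk_apply,
      LinearEquiv.coe_coe] at h1
  rw [h1, smashT₂_tmul]
  generalize HA.T₂ (p ⊗ₜ a) = t
  induction t with
  | zero => simp
  | add x y hx hy => simp only [map_add, hx, hy]
  | tmul p x =>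
    simp only [LinearMap.lTensor_tmul, LinearMap.comp_apply, LinearMap.flip_apply,
      TensorProduct.mk_apply, LinearEquiv.coe_coe, smashSigma_tmul]
    have h2 : ∀ s : B ⊗[ℂ] (A ⊗[ℂ] B), TensorProduct.assoc ℂ A B (A ⊗[ℂ] B)
        (((TensorProduct.curry (smashMul HA M.toRightAction)).flip z).lTensor (A ⊗[ℂ] B)
          ((TensorProduct.assoc ℂ A B (A ⊗[ℂ] B)).symm (p ⊗ₜ s)))
        = p ⊗ₜ ((TensorProduct.curry (smashMul HA M.toRightAction)).flip z).lTensor B s := by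
      intro s
      induction s with
      | zero => simp
      | add x y hx hy => simp only [map_add, TensorProduct.tmul_add, hx, hy]
      | tmul u v => simp
    rw [h2]
    congr 1
    clear h1 hθ θ h2
    obtain ⟨z, rfl⟩ := twist_surjective HA M.toRightAction z
    induction z with
    | zero => simp [LinearMap.lTensor_zero]
    | add x y hx hy =>
      simp only [map_add, TensorProduct.tmul_add, LinearMap.lTensor_add, LinearMap.add_apply,
        hx, hy]
    | tmul b' a' =>
      rw [twistComul_twist]
      -- Bundles u ⊗ v ↦ ru ⊗ kR(v ⊗ a') so as to be linear in r ⊗ k, which can then be replaced by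
      -- P(c ⊗ x).
      let G : B ⊗[ℂ] A →ₗ[ℂ] B ⊗[ℂ] B →ₗ[ℂ] B ⊗[ℂ] (A ⊗[ℂ] B) :=
        TensorProduct.homTensorHomMap (RingHom.id ℂ) B B B (A ⊗[ℂ] B)
          ∘ₗ TensorProduct.map (LinearMap.mul ℂ B)
            (LinearMap.lcomp ℂ (A ⊗[ℂ] B) (twist HA M.toRightAction
              ∘ₗ (TensorProduct.mk ℂ B A).flip a') ∘ₗ LinearMap.rTensorHom B ∘ₗ LinearMap.mul ℂ A)
      have hG : ∀ r k, G (r ⊗ₜ k) = TensorProduct.map (LinearMap.mulLeft ℂ r)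
          ((LinearMap.mulLeft ℂ k).rTensor B ∘ₗ twist HA M.toRightAction
              ∘ₗ (TensorProduct.mk ℂ B A).flip a') := fun r k => rfl
      have h3 : ∀ s : B ⊗[ℂ] B, actMul M (A ⊗[ℂ] B) c (cotwistComul hMC B (x ⊗ₜ
          (twist HA M.toRightAction ∘ₗ (TensorProduct.mk ℂ B A).flip a').lTensor B s))
          = G (mapP M C (c ⊗ₜ x)) s := by
        intro s
        induction s with
        | zero => simp
        | add x y hx hy => simp only [map_add, TensorProduct.tmul_add, hx, hy]
        | tmul u v =>
          rw [LinearMap.lTensor_tmul, actMul_cotwistComul]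
          generalize mapP M C (c ⊗ₜ x) = t
          induction t with
          | zero => simp
          | add x y hx hy => simp only [map_add, LinearMap.add_apply, hx, hy]
          | tmul r k =>
            rw [hG]
            simp [mulTensor_apply]
      rw [h3]
      generalize mapP M C (c ⊗ₜ x) = t
      induction t with
      | zero => simp
      | add x y hx hy =>
        simp only [map_add, LinearMap.add_apply, TensorProduct.add_tmul, hx, hy]
      | tmul r k =>
        rw [hG, TensorProduct.assoc_tmul, outerT₂_tmul, ← LinearMap.lTensor_comp_rTensor,
          LinearMap.comp_apply, HB.mulLeft_T₁]
        generalize HB.T₂ (r ⊗ₜ b) = t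
        induction t with
        | zero => simp
        | add x y hx hy => simp only [map_add, hx, hy]
        | tmul u v =>
          simp [smashMul_tmul_left, mul_twist]

end Cover

end Bicross

namespace Bicross

universe u v w

/-! ### Non-degeneracy and the coproduct of the bicrossproduct -/

section Bicrossproduct

variable {A : Type u} [NonUnitalRing A] [Module ℂ A] [IsScalarTower ℂ A A] [SMulCommClass ℂ A A]
  {B : Type v} [NonUnitalRing B] [Module ℂ B] [IsScalarTower ℂ B B] [SMulCommClass ℂ B B]
  {HA : RegularMHA A} {HB : RegularMHA B} {M : RightModuleAlgebra HA B}
  {C : LeftComoduleCoalgebra HA HB}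

theorem smashRightA_twist (a : A) (t : B ⊗[ℂ] A) :
    smashRightA HA M.toRightAction a (twist HA M.toRightAction t)
      = twist HA M.toRightAction ((LinearMap.mulRight ℂ a).lTensor B t) := by
  induction t with
  | zero => simp
  | add x y hx hy => simp only [map_add, hx, hy]
  | tmul b a' => simp [twist_mul]

theorem smashLeftB_twist (b : B) (t : B ⊗[ℂ] A) :
    smashLeftB HA M.toRightAction b (twist HA M.toRightAction t)
      = twist HA M.toRightAction ((LinearMap.mulLeft ℂ b).rTensor A t) := by
  induction t with
  | zero => simp
  | add x y hx hy => simp only [map_add, hx, hy]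
  | tmul b a' => simp [mul_twist]

/-- Writing x = R(t), right multiplication by ab becomes R(t(1 ⊗ a)) times b. Injectivity of R and
non-degeneracy of A and B then give t = 0. -/
theorem smashMul_right_cancel (HB : RegularMHA B) (x : A ⊗[ℂ] B)
    (h : ∀ y, smashMul HA M.toRightAction (x ⊗ₜ y) = 0) : x = 0 := by
  obtain ⟨t, rfl⟩ := twist_surjective HA M.toRightAction x
  have h1 : ∀ a, smashRightA HA M.toRightAction a (twist HA M.toRightAction t) = 0 := fun a =>
    HB.lTensor_mulRight_cancel (z' := 0) fun b => by
      rw [← smashMul_tmul_right, h, map_zero]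
  have h2 : t = 0 := HA.lTensor_mulRight_cancel (z' := 0) fun a => by
    have := h1 a
    rw [smashRightA_twist, ← map_zero (twist HA M.toRightAction)] at this
    rw [twist_injective HA M.toRightAction this, map_zero]
  rw [h2, map_zero]

theorem smashMul_left_cancel (HB : RegularMHA B) (x : A ⊗[ℂ] B)
    (h : ∀ y, smashMul HA M.toRightAction (y ⊗ₜ x) = 0) : x = 0 := by
  obtain ⟨t, rfl⟩ := twist_surjective HA M.toRightAction x
  have h1 : ∀ b, smashLeftB HA M.toRightAction b (twist HA M.toRightAction t) = 0 := fun b =>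
    HA.rTensor_mulLeft_cancel (z' := 0) fun a => by
      rw [← smashMul_tmul_left, h, map_zero]
  have h2 : t = 0 := HB.rTensor_mulLeft_cancel (z' := 0) fun b => by
    have := h1 b
    rw [smashLeftB_twist, ← map_zero (twist HA M.toRightAction)] at this
    rw [twist_injective HA M.toRightAction this, map_zero]
  rw [h2, map_zero]

theorem smashCanon_mul (hMC : Compatible M C) (x y z : A ⊗[ℂ] B) :
    (TensorProduct.curry (smashMul HA M.toRightAction) x).rTensor (A ⊗[ℂ] B)
        (smashCanonOne hMC (y ⊗ₜ z))
      = ((TensorProduct.curry (smashMul HA M.toRightAction)).flip z).lTensor (A ⊗[ℂ] B)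
          (smashCanonTwo M C (x ⊗ₜ y)) := by
  induction x with
  | zero => simp [LinearMap.rTensor_zero]
  | add x y hx hy =>
    simp only [map_add, LinearMap.rTensor_add, LinearMap.add_apply, TensorProduct.add_tmul, hx, hy]
  | tmul p c =>
    induction y with
    | zero => simp
    | add x y hx hy => simp only [map_add, TensorProduct.add_tmul, TensorProduct.tmul_add, hx, hy]
    | tmul a b => exact (TensorProduct.assoc ℂ A B (A ⊗[ℂ] B)).injective (smashMul_smashT₁ hMC p a c b z)

theorem smashCanonTwo_mul (hMC : Compatible M C) (w x y : A ⊗[ℂ] B) :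
    smashCanonTwo M C (w ⊗ₜ smashMul HA M.toRightAction (x ⊗ₜ y))
      = TensorProduct.lift
        ((LinearMap.lTensorHom (A ⊗[ℂ] B) ∘ₗ TensorProduct.curry (smashMul HA M.toRightAction)).flip
          ∘ₗ (smashCanonTwo M C).toLinearMap
          ∘ₗ (TensorProduct.mk ℂ (A ⊗[ℂ] B) (A ⊗[ℂ] B)).flip y)
        (smashCanonTwo M C (w ⊗ₜ x)) := by
  induction y with
  | zero =>
    have : TensorProduct.lift
        ((LinearMap.lTensorHom (A ⊗[ℂ] B) ∘ₗ TensorProduct.curry (smashMul HA M.toRightAction)).flip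
          ∘ₗ (smashCanonTwo M C).toLinearMap
          ∘ₗ (TensorProduct.mk ℂ (A ⊗[ℂ] B) (A ⊗[ℂ] B)).flip 0) = 0 := by
      refine TensorProduct.ext' fun u v => ?_
      simp
    rw [this]
    simp
  | add x y hx hy =>
    have : ∀ x y, TensorProduct.lift
        ((LinearMap.lTensorHom (A ⊗[ℂ] B) ∘ₗ TensorProduct.curry (smashMul HA M.toRightAction)).flip
          ∘ₗ (smashCanonTwo M C).toLinearMap
          ∘ₗ (TensorProduct.mk ℂ (A ⊗[ℂ] B) (A ⊗[ℂ] B)).flip (x + y)) = TensorProduct.lift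
        ((LinearMap.lTensorHom (A ⊗[ℂ] B) ∘ₗ TensorProduct.curry (smashMul HA M.toRightAction)).flip
          ∘ₗ (smashCanonTwo M C).toLinearMap
          ∘ₗ (TensorProduct.mk ℂ (A ⊗[ℂ] B) (A ⊗[ℂ] B)).flip x) + TensorProduct.lift
        ((LinearMap.lTensorHom (A ⊗[ℂ] B) ∘ₗ TensorProduct.curry (smashMul HA M.toRightAction)).flip
          ∘ₗ (smashCanonTwo M C).toLinearMap
          ∘ₗ (TensorProduct.mk ℂ (A ⊗[ℂ] B) (A ⊗[ℂ] B)).flip y) := by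
      intro x y
      refine TensorProduct.ext' fun u v => ?_
      simp only [TensorProduct.lift.tmul, LinearMap.add_apply, LinearMap.comp_apply, map_add]
    rw [this, TensorProduct.tmul_add, map_add, TensorProduct.tmul_add, map_add, hx, hy,
      LinearMap.add_apply]
  | tmul a' b' =>
    induction x with
    | zero => simp
    | add x y hx hy => simp only [map_add, TensorProduct.add_tmul, TensorProduct.tmul_add, hx, hy]
    | tmul a b =>
      induction w with
      | zero => simp
      | add x y hx hy => simp only [map_add, TensorProduct.add_tmul, hx, hy]
      | tmul p c =>
        refine (TensorProduct.assoc ℂ A B (A ⊗[ℂ] B)).injective ?_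
        refine Eq.trans ?_ (smashT₂_mul hMC p a a' c b b')
        simp [smashCanonTwo]

theorem lTensor_lift_eq_canonMul {R : Type w} [NonUnitalRing R] [Module ℂ R] [IsScalarTower ℂ R R]
    [SMulCommClass ℂ R R] (T : R ⊗[ℂ] R →ₗ[ℂ] R ⊗[ℂ] R) (y : R) :
    canonMul T y = TensorProduct.lift ((LinearMap.lTensorHom R ∘ₗ LinearMap.mul ℂ R).flip ∘ₗ T
      ∘ₗ (TensorProduct.mk ℂ R R).flip y) :=
  TensorProduct.ext' fun p q => by
    rw [canonMul_tmul]
    rfl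

/-- The multiplier Hopf algebra structure of the bicrossproduct. -/
noncomputable def bicrossMHA (hMC : Compatible M C) : MultiplierHopfAlgebra (SmashProduct M) :=
  MultiplierHopfAlgebra.ofCanonicalMaps (A := SmashProduct M)
    (fun x h => smashMul_right_cancel (M := M) HB x h)
    (fun x h => smashMul_left_cancel (M := M) HB x h)
    (smashCanonOne hMC) (smashCanonTwo M C)
    (fun x y z => smashCanon_mul hMC x y z)
    (fun w x y => by
      rw [lTensor_lift_eq_canonMul]
      exact smashCanonTwo_mul hMC w x y)
    (fun x y z => smashCanon_coassoc hMC x y z)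

theorem mulLeft_smashT₁ (hMC : Compatible M C) (a a' : A) (b b' : B) (v : A ⊗[ℂ] B) :
    (LinearMap.mulLeft ℂ a').rTensor _ (smashT₁ hMC (a ⊗ₜ (b ⊗ₜ
        smashLeftB HA M.toRightAction b' v)))
      = TensorProduct.assoc ℂ A B (A ⊗[ℂ] B)
        (((TensorProduct.curry (smashMul HA M.toRightAction)).flip v).lTensor (A ⊗[ℂ] B)
          (middle (cotwist C.Γ) (HA.T₂ (a' ⊗ₜ a) ⊗ₜ HB.T₁ (b ⊗ₜ b')))) := by
  -- For v = b''a'' the product b'v is (b'b'')a'', so the formula for T₁ on values of R applies.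
  obtain ⟨v, rfl⟩ := twist_surjective HA M.toRightAction v
  induction v with
  | zero => simp [LinearMap.lTensor_zero]
  | add x y hx hy =>
    simp only [map_add, TensorProduct.tmul_add, hx, hy, LinearMap.lTensor_add, LinearMap.add_apply]
  | tmul b'' a'' =>
    rw [← mul_twist, smashT₁_tmul, twistComul_twist, HB.T₁_mul_right]
    generalize HB.T₁ (b ⊗ₜ b') = s
    induction s with
    | zero => simp
    | add x y hx hy => simp only [map_add, TensorProduct.tmul_add, hx, hy]
    | tmul r s =>
      have h := cotwistComul_covers_tmul hMC r
        (twist HA M.toRightAction ((s * b'') ⊗ₜ a'')) a' a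
      simp only [LinearMap.comp_apply, LinearMap.flip_apply, TensorProduct.mk_apply,
        LinearEquiv.coe_coe] at h
      simp only [LinearMap.lTensor_tmul, LinearMap.comp_apply, LinearMap.flip_apply,
        TensorProduct.mk_apply, LinearMap.mulRight_apply]
      rw [h]
      generalize HA.T₂ (a' ⊗ₜ a) = t
      induction t with
      | zero => simp
      | add x y hx hy => simp only [map_add, TensorProduct.add_tmul, hx, hy]
      | tmul p q =>
        simp only [LinearMap.lTensor_tmul, LinearMap.comp_apply, LinearMap.flip_apply,
          TensorProduct.mk_apply, middle, LinearEquiv.coe_coe, TensorProduct.assoc_tmul,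
          TensorProduct.assoc_symm_tmul, LinearMap.rTensor_tmul]
        generalize cotwist C.Γ (q ⊗ₜ r) = t
        induction t with
        | zero => simp
        | add x y hx hy => simp only [map_add, TensorProduct.tmul_add, TensorProduct.add_tmul, hx, hy]
        | tmul u v =>
          simp [mulTensor_apply, smashMul_tmul_left, mul_twist]

/-- A multiplier is determined by its left multiplications. On u ⊗ v the factor u can be split off
on the right, as left multiplication by a' commutes with it, leaving `mulLeft_smashT₁`. -/
theorem isSmashCoproduct_bicrossMHA (hMC : Compatible M C) :
    IsSmashCoproduct M C (bicrossMHA hMC).Δ := by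
  intro a a' b b'
  refine Multiplier.ext_L (bicrossMHA hMC).nondeg_right fun x => ?_
  rw [Multiplier.L_comp, Multiplier.L_comp, oneTmul_L, tmulOne_L, incl_L]
  induction x with
  | zero => simp
  | add x y hx hy => simp only [map_add, mul_add, hx, hy]
  | tmul u v =>
    rw [LinearMap.lTensor_tmul, MultiplierHopfAlgebra.Δ_L_tmul]
    have h := mulLeft_smashT₁ hMC a a' b b' v
    have h1 : ((SmashProduct.πA M a').L).rTensor (SmashProduct M) ((bicrossMHA hMC).T₁
        (SmashProduct.mk M (a ⊗ₜ b) ⊗ₜ (SmashProduct.πB M b').L v))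
      = (LinearMap.mulRight ℂ v).lTensor (SmashProduct M)
        (TensorProduct.map (SmashProduct.mk M).toLinearMap (SmashProduct.mk M).toLinearMap
        (middle (cotwist C.Γ) (HA.T₂ (a' ⊗ₜ a) ⊗ₜ HB.T₁ (b ⊗ₜ b')))) := by
      have hm : ∀ t : (A ⊗[ℂ] B) ⊗[ℂ] (A ⊗[ℂ] B), TensorProduct.map (SmashProduct.mk M).toLinearMap
          (SmashProduct.mk M).toLinearMap t = t := fun t =>
        LinearMap.congr_fun (TensorProduct.map_id (R := ℂ) (M := A ⊗[ℂ] B) (N := A ⊗[ℂ] B)) t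
      have ha : ∀ t : (A ⊗[ℂ] B) ⊗[ℂ] (A ⊗[ℂ] B), TensorProduct.assoc ℂ A B (A ⊗[ℂ] B)
          (((LinearMap.mulLeft ℂ a').rTensor B).rTensor (A ⊗[ℂ] B) t)
          = (LinearMap.mulLeft ℂ a').rTensor _ (TensorProduct.assoc ℂ A B (A ⊗[ℂ] B) t) := by
        intro t
        induction t with
        | zero => simp
        | add x y hx hy => simp only [map_add, hx, hy]
        | tmul x y =>
          induction x with
          | zero => simp
          | add x y hx hy => simp only [map_add, TensorProduct.add_tmul, hx, hy]
          | tmul u v => simp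
      rw [hm]
      refine (TensorProduct.assoc ℂ A B (A ⊗[ℂ] B)).injective (Eq.trans ?_ h)
      refine (ha _).trans (congrArg _ ?_)
      exact (TensorProduct.assoc ℂ A B (A ⊗[ℂ] B)).apply_symm_apply _
    rw [← LinearMap.rTensor_comp_apply]
    have h2 : (SmashProduct.πA M a').L ∘ₗ LinearMap.mulRight ℂ u
        = LinearMap.mulRight ℂ u ∘ₗ (SmashProduct.πA M a').L :=
      LinearMap.ext fun x => (SmashProduct.πA M a').L_mul x u
    rw [h2, LinearMap.rTensor_comp_apply, h1, rTensor_lTensor_comm, lTensor_mulRight_rTensor_mulRight]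

end Bicrossproduct

end Bicross

namespace Bicross

universe u v w

/-! ### Counit, antipode and regularity of the bicrossproduct -/

section Antipode

variable {A : Type u} [NonUnitalRing A] [Module ℂ A] [IsScalarTower ℂ A A] [SMulCommClass ℂ A A]
  {B : Type v} [NonUnitalRing B] [Module ℂ B] [IsScalarTower ℂ B B] [SMulCommClass ℂ B B]
  {HA : RegularMHA A} {HB : RegularMHA B} {M : RightModuleAlgebra HA B}
  {C : LeftComoduleCoalgebra HA HB}

/-- `(ι ⊗ ε_A)T = ε_A ⊗ ι`. -/
theorem counit_cotwist_right (hMC : Compatible M C) (a : A) (b : B) :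
    TensorProduct.rid ℂ B (HA.counit.lTensor B (cotwist C.Γ (a ⊗ₜ b))) = HA.counit a • b := by
  let N : A ⊗[ℂ] B →ₗ[ℂ] B :=
    (TensorProduct.rid ℂ B).toLinearMap ∘ₗ HA.counit.lTensor B ∘ₗ cotwist C.Γ
  -- Both sides are compared after the bijection `cotwistComul`, where each gives T(a ⊗ b)
  -- multiplied by w in the A-leg: one by the counit identity for the T₁ of A, the other by
  -- `counit_cotwistComul`. The factor ℂ fills the leg that is not used here.
  have key : ∀ t : A ⊗[ℂ] (B ⊗[ℂ] (A ⊗[ℂ] ℂ)),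
      N.rTensor (A ⊗[ℂ] ℂ) ((TensorProduct.assoc ℂ A B (A ⊗[ℂ] ℂ)).symm t)
        = TensorProduct.lid ℂ _ (HA.counit.rTensor _ t) := by
    intro t
    obtain ⟨t, rfl⟩ := (cotwistComul hMC ℂ).surjective t
    have h1 : ∀ s : A ⊗[ℂ] (B ⊗[ℂ] (A ⊗[ℂ] ℂ)),
        N.rTensor (A ⊗[ℂ] ℂ) ((TensorProduct.assoc ℂ A B (A ⊗[ℂ] ℂ)).symm s)
        = ((TensorProduct.lid ℂ (A ⊗[ℂ] ℂ)).toLinearMap ∘ₗ HA.counit.rTensor _).lTensor B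
          (leg₁₂ (A ⊗[ℂ] ℂ) (cotwist C.Γ) s) := by
      intro s
      induction s with
      | zero => simp
      | add x y hx hy => simp only [map_add, hx, hy]
      | tmul a s =>
        induction s with
        | zero => simp
        | add x y hx hy => simp only [map_add, TensorProduct.tmul_add, hx, hy]
        | tmul b w =>
          rw [TensorProduct.assoc_symm_tmul, LinearMap.rTensor_tmul, leg₁₂_tmul]
          simp only [N, LinearMap.comp_apply, LinearEquiv.coe_coe]
          generalize cotwist C.Γ (a ⊗ₜ b) = t
          induction t with
          | zero => simp
          | add x y hx hy => simp only [map_add, TensorProduct.add_tmul, hx, hy]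
          | tmul u v => simp [TensorProduct.smul_tmul]
    rw [h1, leg₁₂_cotwistComul]
    induction t with
    | zero => simp
    | add x y hx hy => simp only [map_add, hx, hy]
    | tmul a s =>
      induction s with
      | zero => simp
      | add x y hx hy => simp only [map_add, TensorProduct.tmul_add, hx, hy]
      | tmul b w =>
        rw [counit_cotwistComul, leg₁₂_tmul]
        generalize cotwist C.Γ (a ⊗ₜ b) = t
        induction t with
        | zero => simp
        | add x y hx hy => simp only [map_add, TensorProduct.add_tmul, hx, hy]
        | tmul u v =>
          simp only [TensorProduct.assoc_tmul, LinearMap.lTensor_tmul, LinearMap.comp_apply,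
            LinearEquiv.coe_coe, mulTensor_apply]
          congr 1
          induction w with
          | zero => simp
          | add x y hx hy => simp only [map_add, TensorProduct.tmul_add, hx, hy]
          | tmul e k =>
            rw [leg₁₂_tmul, LinearEquiv.coe_coe]
            have h := HA.counit_T₁ (v ⊗ₜ e)
            rw [LinearMap.mul'_apply] at h
            rw [LinearMap.rTensor_tmul, LinearMap.mulLeft_apply, ← h]
            generalize HA.T₁ (v ⊗ₜ e) = t
            induction t with
            | zero => simp
            | add x y hx hy => simp only [map_add, TensorProduct.add_tmul, hx, hy]
            | tmul u v => simp [TensorProduct.smul_tmul']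
  by_cases hA : ∃ x : A, x ≠ 0
  · obtain ⟨x, hx⟩ := hA
    have h := key (a ⊗ₜ (b ⊗ₜ (x ⊗ₜ 1)))
    -- A functional that does not vanish at the auxiliary vector x removes the extra A-leg.
    obtain ⟨f, hf⟩ : ∃ f : Module.Dual ℂ A, f x ≠ 0 := by
      by_contra! h
      exact hx ((Module.forall_dual_apply_eq_zero_iff ℂ x).1 h)
    have h2 := congrArg (fun t => TensorProduct.rid ℂ B
      (((TensorProduct.rid ℂ ℂ).toLinearMap ∘ₗ f.rTensor ℂ).lTensor B t)) h
    simp only [N, TensorProduct.assoc_symm_tmul, LinearMap.rTensor_tmul, LinearMap.comp_apply,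
      LinearEquiv.coe_coe, LinearMap.lTensor_tmul, TensorProduct.rid_tmul, TensorProduct.lid_tmul,
      map_smul, one_smul] at h2
    rw [smul_comm] at h2
    exact smul_right_injective B hf h2
  · push Not at hA
    rw [hA a]; simp

/-- ε_A reduces `cotwistComul` to T followed by a multiplication, ε_B then removes T by the counit
property of Γ, and the counit identity of B leaves the product of AB. -/
theorem counit_smashCanonOne (hMC : Compatible M C) (a : A) (b : B) (z : A ⊗[ℂ] B) :
    TensorProduct.lid ℂ (A ⊗[ℂ] B) ((LinearMap.mul' ℂ ℂ ∘ₗ TensorProduct.map HA.counit HB.counit).rTensor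
        (A ⊗[ℂ] B) (smashCanonOne hMC ((a ⊗ₜ b) ⊗ₜ z)))
      = smashMul HA M.toRightAction ((a ⊗ₜ b) ⊗ₜ z) := by
  have h1 : ∀ t : A ⊗[ℂ] (B ⊗[ℂ] (A ⊗[ℂ] B)), TensorProduct.lid ℂ (A ⊗[ℂ] B)
      ((LinearMap.mul' ℂ ℂ ∘ₗ TensorProduct.map HA.counit HB.counit).rTensor (A ⊗[ℂ] B)
        ((TensorProduct.assoc ℂ A B (A ⊗[ℂ] B)).symm t))
      = TensorProduct.lid ℂ _ (HB.counit.rTensor _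
          (TensorProduct.lid ℂ _ (HA.counit.rTensor _ t))) := by
    intro t
    induction t with
    | zero => simp
    | add x y hx hy => simp only [map_add, hx, hy]
    | tmul a s =>
      induction s with
      | zero => simp
      | add x y hx hy => simp only [map_add, TensorProduct.tmul_add, hx, hy]
      | tmul b w => simp [mul_smul]
  simp only [smashCanonOne, LinearEquiv.trans_apply, TensorProduct.assoc_tmul]
  rw [h1, smashT₁_tmul]
  obtain ⟨z, rfl⟩ := twist_surjective HA M.toRightAction z
  induction z with
  | zero => simp
  | add x y hx hy => simp only [map_add, TensorProduct.tmul_add, hx, hy]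
  | tmul b' a' =>
    have h := HB.counit_T₁ (b ⊗ₜ b')
    rw [LinearMap.mul'_apply] at h
    rw [twistComul_twist, smashMul_tmul_left, ← mul_twist, ← h]
    generalize HB.T₁ (b ⊗ₜ b') = t
    induction t with
    | zero => simp
    | add x y hx hy =>
      simp only [map_add, TensorProduct.tmul_add, TensorProduct.add_tmul, hx, hy]
    | tmul r s =>
      rw [LinearMap.lTensor_tmul, counit_cotwistComul]
      have h2 := C.toLeftCoaction.counit_cotwist a r
      have h3 : ∀ (w : A ⊗[ℂ] B) (t : B ⊗[ℂ] A), TensorProduct.lid ℂ _ (HB.counit.rTensor _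
          ((mulTensor w).lTensor B t)) = mulTensor w (TensorProduct.lid ℂ _ (HB.counit.rTensor _ t)) := by
        intro w t
        induction t with
        | zero => simp
        | add x y hx hy => simp only [map_add, hx, hy]
        | tmul u v => simp
      rw [h3, h2, map_smul, mulTensor_apply]
      simp [← TensorProduct.smul_tmul']

theorem bicrossMHA_counit (hMC : Compatible M C) :
    (bicrossMHA hMC).counit
      = LinearMap.mul' ℂ ℂ ∘ₗ TensorProduct.map HA.counit HB.counit
        ∘ₗ (SmashProduct.mk M).symm.toLinearMap := by
  refine ((bicrossMHA hMC).counit_unique _ fun w => ?_).symm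
  induction w with
  | zero => simp
  | add x y hx hy => simp only [map_add, hx, hy]
  | tmul x z =>
    obtain ⟨x, rfl⟩ := (SmashProduct.mk M).surjective x
    induction x with
    | zero => simp
    | add x y hx hy => simp only [map_add, TensorProduct.add_tmul, hx, hy]
    | tmul a b => exact counit_smashCanonOne hMC a b z

/-- The antipode of the bicrossproduct, `S(ab) = R(S_B ⊗ S_A)T(a ⊗ b)`. -/
noncomputable def smashAntipode (hMC : Compatible M C) : A ⊗[ℂ] B ≃ₗ[ℂ] A ⊗[ℂ] B :=
  cotwistEquiv hMC ≪≫ₗ TensorProduct.congr HB.antipodeEquiv HA.antipodeEquiv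
    ≪≫ₗ twistEquiv HA M.toRightAction

theorem smashMul_twist (b : B) (a : A) (x : A ⊗[ℂ] B) :
    smashMul HA M.toRightAction (twist HA M.toRightAction (b ⊗ₜ a) ⊗ₜ x)
      = smashLeftB HA M.toRightAction b ((LinearMap.mulLeft ℂ a).rTensor B x) := by
  induction x with
  | zero => simp
  | add x y hx hy => simp only [map_add, TensorProduct.tmul_add, hx, hy]
  | tmul c d =>
    rw [smashMul_tmul_right, ← twist_mul, LinearMap.rTensor_tmul, LinearMap.mulLeft_apply,
      smashLeftB_tmul]

theorem smashLeftB_add (b b' : B) (x : A ⊗[ℂ] B) : smashLeftB HA M.toRightAction (b + b') x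
    = smashLeftB HA M.toRightAction b x + smashLeftB HA M.toRightAction b' x := by
  simp [smashLeftB, LinearMap.comp_add]

theorem smashLeftB_smul (c : ℂ) (b : B) (x : A ⊗[ℂ] B) :
    smashLeftB HA M.toRightAction (c • b) x = c • smashLeftB HA M.toRightAction b x := by
  simp [smashLeftB, LinearMap.comp_smul]

/-- S begins with T, which turns `cotwistComul` into the T₁ of A; there S_A cancels to ε_A. By (ι ⊗
ε_A)T = ε_A ⊗ ι, what remains is S_B against the T₁ of B, which cancels to ε_B. -/
theorem smashAntipode_smashCanonOne (hMC : Compatible M C) (a : A) (b : B) (z : A ⊗[ℂ] B) :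
    smashMul HA M.toRightAction ((smashAntipode hMC).toLinearMap.rTensor (A ⊗[ℂ] B)
        (smashCanonOne hMC ((a ⊗ₜ b) ⊗ₜ z)))
      = (HA.counit a * HB.counit b) • z := by
  let F : B ⊗[ℂ] (A ⊗[ℂ] (A ⊗[ℂ] B)) →ₗ[ℂ] A ⊗[ℂ] B := smashMul HA M.toRightAction
    ∘ₗ (twist HA M.toRightAction ∘ₗ TensorProduct.map HB.antipode HA.antipode).rTensor (A ⊗[ℂ] B)
    ∘ₗ (TensorProduct.assoc ℂ B A (A ⊗[ℂ] B)).symm.toLinearMap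
  have hF : ∀ u v x, F (u ⊗ₜ (v ⊗ₜ x)) = smashLeftB HA M.toRightAction (HB.antipode u)
      ((LinearMap.mulLeft ℂ (HA.antipode v)).rTensor B x) := by
    intro u v x
    simp [F, smashMul_twist]
  have h1 : ∀ t : A ⊗[ℂ] (B ⊗[ℂ] (A ⊗[ℂ] B)), smashMul HA M.toRightAction
      ((smashAntipode hMC).toLinearMap.rTensor (A ⊗[ℂ] B)
        ((TensorProduct.assoc ℂ A B (A ⊗[ℂ] B)).symm t)) = F (leg₁₂ _ (cotwist C.Γ) t) := by
    intro t
    induction t with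
    | zero => simp
    | add x y hx hy => simp only [map_add, hx, hy]
    | tmul a s =>
      induction s with
      | zero => simp
      | add x y hx hy => simp only [map_add, TensorProduct.tmul_add, hx, hy]
      | tmul b w =>
        rw [TensorProduct.assoc_symm_tmul, LinearMap.rTensor_tmul, leg₁₂_tmul]
        simp only [smashAntipode, LinearEquiv.coe_coe, LinearEquiv.trans_apply,
          cotwistEquiv_apply, twistEquiv_apply]
        generalize cotwist C.Γ (a ⊗ₜ b) = t
        induction t with
        | zero => simp
        | add x y hx hy => simp only [map_add, TensorProduct.add_tmul, hx, hy]
        | tmul u v => simp [F]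
  have h2 : ∀ (u : B) (v : A) (w : A ⊗[ℂ] B), F (u ⊗ₜ leg₁₂ B HA.T₁.toLinearMap (v ⊗ₜ w))
      = HA.counit v • smashLeftB HA M.toRightAction (HB.antipode u) w := by
    intro u v w
    induction w with
    | zero => simp
    | add x y hx hy => simp only [map_add, TensorProduct.tmul_add, hx, hy, smul_add]
    | tmul e k =>
      have h3 := HA.antipode_T₁ v e
      rw [← map_smul, TensorProduct.smul_tmul', ← h3, leg₁₂_tmul, LinearEquiv.coe_coe]
      generalize HA.T₁ (v ⊗ₜ e) = t
      induction t with
      | zero => simp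
      | add x y hx hy =>
        simp only [map_add, TensorProduct.add_tmul, TensorProduct.tmul_add, hx, hy]
      | tmul r s => simp [hF]
  have h4 : ∀ (b : B) (w : A ⊗[ℂ] B), F (leg₁₂ _ (cotwist C.Γ) (cotwistComul hMC B
      (a ⊗ₜ (b ⊗ₜ w)))) = HA.counit a • smashLeftB HA M.toRightAction (HB.antipode b) w := by
    intro b w
    -- Kept for arbitrary t, so that ε_A can be evaluated on T(a ⊗ b) as a whole.
    have h5 : ∀ t : B ⊗[ℂ] A, F ((leg₁₂ B HA.T₁.toLinearMap).lTensor B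
        (TensorProduct.assoc ℂ B A _ (t ⊗ₜ w))) = smashLeftB HA M.toRightAction
          (HB.antipode (TensorProduct.rid ℂ B (HA.counit.lTensor B t))) w := by
      intro t
      induction t with
      | zero => simp [smashLeftB]
      | add x y hx hy =>
        simp only [map_add, TensorProduct.add_tmul, smashLeftB_add, hx, hy]
      | tmul u v =>
        rw [TensorProduct.assoc_tmul, LinearMap.lTensor_tmul, h2, LinearMap.lTensor_tmul,
          TensorProduct.rid_tmul, map_smul, smashLeftB_smul]
    rw [leg₁₂_cotwistComul, leg₁₂_tmul, h5, counit_cotwist_right hMC, map_smul, smashLeftB_smul]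
  simp only [smashCanonOne, LinearEquiv.trans_apply, TensorProduct.assoc_tmul]
  rw [h1, smashT₁_tmul]
  obtain ⟨z, rfl⟩ := twist_surjective HA M.toRightAction z
  induction z with
  | zero => simp
  | add x y hx hy => simp only [map_add, TensorProduct.tmul_add, smul_add, hx, hy]
  | tmul b' a' =>
    have h := HB.antipode_T₁ b b'
    rw [twistComul_twist, mul_smul, ← map_smul, TensorProduct.smul_tmul', ← h]
    generalize HB.T₁ (b ⊗ₜ b') = t
    induction t with
    | zero => simp
    | add x y hx hy =>
      simp only [map_add, TensorProduct.tmul_add, TensorProduct.add_tmul, smul_add, hx, hy]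
    | tmul r s =>
      rw [LinearMap.lTensor_tmul, h4]
      simp [mul_twist]

theorem SmashProduct.mul'_eq : LinearMap.mul' ℂ (SmashProduct M) = smashMul HA M.toRightAction :=
  TensorProduct.ext' (M := SmashProduct M) (N := SmashProduct M) fun _ _ => rfl

/-- The antipode of the bicrossproduct as a map of the smash product. -/
noncomputable def bicrossAntipode (hMC : Compatible M C) : SmashProduct M ≃ₗ[ℂ] SmashProduct M :=
  smashAntipode hMC

theorem isAntipode_bicrossAntipode (hMC : Compatible M C) :
    (bicrossMHA hMC).IsAntipode (bicrossAntipode hMC).toLinearMap := by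
  have key : ∀ w : SmashProduct M ⊗[ℂ] SmashProduct M, LinearMap.mul' ℂ (SmashProduct M)
      (LinearMap.rTensor (SmashProduct M) (bicrossAntipode hMC).toLinearMap
        ((bicrossMHA hMC).T₁ w))
      = TensorProduct.lid ℂ (SmashProduct M)
        ((bicrossMHA hMC).counit.rTensor (SmashProduct M) w) := by
    intro w
    induction w with
    | zero => simp
    | add x y hx hy => simp only [map_add, hx, hy]
    | tmul x z =>
      obtain ⟨x, rfl⟩ := (SmashProduct.mk M).surjective x
      induction x with
      | zero => simp
      | add x y hx hy => simp only [map_add, TensorProduct.add_tmul, hx, hy]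
      | tmul a b =>
        rw [SmashProduct.mul'_eq]
        refine (smashAntipode_smashCanonOne hMC a b z).trans ?_
        rw [bicrossMHA_counit]
        simp
        rfl
  intro a b
  have h := key ((bicrossMHA hMC).T₁.symm (a ⊗ₜ b))
  rw [LinearEquiv.apply_symm_apply] at h
  exact h

/-- The bicrossproduct. -/
noncomputable def bicrossproduct (hMC : Compatible M C) : RegularMHA (SmashProduct M) :=
  (bicrossMHA hMC).toRegular (bicrossAntipode hMC) (isAntipode_bicrossAntipode hMC)

end Antipode

end Bicross

namespace Bicross

universe u v w

/-! ### The right integral of the bicrossproduct -/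

section Integral

variable {A : Type u} [NonUnitalRing A] [Module ℂ A] [IsScalarTower ℂ A A] [SMulCommClass ℂ A A]
  {B : Type v} [NonUnitalRing B] [Module ℂ B] [IsScalarTower ℂ B B] [SMulCommClass ℂ B B]
  {HA : RegularMHA A} {HB : RegularMHA B} {M : RightModuleAlgebra HA B}
  {C : LeftComoduleCoalgebra HA HB} {Y : Type*} [AddCommGroup Y] [Module ℂ Y]

/-- R also has the form ∑ a₍₁₎ ⊗ θ(a₍₂₎), so coassociativity brings T directly after R, and T∘R = P.
-/
theorem mulLeft_cotwistComul_twist (hMC : Compatible M C) (p a : A) (d : B) (w : A ⊗[ℂ] Y) :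
    (LinearMap.mulLeft ℂ p).rTensor _ (cotwistComul hMC Y (TensorProduct.assoc ℂ A B (A ⊗[ℂ] Y)
        (twist HA M.toRightAction (d ⊗ₜ a) ⊗ₜ w)))
      = ((mulTensor w).lTensor B ∘ₗ mapP M C ∘ₗ TensorProduct.mk ℂ B A d).lTensor A
        (HA.T₂ (p ⊗ₜ a)) := by
  have h1 : ∀ s : A ⊗[ℂ] B, (LinearMap.mulLeft ℂ p).rTensor _ (cotwistComul hMC Y
      (TensorProduct.assoc ℂ A B (A ⊗[ℂ] Y) (s ⊗ₜ w)))
      = ((mulTensor w).lTensor B ∘ₗ cotwist C.Γ).lTensor A (comulLeft HA B p s) := by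
    intro s
    induction s with
    | zero => simp
    | add x y hx hy => simp only [map_add, TensorProduct.add_tmul, hx, hy]
    | tmul q r =>
      have h := cotwistComul_covers_tmul hMC r w p q
      simp only [LinearMap.comp_apply, LinearMap.flip_apply, TensorProduct.mk_apply,
        LinearEquiv.coe_coe] at h
      rw [TensorProduct.assoc_tmul, h, comulLeft_tmul, ← LinearMap.lTensor_comp_apply,
        LinearMap.comp_assoc]
  have h2 := comulLeft_covers (HA.covers_twist M.toRightAction d) p a
  simp only [LinearMap.comp_apply, TensorProduct.mk_apply] at h2
  rw [h1, h2, ← LinearMap.lTensor_comp_apply]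
  congr 2
  refine LinearMap.ext fun x => ?_
  simp only [LinearMap.comp_apply, TensorProduct.mk_apply, hMC.cotwist_twist]

/-- `d ⊗ c ↦ (1 ⊗ 1 ⊗ c)Z(R(d ⊗ a) ⊗ w)` with `Z` the map `cotwistComul`. -/
noncomputable def mulCotwistComul (hMC : Compatible M C) (a : A) (w : A ⊗[ℂ] Y) :
    B ⊗[ℂ] A →ₗ[ℂ] A ⊗[ℂ] (B ⊗[ℂ] (A ⊗[ℂ] Y)) :=
  TensorProduct.lift ((LinearMap.lTensorHom A ∘ₗ LinearMap.lTensorHom B ∘ₗ LinearMap.rTensorHom Y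
      ∘ₗ LinearMap.mul ℂ A).flip ∘ₗ (cotwistComul hMC Y).toLinearMap
      ∘ₗ (TensorProduct.assoc ℂ A B (A ⊗[ℂ] Y)).toLinearMap
      ∘ₗ (TensorProduct.mk ℂ (A ⊗[ℂ] B) (A ⊗[ℂ] Y)).flip w ∘ₗ twist HA M.toRightAction
      ∘ₗ (TensorProduct.mk ℂ B A).flip a)

theorem mulCotwistComul_tmul (hMC : Compatible M C) (a c : A) (d : B) (w : A ⊗[ℂ] Y) :
    mulCotwistComul hMC a w (d ⊗ₜ c)
      = (((LinearMap.mulLeft ℂ c).rTensor Y).lTensor B).lTensor A (cotwistComul hMC Y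
        (TensorProduct.assoc ℂ A B (A ⊗[ℂ] Y) (twist HA M.toRightAction (d ⊗ₜ a) ⊗ₜ w))) := rfl

/-- `y ↦ (1 ⊗ c)P(d ⊗ y)`, depending linearly on `d ⊗ c`. -/
noncomputable def mulMapPRight (M : RightModuleAlgebra HA B) (C : LeftComoduleCoalgebra HA HB) :
    B ⊗[ℂ] A →ₗ[ℂ] A →ₗ[ℂ] B ⊗[ℂ] A :=
  TensorProduct.lift (LinearMap.mk₂ ℂ
    (fun d c => (LinearMap.mulLeft ℂ c).lTensor B ∘ₗ mapP M C ∘ₗ TensorProduct.mk ℂ B A d)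
    (fun _ _ _ => by simp only [map_add, LinearMap.comp_add])
    (fun _ _ _ => by simp only [map_smul, LinearMap.comp_smul])
    (fun _ c c' => by
      change (LinearMap.mul ℂ A (c + c')).lTensor B ∘ₗ _ = _
      rw [map_add, LinearMap.lTensor_add, LinearMap.add_comp]
      rfl)
    (fun k _ c => by
      change (LinearMap.mul ℂ A (k • c)).lTensor B ∘ₗ _ = _
      rw [map_smul, LinearMap.lTensor_smul, LinearMap.smul_comp]
      rfl))

theorem mulMapPRight_apply (t : B ⊗[ℂ] A) (y : A) : mulMapPRight M C t y = mapPMul M C y t := by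
  induction t with
  | zero => simp
  | add x y hx hy => simp only [map_add, LinearMap.add_apply, hx, hy]
  | tmul d c => rw [mapPMul_tmul]; rfl

/-- Summed over P(b ⊗ c) = ∑ d ⊗ c', multiplicativity of P turns (1 ⊗ c')P(d ⊗ ·) into P(b ⊗ c ·).
This replaces the left covering of Δ_A(a) by (1 ⊗ c)Δ_A(a), on whose first leg a right integral can
be evaluated. -/
theorem mulCotwistComul_mapP (hMC : Compatible M C) (a c : A) (b : B) (w : A ⊗[ℂ] Y) :
    mulCotwistComul hMC a w (mapP M C (b ⊗ₜ c))
      = ((mulTensor w).lTensor B ∘ₗ mapP M C ∘ₗ TensorProduct.mk ℂ B A b).lTensor A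
        (HA.T₄ (c ⊗ₜ a)) := by
  refine HA.rTensor_mulLeft_cancel fun p => ?_
  rw [rTensor_lTensor_comm _ _ (HA.T₄ _), HA.mulLeft_T₄]
  have h1 : ∀ t : B ⊗[ℂ] A, (LinearMap.mulLeft ℂ p).rTensor _ (mulCotwistComul hMC a w t)
      = ((mulTensor w).lTensor B ∘ₗ mulMapPRight M C t).lTensor A (HA.T₂ (p ⊗ₜ a)) := by
    intro t
    induction t with
    | zero => simp [LinearMap.lTensor_zero]
    | add x y hx hy =>
      simp only [map_add, LinearMap.comp_add, LinearMap.lTensor_add, LinearMap.add_apply, hx, hy]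
    | tmul d k =>
      rw [mulCotwistComul_tmul, rTensor_lTensor_comm, mulLeft_cotwistComul_twist,
        ← LinearMap.lTensor_comp_apply]
      congr 2
      refine LinearMap.ext fun y => ?_
      simp only [LinearMap.comp_apply, TensorProduct.mk_apply, mulMapPRight_apply, mapPMul_tmul]
      rw [← LinearMap.lTensor_comp_apply, ← LinearMap.lTensor_comp_apply]
      congr 2
      refine LinearMap.ext fun x => ?_
      simp only [LinearMap.comp_apply, LinearMap.mulLeft_apply, mulTensor_apply,
        ← LinearMap.rTensor_comp_apply]
      congr 2
      exact LinearMap.ext fun z => (mul_assoc k x z).symm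
  rw [h1, ← LinearMap.lTensor_comp_apply]
  congr 2
  refine LinearMap.ext fun y => ?_
  simp only [LinearMap.comp_apply, TensorProduct.mk_apply, mulMapPRight_apply,
    LinearMap.mulLeft_apply, hMC.mapP_mul_right]

theorem lid_rTensor_lTensor {V V' : Type*} [AddCommGroup V] [Module ℂ V] [AddCommGroup V']
    [Module ℂ V'] (ψ : A →ₗ[ℂ] ℂ) (f : V →ₗ[ℂ] V') (t : A ⊗[ℂ] V) :
    TensorProduct.lid ℂ V' (ψ.rTensor V' (f.lTensor A t))
      = f (TensorProduct.lid ℂ V (ψ.rTensor V t)) := by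
  induction t with
  | zero => simp
  | add x y hx hy => simp only [map_add, hx, hy]
  | tmul u v => simp

/-- Invariance of ψ_A survives the cotwist: the bijections P and R reduce the claim to invariance on
(1 ⊗ c)Δ_A(a). -/
theorem integral_cotwistComul (hMC : Compatible M C) {ψ : A →ₗ[ℂ] ℂ} (hψ : HA.IsRightIntegral ψ)
    (a : A) (b : B) (w : A ⊗[ℂ] Y) :
    TensorProduct.lid ℂ _ (ψ.rTensor _ (cotwistComul hMC Y (a ⊗ₜ (b ⊗ₜ w))))
      = ψ a • (b ⊗ₜ w) := by
  have hl : ∀ t : A ⊗[ℂ] Y, (∀ c : A, (LinearMap.mulLeft ℂ c).rTensor Y t = 0) → t = 0 :=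
    fun t ht => HA.rTensor_mulLeft_cancel (z' := 0) fun c => by rw [ht, map_zero]
  -- P is onto, so t may be written with terms P(b ⊗ c).
  have h1 : ∀ (a : A) (t : B ⊗[ℂ] A), TensorProduct.lid ℂ _ (ψ.rTensor _ (mulCotwistComul hMC a w t))
      = ψ a • (mulTensor w).lTensor B t := by
    intro a t
    obtain ⟨t, rfl⟩ := (mapPEquiv M C).surjective t
    rw [mapPEquiv_apply]
    induction t with
    | zero => simp
    | add x y hx hy => simp only [map_add, smul_add, hx, hy]
    | tmul b c =>
      rw [mulCotwistComul_mapP, lid_rTensor_lTensor, hψ.left, map_smul]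
      rfl
  -- R is onto, so s may be taken of the form R(d ⊗ a); the last leg is then covered by c to reach
  -- `h1`.
  have h2 : ∀ s : A ⊗[ℂ] B, TensorProduct.lid ℂ _ (ψ.rTensor _ (cotwistComul hMC Y
      (TensorProduct.assoc ℂ A B _ (s ⊗ₜ w))))
      = TensorProduct.lid ℂ B (ψ.rTensor B s) ⊗ₜ w := by
    intro s
    obtain ⟨s, rfl⟩ := twist_surjective HA M.toRightAction s
    induction s with
    | zero => simp
    | add x y hx hy => simp only [map_add, TensorProduct.add_tmul, hx, hy]
    | tmul d a =>
      rw [integral_twist HA M.toRightAction hψ, ← sub_eq_zero]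
      refine lTensor_cancel (fun c : A => (LinearMap.mulLeft ℂ c).rTensor Y) hl _ fun c => ?_
      have h3 := h1 a (d ⊗ₜ c)
      rw [mulCotwistComul_tmul, lid_rTensor_lTensor] at h3
      rw [map_sub, h3]
      simp [mulTensor_apply, ← TensorProduct.smul_tmul']
  have h4 := h2 (a ⊗ₜ b)
  rw [TensorProduct.assoc_tmul] at h4
  rw [h4]
  simp [TensorProduct.smul_tmul']

/-- ψ_A removes `cotwistComul` altogether, which leaves ψ_B on the first leg of Δ_B(b)(1 ⊗ b'). -/
theorem integral_smashCanonOne (hMC : Compatible M C) {ψA : A →ₗ[ℂ] ℂ} {ψB : B →ₗ[ℂ] ℂ}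
    (hA : HA.IsRightIntegral ψA) (hB : HB.IsRightIntegral ψB) (a : A) (b : B) (z : A ⊗[ℂ] B) :
    TensorProduct.lid ℂ (A ⊗[ℂ] B) ((LinearMap.mul' ℂ ℂ ∘ₗ TensorProduct.map ψA ψB).rTensor
        (A ⊗[ℂ] B) (smashCanonOne hMC ((a ⊗ₜ b) ⊗ₜ z)))
      = (ψA a * ψB b) • z := by
  have h1 : ∀ t : A ⊗[ℂ] (B ⊗[ℂ] (A ⊗[ℂ] B)), TensorProduct.lid ℂ (A ⊗[ℂ] B)
      ((LinearMap.mul' ℂ ℂ ∘ₗ TensorProduct.map ψA ψB).rTensor (A ⊗[ℂ] B)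
        ((TensorProduct.assoc ℂ A B (A ⊗[ℂ] B)).symm t))
      = TensorProduct.lid ℂ _ (ψB.rTensor _
          (TensorProduct.lid ℂ _ (ψA.rTensor _ t))) := by
    intro t
    induction t with
    | zero => simp
    | add x y hx hy => simp only [map_add, hx, hy]
    | tmul a s =>
      induction s with
      | zero => simp
      | add x y hx hy => simp only [map_add, TensorProduct.tmul_add, hx, hy]
      | tmul b w => simp [mul_smul]
  simp only [smashCanonOne, LinearEquiv.trans_apply, TensorProduct.assoc_tmul]
  rw [h1, smashT₁_tmul]
  obtain ⟨z, rfl⟩ := twist_surjective HA M.toRightAction z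
  induction z with
  | zero => simp
  | add x y hx hy => simp only [map_add, TensorProduct.tmul_add, smul_add, hx, hy]
  | tmul b' a' =>
    have h := hB.right b b'
    rw [twistComul_twist, mul_smul, ← map_smul, TensorProduct.smul_tmul', ← h]
    generalize HB.T₁ (b ⊗ₜ b') = t
    induction t with
    | zero => simp
    | add x y hx hy =>
      simp only [map_add, TensorProduct.tmul_add, TensorProduct.add_tmul, smul_add, hx, hy]
    | tmul r s =>
      rw [LinearMap.lTensor_tmul, integral_cotwistComul hMC hA]
      simp [← TensorProduct.smul_tmul']

theorem isRightIntegral_functional (hMC : Compatible M C) {ψA : A →ₗ[ℂ] ℂ} {ψB : B →ₗ[ℂ] ℂ}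
    (hA : HA.IsRightIntegral ψA) (hB : HB.IsRightIntegral ψB) :
    (bicrossproduct hMC).IsRightIntegral (SmashProduct.functional M ψA ψB) := by
  refine (bicrossproduct hMC).isRightIntegral_of_right (fun h => ?_) fun x z => ?_
  · refine hA.ne_zero (LinearMap.ext fun a => by_contra fun ha => hB.ne_zero
      (LinearMap.ext fun b => ?_))
    have h1 : ψA a * ψB b = 0 := LinearMap.congr_fun h (SmashProduct.mk M (a ⊗ₜ b))
    exact (mul_eq_zero.1 h1).resolve_left ha
  · obtain ⟨x, rfl⟩ := (SmashProduct.mk M).surjective x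
    induction x with
    | zero => simp
    | add x y hx hy => simp only [map_add, TensorProduct.add_tmul, add_smul, hx, hy]
    | tmul a b => exact integral_smashCanonOne hMC hA hB a b z

end Integral

end Bicross

namespace Bicross

universe u v w

/-! ### The convolution inverse of the coaction -/

section InverseCoaction

variable {A : Type u} [NonUnitalRing A] [Module ℂ A] [IsScalarTower ℂ A A] [SMulCommClass ℂ A A]
  {B : Type v} [NonUnitalRing B] [Module ℂ B] [IsScalarTower ℂ B B] [SMulCommClass ℂ B B]
  {HA : RegularMHA A} {HB : RegularMHA B} {M : RightModuleAlgebra HA B}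
  {C : LeftComoduleCoalgebra HA HB}

/-- `T₂_antipode` for the opposite coproduct, whose antipode is S⁻¹, with S ⊗ S applied to undo the
inverses. -/
theorem RegularMHA.T₄_eq_antipode (H : RegularMHA A) (k y : A) :
    TensorProduct.comm ℂ A A (H.T₃ (H.antipode y ⊗ₜ H.antipode k))
      = TensorProduct.map H.antipode H.antipode (H.T₄ (k ⊗ₜ y)) := by
  have h := H.op.T₂_antipode (H.antipode k) (H.antipode y)
  simp only [op_antipode, antipodeEquiv_symm_antipode] at h
  have h2 : H.op.T₂ (k ⊗ₜ y) = TensorProduct.comm ℂ A A (H.T₄ (k ⊗ₜ y)) := by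
    simp [RegularMHA.T₄, RegularMHA.op]
  have h1 : H.op.T₁ (H.antipode y ⊗ₜ H.antipode k)
      = TensorProduct.comm ℂ A A (H.T₃ (H.antipode y ⊗ₜ H.antipode k)) := by
    simp [RegularMHA.T₃, RegularMHA.op]
  rw [h2, h1] at h
  rw [(TensorProduct.comm ℂ A A).injective h]
  generalize TensorProduct.comm ℂ A A (H.T₃ (H.antipode y ⊗ₜ H.antipode k)) = t
  induction t with
  | zero => simp
  | add x y hx hy => simp only [map_add, ← hx, ← hy]
  | tmul x y => simp [op_antipode]

/-- The map covering `y ↦ (1 ⊗ s)Γ(y)(b ⊗ 1)`. -/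
noncomputable def cotwistCover (hMC : Compatible M C) (b : B) (s : A) :
    A →ₗ[ℂ] A ⊗[ℂ] (B ⊗[ℂ] A) :=
  (legEquiv A (cotwistEquiv hMC)).symm.toLinearMap
    ∘ₗ (HA.T₄.toLinearMap ∘ₗ TensorProduct.mk ℂ A A s).lTensor B
    ∘ₗ cotwist C.Γ ∘ₗ (TensorProduct.mk ℂ A B).flip b

theorem leg₁₂_cotwistCover (hMC : Compatible M C) (b : B) (s e : A) :
    leg₁₂ A (cotwist C.Γ) (cotwistCover hMC b s e)
      = (HA.T₄.toLinearMap ∘ₗ TensorProduct.mk ℂ A A s).lTensor B (cotwist C.Γ (e ⊗ₜ b)) :=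
  (legEquiv A (cotwistEquiv hMC)).apply_symm_apply _

/-- The counterpart of `cotwistComul_covers_tmul` for multiplication from the left in the last leg,
where the left half of the comodule coalgebra condition is used. -/
theorem covers_cotwistCover (hMC : Compatible M C) (b : B) (s : A) :
    HA.Covers (cotwistCover hMC b s)
      ((LinearMap.mulLeft ℂ s).lTensor B ∘ₗ cotwist C.Γ ∘ₗ (TensorProduct.mk ℂ A B).flip b) := by
  intro c a
  obtain ⟨z, hz⟩ := C.covered_left a s b
  have : cotwistCover hMC b s a = z := by
    apply leg₁₂_cotwist_injective hMC
    rw [leg₁₂_cotwistCover, C.comul_left a s b z hz]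
  rw [this, hz.1, ← LinearMap.lTensor_comp_apply]

/-- Formally ∑ Γ(e₍₁₎)(ι ⊗ S)Γ(e₍₂₎) = ε(e)1: the comodule coalgebra condition joins the two copies
of Γ into Δ_A on the A-leg, S cancels there, and (ι ⊗ ε_A)T = ε_A ⊗ ι. So (ι ⊗ S)Γ is a right
convolution inverse of Γ. -/
theorem antipode_cotwistCover (hMC : Compatible M C) (b : B) (s e : A) :
    (LinearMap.mul' ℂ A ∘ₗ HA.antipode.lTensor A).lTensor B
        (leg₁₂ A (cotwist C.Γ) (cotwistCover hMC b s e))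
      = HA.counit e • (b ⊗ₜ HA.antipode s) := by
  rw [leg₁₂_cotwistCover, ← LinearMap.lTensor_comp_apply]
  have : (LinearMap.mul' ℂ A ∘ₗ HA.antipode.lTensor A) ∘ₗ HA.T₄.toLinearMap
      ∘ₗ TensorProduct.mk ℂ A A s = HA.counit.smulRight (HA.antipode s) :=
    LinearMap.ext fun x => HA.antipode_T₄ s x
  rw [this, TensorProduct.smul_tmul', ← counit_cotwist_right hMC]
  generalize cotwist C.Γ (e ⊗ₜ b) = t
  induction t with
  | zero => simp
  | add x y hx hy => simp only [map_add, TensorProduct.add_tmul, hx, hy]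
  | tmul x y => simp [TensorProduct.smul_tmul]

/-- `x ⊗ w ↦ P(c ⊗ x)(ι ⊗ S)(w)`. -/
noncomputable def mapPAntipode (M : RightModuleAlgebra HA B) (C : LeftComoduleCoalgebra HA HB)
    (c : B) : A ⊗[ℂ] (B ⊗[ℂ] A) →ₗ[ℂ] B ⊗[ℂ] A :=
  LinearMap.mul' ℂ (B ⊗[ℂ] A)
    ∘ₗ TensorProduct.map (mapP M C ∘ₗ TensorProduct.mk ℂ B A c) (HA.antipode.lTensor B)

theorem mapPAntipode_tmul (c : B) (x : A) (w : B ⊗[ℂ] A) :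
    mapPAntipode M C c (x ⊗ₜ w) = mapP M C (c ⊗ₜ x) * HA.antipode.lTensor B w := rfl

theorem mul_tmul_eq (t : B ⊗[ℂ] A) (b : B) (a : A) :
    t * (b ⊗ₜ a) = (LinearMap.mulRight ℂ a).lTensor B ((LinearMap.mulRight ℂ b).rTensor A t) := by
  induction t with
  | zero => simp
  | add x y hx hy => simp only [map_add, add_mul, hx, hy]
  | tmul x y => simp

theorem mulRight_cotwistOp_mul (x : A) (e u : B) (v : A) :
    cotwistOp C.Γ (x ⊗ₜ e) * (u ⊗ₜ v)
      = (LinearMap.mulLeft ℂ e).rTensor A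
        ((LinearMap.mulRight ℂ v).lTensor B (cotwist C.Γ (x ⊗ₜ u))) := by
  rw [mul_tmul_eq, ← mulLeft_cotwist, rTensor_lTensor_comm]

theorem mapPAntipode_act (d : B) (f : A) (t : A ⊗[ℂ] (B ⊗[ℂ] A)) :
    mapPAntipode M C (M.act d f) t
      = actMul M A d (((LinearMap.mul' ℂ A ∘ₗ HA.antipode.lTensor A).lTensor B
        ∘ₗ leg₁₂ A (cotwist C.Γ)).lTensor A (comulLeft HA (B ⊗[ℂ] A) f t)) := by
  induction t with
  | zero => simp
  | add x y hx hy => simp only [map_add, hx, hy]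
  | tmul x w =>
    induction w with
    | zero => simp
    | add y z hy hz => simp only [map_add, TensorProduct.tmul_add, hy, hz]
    | tmul u v =>
      rw [mapPAntipode_tmul, comulLeft_tmul, mapP, LinearMap.comp_apply, twistOp_act]
      generalize HA.T₂ (f ⊗ₜ x) = s
      induction s with
      | zero => simp
      | add y z hy hz => simp only [map_add, add_mul, hy, hz]
      | tmul f' x' =>
        simp only [TensorProduct.comm_tmul, LinearMap.lTensor_tmul, LinearMap.flip_apply,
          TensorProduct.mk_apply, LinearMap.comp_apply, leg₁₂_tmul, actMul_tmul]
        rw [mulRight_cotwistOp_mul]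
        congr 1
        generalize cotwist C.Γ (x' ⊗ₜ u) = s
        induction s with
        | zero => simp
        | add y z hy hz => simp only [map_add, TensorProduct.add_tmul, hy, hz]
        | tmul y z => simp

/-- As P(c ⊗ y) = ∑ ((c ◁ y₍₁₎) ⊗ 1)Γ(y₍₂₎), the convolution inverse cancels Γ and leaves c ◁ y. For
c = d ◁ f the element f supplies the covering. -/
theorem mapPAntipode_cotwistCover (hMC : Compatible M C) (c b : B) (s y : A) :
    mapPAntipode M C c (cotwistCover hMC b s y) = (M.act c y * b) ⊗ₜ HA.antipode s := by
  induction c using M.induction with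
  | zero => simp [mapPAntipode]
  | add x z hx hz =>
    rw [map_add, LinearMap.add_apply, add_mul, TensorProduct.add_tmul, ← hx, ← hz]
    simp only [mapPAntipode, map_add, LinearMap.comp_add, TensorProduct.map_add_left,
      LinearMap.add_apply, LinearMap.comp_apply]
  | act d f =>
    rw [mapPAntipode_act, comulLeft_covers (covers_cotwistCover hMC b s),
      ← LinearMap.lTensor_comp_apply, ← M.act_mul, ← LinearMap.mul'_apply (R := ℂ) (a := f),
      ← HA.counit_T₂]
    generalize HA.T₂ (f ⊗ₜ y) = t
    induction t with
    | zero => simp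
    | add x z hx hz => simp only [map_add, add_mul, TensorProduct.add_tmul, hx, hz]
    | tmul f' y' =>
      rw [LinearMap.lTensor_tmul, actMul_tmul, LinearMap.comp_apply, LinearMap.comp_apply,
        antipode_cotwistCover]
      simp [smul_mul_assoc, TensorProduct.smul_tmul']

/-- `y ↦ (d ⊗ h ↦ (d ⊗ h)(ι ⊗ S)Γ(y))`. -/
noncomputable def mulAntipodeCotwist (C : LeftComoduleCoalgebra HA HB) :
    A →ₗ[ℂ] B ⊗[ℂ] A →ₗ[ℂ] B ⊗[ℂ] A :=
  LinearMap.flip (TensorProduct.lift (LinearMap.mk₂ ℂ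
    (fun d h => (LinearMap.lTensorHom B (LinearMap.mul ℂ A h)) ∘ₗ HA.antipode.lTensor B
      ∘ₗ cotwistOp C.Γ ∘ₗ (TensorProduct.mk ℂ A B).flip d)
    (fun _ _ _ => by simp only [map_add, LinearMap.comp_add])
    (fun _ _ _ => by simp only [map_smul, LinearMap.comp_smul])
    (fun _ _ _ => by simp only [map_add, LinearMap.add_comp])
    (fun _ _ _ => by simp only [map_smul, LinearMap.smul_comp])))

theorem mulAntipodeCotwist_tmul (y : A) (d : B) (h : A) :
    mulAntipodeCotwist C y (d ⊗ₜ h) = (LinearMap.mulLeft ℂ h).lTensor B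
      (HA.antipode.lTensor B (cotwistOp C.Γ (y ⊗ₜ d))) := rfl

theorem mulAntipodeCotwist_mul (y s : A) (b : B) (t : B ⊗[ℂ] A) :
    mulAntipodeCotwist C y t * (b ⊗ₜ HA.antipode s)
      = t * HA.antipode.lTensor B ((LinearMap.mulLeft ℂ s).lTensor B (cotwist C.Γ (y ⊗ₜ b))) := by
  induction t with
  | zero => simp
  | add x z hx hz => simp only [map_add, add_mul, hx, hz]
  | tmul d h =>
    have e : (LinearMap.mulLeft ℂ d).rTensor A (cotwist C.Γ (y ⊗ₜ b))
      = (LinearMap.mulRight ℂ b).rTensor A (cotwistOp C.Γ (y ⊗ₜ d)) := mulLeft_cotwist _ _ _ _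
    have e2 : ∀ x : B ⊗[ℂ] A, (d ⊗ₜ h) * HA.antipode.lTensor B ((LinearMap.mulLeft ℂ s).lTensor B x)
        = (LinearMap.mulLeft ℂ h).lTensor B ((LinearMap.mulRight ℂ (HA.antipode s)).lTensor B
          (HA.antipode.lTensor B ((LinearMap.mulLeft ℂ d).rTensor A x))) := by
      intro x
      induction x with
      | zero => simp
      | add x z hx hz => simp only [map_add, mul_add, hx, hz]
      | tmul u v => simp [HA.antipode_mul]
    rw [e2, e, mulAntipodeCotwist_tmul]
    generalize cotwistOp C.Γ (y ⊗ₜ d) = t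
    induction t with
    | zero => simp
    | add x z hx hz => simp only [map_add, add_mul, hx, hz]
    | tmul u v => simp [mul_assoc]

theorem mul_antipode_cancel (HB : RegularMHA B) (HA : RegularMHA A) {z z' : B ⊗[ℂ] A}
    (h : ∀ b s, z * (b ⊗ₜ HA.antipode s) = z' * (b ⊗ₜ HA.antipode s)) : z = z' := by
  refine HB.rTensor_mulRight_cancel fun b => HA.lTensor_mulRight_cancel fun a => ?_
  rw [← mul_tmul_eq, ← mul_tmul_eq, ← HA.antipode_antipodeEquiv_symm a, h]

/-- P(d ⊗ hy₍₁₎) splits by multiplicativity of P into P(d ⊗ h) and P(· ⊗ y₍₁₎), and the latter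
cancels against (ι ⊗ S)Γ(y₍₂₎) by `mapPAntipode_cotwistCover`. -/
theorem mulAntipodeCotwist_mapP (hMC : Compatible M C) (d : B) (h y : A) :
    TensorProduct.lift ((mulAntipodeCotwist C).flip ∘ₗ mapP M C ∘ₗ TensorProduct.mk ℂ B A d)
        (HA.T₂ (h ⊗ₜ y))
      = (M.act.flip y).rTensor A (mapP M C (d ⊗ₜ h)) := by
  refine mul_antipode_cancel HB HA fun b s => ?_
  have h1 : ∀ x : A ⊗[ℂ] A,
      TensorProduct.lift ((mulAntipodeCotwist C).flip ∘ₗ mapP M C ∘ₗ TensorProduct.mk ℂ B A d) x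
        * (b ⊗ₜ HA.antipode s)
      = mapPAntipode M C d (((LinearMap.mulLeft ℂ s).lTensor B ∘ₗ cotwist C.Γ
        ∘ₗ (TensorProduct.mk ℂ A B).flip b).lTensor A x) := by
    intro x
    induction x with
    | zero => simp
    | add x z hx hz => simp only [map_add, add_mul, hx, hz]
    | tmul u v => exact mulAntipodeCotwist_mul _ _ _ _
  rw [h1, ← covers_cotwistCover hMC b s]
  have h2 : ∀ x : A ⊗[ℂ] (B ⊗[ℂ] A), mapPAntipode M C d ((LinearMap.mulLeft ℂ h).rTensor _ x)
      = TensorProduct.lift ((LinearMap.mul ℂ (B ⊗[ℂ] A)).compl₂ (HA.antipode.lTensor B)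
        ∘ₗ mulMapPRight M C (mapP M C (d ⊗ₜ h))) x := by
    intro x
    induction x with
    | zero => simp
    | add x z hx hz => simp only [map_add, hx, hz]
    | tmul u v =>
      rw [LinearMap.rTensor_tmul, mapPAntipode_tmul, LinearMap.mulLeft_apply, hMC.mapP_mul_right,
        ← mulMapPRight_apply]
      rfl
  rw [h2]
  generalize mapP M C (d ⊗ₜ h) = t
  induction t with
  | zero =>
    generalize cotwistCover hMC b s y = q
    induction q with
    | zero => simp
    | add x z hx hz => simp_all
    | tmul u v => simp
  | add x z hx hz =>
    simp only [map_add, LinearMap.comp_add, add_mul, ← hx, ← hz]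
    generalize cotwistCover hMC b s y = q
    induction q with
    | zero => simp
    | add x z hx hz => simp only [map_add, hx, hz]; abel
    | tmul u v => simp
  | tmul d' h' =>
    have h3 : ∀ x : A ⊗[ℂ] (B ⊗[ℂ] A),
        TensorProduct.lift ((LinearMap.mul ℂ (B ⊗[ℂ] A)).compl₂ (HA.antipode.lTensor B)
          ∘ₗ mulMapPRight M C (d' ⊗ₜ h')) x
        = (LinearMap.mulLeft ℂ h').lTensor B (mapPAntipode M C d' x) := by
      intro x
      induction x with
      | zero => simp
      | add x z hx hz => simp only [map_add, hx, hz]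
      | tmul u v =>
        rw [mapPAntipode_tmul]
        change (LinearMap.mulLeft ℂ h').lTensor B (mapP M C (d' ⊗ₜ u)) * _ = _
        generalize mapP M C (d' ⊗ₜ u) = p
        generalize HA.antipode.lTensor B v = q
        induction p with
        | zero => simp
        | add x z hx hz => simp only [map_add, add_mul, hx, hz]
        | tmul p p' =>
          induction q with
          | zero => simp
          | add x z hx hz => simp only [map_add, mul_add, hx, hz]
          | tmul q q' => simp [mul_assoc]
    rw [h3, mapPAntipode_cotwistCover]
    simp

/-- `p ⊗ (a ⊗ y) ↦ pa ⊗ y`. -/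
noncomputable def mulFirst (A : Type u) [NonUnitalRing A] [Module ℂ A] [IsScalarTower ℂ A A]
    [SMulCommClass ℂ A A] (Y : Type*) [AddCommGroup Y] [Module ℂ Y] :
    A ⊗[ℂ] (A ⊗[ℂ] Y) →ₗ[ℂ] A ⊗[ℂ] Y :=
  (LinearMap.mul' ℂ A).rTensor Y ∘ₗ (TensorProduct.assoc ℂ A A Y).symm.toLinearMap

theorem mulFirst_tmul {Y : Type*} [AddCommGroup Y] [Module ℂ Y] (p : A) (t : A ⊗[ℂ] Y) :
    mulFirst A Y (p ⊗ₜ t) = (LinearMap.mulLeft ℂ p).rTensor Y t := by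
  induction t with
  | zero => simp
  | add x z hx hz => simp only [map_add, TensorProduct.tmul_add, hx, hz]
  | tmul u v => simp [mulFirst]

/-- `p ⊗ ((u ⊗ v) ⊗ x) ↦ (p ⊗ 1)R(u ⊗ x) ⊗ v`. -/
noncomputable def mulTwist (M : RightModuleAlgebra HA B) :
    A ⊗[ℂ] ((B ⊗[ℂ] A) ⊗[ℂ] A) →ₗ[ℂ] A ⊗[ℂ] (B ⊗[ℂ] A) :=
  mulFirst A (B ⊗[ℂ] A) ∘ₗ ((TensorProduct.assoc ℂ A B A).toLinearMap
    ∘ₗ (twist HA M.toRightAction).rTensor A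
    ∘ₗ (TensorProduct.rightComm ℂ B A A).toLinearMap).lTensor A

theorem mulTwist_tmul (p x v : A) (u : B) :
    mulTwist M (p ⊗ₜ ((u ⊗ₜ v) ⊗ₜ x))
      = TensorProduct.assoc ℂ A B A (smashRightA HA M.toRightAction x (p ⊗ₜ u) ⊗ₜ v) := by
  rw [smashRightA_tmul]
  change mulFirst A (B ⊗[ℂ] A) (p ⊗ₜ TensorProduct.assoc ℂ A B A
    (twist HA M.toRightAction (u ⊗ₜ x) ⊗ₜ v)) = _
  rw [mulFirst_tmul]
  generalize twist HA M.toRightAction (u ⊗ₜ x) = t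
  induction t with
  | zero => simp
  | add x z hx hz => simp only [map_add, TensorProduct.add_tmul, hx, hz]
  | tmul u v => simp

/-- `z ⊗ z' ↦ (t ◁ z) ⊗ S(z')`. -/
noncomputable def actTensorAntipode (M : RightModuleAlgebra HA B) (t : B ⊗[ℂ] A) :
    A ⊗[ℂ] A →ₗ[ℂ] (B ⊗[ℂ] A) ⊗[ℂ] A :=
  TensorProduct.map ((LinearMap.rTensorHom A ∘ₗ M.act.flip).flip t) HA.antipode

theorem actTensorAntipode_tmul (t : B ⊗[ℂ] A) (z z' : A) :
    actTensorAntipode M t (z ⊗ₜ z') = (M.act.flip z).rTensor A t ⊗ₜ HA.antipode z' := rfl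

theorem actTensorAntipode_add (t t' : B ⊗[ℂ] A) :
    actTensorAntipode M (t + t') = actTensorAntipode M t + actTensorAntipode M t' := by
  simp only [actTensorAntipode, map_add, TensorProduct.map_add_left]

theorem mulTwist_actTensorAntipode (p y z' : A) (t : B ⊗[ℂ] A) :
    mulTwist M ((actTensorAntipode M t).lTensor A
        (TensorProduct.assoc ℂ A A A (HA.T₂ (p ⊗ₜ y) ⊗ₜ z')))
      = leg₁₂ A (smashRightA HA M.toRightAction (y * HA.antipode z')) (p ⊗ₜ t) := by
  induction t with
  | zero =>
    have : actTensorAntipode M 0 = 0 := by simp [actTensorAntipode]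
    simp [this]
  | add x z hx hz =>
    simp only [actTensorAntipode_add, LinearMap.lTensor_add, LinearMap.add_apply, map_add,
      TensorProduct.tmul_add, hx, hz]
  | tmul c h =>
    rw [leg₁₂_tmul, smashRightA_mul, smashRightA_tmul, mulLeft_twist]
    generalize HA.T₂ (p ⊗ₜ y) = s
    induction s with
    | zero => simp
    | add x z hx hz => simp only [map_add, TensorProduct.add_tmul, hx, hz]
    | tmul u v =>
      rw [TensorProduct.assoc_tmul, LinearMap.lTensor_tmul, actTensorAntipode_tmul,
        LinearMap.rTensor_tmul, mulTwist_tmul]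
      simp

theorem leg₁₂_smashRightA_smul (c : ℂ) (q : A) (x : A ⊗[ℂ] (B ⊗[ℂ] A)) :
    leg₁₂ A (smashRightA HA M.toRightAction (c • q)) x
      = c • leg₁₂ A (smashRightA HA M.toRightAction q) x := by
  have : smashRightA HA M.toRightAction (c • q) = c • smashRightA HA M.toRightAction q := by
    ext a b; simp [smashRightA_tmul, TensorProduct.tmul_smul]
  simp only [leg₁₂, this, LinearMap.rTensor_smul, LinearMap.comp_apply, LinearMap.smul_apply,
    map_smul, LinearEquiv.coe_coe]

theorem leg₁₂_smashRightA_add (q q' : A) (x : A ⊗[ℂ] (B ⊗[ℂ] A)) :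
    leg₁₂ A (smashRightA HA M.toRightAction (q + q')) x
      = leg₁₂ A (smashRightA HA M.toRightAction q) x
        + leg₁₂ A (smashRightA HA M.toRightAction q') x := by
  have : smashRightA HA M.toRightAction (q + q')
      = smashRightA HA M.toRightAction q + smashRightA HA M.toRightAction q' := by
    ext a b; simp [smashRightA_tmul, TensorProduct.tmul_add]
  simp only [leg₁₂, this, LinearMap.rTensor_add, LinearMap.comp_apply, LinearMap.add_apply,
    map_add, LinearEquiv.coe_coe]

/-- `p ⊗ (h ⊗ y) ↦ ∑ (p ⊗ 1)R(u ⊗ S(z')) ⊗ v` with `z ⊗ z' = (1 ⊗ k)Δ(y)` and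
 `u ⊗ v = P(d ⊗ h)(ι ⊗ S)Γ(z)`. -/
noncomputable def mulTwistCotwist (M : RightModuleAlgebra HA B) (C : LeftComoduleCoalgebra HA HB)
    (k : A) (d : B) : A ⊗[ℂ] (A ⊗[ℂ] A) →ₗ[ℂ] A ⊗[ℂ] (B ⊗[ℂ] A) :=
  mulTwist M ∘ₗ
    ((TensorProduct.lift ((mulAntipodeCotwist C).flip ∘ₗ mapP M C ∘ₗ
        TensorProduct.mk ℂ B A d)).rTensor A ∘ₗ (TensorProduct.assoc ℂ A A A).symm.toLinearMap
      ∘ₗ (HA.antipode.lTensor A ∘ₗ HA.T₄.toLinearMap ∘ₗ TensorProduct.mk ℂ A A k).lTensor A).lTensor A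

theorem mulTwistCotwist_tmul (k p h y : A) (d : B) :
    mulTwistCotwist M C k d (p ⊗ₜ (h ⊗ₜ y))
      = mulTwist M (p ⊗ₜ ((mulAntipodeCotwist C).flip (mapP M C (d ⊗ₜ h))).rTensor A
        (HA.antipode.lTensor A (HA.T₄ (k ⊗ₜ y)))) := by
  rw [mulTwistCotwist]
  simp only [LinearMap.comp_apply, LinearMap.lTensor_tmul, TensorProduct.mk_apply,
    LinearEquiv.coe_coe]
  congr 2
  generalize HA.antipode.lTensor A (HA.T₄ (k ⊗ₜ y)) = t
  induction t with
  | zero => simp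
  | add x z hx hz => simp only [map_add, TensorProduct.tmul_add, hx, hz]
  | tmul u v => simp

/-- `mulAntipodeCotwist_mapP` replaces the coaction terms by the action of y₍₁₎ on the B-leg. With
the covered first leg this is right multiplication by y₍₁₎ in AB, which meets S(ky₍₂₎) and collapses
to ε(y)S(k). -/
theorem mulTwistCotwist_mulComul (hMC : Compatible M C) (k y : A) (d : B) (w : A ⊗[ℂ] A) :
    mulTwistCotwist M C k d (HA.mulComul (w ⊗ₜ y))
      = HA.counit y • leg₁₂ A (smashRightA HA M.toRightAction (HA.antipode k))
        ((mapP M C ∘ₗ TensorProduct.mk ℂ B A d).lTensor A w) := by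
  induction w with
  | zero => simp
  | add x z hx hz => simp only [map_add, TensorProduct.add_tmul, smul_add, hx, hz]
  | tmul p h =>
    rw [HA.mulComul_tmul, LinearMap.rTensor_tmul, lTensor_T₂flip, mulTwistCotwist,
      LinearMap.comp_apply, ← LinearMap.lTensor_comp_apply]
    have h1 : ((TensorProduct.lift ((mulAntipodeCotwist C).flip ∘ₗ mapP M C ∘ₗ
        TensorProduct.mk ℂ B A d)).rTensor A ∘ₗ (TensorProduct.assoc ℂ A A A).symm.toLinearMap
      ∘ₗ (HA.antipode.lTensor A ∘ₗ HA.T₄.toLinearMap ∘ₗ TensorProduct.mk ℂ A A k).lTensor A)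
        ∘ₗ HA.T₂.toLinearMap ∘ₗ TensorProduct.mk ℂ A A h
      = actTensorAntipode M (mapP M C (d ⊗ₜ h)) ∘ₗ HA.T₄.toLinearMap
        ∘ₗ TensorProduct.mk ℂ A A k := by
      refine LinearMap.ext fun y' => ?_
      simp only [LinearMap.comp_apply, LinearEquiv.coe_coe, TensorProduct.mk_apply]
      rw [LinearMap.lTensor_comp_apply, ← RegularMHA.covers_comul (HA.covers_T₄ k)]
      simp only [LinearMap.comp_apply, LinearEquiv.coe_coe, TensorProduct.mk_apply]
      generalize HA.T₄ (k ⊗ₜ y') = t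
      induction t with
      | zero => simp
      | add x z hx hz => simp only [map_add, hx, hz]
      | tmul z z' =>
        rw [actTensorAntipode_tmul, ← mulAntipodeCotwist_mapP hMC]
        simp only [LinearMap.rTensor_tmul, LinearMap.comp_apply, LinearEquiv.coe_coe,
          TensorProduct.mk_apply]
        generalize HA.T₂ (h ⊗ₜ z) = s
        induction s with
        | zero => simp
        | add x z hx hz => simp only [map_add, TensorProduct.add_tmul, hx, hz]
        | tmul u v => simp
    rw [h1, LinearMap.lTensor_comp_apply]
    change mulTwist M ((actTensorAntipode M (mapP M C (d ⊗ₜ h))).lTensor A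
      ((HA.T₄.toLinearMap ∘ₗ TensorProduct.mk ℂ A A k).lTensor A (HA.T₂ (p ⊗ₜ y)))) = _
    rw [← RegularMHA.covers_comul (HA.covers_T₄ k), LinearMap.lTensor_tmul,
      LinearMap.comp_apply, TensorProduct.mk_apply, ← leg₁₂_smashRightA_smul, ← HA.antipode_T₄]
    simp only [LinearMap.comp_apply, LinearEquiv.coe_coe, TensorProduct.mk_apply]
    generalize HA.T₄ (k ⊗ₜ y) = t
    induction t with
    | zero =>
      have := leg₁₂_smashRightA_smul (M := M) 0 0 (p ⊗ₜ mapP M C (d ⊗ₜ h))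
      simp only [zero_smul] at this
      simp [this]
    | add x z hx hz => simp only [map_add, leg₁₂_smashRightA_add, hx, hz]
    | tmul z z' =>
      rw [LinearMap.rTensor_tmul]
      exact mulTwist_actTensorAntipode _ _ _ _

/-- Another uniqueness of inverses, now for right multiplication: it exchanges ∑ e₍₁₎Γ(e₍₂₎) for an
expression with (ι ⊗ S)ΓS⁻¹(e₍₂₎) to the left of e₍₁₎. -/
theorem mulMapP_comul_eq_twist (hMC : Compatible M C) (p e q : A) (t : B ⊗[ℂ] A) :
    leg₁₂ A (smashRightA HA M.toRightAction q)
        ((mulMapPRight M C t).lTensor A (HA.T₂ (p ⊗ₜ e)))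
      = mulTwist M (p ⊗ₜ ((mulAntipodeCotwist C).flip t ∘ₗ
        HA.antipodeEquiv.symm.toLinearMap).rTensor A
          (TensorProduct.comm ℂ A A (HA.T₃ (e ⊗ₜ q)))) := by
  obtain ⟨t, rfl⟩ := (mapP_bijective M C).2 t
  -- With e = S(y) and q = S(k), the element Δ(e)(q ⊗ 1) is the flipped S ⊗ S-image of (1 ⊗ k)Δ(y).
  obtain ⟨y, rfl⟩ := HA.antipodeEquiv.surjective e
  obtain ⟨k, rfl⟩ := HA.antipodeEquiv.surjective q
  simp only [RegularMHA.antipodeEquiv_apply]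
  rw [RegularMHA.T₄_eq_antipode]
  induction t with
  | zero =>
    simp
  | add x z hx hz =>
    simp only [map_add, LinearMap.lTensor_add, LinearMap.add_apply, hx, hz, LinearMap.add_comp,
      LinearMap.rTensor_add, TensorProduct.tmul_add]
  | tmul d h =>
    -- Both maps are compared after the bijection `mulComul`, where each gives ε(y) times the same
    -- element.
    have h1 : mulTwistCotwist M C k d = leg₁₂ A (smashRightA HA M.toRightAction (HA.antipode k))
        ∘ₗ (mapP M C ∘ₗ TensorProduct.mk ℂ B A d).lTensor A ∘ₗ HA.mulΔAntipode := by
      rw [← LinearMap.cancel_right HA.mulComul.surjective]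
      refine TensorProduct.ext' fun w y => ?_
      simp only [LinearMap.comp_apply, LinearEquiv.coe_coe]
      rw [mulTwistCotwist_mulComul hMC, HA.mulΔAntipode_mulComul]
      simp only [map_smul]
    have h2 := LinearMap.congr_fun h1 (p ⊗ₜ (h ⊗ₜ y))
    rw [mulTwistCotwist_tmul] at h2
    have h3 : ((mulAntipodeCotwist C).flip (mapP M C (d ⊗ₜ h)) ∘ₗ
          HA.antipodeEquiv.symm.toLinearMap).rTensor A
            (TensorProduct.map HA.antipode HA.antipode (HA.T₄ (k ⊗ₜ y)))
        = ((mulAntipodeCotwist C).flip (mapP M C (d ⊗ₜ h))).rTensor A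
          (HA.antipode.lTensor A (HA.T₄ (k ⊗ₜ y))) := by
      generalize HA.T₄ (k ⊗ₜ y) = t
      induction t with
      | zero => simp
      | add x z hx hz => simp only [map_add, hx, hz]
      | tmul u v => simp
    rw [h3, h2, LinearMap.comp_apply, LinearMap.comp_apply]
    have h4 : HA.mulΔAntipode (p ⊗ₜ (h ⊗ₜ y))
        = (LinearMap.mulLeft ℂ h).lTensor A (HA.T₂ (p ⊗ₜ HA.antipode y)) := by
      rw [← TensorProduct.assoc_tmul, HA.mulΔAntipode_assoc, HA.Δ_R_tmul]
    rw [h4, ← LinearMap.lTensor_comp_apply]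
    have h5 : mulMapPRight M C (mapP M C (d ⊗ₜ h))
        = (mapP M C ∘ₗ TensorProduct.mk ℂ B A d) ∘ₗ LinearMap.mulLeft ℂ h := by
      refine LinearMap.ext fun x => ?_
      rw [mulMapPRight_apply, ← hMC.mapP_mul_right]
      rfl
    rw [h5]

end InverseCoaction

end Bicross

namespace Bicross

universe u v w

/-! ### Canonical maps, counit and antipode under the involution -/

section StarHopf

variable {A : Type u} [NonUnitalRing A] [Module ℂ A] [IsScalarTower ℂ A A] [SMulCommClass ℂ A A]
  [StarRing A] [StarModule ℂ A]

theorem starMultiplier_L (m : Multiplier A) (x : A) :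
    (starMultiplier m).L x = star (m.R (star x)) := rfl

theorem starMultiplier_R (m : Multiplier A) (x : A) :
    (starMultiplier m).R x = star (m.L (star x)) := rfl

theorem starMultiplier_mul (m n : Multiplier A) :
    starMultiplier (m * n) = starMultiplier n * starMultiplier m :=
  Multiplier.ext
    (fun x => by simp [Multiplier.L_comp, starMultiplier_L, Multiplier.R_comp])
    (fun x => by simp [Multiplier.R_comp, starMultiplier_R, Multiplier.L_comp])

theorem starMultiplier_incl (a : A) : starMultiplier (incl a) = incl (star a) :=
  Multiplier.ext (fun x => by simp [starMultiplier_L]) (fun x => by simp [starMultiplier_R])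

theorem starMultiplier_tmulOne (m : Multiplier A) :
    starMultiplier (tmulOne m) = tmulOne (starMultiplier m) := by
  refine Multiplier.ext (fun x => ?_) (fun x => ?_)
  · rw [starMultiplier_L, tmulOne_L, tmulOne_R]
    induction x with
    | zero => simp
    | add x y hx hy => simp only [map_add, star_add, hx, hy]
    | tmul x y => simp [starMultiplier_L]
  · rw [starMultiplier_R, tmulOne_L, tmulOne_R]
    induction x with
    | zero => simp
    | add x y hx hy => simp only [map_add, star_add, hx, hy]
    | tmul x y => simp [starMultiplier_R]

theorem starMultiplier_oneTmul (m : Multiplier A) :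
    starMultiplier (oneTmul m) = oneTmul (starMultiplier m) := by
  refine Multiplier.ext (fun x => ?_) (fun x => ?_)
  · rw [starMultiplier_L, oneTmul_L, oneTmul_R]
    induction x with
    | zero => simp
    | add x y hx hy => simp only [map_add, star_add, hx, hy]
    | tmul x y => simp [starMultiplier_L]
  · rw [starMultiplier_R, oneTmul_L, oneTmul_R]
    induction x with
    | zero => simp
    | add x y hx hy => simp only [map_add, star_add, hx, hy]
    | tmul x y => simp [starMultiplier_R]

namespace RegularMHA

variable {H : RegularMHA A} (hs : H.IsMultiplierHopfStar)

include hs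

theorem IsMultiplierHopfStar.star_T₁ (a b : A) :
    star (H.T₁ (a ⊗ₜ b)) = H.T₄ (star b ⊗ₜ star a) := by
  apply H.incl_injective
  rw [← H.T₄_spec, hs, ← starMultiplier_incl, ← H.T₁_spec, starMultiplier_mul,
    starMultiplier_oneTmul, starMultiplier_incl]

theorem IsMultiplierHopfStar.star_T₂ (a b : A) :
    star (H.T₂ (a ⊗ₜ b)) = H.T₃ (star b ⊗ₜ star a) := by
  apply H.incl_injective
  rw [← H.T₃_spec, hs, ← starMultiplier_incl, ← H.T₂_spec, starMultiplier_mul,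
    starMultiplier_tmulOne, starMultiplier_incl]

theorem IsMultiplierHopfStar.star_T₃ (a b : A) :
    star (H.T₃ (a ⊗ₜ b)) = H.T₂ (star b ⊗ₜ star a) := by
  apply star_injective
  rw [star_star, hs.star_T₂, star_star, star_star]

theorem IsMultiplierHopfStar.star_T₄ (a b : A) :
    star (H.T₄ (a ⊗ₜ b)) = H.T₁ (star b ⊗ₜ star a) := by
  apply star_injective
  rw [star_star, hs.star_T₁, star_star, star_star]

theorem IsMultiplierHopfStar.counit_star (a : A) : H.counit (star a) = star (H.counit a) := by
  let f : A →ₗ[ℂ] ℂ :=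
    { toFun := fun x => star (H.counit (star x))
      map_add' := fun x y => by simp
      map_smul' := fun c x => by simp }
  have h : f = H.counit := by
    refine H.counit_unique f fun w => ?_
    induction w with
    | zero => simp
    | add x y hx hy => simp only [map_add, hx, hy]
    | tmul x y =>
      have h1 : ∀ t : A ⊗[ℂ] A, TensorProduct.lid ℂ A (f.rTensor A t)
          = star (TensorProduct.rid ℂ A (H.coop.counit.lTensor A
            (TensorProduct.comm ℂ A A (star t)))) := by
        intro t
        rw [H.coop_counit]
        induction t with
        | zero => simp
        | add x y hx hy => simp only [map_add, star_add, hx, hy]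
        | tmul x y => simp [f]
      rw [h1, hs.star_T₁]
      have h2 : TensorProduct.comm ℂ A A (H.T₄ (star y ⊗ₜ star x))
          = H.coop.T₂ (star y ⊗ₜ star x) := by simp [RegularMHA.T₄]
      rw [h2, H.coop.counit_T₂]
      simp
  have := LinearMap.congr_fun h a
  rw [← this]
  simp [f]

/-- The map a ↦ S(a*)* satisfies the identity characteristic of S⁻¹, namely the adjoint of the
antipode identity for T₁. -/
theorem IsMultiplierHopfStar.antipode_star_antipode (a : A) :
    H.antipode (star (H.antipode a)) = star a := by
  let f : A →ₗ[ℂ] A :=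
    { toFun := fun x => star (H.antipode (star x))
      map_add' := fun x y => by simp
      map_smul' := fun c x => by simp }
  have h := H.antipode_leftInverse f (fun y x => ?_) (star a)
  · simpa [f] using h
  · have h1 : ∀ t : A ⊗[ℂ] A, LinearMap.mul' ℂ A (f.lTensor A (TensorProduct.comm ℂ A A (star t)))
        = star (LinearMap.mul' ℂ A (H.antipode.rTensor A t)) := by
      intro t
      induction t with
      | zero => simp
      | add x y hx hy => simp only [map_add, star_add, hx, hy]
      | tmul x y => simp [f]
    have h2 := hs.star_T₁ (star x) (star y)
    rw [star_star, star_star] at h2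
    rw [← h2, h1, H.antipode_T₁, hs.counit_star]
    simp

theorem IsMultiplierHopfStar.antipodeEquiv_symm_star (a : A) :
    H.antipodeEquiv.symm (star a) = star (H.antipode a) := by
  rw [LinearEquiv.symm_apply_eq]
  exact (hs.antipode_star_antipode a).symm

end RegularMHA

end StarHopf

/-! ### The involution of the smash product -/

section SmashStar

variable {A : Type u} [NonUnitalRing A] [Module ℂ A] [IsScalarTower ℂ A A] [SMulCommClass ℂ A A]
  {B : Type v} [NonUnitalRing B] [Module ℂ B] [IsScalarTower ℂ B B] [SMulCommClass ℂ B B]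
  {HA : RegularMHA A} [StarRing A] [StarModule ℂ A] [StarRing B] [StarModule ℂ B]

/-- The involution `(ab)* = b*a*` of the smash product. -/
noncomputable def smashStar (M : RightModuleAlgebra HA B) (x : A ⊗[ℂ] B) : A ⊗[ℂ] B :=
  twist HA M.toRightAction (star (TensorProduct.comm ℂ A B x))

variable (M : RightModuleAlgebra HA B)

theorem smashStar_tmul (a : A) (b : B) :
    smashStar M (a ⊗ₜ b) = twist HA M.toRightAction (star b ⊗ₜ star a) := rfl

theorem smashStar_add (x y : A ⊗[ℂ] B) : smashStar M (x + y) = smashStar M x + smashStar M y := by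
  simp [smashStar]

theorem smashStar_smul (c : ℂ) (x : A ⊗[ℂ] B) : smashStar M (c • x) = star c • smashStar M x := by
  simp [smashStar]

theorem smashStar_mulLeft (c : A) (t : A ⊗[ℂ] B) :
    smashStar M ((LinearMap.mulLeft ℂ c).rTensor B t)
      = smashRightA HA M.toRightAction (star c) (smashStar M t) := by
  rw [smashStar, smashStar, smashRightA_twist]
  congr 1
  induction t with
  | zero => simp
  | add x y hx hy => simp only [map_add, star_add, hx, hy]
  | tmul x y => simp

theorem smashStar_mulRight (d : B) (t : A ⊗[ℂ] B) :
    smashStar M ((LinearMap.mulRight ℂ d).lTensor A t)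
      = smashLeftB HA M.toRightAction (star d) (smashStar M t) := by
  rw [smashStar, smashStar, smashLeftB_twist]
  congr 1
  induction t with
  | zero => simp
  | add x y hx hy => simp only [map_add, star_add, hx, hy]
  | tmul x y => simp

variable {M} (hs : HA.IsMultiplierHopfStar) (hact : IsStarAction M)

include hs hact

/-- Formally (ba)* = a*b*. Comparing with the explicit R⁻¹ reduces this to (b ◁ y)* = b* ◁ S⁻¹(y*),
which is the star condition on the action because S⁻¹(y*) = S(y)*. -/
theorem smashStar_twist (b : B) (a : A) :
    smashStar M (twist HA M.toRightAction (b ⊗ₜ a)) = star a ⊗ₜ star b := by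
  obtain ⟨t, ht⟩ := twist_surjective HA M.toRightAction (star a ⊗ₜ star b)
  rw [← ht, smashStar]
  congr 1
  refine HA.lTensor_mulRight_cancel fun k => ?_
  rw [← twistInvMul_twist HA M.toRightAction k t, ht, twistInvMul_tmul]
  have h1 : HA.coop.T₁ (star a ⊗ₜ k) = TensorProduct.comm ℂ A A (HA.T₃ (star a ⊗ₜ k)) := by
    simp [RegularMHA.T₃]
  have h2 := hs.star_T₂ (star k) a
  rw [star_star] at h2
  have h3 : ∀ t : A ⊗[ℂ] B, (LinearMap.mulRight ℂ k).lTensor B (star (TensorProduct.comm ℂ A B t))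
      = star (TensorProduct.comm ℂ A B ((LinearMap.mulLeft ℂ (star k)).rTensor B t)) := by
    intro t
    induction t with
    | zero => simp
    | add x y hx hy => simp only [map_add, star_add, hx, hy]
    | tmul x y => simp
  rw [h1, ← h2, h3, mulLeft_twist]
  generalize HA.T₂ (star k ⊗ₜ a) = s
  induction s with
  | zero => simp
  | add x y hx hy => simp only [map_add, star_add, hx, hy]
  | tmul x y =>
    simp only [LinearMap.lTensor_tmul, TensorProduct.comm_tmul, TensorProduct.star_tmul,
      LinearMap.rTensor_tmul, LinearMap.comp_apply, RegularMHA.op_antipode]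
    rw [hact, hs.antipodeEquiv_symm_star]

theorem smashStar_smashStar (x : A ⊗[ℂ] B) : smashStar M (smashStar M x) = x := by
  induction x with
  | zero => simp [smashStar]
  | add x y hx hy => simp only [smashStar_add, hx, hy]
  | tmul a b => rw [smashStar_tmul, smashStar_twist hs hact, star_star, star_star]

/-- In a(ba')b' the outer factors are reversed by `smashStar_mulLeft` and `smashStar_mulRight`, the
inner one by `smashStar_twist`. -/
theorem smashStar_smashMul (x y : A ⊗[ℂ] B) :
    smashStar M (smashMul HA M.toRightAction (x ⊗ₜ y))
      = smashMul HA M.toRightAction (smashStar M y ⊗ₜ smashStar M x) := by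
  induction x with
  | zero => simp [smashStar]
  | add x z hx hz => simp only [TensorProduct.add_tmul, TensorProduct.tmul_add, map_add,
      smashStar_add, hx, hz]
  | tmul a b =>
    induction y with
    | zero => simp [smashStar]
    | add x z hx hz => simp only [TensorProduct.add_tmul, TensorProduct.tmul_add, map_add,
        smashStar_add, hx, hz]
    | tmul a' b' =>
      rw [smashMul_tmul_tmul, smashStar_tmul, smashMul_twist, smashStar_tmul]
      have : TensorProduct.map (LinearMap.mulLeft ℂ a) (LinearMap.mulRight ℂ b')
          (twist HA M.toRightAction (b ⊗ₜ a')) = (LinearMap.mulLeft ℂ a).rTensor B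
          ((LinearMap.mulRight ℂ b').lTensor A (twist HA M.toRightAction (b ⊗ₜ a'))) :=
        (LinearMap.congr_fun (LinearMap.rTensor_comp_lTensor _ _ _) _).symm
      rw [this, smashStar_mulLeft, smashStar_mulRight, smashStar_twist hs hact,
        ← smashLeftB_smashRightA, smashRightA_tmul]

omit hs hact in
/-- The `*`-ring structure of the smash product. -/
@[reducible] noncomputable def SmashProduct.starRing (hs : HA.IsMultiplierHopfStar)
    (hact : IsStarAction M) : StarRing (SmashProduct M) where
  star := smashStar M
  star_involutive := smashStar_smashStar hs hact
  star_mul := smashStar_smashMul hs hact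
  star_add := smashStar_add M

end SmashStar

/-! ### The smash coproduct covered from the opposite sides -/

section StarComul

variable {A : Type u} [NonUnitalRing A] [Module ℂ A] [IsScalarTower ℂ A A] [SMulCommClass ℂ A A]
  {B : Type v} [NonUnitalRing B] [Module ℂ B] [IsScalarTower ℂ B B] [SMulCommClass ℂ B B]
  {HA : RegularMHA A} {HB : RegularMHA B} {M : RightModuleAlgebra HA B}
  {C : LeftComoduleCoalgebra HA HB}

/-- `b ↦ R(u ⊗ y) ⊗ v` with `u ⊗ v = (b ⊗ 1)(ι ⊗ S)Γ(S⁻¹(x))`, for `t = x ⊗ y`. -/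
noncomputable def twistAntipodeCotwist (M : RightModuleAlgebra HA B)
    (C : LeftComoduleCoalgebra HA HB) (t : A ⊗[ℂ] A) : B →ₗ[ℂ] (A ⊗[ℂ] B) ⊗[ℂ] A :=
  (twist HA M.toRightAction).rTensor A ∘ₗ (TensorProduct.rightComm ℂ B A A).toLinearMap
    ∘ₗ LinearMap.flip (LinearMap.rTensorHom A ∘ₗ TensorProduct.curry
      (HA.antipode.lTensor B ∘ₗ cotwistOp C.Γ ∘ₗ HA.antipodeEquiv.symm.toLinearMap.rTensor B
        ∘ₗ (TensorProduct.comm ℂ B A).toLinearMap)) t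

theorem twistAntipodeCotwist_apply (t : A ⊗[ℂ] A) (b : B) :
    twistAntipodeCotwist M C t b = (twist HA M.toRightAction).rTensor A
      (TensorProduct.rightComm ℂ B A A ((HA.antipode.lTensor B ∘ₗ cotwistOp C.Γ
        ∘ₗ (TensorProduct.mk ℂ A B).flip b ∘ₗ HA.antipodeEquiv.symm.toLinearMap).rTensor A t)) := rfl

theorem twistAntipodeCotwist_zero : twistAntipodeCotwist M C (0 : A ⊗[ℂ] A) = 0 := by
  simp [twistAntipodeCotwist]

theorem twistAntipodeCotwist_add (s t : A ⊗[ℂ] A) :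
    twistAntipodeCotwist M C (s + t)
      = twistAntipodeCotwist M C s + twistAntipodeCotwist M C t := by
  simp only [twistAntipodeCotwist, map_add, LinearMap.comp_add]

theorem smashLeftB_twistAntipodeCotwist (t : A ⊗[ℂ] A) (c b : B) :
    (smashLeftB HA M.toRightAction c).rTensor A (twistAntipodeCotwist M C t b)
      = twistAntipodeCotwist M C t (c * b) := by
  rw [twistAntipodeCotwist_apply, twistAntipodeCotwist_apply]
  induction t with
  | zero => simp
  | add x y hx hy => simp only [map_add, hx, hy]
  | tmul x y =>
    simp only [LinearMap.rTensor_tmul, LinearMap.comp_apply, LinearMap.flip_apply,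
      TensorProduct.mk_apply, LinearEquiv.coe_coe]
    rw [cotwistOp_mul]
    generalize cotwistOp C.Γ (HA.antipodeEquiv.symm x ⊗ₜ b) = s
    induction s with
    | zero => simp
    | add x y hx hy => simp only [map_add, TensorProduct.add_tmul, hx, hy]
    | tmul u v => simp [smashLeftB_twist]

/-- Formally ∑ (e₍₁₎ ⊗ 1)Γ(e₍₂₎) = ∑ Γ'(e₍₂₎)(e₍₁₎ ⊗ 1) with Γ' = (ι ⊗ S)ΓS⁻¹, covered by c and p on
the left and by q on the right. A further covering of the last leg by h gives
`mulMapP_comul_eq_twist`. -/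
theorem twist_mapP_comul (hMC : Compatible M C) (p e q : A) (c : B) :
    leg₁₂ A (smashRightA HA M.toRightAction q)
        ((mapP M C ∘ₗ TensorProduct.mk ℂ B A c).lTensor A (HA.T₂ (p ⊗ₜ e)))
      = TensorProduct.assoc ℂ A B A (((LinearMap.mulLeft ℂ p).rTensor B).rTensor A
          (twistAntipodeCotwist M C (TensorProduct.comm ℂ A A (HA.T₃ (e ⊗ₜ q))) c)) := by
  rw [← sub_eq_zero]
  refine lTensor_cancel (fun h : A => (LinearMap.mulLeft ℂ h).lTensor B)
    (fun z hz => lTensor_cancel (fun h : A => LinearMap.mulLeft ℂ h)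
      (fun a ha => HA.nondeg_left a ha) z hz) _ fun h => ?_
  rw [map_sub, sub_eq_zero]
  have key := mulMapP_comul_eq_twist hMC p e q (c ⊗ₜ h)
  have e1 : mulMapPRight M C (c ⊗ₜ h)
      = (LinearMap.mulLeft ℂ h).lTensor B ∘ₗ mapP M C ∘ₗ TensorProduct.mk ℂ B A c := rfl
  rw [e1, LinearMap.lTensor_comp_apply A ((LinearMap.mulLeft ℂ h).lTensor B), leg₁₂_lTensor] at key
  rw [key, twistAntipodeCotwist_apply]
  generalize TensorProduct.comm ℂ A A (HA.T₃ (e ⊗ₜ q)) = t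
  induction t with
  | zero => simp
  | add x y hx hy => simp only [map_add, TensorProduct.tmul_add, hx, hy]
  | tmul x y =>
    simp only [LinearMap.rTensor_tmul, LinearMap.comp_apply, LinearMap.flip_apply,
      TensorProduct.mk_apply, LinearEquiv.coe_coe]
    rw [mulAntipodeCotwist_tmul]
    generalize HA.antipode.lTensor B (cotwistOp C.Γ (HA.antipodeEquiv.symm x ⊗ₜ c)) = s
    induction s with
    | zero => simp
    | add x y hx hy => simp only [map_add, TensorProduct.add_tmul, TensorProduct.tmul_add, hx, hy]
    | tmul u v =>
      rw [LinearMap.lTensor_tmul, mulTwist_tmul, smashRightA_tmul, TensorProduct.rightComm_tmul,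
        LinearMap.rTensor_tmul, LinearMap.rTensor_tmul]
      generalize (LinearMap.mulLeft ℂ p).rTensor B (twist HA M.toRightAction (u ⊗ₜ y)) = r
      induction r with
      | zero => simp
      | add x y hx hy => simp only [map_add, TensorProduct.add_tmul, hx, hy]
      | tmul u v => simp

/-- `(x ⊗ a) ⊗ b ↦ x ⊗ R(b ⊗ a)`. -/
noncomputable def twistRight (M : RightModuleAlgebra HA B) (X : Type*) [AddCommGroup X]
    [Module ℂ X] : (X ⊗[ℂ] A) ⊗[ℂ] B →ₗ[ℂ] X ⊗[ℂ] (A ⊗[ℂ] B) :=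
  (twist HA M.toRightAction ∘ₗ (TensorProduct.comm ℂ A B).toLinearMap).lTensor X
    ∘ₗ (TensorProduct.assoc ℂ X A B).toLinearMap

@[simp] theorem twistRight_tmul {X : Type*} [AddCommGroup X] [Module ℂ X] (x : X) (a : A) (b : B) :
    twistRight M X ((x ⊗ₜ a) ⊗ₜ b) = x ⊗ₜ twist HA M.toRightAction (b ⊗ₜ a) := rfl

theorem rTensor_twistRight {X Y : Type*} [AddCommGroup X] [Module ℂ X] [AddCommGroup Y]
    [Module ℂ Y] (f : X →ₗ[ℂ] Y) (t : (X ⊗[ℂ] A) ⊗[ℂ] B) :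
    f.rTensor _ (twistRight M X t) = twistRight M Y ((f.rTensor A).rTensor B t) := by
  induction t with
  | zero => simp
  | add x y hx hy => simp only [map_add, hx, hy]
  | tmul x b =>
    induction x with
    | zero => simp
    | add x y hx hy => simp only [map_add, TensorProduct.add_tmul, hx, hy]
    | tmul x a => simp

/-- `smashT₂_twist` expresses the left side through P and (c ⊗ 1)Δ_B(b). The P-part is rewritten by
`twist_mapP_comul`, and c is drawn out again by the link between the T₂ and the T₄ of B. -/
theorem smashCanonTwo_twist (hMC : Compatible M C) (p e q : A) (c b d : B) :
    (smashLeftB HA M.toRightAction d).lTensor _ ((smashRightA HA M.toRightAction q).rTensor _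
        (smashCanonTwo M C ((p ⊗ₜ c) ⊗ₜ twist HA M.toRightAction (b ⊗ₜ e))))
      = (TensorProduct.curry (smashMul HA M.toRightAction) (p ⊗ₜ c)).rTensor _
        (twistRight M _ ((twistAntipodeCotwist M C (TensorProduct.comm ℂ A A
          (HA.T₃ (e ⊗ₜ q)))).rTensor B (HB.T₄ (d ⊗ₜ b)))) := by
  have h1 : TensorProduct.curry (smashMul HA M.toRightAction) (p ⊗ₜ c)
      = (LinearMap.mulLeft ℂ p).rTensor B ∘ₗ smashLeftB HA M.toRightAction c :=
    LinearMap.ext fun y => smashMul_tmul_left HA M.toRightAction p c y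
  have h2 : ((TensorProduct.curry (smashMul HA M.toRightAction) (p ⊗ₜ c)).rTensor A)
        ∘ₗ twistAntipodeCotwist M C (TensorProduct.comm ℂ A A (HA.T₃ (e ⊗ₜ q)))
      = ((TensorProduct.assoc ℂ A B A).symm.toLinearMap
        ∘ₗ leg₁₂ A (smashRightA HA M.toRightAction q)
        ∘ₗ ((LinearMap.lTensorHom A ∘ₗ TensorProduct.curry (mapP M C)).flip (HA.T₂ (p ⊗ₜ e))))
        ∘ₗ LinearMap.mulLeft ℂ c := by
    refine LinearMap.ext fun b' => ?_
    rw [LinearMap.comp_apply, h1, LinearMap.rTensor_comp_apply, smashLeftB_twistAntipodeCotwist]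
    have := twist_mapP_comul hMC p e q (c * b')
    rw [← LinearEquiv.symm_apply_eq] at this
    rw [← this]
    rfl
  rw [rTensor_twistRight, ← LinearMap.rTensor_comp_apply, h2, LinearMap.rTensor_comp_apply,
    HB.mulLeft_T₄]
  have h3 : smashCanonTwo M C ((p ⊗ₜ c) ⊗ₜ twist HA M.toRightAction (b ⊗ₜ e))
      = (TensorProduct.assoc ℂ A B (A ⊗[ℂ] B)).symm
        (smashT₂ M C (p ⊗ₜ (c ⊗ₜ twist HA M.toRightAction (b ⊗ₜ e)))) := rfl
  rw [h3, smashT₂_twist hMC]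
  generalize HB.T₂ (c ⊗ₜ b) = y
  generalize HA.T₂ (p ⊗ₜ e) = x
  induction y with
  | zero => simp
  | add y z hy hz =>
    simp only [map_add, LinearMap.comp_add, LinearMap.lTensor_add, LinearMap.add_apply, hy, hz]
  | tmul c' b' =>
    induction x with
    | zero => simp
    | add y z hy hz =>
      simp only [map_add, LinearMap.comp_add, LinearMap.rTensor_add, LinearMap.add_apply, hy, hz]
    | tmul p' e' =>
      simp only [LinearMap.lTensor_tmul, LinearMap.rTensor_tmul, LinearMap.comp_apply,
        TensorProduct.mk_apply, LinearEquiv.coe_coe, TensorProduct.assoc_tmul, outerP_tmul,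
        LinearMap.flip_apply, LinearMap.coe_lTensorHom, TensorProduct.curry_apply,
        LinearMap.mulLeft_apply]
      generalize mapP M C (c' ⊗ₜ e') = s
      induction s with
      | zero => simp
      | add y z hy hz => simp only [map_add, TensorProduct.add_tmul, TensorProduct.tmul_add, hy, hz]
      | tmul r s => simp [smashLeftB_twist]

end StarComul

end Bicross

namespace Bicross

universe u v w

/-! ### Positive functionals and Gram matrices -/

section Positive

variable {A : Type u} [NonUnitalRing A] [Module ℂ A] [IsScalarTower ℂ A A] [SMulCommClass ℂ A A]
  [StarRing A] [StarModule ℂ A]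

/-- Polarisation: ψ(z*z) is real at z = x + y, which compares imaginary parts, and at z = x + iy,
which compares real parts. -/
theorem IsPositiveFunctional.map_star_mul {ψ : A →ₗ[ℂ] ℂ} (h : IsPositiveFunctional ψ) (x y : A) :
    star (ψ (star x * y)) = ψ (star y * x) := by
  have him : ∀ z, (ψ (star z * z)).im = 0 := fun z => (Complex.le_def.1 (h z)).2.symm
  have h1 := him (x + y)
  have h2 := him (x + Complex.I • y)
  simp only [star_add, star_smul, add_mul, mul_add, map_add, smul_mul_assoc, mul_smul_comm,
    map_smul, Complex.add_im, him, smul_eq_mul, Complex.mul_im, Complex.mul_re, Complex.I_re,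
    Complex.I_im, Complex.star_def, Complex.conj_I, Complex.neg_re, Complex.neg_im] at h1 h2
  apply Complex.ext
  · simp only [Complex.star_def, Complex.conj_re]
    linarith
  · simp only [Complex.star_def, Complex.conj_im]
    linarith

theorem IsPositiveFunctional.posSemidef {ψ : A →ₗ[ℂ] ℂ} (h : IsPositiveFunctional ψ) {k : ℕ}
    (a : Fin k → A) : (Matrix.of fun i j => ψ (star (a i) * a j)).PosSemidef := by
  rw [Matrix.posSemidef_iff_dotProduct_mulVec]
  refine ⟨Matrix.IsHermitian.ext fun i j => h.map_star_mul _ _, fun x => ?_⟩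
  refine (h (∑ i, x i • a i)).trans_eq ?_
  simp only [star_sum, star_smul, Finset.sum_mul_sum, smul_mul_assoc, mul_smul_comm, map_sum,
    map_smul]
  simp only [dotProduct, Matrix.mulVec, Finset.mul_sum, Matrix.of_apply, Pi.star_apply,
    smul_eq_mul]
  exact Finset.sum_congr rfl fun i _ => Finset.sum_congr rfl fun j _ => by ring

end Positive

/-! ### The involution and positivity on the bicrossproduct -/

section StarBicross

variable {A : Type u} [NonUnitalRing A] [Module ℂ A] [IsScalarTower ℂ A A] [SMulCommClass ℂ A A]
  {B : Type v} [NonUnitalRing B] [Module ℂ B] [IsScalarTower ℂ B B] [SMulCommClass ℂ B B]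
  {HA : RegularMHA A} {HB : RegularMHA B} {M : RightModuleAlgebra HA B}
  {C : LeftComoduleCoalgebra HA HB}

theorem smashLeftB_cancel (HB : RegularMHA B) (x : A ⊗[ℂ] B)
    (h : ∀ d, smashLeftB HA M.toRightAction d x = 0) : x = 0 := by
  obtain ⟨t, rfl⟩ := twist_surjective HA M.toRightAction x
  have ht : t = 0 := by
    refine HB.rTensor_mulLeft_cancel fun d => ?_
    apply twist_injective HA M.toRightAction
    rw [← smashLeftB_twist, h, map_zero, map_zero]
  rw [ht, map_zero]

/-- The product of T₁⁻¹(c ⊗ a) is ε(c)a, so ε(c) = 1 suffices. -/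
theorem MultiplierHopfAlgebra.mul'_surjective (H : MultiplierHopfAlgebra A) :
    Function.Surjective (LinearMap.mul' ℂ A) := by
  intro a
  obtain ⟨c, hc⟩ | h := H.exists_counit_eq_one
  · exact ⟨H.T₁.symm (c ⊗ₜ a), by rw [H.mul_T₁_symm, hc, one_smul]⟩
  · exact ⟨0, by rw [map_zero, h a]⟩

/-- Left multiplications by B are jointly injective on AB, and A = A² makes the elements qx span AB.
These coverings are on the opposite sides from the ones defining Δ_#, which is where taking adjoints
puts them. -/
theorem Multiplier.ext_smash (hMC : Compatible M C)
    {m n : Multiplier (SmashProduct M ⊗[ℂ] SmashProduct M)}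
    (h : ∀ d q, oneTmul (SmashProduct.πB M d) * m * tmulOne (SmashProduct.πA M q)
      = oneTmul (SmashProduct.πB M d) * n * tmulOne (SmashProduct.πA M q)) : m = n := by
  refine Multiplier.ext_L (bicrossMHA hMC).nondeg_right fun x => ?_
  have key : ∀ q (y : SmashProduct M ⊗[ℂ] SmashProduct M),
      m.L ((SmashProduct.πA M q).L.rTensor _ y) = n.L ((SmashProduct.πA M q).L.rTensor _ y) := by
    intro q y
    rw [← sub_eq_zero]
    refine lTensor_cancel (fun d => (SmashProduct.πB M d).L)
      (fun z hz => smashLeftB_cancel (M := M) HB z hz) _ fun d => ?_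
    have := congrArg (fun k => Multiplier.L k y) (h d q)
    simp only [Multiplier.L_comp, oneTmul_L, tmulOne_L] at this
    rw [map_sub, this, sub_self]
  induction x with
  | zero => simp
  | add x y hx hy => simp only [map_add, hx, hy]
  | tmul x y =>
    obtain ⟨x, rfl⟩ := (SmashProduct.mk M).surjective x
    induction x with
    | zero => simp
    | add x y hx hy => simp only [map_add, TensorProduct.add_tmul, hx, hy]
    | tmul a b =>
      obtain ⟨t, rfl⟩ := HA.mul'_surjective a
      induction t with
      | zero => simp
      | add x y hx hy => simp only [map_add, TensorProduct.add_tmul, hx, hy]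
      | tmul p q => exact key p (SmashProduct.mk M (q ⊗ₜ b) ⊗ₜ y)

/-- After left multiplication by pc ⊗ 1 this is `smashCanonTwo_twist`. The factor cancels, since
products span AB. -/
theorem bicross_mul_twist (hMC : Compatible M C) (e q : A) (b d : B) :
    oneTmul (SmashProduct.πB M d)
        * (bicrossMHA hMC).Δ (SmashProduct.mk M (twist HA M.toRightAction (b ⊗ₜ e)))
        * tmulOne (SmashProduct.πA M q)
      = incl (TensorProduct.map (SmashProduct.mk M).toLinearMap (SmashProduct.mk M).toLinearMap
        (twistRight M _ ((twistAntipodeCotwist M C (TensorProduct.comm ℂ A A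
          (HA.T₃ (e ⊗ₜ q)))).rTensor B (HB.T₄ (d ⊗ₜ b))))) := by
  have hmk : ∀ x : (A ⊗[ℂ] B) ⊗[ℂ] (A ⊗[ℂ] B),
      (TensorProduct.map (SmashProduct.mk M).toLinearMap (SmashProduct.mk M).toLinearMap) x = x :=
    fun x => LinearMap.congr_fun (TensorProduct.map_id (R := ℂ) (M := A ⊗[ℂ] B)
      (N := A ⊗[ℂ] B)) x
  have hw : ∀ p c, tmulOne (incl (SmashProduct.mk M (p ⊗ₜ c))) * (oneTmul (SmashProduct.πB M d)
        * (bicrossMHA hMC).Δ (SmashProduct.mk M (twist HA M.toRightAction (b ⊗ₜ e)))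
        * tmulOne (SmashProduct.πA M q))
      = tmulOne (incl (SmashProduct.mk M (p ⊗ₜ c))) * incl (TensorProduct.map
        (SmashProduct.mk M).toLinearMap (SmashProduct.mk M).toLinearMap
        (twistRight M _ ((twistAntipodeCotwist M C (TensorProduct.comm ℂ A A
          (HA.T₃ (e ⊗ₜ q)))).rTensor B (HB.T₄ (d ⊗ₜ b))))) := by
    intro p c
    rw [← mul_assoc, ← mul_assoc, tmulOne_mul_oneTmul, mul_assoc (oneTmul _),
      (bicrossMHA hMC).T₂_spec, MultiplierHopfAlgebra.mul_incl, MultiplierHopfAlgebra.incl_mul,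
      tmulOne_mul_incl, oneTmul_L, tmulOne_R, hmk, rTensor_lTensor_comm]
    congr 1
    exact smashCanonTwo_twist hMC p e q c b d
  generalize oneTmul (SmashProduct.πB M d) * _ * _ = m at hw ⊢
  generalize incl (TensorProduct.map (SmashProduct.mk M).toLinearMap
    (SmashProduct.mk M).toLinearMap _) = n at hw ⊢
  refine Multiplier.ext_R (bicrossMHA hMC).nondeg_left fun x => ?_
  induction x with
  | zero => simp
  | add x y hx hy => simp only [map_add, hx, hy]
  | tmul x y =>
    obtain ⟨t, rfl⟩ := (bicrossMHA hMC).mul'_surjective x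
    induction t with
    | zero => simp
    | add x y hx hy => simp only [map_add, TensorProduct.add_tmul, hx, hy]
    | tmul x w =>
      rw [LinearMap.mul'_apply]
      obtain ⟨w, rfl⟩ := (SmashProduct.mk M).surjective w
      induction w with
      | zero => simp
      | add z w hz hw => simp only [map_add, mul_add, TensorProduct.add_tmul, hz, hw]
      | tmul p c => exact congrArg (fun k => Multiplier.R k (x ⊗ₜ y)) (hw p c)

variable [StarRing A] [StarModule ℂ A] [StarRing B] [StarModule ℂ B]
  [StarRing (SmashProduct M)] [StarModule ℂ (SmashProduct M)]
  (hst : ∀ x : A ⊗[ℂ] B, star (SmashProduct.mk M x) = SmashProduct.mk M (smashStar M x))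

include hst

theorem starMultiplier_πA (q : A) :
    starMultiplier (SmashProduct.πA M q) = SmashProduct.πA M (star q) := by
  refine Multiplier.ext (fun x => ?_) (fun x => ?_)
  · apply star_injective
    rw [starMultiplier_L, star_star]
    obtain ⟨x, rfl⟩ := (SmashProduct.mk M).surjective x
    have h := smashStar_mulLeft M (star q) x
    rw [star_star] at h
    rw [hst]
    exact h.symm.trans (hst _).symm
  · rw [starMultiplier_R]
    obtain ⟨y, hy⟩ := (SmashProduct.mk M).surjective (star x)
    have h := smashStar_mulLeft M q y
    rw [← star_star x, ← hy, hst, ← hst y, star_star, hst]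
    exact (hst _).trans h

theorem starMultiplier_πB (d : B) :
    starMultiplier (SmashProduct.πB M d) = SmashProduct.πB M (star d) := by
  refine Multiplier.ext (fun x => ?_) (fun x => ?_)
  · rw [starMultiplier_L]
    obtain ⟨y, hy⟩ := (SmashProduct.mk M).surjective (star x)
    have h := smashStar_mulRight M d y
    rw [← star_star x, ← hy, hst, ← hst y, star_star, hst]
    exact (hst _).trans h
  · apply star_injective
    rw [starMultiplier_R, star_star]
    obtain ⟨x, rfl⟩ := (SmashProduct.mk M).surjective x
    have h := smashStar_mulRight M (star d) x
    rw [star_star] at h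
    rw [hst]
    exact h.symm.trans (hst _).symm

/-- The star condition on the coaction at S⁻¹(x₂) identifies Γ(x₂*)(b₁* ⊗ 1) with the adjoint of (b₁
⊗ 1)(ι ⊗ S)Γ(S⁻¹(x₂)). The remaining twists are (ab)* = b*a* in each leg. -/
theorem star_middle (hco : IsStarCoaction C) (z : A ⊗[ℂ] A) (y : B ⊗[ℂ] B) :
    star (TensorProduct.map (SmashProduct.mk M).toLinearMap (SmashProduct.mk M).toLinearMap
        (middle (cotwist C.Γ) (star z ⊗ₜ star y)))
      = TensorProduct.map (SmashProduct.mk M).toLinearMap (SmashProduct.mk M).toLinearMap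
        (twistRight M _ ((twistAntipodeCotwist M C (TensorProduct.comm ℂ A A z)).rTensor B y)) := by
  induction z with
  | zero => simp [twistAntipodeCotwist_zero]
  | add x z hx hz =>
    simp only [star_add, TensorProduct.add_tmul, map_add, hx, hz, twistAntipodeCotwist_add,
      LinearMap.rTensor_add, LinearMap.add_apply]
  | tmul x₁ x₂ =>
    induction y with
    | zero => simp
    | add x z hx hz => simp only [star_add, TensorProduct.tmul_add, map_add, hx, hz]
    | tmul b₁ b₂ =>
      have h := (hco (HA.antipodeEquiv.symm x₂) (star b₁)).2
      rw [RegularMHA.antipode_antipodeEquiv_symm, star_star] at h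
      rw [TensorProduct.comm_tmul, LinearMap.rTensor_tmul, twistAntipodeCotwist_apply,
        LinearMap.rTensor_tmul, TensorProduct.star_tmul, TensorProduct.star_tmul]
      simp only [LinearMap.comp_apply, LinearMap.flip_apply, TensorProduct.mk_apply,
        LinearEquiv.coe_coe]
      have h2 : middle (cotwist C.Γ) ((star x₁ ⊗ₜ star x₂) ⊗ₜ[ℂ] (star b₁ ⊗ₜ star b₂))
          = (TensorProduct.assoc ℂ A B (A ⊗[ℂ] B)).symm (star x₁ ⊗ₜ TensorProduct.assoc ℂ B A B
            (cotwist C.Γ (star x₂ ⊗ₜ star b₁) ⊗ₜ star b₂)) := rfl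
      rw [h2, h]
      generalize HA.antipode.lTensor B (cotwistOp C.Γ (HA.antipodeEquiv.symm x₂ ⊗ₜ b₁)) = s
      induction s with
      | zero => simp
      | add x z hx hz =>
        simp only [star_add, TensorProduct.tmul_add, TensorProduct.add_tmul, map_add, hx, hz]
      | tmul u v =>
        simp only [TensorProduct.star_tmul, TensorProduct.assoc_tmul,
          TensorProduct.assoc_symm_tmul, TensorProduct.map_tmul, TensorProduct.rightComm_tmul,
          LinearMap.rTensor_tmul, twistRight_tmul, LinearEquiv.coe_coe, hst, smashStar_tmul,
          star_star]

theorem isMultiplierHopfStar_bicrossproduct (hMC : Compatible M C)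
    (hsA : HA.IsMultiplierHopfStar) (hsB : HB.IsMultiplierHopfStar)
    (hco : IsStarCoaction C) : (bicrossproduct hMC).IsMultiplierHopfStar := by
  intro x
  change (bicrossMHA hMC).Δ (star x) = starMultiplier ((bicrossMHA hMC).Δ x)
  obtain ⟨x, rfl⟩ := (SmashProduct.mk M).surjective x
  rw [hst]
  induction x with
  | zero =>
    simp only [smashStar, map_zero, star_zero]
    exact Multiplier.ext (fun x => star_zero _ |>.symm) (fun x => star_zero _ |>.symm)
  | add x y hx hy =>
    rw [smashStar_add, map_add, map_add, hx, hy, map_add, map_add]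
    exact Multiplier.ext (fun x => (star_add _ _).symm) (fun x => (star_add _ _).symm)
  | tmul a b =>
    -- Once covered, Δ_#(b*a*) is given by `bicross_mul_twist`, and Δ_#(ab)* is the adjoint of the
    -- defining formula of Δ_# with q* and d* as covering elements.
    refine Multiplier.ext_smash hMC fun d q => ?_
    rw [smashStar_tmul, bicross_mul_twist, ← star_middle hst hco,
      ← starMultiplier_incl, hsA.star_T₃, hsB.star_T₄, star_star, star_star,
      ← isSmashCoproduct_bicrossMHA hMC, starMultiplier_mul, starMultiplier_mul,
      starMultiplier_oneTmul, starMultiplier_tmulOne, starMultiplier_πA hst,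
      starMultiplier_πB hst, star_star, star_star, mul_assoc]

/-- (ab)*(a'b') equals R(b* ⊗ a*a') times b', and ψ_A on the first leg of R(b* ⊗ a*a') leaves
ψ_A(a*a')b*. -/
theorem functional_star_mul {ψA : A →ₗ[ℂ] ℂ} (ψB : B →ₗ[ℂ] ℂ) (hA : HA.IsRightIntegral ψA)
    (a a' : A) (b b' : B) :
    SmashProduct.functional M ψA ψB
        (star (SmashProduct.mk M (a ⊗ₜ b)) * SmashProduct.mk M (a' ⊗ₜ b'))
      = ψA (star a * a') * ψB (star b * b') := by
  rw [hst, SmashProduct.mul_def, smashStar_tmul, smashMul_twist, LinearMap.rTensor_tmul,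
    smashLeftB_tmul, LinearMap.mulLeft_apply]
  have h := integral_twist HA M.toRightAction hA (star b) (star a * a')
  rw [← smul_eq_mul (ψA _), ← map_smul, ← smul_mul_assoc, ← h]
  generalize twist HA M.toRightAction (star b ⊗ₜ (star a * a')) = t
  induction t with
  | zero => simp
  | add x y hx hy => simp only [map_add, add_mul, hx, hy]
  | tmul x y => simp [SmashProduct.functional, smul_mul_assoc]

theorem isPositiveFunctional_functional {ψA : A →ₗ[ℂ] ℂ} {ψB : B →ₗ[ℂ] ℂ}
    (hA : HA.IsRightIntegral ψA) (hpA : IsPositiveFunctional ψA) (hpB : IsPositiveFunctional ψB) :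
    IsPositiveFunctional (SmashProduct.functional M ψA ψB) := by
  intro x
  obtain ⟨x, rfl⟩ := (SmashProduct.mk M).surjective x
  obtain ⟨k, a, b, rfl⟩ := TensorProduct.exists_sum_tmul_eq x
  -- Schur product theorem: the Hadamard product of the two Gram matrices is positive semidefinite.
  -- Its quadratic form at the all-ones vector is the sum of its entries, which is ψ_#(x*x).
  have h := ((hpA.posSemidef a).hadamard (hpB.posSemidef b))
  rw [Matrix.posSemidef_iff_dotProduct_mulVec] at h
  refine (h.2 1).trans_eq ?_
  simp only [map_sum, star_sum, Finset.sum_mul_sum, functional_star_mul hst ψB hA]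
  simp [dotProduct, Matrix.mulVec]

end StarBicross

end Bicross

theorem theorem4p3
    {A : Type*} [NonUnitalRing A] [Module ℂ A] [IsScalarTower ℂ A A] [SMulCommClass ℂ A A]
    {B : Type*} [NonUnitalRing B] [Module ℂ B] [IsScalarTower ℂ B B] [SMulCommClass ℂ B B]
    (HA : RegularMHA A) (HB : RegularMHA B)
    (hA : HA.IsAlgebraicQuantumGroup) (hB : HB.IsAlgebraicQuantumGroup)
    (M : RightModuleAlgebra HA B) (C : LeftComoduleCoalgebra HA HB) (hMC : Compatible M C) :
    ∃ H : RegularMHA (SmashProduct M),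
      IsSmashCoproduct M C H.Δ ∧
      H.IsAlgebraicQuantumGroup ∧
      (∀ ψA ψB, HA.IsRightIntegral ψA → HB.IsRightIntegral ψB →
        H.IsRightIntegral (SmashProduct.functional M ψA ψB)) ∧
      ∀ [StarRing A] [StarModule ℂ A] [StarRing B] [StarModule ℂ B],
        HA.IsStarAlgebraicQuantumGroup → HB.IsStarAlgebraicQuantumGroup →
        IsStarAction M → IsStarCoaction C →
        ∃ (_ : StarRing (SmashProduct M)) (_ : StarModule ℂ (SmashProduct M)),
          (∀ a b, star (SmashProduct.mk M (a ⊗ₜ[ℂ] b))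
            = SmashProduct.mk M (twist HA M.toRightAction (star b ⊗ₜ[ℂ] star a))) ∧
          H.IsStarAlgebraicQuantumGroup ∧
          ∀ ψA ψB, HA.IsRightIntegral ψA → HB.IsRightIntegral ψB →
            IsPositiveFunctional ψA → IsPositiveFunctional ψB →
            IsPositiveFunctional (SmashProduct.functional M ψA ψB) := by
  obtain ⟨ψA, hψA⟩ := hA.2
  obtain ⟨ψB, hψB⟩ := hB.2
  -- A right integral is enough, the left one being its composite with S⁻¹.
  have hH : (bicrossproduct hMC).IsAlgebraicQuantumGroup :=
    (bicrossproduct hMC).isAlgebraicQuantumGroup_of_right (isRightIntegral_functional hMC hψA hψB)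
  refine ⟨bicrossproduct hMC, isSmashCoproduct_bicrossMHA hMC, hH,
    fun ψA ψB h h' => isRightIntegral_functional hMC h h', ?_⟩
  intro _ _ _ _ hsA hsB hact hco
  let iR : StarRing (SmashProduct M) := SmashProduct.starRing hsA.1 hact
  let iM : StarModule ℂ (SmashProduct M) := ⟨smashStar_smul M⟩
  have hst : ∀ x : A ⊗[ℂ] B, star (SmashProduct.mk M x) = SmashProduct.mk M (smashStar M x) :=
    fun _ => rfl
  exact ⟨iR, iM, fun a b => rfl,
    ⟨isMultiplierHopfStar_bicrossproduct hst hMC hsA.1 hsB.1 hco, hH⟩,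
    fun ψA ψB h _ hpA hpB => isPositiveFunctional_functional hst h hpA hpB⟩
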